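/- Notation. $S=\mathbf C\cup\{\infty\}$ is the Riemann sphere, $H$ is the open upper half-plane, and $\overline H$ is its closure in $S$. A circle in $S$ is the non-empty set of fixed points of an anti-conformal involution of $S$, which is called the reflection in that circle. Fix real numbers $x>1$, $q\in\mathbf R\setminus\{0,1,x\}$ and $\kappa_1,\dots,\kappa_4\ge 0$, and put $(t_1,t_2,t_3,t_4)=(0,1,x,\infty)$. For real $p,h_1,h_2,h_3$ consider the equation $$w''-\Big(\frac1{z-q}+\sum_{j=1}^3\frac{\kappa_j-1}{z-t_j}\Big)w'+\Big(\frac p{z-q}-\sum_{j=1}^3\frac{h_j}{z-t_j}\Big)w=0 \qquad (1a)$$ and the conditions a) $\infty$ is a regular singularity, with exponent difference $\kappa_4$; b) the singularity $q$ is apparent (its local projective monodromy is trivial), and the singularities $0,1,x,\infty$ are not apparent (their local projective monodromies are not trivial). A developing map of a circular polygon on $H$ with a given finite set of corners in $\partial H=\mathbf R\cup\{\infty\}$ is a continuous map $f:\overline H\to S$ which, at every point of $\overline H$ that is not a corner, is holomorphic (at boundary points: has a holomorphic extension to a neighbourhood) with non-vanishing derivative, maps each side (arc of $\partial H$ between consecutive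 corners) into a circle, and at each corner $t$, in a local coordinate $\zeta$ of $\overline H$ vanishing at $t$ ($\zeta=z-t$, or $\zeta=-1/z$ if $t=\infty$), satisfies $f-f(t)\sim c\,\zeta^{\alpha}$ with $\alpha>0$, $c\ne0$ (angle $\alpha$), or $f-f(t)\sim c/\log\zeta$, $c\neq 0$ (angle $0$); with the evident modification when $f$ takes the value $\infty$. Let $\mathcal P$ be the class of developing maps of circular pentagons on $H$ with corners $0,1,x,\infty$ and $q$, with angles $\kappa_j$ at $t_j$, $1\le j\le 4$, and $2$ at $q$, such that the two sides meeting at $q$ are mapped into the same circle. (i) If (1a) satisfies a) and its singularity $q$ is apparent (in particular, if it satisfies a) and b)), then the ratio $f=w_1/w_2$ of any two linearly independent solutions in $H$ extends to $\overline H$ as an element of $\mathcal P$. (ii) Conversely, every $f\in\mathcal P$ is, in $H$, the ratio of two linearly independent solutions of an equation (1a) with real $p,h_1,h_2,h_3$ and the given $x,q,\kappa_j$, which satisfies a) and for which $q$ is apparent; this equation satisfies the whole of b) if and only if, for no $j\in\{1,2,3,4\}$, the two sides meeting at $t_j$ are mapped by $f$ into the same circle. (iii) In the situation of (i), let $x_0\in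 H$. For each loop $\gamma$ at $x_0$ in $\mathbf C\setminus\{0,1,x\}$, the analytic continuation of $f$ along $\gamma$ is $T_\gamma\circ f$ with a unique linear-fractional transformation $T_\gamma$. The projective monodromy group $\{T_\gamma\}$ is the set of all products of even numbers of reflections in the circles containing the images of the sides of the pentagon. Let $T_j=T_{\gamma_j}$, $1\le j\le 4$, where $\gamma_j$ goes from $H$ to the lower half-plane across the interval $(t_{j-1},t_j)$ and back to $H$ across $(t_j,t_{j+1})$ (indices modulo $4$, intervals of $\mathbf R\cup\{\infty\}$). Then $$T_j\ne\mathrm{id},\quad 1\le j\le 4,\qquad\text{(as)}$$ holds if and only if, for no $j\in\{1,2,3,4\}$, the two sides meeting at $t_j$ are mapped by $f$ into the same circle. -/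

import Mathlib

open Filter Topology OnePoint

noncomputable section

namespace CircularPolygon

/-! ### The sphere, reflections and circles

The conformal sphere is `OnePoint ℂ`, on which `GL (Fin 2) ℂ` acts by linear-fractional
transformations (this is Mathlib's action). -/

/-- Complex conjugation of the sphere. -/
def conjS : OnePoint ℂ → OnePoint ℂ := OnePoint.map (starRingEnd ℂ)

/-- An anti-conformal involution of the sphere whose set of fixed points is not empty. The
anti-conformal automorphisms of the sphere are the maps `z ↦ L (conj z)` with `L`
linear-fractional. -/
def IsReflection (σ : Equiv.Perm (OnePoint ℂ)) : Prop :=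
  (∃ g : GL (Fin 2) ℂ, ∀ z, σ z = g • conjS z) ∧ (∀ z, σ (σ z) = z) ∧ ∃ z, σ z = z

/-- `σ` is the reflection in `C`: the set `C` is the set of fixed points of `σ`. -/
def IsReflectionIn (σ : Equiv.Perm (OnePoint ℂ)) (C : Set (OnePoint ℂ)) : Prop :=
  IsReflection σ ∧ C = {z | σ z = z}

/-- A circle on the sphere: the set of fixed points of an anti-conformal involution. -/
def IsCircle (C : Set (OnePoint ℂ)) : Prop := ∃ σ, IsReflectionIn σ C

/-! ### Corners and sides in the boundary of the upper half-plane `H`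

The boundary of `H` in the sphere is `OnePoint ℝ`. A set of corners is given by the set `V` of
its real elements; the point `∞` is always a corner as well. The boundary is oriented in the
direction of increasing real numbers. -/

/-- A boundary point, as a point of the sphere. -/
def bdry (c : OnePoint ℝ) : OnePoint ℂ := OnePoint.map (fun y : ℝ => (y : ℂ)) c

/-- The corners: the points of `V`, and `∞`. -/
def IsCorner (V : Set ℝ) (c : OnePoint ℝ) : Prop := c.elim True (fun y => y ∈ V)

/-- The open side that ends at the corner `c`. -/
def sideBefore (V : Set ℝ) (c : OnePoint ℝ) : Set ℝ :=
  c.elim {y | ∀ v ∈ V, v < y} (fun c => {y | y < c ∧ ∀ v ∈ V, v < y ∨ c ≤ v})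

/-- The open side that begins at the corner `c`. -/
def sideAfter (V : Set ℝ) (c : OnePoint ℝ) : Set ℝ :=
  c.elim {y | ∀ v ∈ V, y < v} (fun c => {y | c < y ∧ ∀ v ∈ V, v ≤ c ∨ y < v})

/-! ### Developing maps -/

/-- The closure of `H` in the sphere. -/
def closedH : Set (OnePoint ℂ) := {∞} ∪ (fun z : ℂ => (z : OnePoint ℂ)) '' {z | 0 ≤ z.im}

/-- A local coordinate at a boundary point `c`: this is `ζ ↦ c + ζ` for real `c` and `ζ ↦ -1/ζ`
for `c = ∞`. Both map `{Im ζ ≥ 0}`, near `0`, into the closure of `H`. -/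
def localParam (c : OnePoint ℝ) (ζ : ℂ) : ℂ := c.elim (-ζ⁻¹) (fun y => (y : ℂ) + ζ)

/-- `f` is holomorphic at the point `z` of `ℂ` with `Im z ≥ 0`, and its derivative does not
vanish there: after composition with some linear-fractional transformation `g` (which takes care
of the case `f z = ∞`), `f` agrees on a neighbourhood of `z` in the closed half-plane with a
function `F` that is analytic in a full neighbourhood of `z` and has `F'(z) ≠ 0`. -/
def ConformalAt (f : OnePoint ℂ → OnePoint ℂ) (z : ℂ) : Prop :=
  ∃ (g : GL (Fin 2) ℂ) (F : ℂ → ℂ), AnalyticAt ℂ F z ∧ deriv F z ≠ 0 ∧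
    ∀ᶠ w : ℂ in 𝓝[{w : ℂ | 0 ≤ w.im}] z, g • f (w : OnePoint ℂ) = (F w : OnePoint ℂ)

/-- The polygon with developing map `f` has the angle `α` (in half-turns) at the corner `c`. In the
local coordinate `ζ` at `c`, one has `f = f(c) + k ζ ^ α (1 + o(1))` when `α > 0`, and
`f = f(c) + (k / log ζ) (1 + o(1))` when `α = 0`, with a constant `k ≠ 0`; the linear-fractional
transformation `g` brings `f(c)` to `0`, which includes the case `f(c) = ∞`. The branches of power
and logarithm are the principal ones, which are continuous on `{Im ζ ≥ 0, ζ ≠ 0}`. -/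
def HasAngle (f : OnePoint ℂ → OnePoint ℂ) (c : OnePoint ℝ) (α : ℝ) : Prop :=
  ∃ (g : GL (Fin 2) ℂ) (F : ℂ → ℂ) (k : ℂ), k ≠ 0 ∧
    g • f (bdry c) = ((0 : ℂ) : OnePoint ℂ) ∧
    (∀ᶠ ζ : ℂ in 𝓝[{ζ : ℂ | 0 ≤ ζ.im ∧ ζ ≠ 0}] 0,
      g • f (localParam c ζ : OnePoint ℂ) = (F ζ : OnePoint ℂ)) ∧
    ((0 < α ∧
        Tendsto (fun ζ : ℂ => F ζ / ζ ^ (α : ℂ)) (𝓝[{ζ : ℂ | 0 ≤ ζ.im ∧ ζ ≠ 0}] 0) (𝓝 k)) ∨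
      (α = 0 ∧
        Tendsto (fun ζ : ℂ => F ζ * Complex.log ζ) (𝓝[{ζ : ℂ | 0 ≤ ζ.im ∧ ζ ≠ 0}] 0) (𝓝 k)))

/-- `f` (only its values on the closure of `H` matter) is the developing map of a circular polygon
on `H` whose corners are the points of the finite set `V` and `∞`. -/
structure IsDevelopingMap (V : Set ℝ) (f : OnePoint ℂ → OnePoint ℂ) : Prop where
  continuousOn : ContinuousOn f closedH
  conformal : ∀ z : ℂ, 0 ≤ z.im → (∀ v ∈ V, z ≠ (v : ℂ)) → ConformalAt f z
  angle : ∀ c, IsCorner V c → ∃ α, HasAngle f c α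
  side : ∀ c, IsCorner V c →
    ∃ C, IsCircle C ∧ ∀ y ∈ sideBefore V c, f (bdry (y : OnePoint ℝ)) ∈ C

/-- The two sides that meet at the corner `c` are mapped by `f` into the same circle. -/
def SameCircleAt (V : Set ℝ) (f : OnePoint ℂ → OnePoint ℂ) (c : OnePoint ℝ) : Prop :=
  ∃ C, IsCircle C ∧ ∀ y ∈ sideBefore V c ∪ sideAfter V c, f (bdry (y : OnePoint ℝ)) ∈ C

/-- `σ` is the reflection in (the circle containing the image of) one of the sides. -/
def IsSideReflection (V : Set ℝ) (f : OnePoint ℂ → OnePoint ℂ)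
    (σ : Equiv.Perm (OnePoint ℂ)) : Prop :=
  ∃ c C, IsCorner V c ∧ IsReflectionIn σ C ∧
    ∀ y ∈ sideBefore V c, f (bdry (y : OnePoint ℝ)) ∈ C

/-- The products of even numbers of reflections in the sides. -/
def evenProducts (V : Set ℝ) (f : OnePoint ℂ → OnePoint ℂ) : Set (Equiv.Perm (OnePoint ℂ)) :=
  {T | ∃ l : List (Equiv.Perm (OnePoint ℂ)),
    Even l.length ∧ (∀ σ ∈ l, IsSideReflection V f σ) ∧ T = l.prod}

/-- The points `(t₁, t₂, t₃) = (0, 1, x)`. -/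
def sing (x : ℝ) : Fin 3 → ℝ := ![0, 1, x]

/-- The corners `(t₁, t₂, t₃, t₄) = (0, 1, x, ∞)`. -/
def corner (x : ℝ) : Fin 4 → OnePoint ℝ :=
  ![((0 : ℝ) : OnePoint ℝ), ((1 : ℝ) : OnePoint ℝ), (x : OnePoint ℝ), ∞]

/-- `f` is the developing map of a circular pentagon on `H` with corners `0, 1, x, ∞` and `q`,
angles `κ j` at the first four of them and `2` at `q`, such that the two sides that meet at `q` are
mapped into the same circle. -/
structure IsSlitPentagon (κ : Fin 4 → ℝ) (x q : ℝ) (f : OnePoint ℂ → OnePoint ℂ) : Prop where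
  developing : IsDevelopingMap {0, 1, x, q} f
  angle : ∀ j, HasAngle f (corner x j) (κ j)
  angle_q : HasAngle f (q : OnePoint ℝ) 2
  slit : SameCircleAt {0, 1, x, q} f (q : OnePoint ℝ)

/-! ### Analytic continuation and projective monodromy -/

/-- The value of `a / b` in the sphere (used when `a` and `b` are not both `0`). -/
def ratio (a b : ℂ) : OnePoint ℂ := if b = 0 then ∞ else ((a / b : ℂ) : OnePoint ℂ)

/-- `W` is an analytic continuation along the path `γ`: for each `s`, `W s` is a function element
at `γ s`, and these elements are locally coherent. -/
def IsContinuation {a b : ℂ} (γ : Path a b) (W : unitInterval → ℂ → ℂ) : Prop :=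
  ∀ s, AnalyticAt ℂ (W s) (γ s) ∧ ∀ᶠ s' in 𝓝 s, W s' =ᶠ[𝓝 (γ s')] W s

/-- The germs of `w₁` and `w₂` at `x₀` have analytic continuations along the loop `γ`, and the
continuation of their ratio `f` is `f^γ = T ∘ f` with the linear-fractional transformation `T`. -/
def IsProjMonodromy (w₁ w₂ : ℂ → ℂ) {x₀ : ℂ} (γ : Path x₀ x₀)
    (T : Equiv.Perm (OnePoint ℂ)) : Prop :=
  ∃ W₁ W₂ : unitInterval → ℂ → ℂ, IsContinuation γ W₁ ∧ IsContinuation γ W₂ ∧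
    W₁ 0 =ᶠ[𝓝 x₀] w₁ ∧ W₂ 0 =ᶠ[𝓝 x₀] w₂ ∧
    (∃ g : GL (Fin 2) ℂ, ∀ z, T z = g • z) ∧
    ∀ᶠ z in 𝓝 x₀, ratio (W₁ 1 z) (W₂ 1 z) = T (ratio (w₁ z) (w₂ z))

/-- The projective monodromy group: the transformations `T` that arise by continuation along the
loops at `x₀` in `ℂ \ V`. -/
def projMonodromyGroup (V : Set ℝ) (w₁ w₂ : ℂ → ℂ) (x₀ : ℂ) : Set (Equiv.Perm (OnePoint ℂ)) :=
  {T | ∃ γ : Path x₀ x₀, (∀ s, ∀ v ∈ V, γ s ≠ (v : ℂ)) ∧ IsProjMonodromy w₁ w₂ γ T}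

/-- A loop (with base point in `H`) that goes from `H` to the lower half-plane through the side
that ends at `c`, and returns to `H` through the side that begins at `c`. Such a loop goes once
around `c`, and it determines one element of the fundamental group of `ℂ \ V`. -/
def LoopAround (V : Set ℝ) (c : OnePoint ℝ) {x₀ : ℂ} (γ : Path x₀ x₀) : Prop :=
  ∃ a b : unitInterval, a < b ∧
    (∀ s, s < a → 0 < (γ s).im) ∧
    (∃ y ∈ sideBefore V c, γ a = (y : ℂ)) ∧
    (∀ s, a < s → s < b → (γ s).im < 0) ∧
    (∃ y ∈ sideAfter V c, γ b = (y : ℂ)) ∧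
    (∀ s, b < s → 0 < (γ s).im)

/-- The condition `T_j ≠ id`, `1 ≤ j ≤ 4`, for the generators `T_j` of the projective monodromy
representation of `f = w₁ / w₂`, which belong to the loops around `t_j` in `ℂ \ {0, 1, x}`. -/
def GeneratorsNontrivial (x : ℝ) (w₁ w₂ : ℂ → ℂ) (x₀ : ℂ) : Prop :=
  ∀ j, ∃ (γ : Path x₀ x₀) (T : Equiv.Perm (OnePoint ℂ)),
    LoopAround {0, 1, x} (corner x j) γ ∧ IsProjMonodromy w₁ w₂ γ T ∧ T ≠ 1

/-! ### The class of linear differential equations -/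

/-- The parameters of the equation
`w'' - (1/(z-q) + ∑ (κ_j - 1)/(z - t_j)) w' + (p/(z-q) - ∑ h_j/(z - t_j)) w = 0`,
where the sums are over `1 ≤ j ≤ 3`; the fourth `κ` is the exponent difference at `∞`, imposed by
`RegularAtInfinity`. -/
structure FuchsEquation where
  κ : Fin 4 → ℝ
  x : ℝ
  q : ℝ
  p : ℝ
  h : Fin 3 → ℝ

namespace FuchsEquation

variable (E : FuchsEquation)

/-- The coefficient `P` of the equation `w'' - P w' + Q w = 0`. -/
def P (z : ℂ) : ℂ :=
  1 / (z - E.q) + ∑ j : Fin 3, ((E.κ j.castSucc : ℂ) - 1) / (z - sing E.x j)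

/-- The coefficient `Q` of the equation `w'' - P w' + Q w = 0`. -/
def Q (z : ℂ) : ℂ :=
  (E.p : ℂ) / (z - E.q) - ∑ j : Fin 3, (E.h j : ℂ) / (z - sing E.x j)

/-- `w` is a solution in `H`. -/
def IsSolution (w : ℂ → ℂ) : Prop :=
  DifferentiableOn ℂ w {z : ℂ | 0 < z.im} ∧
    ∀ z : ℂ, 0 < z.im → deriv (deriv w) z - E.P z * deriv w z + E.Q z * w z = 0

/-- Two linearly independent solutions in `H`. -/
def IsFundamentalPair (w₁ w₂ : ℂ → ℂ) : Prop :=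
  E.IsSolution w₁ ∧ E.IsSolution w₂ ∧
    ∀ a b : ℂ, (∀ z : ℂ, 0 < z.im → a * w₁ z + b * w₂ z = 0) → a = 0 ∧ b = 0

/-- Condition a): `∞` is a regular singularity (`z P` and `z² Q` have finite limits `A`, `B` at
`∞`), and the exponents at `∞`, which are the roots `ρ` of `ρ (ρ + 1) + A ρ + B`, have difference
`κ_4`. -/
def RegularAtInfinity : Prop :=
  ∃ A B : ℂ, Tendsto (fun z : ℂ => z * E.P z) (Bornology.cobounded ℂ) (𝓝 A) ∧
    Tendsto (fun z : ℂ => z ^ 2 * E.Q z) (Bornology.cobounded ℂ) (𝓝 B) ∧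
    ∃ ρ₁ ρ₂ : ℂ, (∀ ρ : ℂ, ρ * (ρ + 1) + A * ρ + B = (ρ - ρ₁) * (ρ - ρ₂)) ∧
      ρ₁ - ρ₂ = (E.κ 3 : ℂ)

/-- The singular point `c` is apparent: the local projective monodromy around it is trivial. -/
def IsApparentAt (c : OnePoint ℝ) : Prop :=
  ∀ w₁ w₂ : ℂ → ℂ, E.IsFundamentalPair w₁ w₂ → ∀ x₀ : ℂ, 0 < x₀.im → ∀ γ : Path x₀ x₀,
    LoopAround {0, 1, E.x, E.q} c γ → IsProjMonodromy w₁ w₂ γ 1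

/-- Condition b): the singularity `q` is apparent, those at `0, 1, x, ∞` are not. -/
def ConditionB : Prop :=
  E.IsApparentAt (E.q : OnePoint ℝ) ∧ ∀ j, ¬ E.IsApparentAt (corner E.x j)

end FuchsEquation

end CircularPolygon

end

open CircularPolygon

/-!
# Slit circular pentagons and Fuchsian equations with an apparent singularity

A pair of solutions is treated as a function `w` with values in `ℂ²`, and its ratio as the point
`vr (w z)` of the sphere, on which `GL₂(ℂ)` acts; this avoids a separate discussion of the poles of
the ratio.

**From the equation to the pentagon.** The coefficients are real, so `sharp w`, with
`sharp w z = conj (w (conj z))`, is a pair of solutions in the lower half-plane, and the continuation of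
`w` across a regular point `y` of the real line is `M • sharp w` with a constant matrix `M`
(`SolvesV.extendable`). The anti-conformal map `p ↦ M • conj p` is an involution that fixes the image
of the side containing `y`, so it is the reflection in the circle of this side
(`Extendable.isReflection_antiMob`, `Extendable.eq_antiMob`). At a singular point, the explicit
Wronskian turns the Frobenius solution with the larger exponent into a fundamental pair whose ratio is
`ζ ^ (-κ) F(ζ) + e log ζ` with `F` analytic (`exists_cornerForm`). This yields the continuous
extension of the ratio and its angles (`HasCornerForm.exists_asymptotics`,
`Extendable.exists_boundaryExtension`).

**Monodromy.** Each passage of a loop through a side contributes one reflection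
(`Extendable.exists_continuation`, `Extendable.projMonodromyGroup_eq`), and the monodromy around a
corner is the product of the reflections in the two sides that meet there. It is trivial if and only if
the sides lie on one circle (`Extendable.mob_eq_one_iff`); in particular `q` is apparent if and only if
the sides at `q` lie on one circle (`FuchsEquation.IsFundamentalPair.isApparentAt_iff`). If `q` is
apparent, the coefficient `e` at `q` vanishes and the solutions continue through `q`
(`Extendable.exists_crossing_of_mob_eq_one`), so that the loops need only avoid `0`, `1` and `x`.

**From the pentagon to the equation.** The Schwarzian derivative of a developing map does not change
under linear-fractional transformations, so it is real on the sides and continues by symmetry to a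
function that is analytic except at the corners (`IsDevelopingMap.analyticAt_symSchw`). At a corner
with angle `α` it is asymptotic to `(1 - α²) / (2 ζ²)` (`IsDevelopingMap.tendsto_schw`). The asymptotics
of the map are given only in the closed half-plane, where they may not be differentiated up to the
boundary; but reflection in the two sides extends the map, with its asymptotics, to a sector with an
opening greater than `π`, in which the Cauchy estimates apply (`tendsto_sch_of_pos`). If the angle is
`0`, the circles of the two sides are tangent; in the coordinate `Y`, in which the map is asymptotic to
a logarithm, they are parallel lines, so `ζ Y'` is single-valued and has a removable singularity
(`tendsto_sch_of_log`). By the theorem of Liouville the Schwarzian derivative is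
`P' - P² / 2 + 2 Q` with the prescribed `P` and a sum `Q` of real partial fractions
(`exists_pf_of_schwarzian`), and its behaviour at `∞` gives the exponents there. Locally, a function `F`
with this Schwarzian derivative is the ratio of the solutions `F s` and `s`, where
`s' / s = (P - F'' / F') / 2` (`exists_solvesV_of_schwarzian`); since the half-plane is simply connected,
one fundamental pair serves everywhere (`exists_solvesV_of_locally`).
-/

open CircularPolygon

namespace CircularPolygon
open scoped ComplexConjugate
open Matrix

/-! ### Homogeneous coordinates on the sphere -/

/-- The point of the sphere with homogeneous coordinates `v`; a junk value if `v = 0`. -/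
noncomputable def vr (v : Fin 2 → ℂ) : OnePoint ℂ := ratio (v 0) (v 1)

/-- The complex conjugate of a matrix in `GL₂(ℂ)`. -/
noncomputable def conjGL (g : GL (Fin 2) ℂ) : GL (Fin 2) ℂ :=
  Matrix.GeneralLinearGroup.map (starRingEnd ℂ) g

lemma vec_ne_zero_iff (v : Fin 2 → ℂ) : v ≠ 0 ↔ v 0 ≠ 0 ∨ v 1 ≠ 0 := by
  rw [Ne, funext_iff, Fin.forall_fin_two]
  simp only [Pi.zero_apply]
  tauto

lemma GL_smul_zero_apply (g : GL (Fin 2) ℂ) (v : Fin 2 → ℂ) :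
    (g • v) 0 = g 0 0 * v 0 + g 0 1 * v 1 := by simp

lemma GL_smul_one_apply (g : GL (Fin 2) ℂ) (v : Fin 2 → ℂ) :
    (g • v) 1 = g 1 0 * v 0 + g 1 1 * v 1 := by simp

lemma GL_det_ne_zero (g : GL (Fin 2) ℂ) : g 0 0 * g 1 1 - g 0 1 * g 1 0 ≠ 0 := by
  have := g.det_ne_zero
  rwa [Matrix.det_fin_two] at this

/-- The element of `GL₂(ℂ)` with given entries. -/
noncomputable def mkGL (a b c d : ℂ) (h : a * d - b * c ≠ 0) : GL (Fin 2) ℂ :=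
  Matrix.GeneralLinearGroup.mkOfDetNeZero !![a, b; c, d] (by rwa [Matrix.det_fin_two_of])

@[simp] lemma mkGL_00 (a b c d : ℂ) (h) : (mkGL a b c d h) 0 0 = a := rfl
@[simp] lemma mkGL_01 (a b c d : ℂ) (h) : (mkGL a b c d h) 0 1 = b := rfl
@[simp] lemma mkGL_10 (a b c d : ℂ) (h) : (mkGL a b c d h) 1 0 = c := rfl
@[simp] lemma mkGL_11 (a b c d : ℂ) (h) : (mkGL a b c d h) 1 1 = d := rfl

lemma GL_smul_ne_zero {g : GL (Fin 2) ℂ} {v : Fin 2 → ℂ} (hv : v ≠ 0) : g • v ≠ 0 := by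
  intro h
  apply hv
  have : g⁻¹ • (g • v) = 0 := by rw [h]; ext i; fin_cases i <;> simp
  rwa [inv_smul_smul] at this

@[simp] lemma vr_coe (z : ℂ) : vr ![z, 1] = (z : OnePoint ℂ) := by simp [vr, ratio]

@[simp] lemma vr_infty (z : ℂ) : vr ![z, 0] = (∞ : OnePoint ℂ) := by simp [vr, ratio]

lemma exists_vr (p : OnePoint ℂ) : ∃ v : Fin 2 → ℂ, v ≠ 0 ∧ vr v = p := by
  induction p using OnePoint.rec with
  | infty => exact ⟨![1, 0], by simp, vr_infty 1⟩
  | coe z => exact ⟨![z, 1], by simp, vr_coe z⟩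

lemma vr_eq_iff {u v : Fin 2 → ℂ} (hu : u ≠ 0) (hv : v ≠ 0) :
    vr u = vr v ↔ u 0 * v 1 = u 1 * v 0 := by
  rw [vec_ne_zero_iff] at hu hv
  unfold vr ratio
  by_cases h1 : u 1 = 0 <;> by_cases h2 : v 1 = 0 <;> simp [h1, h2] at hu hv ⊢
  · exact hu
  · exact hv
  · rw [div_eq_div_iff h1 h2]; constructor <;> intro h <;> linear_combination h

lemma smul_vr (g : GL (Fin 2) ℂ) {v : Fin 2 → ℂ} (hv : v ≠ 0) : g • vr v = vr (g • v) := by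
  by_cases h1 : v 1 = 0
  · have h0 : v 0 ≠ 0 := by rw [vec_ne_zero_iff] at hv; simpa [h1] using hv
    have : vr v = ∞ := by simp [vr, ratio, h1]
    rw [this, smul_infty_eq_ite]
    simp [vr, ratio, h1, h0]
    split_ifs with h
    · rfl
    · rw [mul_div_mul_right _ _ h0]
  · have : vr v = ((v 0 / v 1 : ℂ) : OnePoint ℂ) := by simp [vr, ratio, h1]
    rw [this, smul_some_eq_ite]
    have e : g 1 0 * (v 0 / v 1) + g 1 1 = (g 1 0 * v 0 + g 1 1 * v 1) / v 1 := by field_simp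
    have e' : g 0 0 * (v 0 / v 1) + g 0 1 = (g 0 0 * v 0 + g 0 1 * v 1) / v 1 := by field_simp
    rw [e, e', div_div_div_cancel_right₀ h1]
    simp [vr, ratio, h1]

lemma vr_smul_of_ne_zero {c : ℂ} (hc : c ≠ 0) (v : Fin 2 → ℂ) : vr (c • v) = vr v := by
  simp only [vr, ratio, Pi.smul_apply, smul_eq_mul, mul_eq_zero, hc, false_or]
  split_ifs with h
  · rfl
  · rw [mul_div_mul_left _ _ hc]

lemma star_ne_zero_vec {v : Fin 2 → ℂ} (hv : v ≠ 0) : star v ≠ 0 := by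
  rwa [Ne, star_eq_zero]

lemma conjS_vr (v : Fin 2 → ℂ) : conjS (vr v) = vr (star v) := by
  unfold vr ratio conjS
  simp only [Pi.star_apply, star_eq_zero]
  split_ifs with h <;> simp

lemma conjS_conjS (p : OnePoint ℂ) : conjS (conjS p) = p := by
  obtain ⟨v, hv, rfl⟩ := exists_vr p
  simp [conjS_vr]

@[simp] lemma conjS_coe (z : ℂ) : conjS (z : OnePoint ℂ) = ((conj z : ℂ) : OnePoint ℂ) := rfl

lemma conjGL_apply (g : GL (Fin 2) ℂ) (i j : Fin 2) : conjGL g i j = conj (g i j) := rfl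

lemma star_GL_smul (g : GL (Fin 2) ℂ) (v : Fin 2 → ℂ) : star (g • v) = conjGL g • star v := by
  ext i; fin_cases i <;> simp [conjGL_apply]

lemma conjS_smul (g : GL (Fin 2) ℂ) (p : OnePoint ℂ) : conjS (g • p) = conjGL g • conjS p := by
  obtain ⟨v, hv, rfl⟩ := exists_vr p
  rw [smul_vr _ hv, conjS_vr, conjS_vr, smul_vr _ (star_ne_zero_vec hv), star_GL_smul]

/-! ### Continuity of the action on the sphere -/

lemma tendsto_coe_infty_iff {α : Type*} {l : Filter α} {f : α → ℂ} :
    Tendsto (fun x => (f x : OnePoint ℂ)) l (𝓝 ∞) ↔ Tendsto f l (Bornology.cobounded ℂ) := by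
  rw [Metric.cobounded_eq_cocompact, ← coclosedCompact_eq_cocompact, ← comap_coe_nhds_infty,
    tendsto_comap_iff]
  rfl

lemma continuousAt_vr {v : Fin 2 → ℂ} (hv : v ≠ 0) : ContinuousAt vr v := by
  have c0 : ContinuousAt (fun u : Fin 2 → ℂ => u 0) v := (continuous_apply 0).continuousAt
  have c1 : ContinuousAt (fun u : Fin 2 → ℂ => u 1) v := (continuous_apply 1).continuousAt
  by_cases h1 : v 1 = 0
  · have h0 : v 0 ≠ 0 := by rw [vec_ne_zero_iff] at hv; simpa [h1] using hv
    have hval : vr v = ∞ := by simp [vr, ratio, h1]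
    have t : Tendsto (fun u : Fin 2 → ℂ => u 1 / u 0) (𝓝 v) (𝓝 0) := by
      have := (c1.div c0 h0).tendsto
      rwa [Pi.div_apply, h1, zero_div] at this
    unfold ContinuousAt
    rw [hval]
    intro s hs
    have hs' : (fun z : ℂ => (z : OnePoint ℂ)) ⁻¹' s ∈ Bornology.cobounded ℂ :=
      tendsto_coe_infty_iff.2 tendsto_id hs
    have hs2 : ∀ᶠ z in 𝓝[≠] (0 : ℂ), ((z⁻¹ : ℂ) : OnePoint ℂ) ∈ s :=
      tendsto_inv₀_nhdsNE_zero hs'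
    rw [eventually_nhdsWithin_iff] at hs2
    change ∀ᶠ u in 𝓝 v, vr u ∈ s
    filter_upwards [t.eventually hs2, c0.eventually_ne h0] with u hu hu0
    by_cases h : u 1 = 0
    · simpa [vr, ratio, h] using mem_of_mem_nhds hs
    · have := hu (by simp [h, hu0])
      simpa [vr, ratio, h] using this
  · have : (fun u : Fin 2 → ℂ => ((u 0 / u 1 : ℂ) : OnePoint ℂ)) =ᶠ[𝓝 v] vr := by
      filter_upwards [c1.eventually_ne h1] with u hu
      simp [vr, ratio, hu]
    refine ContinuousAt.congr ?_ this
    exact (continuous_coe.continuousAt).comp (c0.div c1 h1)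

lemma continuous_GL_smul_vec (g : GL (Fin 2) ℂ) : Continuous (fun v : Fin 2 → ℂ => g • v) := by
  refine continuous_pi fun i => ?_
  fin_cases i <;> simp <;> fun_prop

lemma continuous_mobius (g : GL (Fin 2) ℂ) : Continuous (fun p : OnePoint ℂ => g • p) := by
  rw [continuous_iff_continuousAt]
  intro p
  induction p using OnePoint.rec with
  | infty =>
    rw [OnePoint.continuousAt_infty']
    have h10 : (![1, 0] : Fin 2 → ℂ) ≠ 0 := by simp
    have e : g • (∞ : OnePoint ℂ) = vr (g • (![1, 0] : Fin 2 → ℂ)) := by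
      rw [← smul_vr _ h10, vr_infty]
    rw [e, coclosedCompact_eq_cocompact, ← Metric.cobounded_eq_cocompact]
    have t : Tendsto (fun z : ℂ => g • (![1, z⁻¹] : Fin 2 → ℂ)) (Bornology.cobounded ℂ)
        (𝓝 (g • (![1, 0] : Fin 2 → ℂ))) := by
      refine ((continuous_GL_smul_vec g).tendsto _).comp ?_
      rw [tendsto_pi_nhds]
      intro i; fin_cases i
      · simp
      · simpa using tendsto_inv₀_cobounded (α := ℂ)
    refine ((continuousAt_vr (GL_smul_ne_zero h10)).tendsto.comp t).congr' ?_
    filter_upwards [(Bornology.eventually_ne_cobounded (0 : ℂ))] with z hz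
    simp only [Function.comp]
    rw [← smul_vr _ (by simp)]
    simp [vr, ratio, hz]
  | coe z =>
    rw [OnePoint.continuousAt_coe]
    have h : ∀ z : ℂ, (![z, 1] : Fin 2 → ℂ) ≠ 0 := fun z => by simp
    have e : (fun p : OnePoint ℂ => g • p) ∘ (fun z : ℂ => (z : OnePoint ℂ)) =
        fun z => vr (g • (![z, 1] : Fin 2 → ℂ)) := by
      ext1 z
      simp only [Function.comp]
      rw [← smul_vr _ (h z), vr_coe]
    change ContinuousAt ((fun p : OnePoint ℂ => g • p) ∘ (fun z : ℂ => (z : OnePoint ℂ))) z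
    rw [e]
    refine ContinuousAt.comp (g := vr) (continuousAt_vr (GL_smul_ne_zero (h z))) ?_
    refine ((continuous_GL_smul_vec g).continuousAt).comp ?_
    rw [continuousAt_pi]
    intro i; fin_cases i
    · exact continuousAt_id
    · exact continuousAt_const

/-! ### Independent pairs of analytic functions -/

lemma AnalyticAt.GL_smul {v : ℂ → Fin 2 → ℂ} {z : ℂ} (hv : AnalyticAt ℂ v z)
    (g : GL (Fin 2) ℂ) : AnalyticAt ℂ (fun z => g • v z) z := by
  rw [analyticAt_pi_iff] at hv ⊢
  intro i
  fin_cases i <;> simp <;>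
  exact (analyticAt_const.mul (hv 0)).add (analyticAt_const.mul (hv 1))

/-- No nontrivial linear relation holds between the components of `v` near `z`. -/
def IndepAt (v : ℂ → Fin 2 → ℂ) (z : ℂ) : Prop :=
  ∀ a b : ℂ, (∀ᶠ z' in 𝓝 z, a * v z' 0 + b * v z' 1 = 0) → a = 0 ∧ b = 0

lemma IndepAt.congr {v w : ℂ → Fin 2 → ℂ} {z : ℂ} (hv : IndepAt v z) (h : v =ᶠ[𝓝 z] w) :
    IndepAt w z := fun a b hab => hv a b (by
  filter_upwards [h, hab] with z' h1 h2
  rw [h1, h2])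

/-- A quadratic form that vanishes on an independent pair of analytic functions is zero, because
it is a product of two linear forms. -/
lemma IndepAt.quadratic_eq_zero {v : ℂ → Fin 2 → ℂ} {z : ℂ} (hv : AnalyticAt ℂ v z)
    (hi : IndepAt v z) {α β γ : ℂ}
    (h : ∃ᶠ z' in 𝓝[≠] z, α * v z' 0 ^ 2 + β * (v z' 0 * v z' 1) + γ * v z' 1 ^ 2 = 0) :
    α = 0 ∧ β = 0 ∧ γ = 0 := by
  have hv' := analyticAt_pi_iff.1 hv
  have lin : ∀ a b : ℂ, (∃ᶠ z' in 𝓝[≠] z, a * v z' 0 + b * v z' 1 = 0) → a = 0 ∧ b = 0 := by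
    intro a b hab
    apply hi
    have : AnalyticAt ℂ (fun z' => a * v z' 0 + b * v z' 1) z :=
      (analyticAt_const.mul (hv' 0)).add (analyticAt_const.mul (hv' 1))
    exact this.frequently_zero_iff_eventually_zero.1 hab
  by_cases hα : α = 0
  · subst hα
    have h2 : ∃ᶠ z' in 𝓝[≠] z, (0 * v z' 0 + 1 * v z' 1 = 0) ∨ (β * v z' 0 + γ * v z' 1 = 0) := by
      refine h.mono fun z' hz => ?_
      rw [← mul_eq_zero]; linear_combination hz
    rcases frequently_or_distrib.1 h2 with h3 | h3
    · simpa using (lin _ _ h3).2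
    · exact ⟨rfl, lin _ _ h3⟩
  -- `d` is a square root of the discriminant, so the form is a product of two linear forms
  · obtain ⟨d, hd⟩ := IsAlgClosed.exists_pow_nat_eq (β ^ 2 - 4 * α * γ) (n := 2) (by norm_num)
    have h2 : ∃ᶠ z' in 𝓝[≠] z, (2 * α * v z' 0 + (β - d) * v z' 1 = 0) ∨
        (2 * α * v z' 0 + (β + d) * v z' 1 = 0) := by
      refine h.mono fun z' hz => ?_
      rw [← mul_eq_zero]; linear_combination 4 * α * hz - v z' 1 ^ 2 * hd
    rcases frequently_or_distrib.1 h2 with h3 | h3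
    · have := (lin _ _ h3).1; simp [hα] at this
    · have := (lin _ _ h3).1; simp [hα] at this

/-- Two linear-fractional transformations that agree on the values of the ratio of an independent
pair of analytic functions are equal. -/
lemma IndepAt.smul_eq_smul {v : ℂ → Fin 2 → ℂ} {z : ℂ} (hv : AnalyticAt ℂ v z)
    (hi : IndepAt v z) {g h : GL (Fin 2) ℂ}
    (hf : ∃ᶠ z' in 𝓝[≠] z, v z' ≠ 0 → g • vr (v z') = h • vr (v z')) (p : OnePoint ℂ) :
    g • p = h • p := by
  set k := h⁻¹ * g with hk
  suffices H : k • p = p by rw [hk, mul_smul, inv_smul_eq_iff] at H; exact H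
  -- the fixed points of `k` are the zeros of a quadratic form
  have hq := hi.quadratic_eq_zero hv (α := -k 1 0) (β := k 0 0 - k 1 1) (γ := k 0 1) (by
    refine hf.mono fun z' hz => ?_
    by_cases h0 : v z' = 0
    · simp [h0]
    have h1 : k • vr (v z') = vr (v z') := by rw [hk, mul_smul, inv_smul_eq_iff]; exact hz h0
    rw [smul_vr _ h0, vr_eq_iff (GL_smul_ne_zero h0) h0, GL_smul_zero_apply,
      GL_smul_one_apply] at h1
    linear_combination h1)
  obtain ⟨u, hu, rfl⟩ := exists_vr p
  rw [smul_vr _ hu, vr_eq_iff (GL_smul_ne_zero hu) hu, GL_smul_zero_apply, GL_smul_one_apply]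
  linear_combination (u 0) ^ 2 * hq.1 + u 0 * u 1 * hq.2.1 + u 1 ^ 2 * hq.2.2

/-! ### Reflection of functions in the real axis -/

/-- The function `z ↦ conj (f (conj z))`, for scalar or vector valued `f`. -/
noncomputable def sharp {F : Type*} [Star F] (f : ℂ → F) (z : ℂ) : F := star (f (conj z))

lemma differentiableAt_sharp {f : ℂ → ℂ} {z : ℂ} (hf : DifferentiableAt ℂ f (conj z)) :
    DifferentiableAt ℂ (sharp f) z :=
  differentiableAt_conj_conj_iff.2 hf

lemma deriv_sharp (f : ℂ → ℂ) : deriv (sharp f) = sharp (deriv f) := deriv_conj_conj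

lemma analyticAt_sharp {f : ℂ → ℂ} {z : ℂ} (hf : AnalyticAt ℂ f (conj z)) :
    AnalyticAt ℂ (sharp f) z := by
  rw [Complex.analyticAt_iff_eventually_differentiableAt] at hf ⊢
  have := (Complex.continuous_conj.tendsto z).eventually hf
  filter_upwards [this] with z' hz' using differentiableAt_sharp hz'

lemma analyticAt_sharp_vec {v : ℂ → Fin 2 → ℂ} {z : ℂ} (hv : AnalyticAt ℂ v (conj z)) :
    AnalyticAt ℂ (sharp v) z := by
  rw [analyticAt_pi_iff] at hv ⊢
  exact fun i => analyticAt_sharp (hv i)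

/-! ### Linear-fractional and anti-conformal permutations of the sphere -/

/-- The linear-fractional permutation of the sphere given by a matrix. -/
noncomputable def mob (g : GL (Fin 2) ℂ) : Equiv.Perm (OnePoint ℂ) := MulAction.toPerm g

/-- The anti-conformal permutation `p ↦ g (conj p)` of the sphere. -/
noncomputable def antiMob (g : GL (Fin 2) ℂ) : Equiv.Perm (OnePoint ℂ) where
  toFun p := g • conjS p
  invFun p := conjS (g⁻¹ • p)
  left_inv p := by simp [conjS_conjS]
  right_inv p := by simp [conjS_conjS]

@[simp] lemma mob_apply (g : GL (Fin 2) ℂ) (p : OnePoint ℂ) : mob g p = g • p := rfl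

@[simp] lemma antiMob_apply (g : GL (Fin 2) ℂ) (p : OnePoint ℂ) : antiMob g p = g • conjS p := rfl

lemma mob_mul (g h : GL (Fin 2) ℂ) : mob (g * h) = mob g * mob h := by
  ext1 p; simp [mul_smul]

lemma mob_one : mob 1 = 1 := by ext1 p; simp

lemma mob_mul_antiMob (g h : GL (Fin 2) ℂ) : mob g * antiMob h = antiMob (g * h) := by
  ext1 p; simp [mul_smul]

lemma antiMob_mul_antiMob (g h : GL (Fin 2) ℂ) :
    antiMob g * antiMob h = mob (g * conjGL h) := by
  ext1 p; simp [mul_smul, conjS_smul, conjS_conjS]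

/-! ### Analytic continuation along paths -/

/-- Analytic continuation of a vector-valued function element along a path. -/
def VCont {a b : ℂ} (γ : Path a b) (W : unitInterval → ℂ → Fin 2 → ℂ) : Prop :=
  ∀ s, AnalyticAt ℂ (W s) (γ s) ∧ ∀ᶠ s' in 𝓝 s, W s' =ᶠ[𝓝 (γ s')] W s

lemma VCont.component {a b : ℂ} {γ : Path a b} {W : unitInterval → ℂ → Fin 2 → ℂ}
    (h : VCont γ W) (i : Fin 2) : IsContinuation γ (fun s z => W s z i) := fun s =>
  ⟨analyticAt_pi_iff.1 (h s).1 i, (h s).2.mono fun _ hs' => hs'.mono fun z hz => by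
    simp only [hz]⟩

lemma VCont.of_components {a b : ℂ} {γ : Path a b} {W₁ W₂ : unitInterval → ℂ → ℂ}
    (h₁ : IsContinuation γ W₁) (h₂ : IsContinuation γ W₂) :
    VCont γ (fun s z => ![W₁ s z, W₂ s z]) := fun s =>
  ⟨analyticAt_pi_iff.2 (Fin.forall_fin_two.2 ⟨(h₁ s).1, (h₂ s).1⟩), by
    filter_upwards [(h₁ s).2, (h₂ s).2] with s' a b
    filter_upwards [a, b] with z az bz
    rw [az, bz]⟩

/-- If every point of the path has a neighbourhood `D` such that an admissible germ at one point of
`D` is the germ of a function whose germs at all points of `D` are admissible, then admissible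
germs have continuations along the path. -/
lemma exists_continuation {a b : ℂ} (γ : Path a b) (Good : ℂ → (ℂ → Fin 2 → ℂ) → Prop)
    (hA : ∀ z ψ, Good z ψ → AnalyticAt ℂ ψ z)
    (hloc : ∀ s, ∃ D : Set ℂ, IsOpen D ∧ γ s ∈ D ∧ ∀ z₁ ∈ D, ∀ ψ, Good z₁ ψ →
      ∃ ψ', ψ' =ᶠ[𝓝 z₁] ψ ∧ ∀ z₂ ∈ D, Good z₂ ψ')
    {ψ₀ : ℂ → Fin 2 → ℂ} (h₀ : Good a ψ₀) :
    ∃ W, VCont γ W ∧ W 0 = ψ₀ ∧ ∀ s, Good (γ s) (W s) := by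
  choose D hDo hDm hD using hloc
  obtain ⟨t, ht0, htm, ⟨N, hN⟩, hts⟩ := exists_monotone_Icc_subset_open_cover_unitInterval
    (c := fun s => γ ⁻¹' D s) (fun s => (hDo s).preimage γ.continuous)
    (fun s _ => Set.mem_iUnion.2 ⟨s, hDm s⟩)
  -- each interval `[t n, t (n + 1)]` is mapped into a single neighbourhood `D i`, so a continuation
  -- up to the parameter `t n` can be prolonged to `t (n + 1)`
  have key : ∀ n : ℕ, ∃ W : unitInterval → ℂ → Fin 2 → ℂ, W 0 = ψ₀ ∧
      (∀ s ≤ t n, Good (γ s) (W s)) ∧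
      (∀ s ≤ t n, ∀ᶠ s' in 𝓝 s, s' ≤ t n → W s' =ᶠ[𝓝 (γ s')] W s) := by
    intro n
    induction n with
    | zero =>
      refine ⟨fun _ => ψ₀, rfl, fun s hs => ?_, fun s hs => Eventually.of_forall fun _ _ =>
        EventuallyEq.rfl⟩
      have : s = 0 := le_antisymm (ht0 ▸ hs) bot_le
      rw [this, γ.source]; exact h₀
    | succ n ih =>
      obtain ⟨W, hW0, hWG, hWc⟩ := ih
      obtain ⟨i, hi⟩ := hts n
      obtain ⟨ψ', h1, h2⟩ := hD i (γ (t n)) (hi ⟨le_rfl, htm (Nat.le_succ n)⟩) _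
        (hWG (t n) le_rfl)
      refine ⟨fun s => if s ≤ t n then W s else ψ', ?_, fun s hs => ?_, fun s hs => ?_⟩
      · have h0 : (0 : unitInterval) ≤ t n := bot_le
        simp only [h0, if_true]; exact hW0
      · by_cases h : s ≤ t n
        · simp only [h, if_true]; exact hWG s h
        · simp only [h, if_false]; exact h2 _ (hi ⟨(not_le.1 h).le, hs⟩)
      · rcases lt_trichotomy s (t n) with h | h | h
        · filter_upwards [hWc s h.le, eventually_lt_nhds h] with s' h3 h4 _
          simp only [h.le, h4.le, if_true]
          exact h3 h4.le
        · subst h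
          have h5 := (γ.continuous.tendsto (t n)).eventually (eventually_eventually_nhds.2 h1)
          filter_upwards [hWc (t n) le_rfl, h5] with s' h3 h4 _
          simp only [le_refl, if_true]
          by_cases h6 : s' ≤ t n
          · simp only [h6, if_true]; exact h3 h6
          · simp only [h6, if_false]; exact h4
        · filter_upwards [eventually_gt_nhds h] with s' h3 _
          simp only [not_le.2 h3, not_le.2 h, if_false]
          exact EventuallyEq.rfl
  obtain ⟨W, hW0, hWG, hWc⟩ := key N
  have hN1 : t N = 1 := hN N le_rfl
  have le1 : ∀ s, s ≤ t N := fun s => hN1 ▸ le_top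
  exact ⟨W, fun s => ⟨hA _ _ (hWG s (le1 s)), (hWc s (le1 s)).mono fun s' h => h (le1 s')⟩, hW0,
    fun s => hWG s (le1 s)⟩

lemma eventuallyEq_of_mem_ball {z₀ z₁ : ℂ} {r : ℝ} {f g : ℂ → Fin 2 → ℂ}
    (hf : AnalyticOnNhd ℂ f (Metric.ball z₀ r)) (hg : AnalyticOnNhd ℂ g (Metric.ball z₀ r))
    (h₁ : z₁ ∈ Metric.ball z₀ r) (h : f =ᶠ[𝓝 z₁] g) : Set.EqOn f g (Metric.ball z₀ r) :=
  hf.eqOn_of_preconnected_of_eventuallyEq hg (convex_ball _ _).isPreconnected h₁ h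

/-- The continuation along a path is determined by its initial germ. -/
lemma VCont.unique {a b : ℂ} {γ : Path a b} {W W' : unitInterval → ℂ → Fin 2 → ℂ}
    (h : VCont γ W) (h' : VCont γ W') (h0 : W 0 =ᶠ[𝓝 a] W' 0) (s : unitInterval) :
    W s =ᶠ[𝓝 (γ s)] W' s := by
  set S : Set unitInterval := {s | W s =ᶠ[𝓝 (γ s)] W' s} with hS
  have hopen : IsOpen S := by
    rw [isOpen_iff_mem_nhds]
    intro s hs
    have h1 := (γ.continuous.tendsto s).eventually (eventually_eventually_nhds.2 hs)
    filter_upwards [(h s).2, (h' s).2, h1] with s' h2 h3 h4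
    exact h2.trans (EventuallyEq.trans h4 h3.symm)
  have hclosed : IsClosed S := by
    rw [← isOpen_compl_iff, isOpen_iff_mem_nhds]
    intro s hs
    obtain ⟨r, hr, hb⟩ := Metric.eventually_nhds_iff_ball.1
      ((h s).1.eventually_analyticAt.and (h' s).1.eventually_analyticAt)
    have h1 := (γ.continuous.tendsto s).eventually (Metric.ball_mem_nhds (γ s) hr)
    filter_upwards [(h s).2, (h' s).2, h1] with s' h2 h3 h4 h5
    apply hs
    have h6 : W s =ᶠ[𝓝 (γ s')] W' s := h2.symm.trans (EventuallyEq.trans h5 h3)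
    have := eventuallyEq_of_mem_ball (fun z hz => (hb z hz).1) (fun z hz => (hb z hz).2) h4 h6
    filter_upwards [Metric.ball_mem_nhds (γ s) hr] with z hz using this hz
  have : S = Set.univ := IsClopen.eq_univ ⟨hclosed, hopen⟩ ⟨0, by
    rw [hS, Set.mem_ofPred_eq, γ.source]; exact h0⟩
  exact (this ▸ Set.mem_univ s : s ∈ S)

/-! ### Pairs of functions in the upper half-plane that extend across the real axis -/

/-- `w` extends analytically to a neighbourhood of the real point `y`, without zeros, and in the
lower half-plane the extension is `M • sharp w`. -/
def Crossing (w : ℂ → Fin 2 → ℂ) (y : ℝ) (M : GL (Fin 2) ℂ) : Prop :=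
  ∃ r > 0, ∃ φ : ℂ → Fin 2 → ℂ, (∀ z ∈ Metric.ball (y : ℂ) r, AnalyticAt ℂ φ z ∧ φ z ≠ 0) ∧
    (∀ z ∈ Metric.ball (y : ℂ) r, 0 < z.im → φ z = w z) ∧
    (∀ z ∈ Metric.ball (y : ℂ) r, z.im < 0 → φ z = M • sharp w z)

/-- The pair `w` of functions in the upper half-plane is analytic, independent and without common
zeros, and it has a `Crossing` at all real points outside of `V`. -/
structure Extendable (V : Set ℝ) (w : ℂ → Fin 2 → ℂ) : Prop where
  analytic : ∀ z : ℂ, 0 < z.im → AnalyticAt ℂ w z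
  ne_zero : ∀ z : ℂ, 0 < z.im → w z ≠ 0
  indep : ∀ z : ℂ, 0 < z.im → IndepAt w z
  cross : ∀ y : ℝ, y ∉ V → ∃ M, Crossing w y M

lemma frequently_im_pos {z : ℂ} (hz : 0 ≤ z.im) : ∃ᶠ z' in 𝓝[≠] z, 0 < z'.im := by
  have t : Tendsto (fun t : ℝ => z + Complex.I * t) (𝓝[>] 0) (𝓝[≠] z) := by
    refine tendsto_nhdsWithin_iff.2 ⟨?_, ?_⟩
    · have : Continuous (fun t : ℝ => z + Complex.I * t) := by fun_prop
      simpa using (this.tendsto 0).mono_left nhdsWithin_le_nhds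
    · filter_upwards [self_mem_nhdsWithin] with t ht
      have : t ≠ 0 := (ne_of_gt ht)
      simp [this]
  refine t.frequently (Eventually.frequently ?_)
  filter_upwards [self_mem_nhdsWithin] with t ht
  simp only [Set.mem_Ioi] at ht
  simp; linarith

lemma frequently_im_neg {z : ℂ} (hz : z.im ≤ 0) : ∃ᶠ z' in 𝓝[≠] z, z'.im < 0 := by
  have t : Tendsto (fun t : ℝ => z - Complex.I * t) (𝓝[>] 0) (𝓝[≠] z) := by
    refine tendsto_nhdsWithin_iff.2 ⟨?_, ?_⟩
    · have : Continuous (fun t : ℝ => z - Complex.I * t) := by fun_prop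
      simpa using (this.tendsto 0).mono_left nhdsWithin_le_nhds
    · filter_upwards [self_mem_nhdsWithin] with t ht
      have : t ≠ 0 := (ne_of_gt ht)
      simp [this]
  refine t.frequently (Eventually.frequently ?_)
  filter_upwards [self_mem_nhdsWithin] with t ht
  simp only [Set.mem_Ioi] at ht
  simp; linarith

lemma eventually_im_pos {z : ℂ} (hz : 0 < z.im) : ∀ᶠ z' in 𝓝 z, 0 < z'.im :=
  (Complex.continuous_im.tendsto z).eventually (eventually_gt_nhds hz)

lemma eventually_im_neg {z : ℂ} (hz : z.im < 0) : ∀ᶠ z' in 𝓝 z, z'.im < 0 :=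
  (Complex.continuous_im.tendsto z).eventually (eventually_lt_nhds hz)

lemma Extendable.sharp_analytic {V : Set ℝ} {w : ℂ → Fin 2 → ℂ} (h : Extendable V w) {z : ℂ}
    (hz : z.im < 0) : AnalyticAt ℂ (sharp w) z :=
  analyticAt_sharp_vec (h.analytic _ (by simpa using hz))

/-- A germ at `z` is of type `(E, O)` if it is `A • w` in the upper half-plane, with `A ∈ E`, and
`B • sharp w` in the lower half-plane, with `B ∈ O`. -/
def GoodGerm (E O : Set (GL (Fin 2) ℂ)) (w : ℂ → Fin 2 → ℂ) (z : ℂ) (ψ : ℂ → Fin 2 → ℂ) : Prop :=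
  AnalyticAt ℂ ψ z ∧ ∃ A ∈ E, ∃ B ∈ O, (∀ᶠ z' in 𝓝 z, 0 < z'.im → ψ z' = A • w z') ∧
    (∀ᶠ z' in 𝓝 z, z'.im < 0 → ψ z' = B • sharp w z')

/-- The continuation of `w` along a loop which avoids `V` exists, and it is `A • w` with `A ∈ E`, if
the sets `E` and `O` are interchanged by the matrices of the crossings. For the smallest such sets,
`E` accounts for even numbers of crossings of the real line, and `O` for odd numbers. -/
lemma Extendable.exists_continuation {V : Set ℝ} {w : ℂ → Fin 2 → ℂ} (h : Extendable V w)
    {E O : Set (GL (Fin 2) ℂ)}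
    (hEO : ∀ y ∉ V, ∀ M, Crossing w y M → (∀ A ∈ E, A * M ∈ O) ∧ ∀ B ∈ O, B * M⁻¹ ∈ E)
    (h1 : 1 ∈ E) (hO : O.Nonempty) {x₀ : ℂ} (hx₀ : 0 < x₀.im) (γ : Path x₀ x₀)
    (hγ : ∀ s, ∀ v ∈ V, γ s ≠ (v : ℂ)) :
    ∃ W, VCont γ W ∧ W 0 = w ∧ ∃ A ∈ E, W 1 =ᶠ[𝓝 x₀] fun z => A • w z := by
  obtain ⟨B₀, hB₀⟩ := hO
  have h₀ : GoodGerm E O w x₀ w := by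
    refine ⟨h.analytic x₀ hx₀, 1, h1, B₀, hB₀, Eventually.of_forall fun z _ => by simp, ?_⟩
    filter_upwards [eventually_im_pos hx₀] with z hz hz'
    linarith
  have hloc : ∀ s, ∃ D : Set ℂ, IsOpen D ∧ γ s ∈ D ∧ ∀ z₁ ∈ D, ∀ ψ, GoodGerm E O w z₁ ψ →
      ∃ ψ', ψ' =ᶠ[𝓝 z₁] ψ ∧ ∀ z₂ ∈ D, GoodGerm E O w z₂ ψ' := by
    intro s
    -- the neighbourhood is a half-plane, or a disc about a real point in which a crossing exists
    rcases lt_trichotomy (γ s).im 0 with hs | hs | hs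
    · refine ⟨{z | z.im < 0}, isOpen_lt Complex.continuous_im continuous_const, hs, ?_⟩
      rintro z₁ hz₁ ψ ⟨hψ, A, hA, B, hB, -, h2⟩
      refine ⟨fun z => B • sharp w z, ?_, fun z₂ hz₂ => ⟨?_, A, hA, B, hB, ?_,
        Eventually.of_forall fun _ _ => rfl⟩⟩
      · filter_upwards [h2, eventually_im_neg hz₁] with z h3 h4 using (h3 h4).symm
      · exact AnalyticAt.GL_smul (h.sharp_analytic hz₂) B
      · filter_upwards [eventually_im_neg hz₂] with z h3 h4
        linarith
    · obtain ⟨y, hy⟩ : ∃ y : ℝ, γ s = y := ⟨(γ s).re, by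
        apply Complex.ext <;> simp [hs]⟩
      have hyV : y ∉ V := fun hyV => hγ s y hyV hy
      obtain ⟨M, hM⟩ := h.cross y hyV
      have hEO' := hEO y hyV M hM
      obtain ⟨r, hr, φ, hφ, hup, hlow⟩ := hM
      refine ⟨Metric.ball (y : ℂ) r, Metric.isOpen_ball, by rw [hy]; exact Metric.mem_ball_self hr,
        ?_⟩
      -- every multiple of `φ` with a matrix of `E` has admissible germs
      have good : ∀ A ∈ E, ∀ z₂ ∈ Metric.ball (y : ℂ) r, GoodGerm E O w z₂ (fun z => A • φ z) := by
        intro A hA z₂ hz₂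
        refine ⟨AnalyticAt.GL_smul (hφ z₂ hz₂).1 A, A, hA, A * M, hEO'.1 A hA, ?_, ?_⟩
        · filter_upwards [Metric.isOpen_ball.mem_nhds hz₂] with z hz hz'
          rw [hup z hz hz']
        · filter_upwards [Metric.isOpen_ball.mem_nhds hz₂] with z hz hz'
          rw [hlow z hz hz', mul_smul]
      rintro z₁ hz₁ ψ ⟨hψ, A, hA, B, hB, h1, h2⟩
      rcases le_or_gt 0 z₁.im with h0 | h0
      · refine ⟨fun z => A • φ z, ?_, good A hA⟩
        refine ((AnalyticAt.GL_smul (hφ z₁ hz₁).1 A).frequently_eq_iff_eventually_eq hψ).1 ?_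
        refine (frequently_im_pos h0).mp ?_
        filter_upwards [nhdsWithin_le_nhds h1,
          nhdsWithin_le_nhds (Metric.isOpen_ball.mem_nhds hz₁)] with z h3 h4 h5
        rw [h3 h5, hup z h4 h5]
      · refine ⟨fun z => (B * M⁻¹) • φ z, ?_, good _ (hEO'.2 B hB)⟩
        refine ((AnalyticAt.GL_smul (hφ z₁ hz₁).1 _).frequently_eq_iff_eventually_eq hψ).1 ?_
        refine (frequently_im_neg h0.le).mp ?_
        filter_upwards [nhdsWithin_le_nhds h2,
          nhdsWithin_le_nhds (Metric.isOpen_ball.mem_nhds hz₁)] with z h3 h4 h5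
        rw [h3 h5, hlow z h4 h5, mul_smul, inv_smul_smul]
    · refine ⟨{z | 0 < z.im}, isOpen_lt continuous_const Complex.continuous_im, hs, ?_⟩
      rintro z₁ hz₁ ψ ⟨hψ, A, hA, B, hB, h1, -⟩
      refine ⟨fun z => A • w z, ?_, fun z₂ hz₂ => ⟨?_, A, hA, B, hB,
        Eventually.of_forall fun _ _ => rfl, ?_⟩⟩
      · filter_upwards [h1, eventually_im_pos hz₁] with z h3 h4 using (h3 h4).symm
      · exact AnalyticAt.GL_smul (h.analytic _ hz₂) A
      · filter_upwards [eventually_im_pos hz₂] with z h3 h4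
        linarith
  obtain ⟨W, hW, hW0, hWG⟩ := CircularPolygon.exists_continuation γ (GoodGerm E O w)
    (fun z ψ hψ => hψ.1) hloc h₀
  refine ⟨W, hW, hW0, ?_⟩
  obtain ⟨-, A, hA, -, -, hA', -⟩ := hWG 1
  rw [γ.target] at hA'
  refine ⟨A, hA, ?_⟩
  filter_upwards [hA', eventually_im_pos hx₀] with z h1 h2 using h1 h2

/-- The continuation of `w` along the loop `γ` is `A • w`. -/
def Transport (w : ℂ → Fin 2 → ℂ) {x₀ : ℂ} (γ : Path x₀ x₀) (A : GL (Fin 2) ℂ) : Prop :=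
  ∃ W, VCont γ W ∧ W 0 =ᶠ[𝓝 x₀] w ∧ W 1 =ᶠ[𝓝 x₀] fun z => A • w z

/-- The projective monodromy along a loop is unique, and it is given by the transport of `w`. -/
lemma Extendable.isProjMonodromy_iff {V : Set ℝ} {w : ℂ → Fin 2 → ℂ} (h : Extendable V w)
    {x₀ : ℂ} (hx₀ : 0 < x₀.im) {γ : Path x₀ x₀} {A : GL (Fin 2) ℂ} (hA : Transport w γ A)
    (T : Equiv.Perm (OnePoint ℂ)) :
    IsProjMonodromy (fun z => w z 0) (fun z => w z 1) γ T ↔ T = mob A := by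
  obtain ⟨W, hW, hW0, hW1⟩ := hA
  have hne : ∀ᶠ z in 𝓝 x₀, w z ≠ 0 := by
    filter_upwards [eventually_im_pos hx₀] with z hz using h.ne_zero z hz
  constructor
  · rintro ⟨W₁, W₂, hc₁, hc₂, h₁, h₂, ⟨g, hg⟩, hT⟩
    have hu := hW.unique (VCont.of_components hc₁ hc₂) (by
      filter_upwards [hW0, h₁, h₂] with z a b c
      ext i; fin_cases i <;> simp [a, b, c]) 1
    rw [γ.target] at hu
    ext1 p
    rw [hg, mob_apply]
    refine (h.indep x₀ hx₀).smul_eq_smul (h.analytic x₀ hx₀) ?_ p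
    apply Eventually.frequently
    apply nhdsWithin_le_nhds
    filter_upwards [hT, hu, hW1] with z h1 h2 h3 h4
    rw [smul_vr A h4, ← hg]
    rw [h3] at h2
    rw [h2]
    exact h1.symm
  · rintro rfl
    refine ⟨_, _, hW.component 0, hW.component 1, ?_, ?_, ⟨A, fun z => rfl⟩, ?_⟩
    · filter_upwards [hW0] with z hz; rw [hz]
    · filter_upwards [hW0] with z hz; rw [hz]
    · filter_upwards [hW1, hne] with z h1 h2
      change vr (W 1 z) = A • vr (w z)
      rw [h1, smul_vr A h2]

/-! ### Loops through two points of the real axis -/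

/-- The loop goes from the upper half-plane to the lower one through `y`, and back through `y'`. -/
def CrossLoop (y y' : ℝ) {x₀ : ℂ} (γ : Path x₀ x₀) : Prop :=
  ∃ a b : unitInterval, a < b ∧ (∀ s, s < a → 0 < (γ s).im) ∧ γ a = (y : ℂ) ∧
    (∀ s, a < s → s < b → (γ s).im < 0) ∧ γ b = (y' : ℂ) ∧ (∀ s, b < s → 0 < (γ s).im)

lemma LoopAround.crossLoop {V : Set ℝ} {c : OnePoint ℝ} {x₀ : ℂ} {γ : Path x₀ x₀}
    (h : LoopAround V c γ) : ∃ y ∈ sideBefore V c, ∃ y' ∈ sideAfter V c, CrossLoop y y' γ := by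
  obtain ⟨a, b, hab, h1, ⟨y, hy, hya⟩, h2, ⟨y', hy', hyb⟩, h3⟩ := h
  exact ⟨y, hy, y', hy', a, b, hab, h1, hya, h2, hyb, h3⟩

lemma CrossLoop.loopAround {V : Set ℝ} {c : OnePoint ℝ} {x₀ : ℂ} {γ : Path x₀ x₀} {y y' : ℝ}
    (hy : y ∈ sideBefore V c) (hy' : y' ∈ sideAfter V c) (h : CrossLoop y y' γ) :
    LoopAround V c γ := by
  obtain ⟨a, b, hab, h1, hya, h2, hyb, h3⟩ := h
  exact ⟨a, b, hab, h1, ⟨y, hy, hya⟩, h2, ⟨y', hy', hyb⟩, h3⟩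

lemma CrossLoop.avoids {V : Set ℝ} {x₀ : ℂ} {γ : Path x₀ x₀} {y y' : ℝ} (h : CrossLoop y y' γ)
    (hy : y ∉ V) (hy' : y' ∉ V) (s : unitInterval) (v : ℝ) (hv : v ∈ V) : γ s ≠ (v : ℂ) := by
  obtain ⟨a, b, hab, h1, hya, h2, hyb, h3⟩ := h
  intro hs
  have him : (γ s).im = 0 := by rw [hs]; simp
  rcases lt_trichotomy s a with h | h | h
  · exact absurd (h1 s h) (by simp [him])
  · rw [h, hya] at hs; exact hy (by rwa [Complex.ofReal_injective hs])
  rcases lt_trichotomy s b with h' | h' | h'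
  · exact absurd (h2 s h h') (by simp [him])
  · rw [h', hyb] at hs; exact hy' (by rwa [Complex.ofReal_injective hs])
  · exact absurd (h3 s h') (by simp [him])

/-- Along the loop, `w` is continued to `M • sharp w` in the lower half-plane. As `sharp w` is
continued to `M'⁻¹ • w` through `y'`, the final result is `(M * M'⁻¹) • w`. -/
lemma Extendable.transport_crossLoop {V : Set ℝ} {w : ℂ → Fin 2 → ℂ} (h : Extendable V w)
    {x₀ : ℂ} (hx₀ : 0 < x₀.im) {γ : Path x₀ x₀} {y y' : ℝ} (hγ : CrossLoop y y' γ)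
    {M M' : GL (Fin 2) ℂ} (hM : Crossing w y M) (hM' : Crossing w y' M') :
    Transport w γ (M * M'⁻¹) := by
  obtain ⟨a, b, hab, h1, hya, h2, hyb, h3⟩ := hγ
  obtain ⟨r, hr, φ, hφ, hup, hlow⟩ := hM
  obtain ⟨r', hr', φ', hφ', hup', hlow'⟩ := hM'
  set A := M * M'⁻¹ with hA
  have ha0 : 0 < a := by
    refine lt_of_le_of_ne bot_le fun h => ?_
    rw [← h, γ.source] at hya
    rw [hya] at hx₀
    simp at hx₀
  have hb1 : b < 1 := by
    refine lt_of_le_of_ne le_top fun h => ?_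
    rw [h, γ.target] at hyb
    rw [hyb] at hx₀
    simp at hx₀
  let W : unitInterval → ℂ → Fin 2 → ℂ := fun s =>
    if s < a then w else if s = a then φ else if s < b then (fun z => M • sharp w z)
      else if s = b then (fun z => A • φ' z) else fun z => A • w z
  have W1 : ∀ s, s < a → W s = w := fun s hs => by simp [W, hs]
  have W2 : W a = φ := by simp [W]
  have W3 : ∀ s, a < s → s < b → W s = fun z => M • sharp w z := fun s hs hs' => by
    simp [W, hs', hs.ne', hs.not_gt]
  have W4 : W b = fun z => A • φ' z := by simp [W, hab.ne', hab.not_gt]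
  have W5 : ∀ s, b < s → W s = fun z => A • w z := fun s hs => by
    simp [W, hs.ne', hs.not_gt, (hab.trans hs).ne', (hab.trans hs).not_gt]
  have mema : (y : ℂ) ∈ Metric.ball (y : ℂ) r := Metric.mem_ball_self hr
  have memb : (y' : ℂ) ∈ Metric.ball (y' : ℂ) r' := Metric.mem_ball_self hr'
  have bq : ∀ {z₀ z : ℂ} {r : ℝ}, z ∈ Metric.ball z₀ r → ∀ᶠ z' in 𝓝 z, z' ∈ Metric.ball z₀ r :=
    fun hz => Metric.isOpen_ball.mem_nhds hz
  have hAup : ∀ z ∈ Metric.ball (y' : ℂ) r', z.im < 0 → A • φ' z = M • sharp w z := by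
    intro z hz hz'
    rw [hlow' z hz hz', hA, mul_smul, inv_smul_smul]
  refine ⟨W, fun s => ?_, ?_, ?_⟩
  · rcases lt_trichotomy s a with hs | hs | hs
    · refine ⟨by rw [W1 s hs]; exact h.analytic _ (h1 s hs), ?_⟩
      filter_upwards [eventually_lt_nhds hs] with s' hs'
      rw [W1 s hs, W1 s' hs']
    · subst hs
      refine ⟨by rw [W2, hya]; exact (hφ y mema).1, ?_⟩
      have hb := (γ.continuous.tendsto s).eventually (Metric.isOpen_ball.mem_nhds (hya ▸ mema :
        γ s ∈ Metric.ball (y : ℂ) r))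
      filter_upwards [hb, eventually_lt_nhds hab] with s' hb' hs'
      rw [W2]
      rcases lt_trichotomy s' s with h4 | h4 | h4
      · rw [W1 s' h4]
        filter_upwards [bq hb', eventually_im_pos (h1 s' h4)] with z h5 h6 using (hup z h5 h6).symm
      · rw [h4, W2]
      · rw [W3 s' h4 hs']
        filter_upwards [bq hb', eventually_im_neg (h2 s' h4 hs')] with z h5 h6
          using (hlow z h5 h6).symm
    rcases lt_trichotomy s b with hs' | hs' | hs'
    · refine ⟨by rw [W3 s hs hs']; exact AnalyticAt.GL_smul (h.sharp_analytic (h2 s hs hs')) M, ?_⟩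
      filter_upwards [eventually_gt_nhds hs, eventually_lt_nhds hs'] with s' h4 h5
      rw [W3 s hs hs', W3 s' h4 h5]
    · subst hs'
      refine ⟨by rw [W4, hyb]; exact AnalyticAt.GL_smul (hφ' y' memb).1 A, ?_⟩
      have hb := (γ.continuous.tendsto s).eventually (Metric.isOpen_ball.mem_nhds (hyb ▸ memb :
        γ s ∈ Metric.ball (y' : ℂ) r'))
      filter_upwards [hb, eventually_gt_nhds hab] with s' hb' hs'
      rw [W4]
      rcases lt_trichotomy s' s with h4 | h4 | h4
      · rw [W3 s' hs' h4]
        filter_upwards [bq hb', eventually_im_neg (h2 s' hs' h4)] with z h5 h6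
          using (hAup z h5 h6).symm
      · rw [h4, W4]
      · rw [W5 s' h4]
        filter_upwards [bq hb', eventually_im_pos (h3 s' h4)] with z h5 h6
        rw [hup' z h5 h6]
    · refine ⟨by rw [W5 s hs']; exact AnalyticAt.GL_smul (h.analytic _ (h3 s hs')) A, ?_⟩
      filter_upwards [eventually_gt_nhds hs'] with s' h4
      rw [W5 s hs', W5 s' h4]
  · rw [W1 0 ha0]
  · rw [W5 1 hb1]

/-! ### Composition of loops, and an explicit loop -/

lemma VCont.comp {a b a' b' : ℂ} {γ : Path a b} {γ' : Path a' b'}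
    {W : unitInterval → ℂ → Fin 2 → ℂ} (h : VCont γ W) {g : unitInterval → unitInterval}
    (hg : Continuous g) (hγ : ∀ s, γ' s = γ (g s)) : VCont γ' (fun s => W (g s)) := fun s => by
  refine ⟨by rw [hγ]; exact (h (g s)).1, ?_⟩
  filter_upwards [(hg.tendsto s).eventually (h (g s)).2] with s' hs'
  rw [hγ]; exact hs'

lemma VCont.GL_smul {a b : ℂ} {γ : Path a b} {W : unitInterval → ℂ → Fin 2 → ℂ} (h : VCont γ W)
    (A : GL (Fin 2) ℂ) : VCont γ (fun s z => A • W s z) := fun s => by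
  refine ⟨AnalyticAt.GL_smul (h s).1 A, ?_⟩
  filter_upwards [(h s).2] with s' hs'
  filter_upwards [hs'] with z hz
  rw [hz]

lemma Transport.GL_smul {w : ℂ → Fin 2 → ℂ} {x₀ : ℂ} {γ : Path x₀ x₀} {B : GL (Fin 2) ℂ}
    (h : Transport w γ B) (A : GL (Fin 2) ℂ) :
    Transport (fun z => A • w z) γ (A * B * A⁻¹) := by
  obtain ⟨W, hW, h0, h1⟩ := h
  refine ⟨_, hW.GL_smul A, ?_, ?_⟩
  · filter_upwards [h0] with z hz; rw [hz]
  · filter_upwards [h1] with z hz; rw [hz]; simp only [mul_smul, inv_smul_smul]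

lemma transport_refl {V : Set ℝ} {w : ℂ → Fin 2 → ℂ} (h : Extendable V w) {x₀ : ℂ}
    (hx₀ : 0 < x₀.im) : Transport w (Path.refl x₀) 1 :=
  ⟨fun _ => w, fun _ => ⟨h.analytic _ hx₀, Eventually.of_forall fun _ => EventuallyEq.rfl⟩,
    EventuallyEq.rfl, by simp⟩

lemma Extendable.exists_transport {V : Set ℝ} {w : ℂ → Fin 2 → ℂ} (h : Extendable V w) {x₀ : ℂ}
    (hx₀ : 0 < x₀.im) (γ : Path x₀ x₀) (hγ : ∀ s, ∀ v ∈ V, γ s ≠ (v : ℂ)) :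
    ∃ A, Transport w γ A := by
  obtain ⟨W, hW, h0, A, -, hA⟩ := h.exists_continuation (E := Set.univ) (O := Set.univ)
    (fun _ _ _ _ => ⟨fun _ _ => trivial, fun _ _ => trivial⟩) trivial ⟨1, trivial⟩ hx₀ γ hγ
  exact ⟨A, W, hW, by rw [h0], hA⟩

/-- Transport along the loop `γ₁` followed by `γ₂`: the continuation along `γ₂` starts from `A₁ • w`,
and constants commute with the continuation, so that the matrix of the first loop is on the left. -/
lemma Extendable.transport_trans {V : Set ℝ} {w : ℂ → Fin 2 → ℂ} (h : Extendable V w) {x₀ : ℂ}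
    (hx₀ : 0 < x₀.im) {γ₁ γ₂ : Path x₀ x₀} (h₁ : ∀ s, ∀ v ∈ V, γ₁ s ≠ (v : ℂ))
    (h₂ : ∀ s, ∀ v ∈ V, γ₂ s ≠ (v : ℂ)) {A₁ A₂ : GL (Fin 2) ℂ} (hA₁ : Transport w γ₁ A₁)
    (hA₂ : Transport w γ₂ A₂) :
    (∀ s, ∀ v ∈ V, (γ₁.trans γ₂) s ≠ (v : ℂ)) ∧ Transport w (γ₁.trans γ₂) (A₁ * A₂) := by
  have havoid : ∀ s, ∀ v ∈ V, (γ₁.trans γ₂) s ≠ (v : ℂ) := by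
    intro s v hv
    rw [Path.trans_apply]
    split_ifs
    · exact h₁ _ v hv
    · exact h₂ _ v hv
  refine ⟨havoid, ?_⟩
  obtain ⟨A, W, hW, hW0, hW1⟩ := h.exists_transport hx₀ _ havoid
  obtain ⟨V₁, hV₁, hV₁0, hV₁1⟩ := hA₁
  obtain ⟨V₂, hV₂, hV₂0, hV₂1⟩ := hA₂
  let i₁ : unitInterval → unitInterval := fun s =>
    ⟨s / 2, by have := s.2.1; positivity, by have := s.2.2; linarith⟩
  let i₂ : unitInterval → unitInterval := fun s =>
    ⟨(s + 1) / 2, by have := s.2.1; positivity, by have := s.2.2; linarith⟩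
  have hi₁ : Continuous i₁ := by
    apply Continuous.subtype_mk; fun_prop
  have hi₂ : Continuous i₂ := by
    apply Continuous.subtype_mk; fun_prop
  have e₁ : ∀ s, γ₁ s = (γ₁.trans γ₂) (i₁ s) := by
    intro s
    rw [Path.trans_apply, dif_pos (by have := s.2.2; simp [i₁]; linarith)]
    congr 1
    apply Subtype.ext
    simp [i₁]; ring
  have e₂ : ∀ s, γ₂ s = (γ₁.trans γ₂) (i₂ s) := by
    intro s
    rw [Path.trans_apply]
    split_ifs with hs
    · have h0 : (s : ℝ) = 0 := by
        have := s.2.1; simp only [i₂] at hs; linarith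
      have h0' : s = 0 := Subtype.ext h0
      have : (⟨2 * (i₂ s : ℝ), (unitInterval.mul_pos_mem_iff zero_lt_two).2
          ⟨(i₂ s).2.1, hs⟩⟩ : unitInterval) = 1 := by
        apply Subtype.ext; simp [i₂, h0]
      rw [this, h0', γ₂.source, γ₁.target]
    · congr 1
      apply Subtype.ext
      simp [i₂]; ring
  have z₁ : i₁ 0 = 0 := by apply Subtype.ext; simp [i₁]
  have z₂ : i₂ 1 = 1 := by apply Subtype.ext; simp [i₂]
  have z₃ : i₂ 0 = i₁ 1 := by apply Subtype.ext; simp [i₁, i₂]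
  -- Uniqueness of the continuation on the first and on the second half of the path.
  have u₁ := (hW.comp hi₁ e₁).unique hV₁ (by
    simp only [z₁]; exact hW0.trans hV₁0.symm) 1
  rw [γ₁.target] at u₁
  have u₂ := (hW.comp hi₂ e₂).unique (hV₂.GL_smul A₁) (by
    simp only [z₃]
    filter_upwards [u₁, hV₁1, hV₂0] with z a b c
    rw [a, b, c]) 1
  rw [γ₂.target] at u₂
  refine ⟨W, hW, hW0, ?_⟩
  filter_upwards [u₂, hV₂1] with z a b
  simp only [z₂] at a
  rw [a, b, mul_smul]

/-- The imaginary part of the loop is quadratic in the parameter, with zeros at `1/3` and `2/3`, and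
the real part is a cubic that takes there the values `y` and `y'`. -/
lemma exists_crossLoop (y y' : ℝ) {x₀ : ℂ} (hx₀ : 0 < x₀.im) :
    ∃ γ : Path x₀ x₀, CrossLoop y y' γ := by
  let re : ℝ → ℝ := fun s => x₀.re * ((s - 1 / 3) * (s - 2 / 3) * 9 / 2)
    + y * (27 / 2 * s * (2 / 3 - s) * (1 - s)) + y' * (27 / 2 * s * (s - 1 / 3) * (1 - s))
  let im : ℝ → ℝ := fun s => x₀.im * ((s - 1 / 3) * (s - 2 / 3) * 9 / 2)
  let γ : Path x₀ x₀ :=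
    { toFun := fun s => ⟨re s, im s⟩
      continuous_toFun := by
        have h1 : Continuous re := by fun_prop
        have h2 : Continuous im := by fun_prop
        have : (fun s : unitInterval => (⟨re s, im s⟩ : ℂ)) =
            fun s : unitInterval => (re s : ℂ) + (im s : ℂ) * Complex.I := by
          ext s; exact Complex.mk_eq_add_mul_I _ _
        rw [this]
        fun_prop
      source' := by apply Complex.ext <;> simp [re, im] <;> ring
      target' := by apply Complex.ext <;> simp [re, im] <;> ring }
  have hγ : ∀ s, γ s = ⟨re s, im s⟩ := fun s => rfl
  refine ⟨γ, ⟨1 / 3, by norm_num, by norm_num⟩, ⟨2 / 3, by norm_num, by norm_num⟩, ?_, ?_, ?_, ?_,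
    ?_, ?_⟩
  · change (1 / 3 : ℝ) < 2 / 3; norm_num
  · intro s hs
    have hs' : (s : ℝ) < 1 / 3 := hs
    rw [hγ]
    have : 0 < ((s : ℝ) - 1 / 3) * (s - 2 / 3) := mul_pos_of_neg_of_neg (by linarith) (by linarith)
    simp only [im]; positivity
  · rw [hγ]; apply Complex.ext <;> simp [re, im]; ring
  · intro s hs hs'
    have h1 : 1 / 3 < (s : ℝ) := hs
    have h2 : (s : ℝ) < 2 / 3 := hs'
    rw [hγ]
    have : ((s : ℝ) - 1 / 3) * (s - 2 / 3) < 0 := mul_neg_of_pos_of_neg (by linarith) (by linarith)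
    simp only [im]; nlinarith
  · rw [hγ]; apply Complex.ext <;> simp [re, im]; ring
  · intro s hs
    have h1 : 2 / 3 < (s : ℝ) := hs
    rw [hγ]
    have : 0 < ((s : ℝ) - 1 / 3) * (s - 2 / 3) := mul_pos (by linarith) (by linarith)
    simp only [im]; positivity

/-! ### The reflection belonging to a crossing -/

lemma IndepAt.GL_eq {v : ℂ → Fin 2 → ℂ} {z : ℂ} (hv : IndepAt v z) {g h : GL (Fin 2) ℂ}
    (hgh : ∀ᶠ z' in 𝓝 z, g • v z' = h • v z') : g = h := by
  have h0 := hv (g 0 0 - h 0 0) (g 0 1 - h 0 1) (by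
    filter_upwards [hgh] with z' hz
    have := congrFun hz 0
    rw [GL_smul_zero_apply, GL_smul_zero_apply] at this
    linear_combination this)
  have h1 := hv (g 1 0 - h 1 0) (g 1 1 - h 1 1) (by
    filter_upwards [hgh] with z' hz
    have := congrFun hz 1
    rw [GL_smul_one_apply, GL_smul_one_apply] at this
    linear_combination this)
  ext i j
  fin_cases i <;> fin_cases j
  · exact sub_eq_zero.1 h0.1
  · exact sub_eq_zero.1 h0.2
  · exact sub_eq_zero.1 h1.1
  · exact sub_eq_zero.1 h1.2

lemma IndepAt.of_frequently {v : ℂ → Fin 2 → ℂ} {z : ℂ}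
    (h : ∃ᶠ z' in 𝓝 z, IndepAt v z') : IndepAt v z := fun a b hab => by
  obtain ⟨z', h1, h2⟩ := (h.and_eventually (eventually_eventually_nhds.2 hab)).exists
  exact h1 a b h2

lemma IndepAt.sharp {v : ℂ → Fin 2 → ℂ} {z : ℂ} (h : IndepAt v (conj z)) :
    IndepAt (sharp v) z := by
  intro a b hab
  have := h (conj a) (conj b) (by
    have h1 := (Complex.continuous_conj.tendsto (conj z))
    rw [Complex.conj_conj] at h1
    filter_upwards [h1.eventually hab] with z' hz'
    have := congrArg conj hz'
    simpa [CircularPolygon.sharp] using this)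
  simpa using this

lemma Crossing.eventually {w : ℂ → Fin 2 → ℂ} {y : ℝ} {M : GL (Fin 2) ℂ} (h : Crossing w y M) :
    ∀ᶠ y' in 𝓝 y, Crossing w y' M := by
  obtain ⟨r, hr, φ, hφ, hup, hlow⟩ := h
  filter_upwards [Metric.ball_mem_nhds y hr] with y' hy'
  obtain ⟨r', hr', hb⟩ := Metric.isOpen_iff.1 (Metric.isOpen_ball (x := (y : ℂ)) (ε := r)) y' (by
    rw [Metric.mem_ball] at *
    simpa [Complex.dist_eq, Real.dist_eq, ← Complex.ofReal_sub, Complex.norm_real] using hy')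
  exact ⟨r', hr', φ, fun z hz => hφ z (hb hz), fun z hz => hup z (hb hz),
    fun z hz => hlow z (hb hz)⟩

/-- The continuation across a point determines the matrix, since the components of `sharp w` are
linearly independent. -/
lemma Extendable.crossing_unique {V : Set ℝ} {w : ℂ → Fin 2 → ℂ} (h : Extendable V w) {y : ℝ}
    {M M' : GL (Fin 2) ℂ} (hM : Crossing w y M) (hM' : Crossing w y M') : M = M' := by
  obtain ⟨r, hr, φ, hφ, hup, hlow⟩ := hM
  obtain ⟨r', hr', φ', hφ', hup', hlow'⟩ := hM'
  have hy0 : (0 : ℝ) ≤ (y : ℂ).im := by simp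
  have hy0' : (y : ℂ).im ≤ 0 := by simp
  have m : ∀ᶠ z in 𝓝 (y : ℂ), z ∈ Metric.ball (y : ℂ) r ∧ z ∈ Metric.ball (y : ℂ) r' := by
    filter_upwards [Metric.ball_mem_nhds _ hr, Metric.ball_mem_nhds _ hr'] with z a b
      using ⟨a, b⟩
  have e : φ =ᶠ[𝓝 (y : ℂ)] φ' := by
    refine ((hφ _ (Metric.mem_ball_self hr)).1.frequently_eq_iff_eventually_eq
      (hφ' _ (Metric.mem_ball_self hr')).1).1 ?_
    refine (frequently_im_pos hy0).mp (nhdsWithin_le_nhds ?_)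
    filter_upwards [m] with z hz h0
    rw [hup z hz.1 h0, hup' z hz.2 h0]
  obtain ⟨z, h0, hz⟩ := ((frequently_im_neg hy0').and_eventually
    (nhdsWithin_le_nhds (eventually_eventually_nhds.2 (m.and e)))).exists
  refine (IndepAt.sharp (z := z) (h.indep _ (by simpa using h0))).GL_eq ?_
  filter_upwards [hz, eventually_im_neg h0] with z' hz' h0'
  rw [← hlow z' hz'.1.1 h0', ← hlow' z' hz'.1.2 h0', hz'.2]

/-- The matrix of a crossing is constant on intervals without singular points. -/
lemma Extendable.crossing_of_mem {V : Set ℝ} {w : ℂ → Fin 2 → ℂ} (h : Extendable V w)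
    {S : Set ℝ} (hS : IsPreconnected S) (hSV : ∀ y ∈ S, y ∉ V) {y y' : ℝ} (hy : y ∈ S)
    (hy' : y' ∈ S) {M : GL (Fin 2) ℂ} (hM : Crossing w y M) : Crossing w y' M := by
  have o1 : IsOpen {y | Crossing w y M} := isOpen_iff_mem_nhds.2 fun y hy => Crossing.eventually hy
  have o2 : IsOpen {y | ∃ M' ≠ M, Crossing w y M'} := by
    rw [isOpen_iff_mem_nhds]
    rintro y ⟨M', hne, hy⟩
    filter_upwards [hy.eventually] with y' hy' using ⟨M', hne, hy'⟩
  refine hS.subset_left_of_subset_union o1 o2 ?_ ?_ ⟨y, hy, hM⟩ hy'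
  · rw [Set.disjoint_left]
    rintro y h1 ⟨M', hne, h2⟩
    exact hne (h.crossing_unique h2 h1)
  · intro y hy
    obtain ⟨M', hM'⟩ := h.cross y (hSV y hy)
    by_cases e : M' = M
    · left; rw [← e]; exact hM'
    · right; exact ⟨M', e, hM'⟩

/-- The extension `φ` that belongs to a crossing satisfies `φ = M • sharp φ`. -/
lemma Extendable.crossing_symm {V : Set ℝ} {w : ℂ → Fin 2 → ℂ} (h : Extendable V w) {y : ℝ}
    {M : GL (Fin 2) ℂ} (hM : Crossing w y M) : ∃ φ : ℂ → Fin 2 → ℂ, AnalyticAt ℂ φ y ∧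
      φ y ≠ 0 ∧ IndepAt φ y ∧ (∀ᶠ z in 𝓝 (y : ℂ), 0 < z.im → φ z = w z) ∧
      (∀ᶠ z in 𝓝 (y : ℂ), φ z = M • sharp φ z) := by
  obtain ⟨r, hr, φ, hφ, hup, hlow⟩ := hM
  have m := Metric.ball_mem_nhds (y : ℂ) hr
  have hy := hφ _ (Metric.mem_ball_self hr)
  have hy0 : (0 : ℝ) ≤ (y : ℂ).im := by simp
  have hy0' : (y : ℂ).im ≤ 0 := by simp
  refine ⟨φ, hy.1, hy.2, ?_, ?_, ?_⟩
  · apply IndepAt.of_frequently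
    refine ((frequently_im_pos hy0).filter_mono nhdsWithin_le_nhds).mp ?_
    filter_upwards [eventually_eventually_nhds.2 m] with z hz h0
    refine (h.indep z h0).congr ?_
    filter_upwards [hz, eventually_im_pos h0] with z' hz' h0' using (hup z' hz' h0').symm
  · filter_upwards [m] with z hz using hup z hz
  · refine (hy.1.frequently_eq_iff_eventually_eq
      (AnalyticAt.GL_smul (analyticAt_sharp_vec (by simpa using hy.1)) M)).1 ?_
    refine (frequently_im_neg hy0').mp (nhdsWithin_le_nhds ?_)
    filter_upwards [m] with z hz h0
    rw [hlow z hz h0, CircularPolygon.sharp, CircularPolygon.sharp, hup]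
    · rw [Metric.mem_ball, Complex.dist_eq] at *
      rw [← Complex.conj_ofReal, ← map_sub, Complex.norm_conj]
      exact hz
    · simpa using h0

/-- The anti-conformal map defined by the matrix of a crossing is an involution. -/
lemma Extendable.crossing_mul_conj {V : Set ℝ} {w : ℂ → Fin 2 → ℂ} (h : Extendable V w) {y : ℝ}
    {M : GL (Fin 2) ℂ} (hM : Crossing w y M) : M * conjGL M = 1 := by
  obtain ⟨φ, hφ, -, hi, -, hs⟩ := h.crossing_symm hM
  refine hi.GL_eq ?_
  have hc := Complex.continuous_conj.tendsto (y : ℂ)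
  rw [Complex.conj_ofReal] at hc
  filter_upwards [hs, hc.eventually hs] with z h1 h2
  have h3 : CircularPolygon.sharp φ z = conjGL M • φ z := by
    have := congrArg star h2
    rw [star_GL_smul] at this
    simpa [CircularPolygon.sharp] using this
  rw [mul_smul, ← h3, one_smul, ← h1]

/-- The function `f` on the closed upper half-plane is the continuous extension of the ratio of the
components of `w`. -/
def IsBoundaryExtension (w : ℂ → Fin 2 → ℂ) (f : OnePoint ℂ → OnePoint ℂ) : Prop :=
  ContinuousOn f closedH ∧ ∀ z : ℂ, 0 < z.im → f (z : OnePoint ℂ) = vr (w z)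

lemma coe_mem_closedH {z : ℂ} (hz : 0 ≤ z.im) : (z : OnePoint ℂ) ∈ closedH :=
  Or.inr ⟨z, hz, rfl⟩

lemma tendsto_coe_closedH {z : ℂ} :
    Tendsto (fun w : ℂ => (w : OnePoint ℂ)) (𝓝[{w | 0 ≤ w.im}] z) (𝓝[closedH] (z : OnePoint ℂ)) :=
  tendsto_nhdsWithin_iff.2 ⟨(continuous_coe.tendsto z).mono_left nhdsWithin_le_nhds, by
    filter_upwards [self_mem_nhdsWithin] with w hw using coe_mem_closedH hw⟩

lemma nhdsWithin_im_pos_neBot {z : ℂ} (hz : 0 ≤ z.im) : (𝓝[{w : ℂ | 0 < w.im}] z).NeBot := by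
  rw [nhdsWithin_neBot]
  intro s hs
  obtain ⟨w, h1, h2⟩ := (((frequently_im_pos hz).filter_mono nhdsWithin_le_nhds).and_eventually
    hs).exists
  exact ⟨w, h2, h1⟩

lemma IsBoundaryExtension.eq_vr {w : ℂ → Fin 2 → ℂ} {f : OnePoint ℂ → OnePoint ℂ}
    (hf : IsBoundaryExtension w f) {φ : ℂ → Fin 2 → ℂ} {z : ℂ} (hz : 0 ≤ z.im)
    (hφ : ContinuousAt φ z) (h0 : φ z ≠ 0) (hw : ∀ᶠ z' in 𝓝 z, 0 < z'.im → φ z' = w z') :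
    f (z : OnePoint ℂ) = vr (φ z) := by
  have := nhdsWithin_im_pos_neBot hz
  have t1 : Tendsto (fun z' : ℂ => f (z' : OnePoint ℂ)) (𝓝[{w : ℂ | 0 < w.im}] z)
      (𝓝 (f (z : OnePoint ℂ))) :=
    ((hf.1 _ (coe_mem_closedH hz)).tendsto.comp tendsto_coe_closedH).mono_left
      (nhdsWithin_mono _ fun w (hw : 0 < w.im) => hw.le)
  have t2 : Tendsto (fun z' : ℂ => vr (φ z')) (𝓝[{w : ℂ | 0 < w.im}] z) (𝓝 (vr (φ z))) :=
    ((continuousAt_vr h0).comp hφ).tendsto.mono_left nhdsWithin_le_nhds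
  refine tendsto_nhds_unique (t1.congr' ?_) t2
  filter_upwards [self_mem_nhdsWithin, nhdsWithin_le_nhds hw] with z' h1 h2
  rw [hf.2 z' h1, h2 h1]

/-- The anti-conformal map that belongs to a crossing fixes the image of the crossing point, because
`φ y = M • star (φ y)` at a real point `y`. -/
lemma Extendable.antiMob_fixes {V : Set ℝ} {w : ℂ → Fin 2 → ℂ} (h : Extendable V w)
    {f : OnePoint ℂ → OnePoint ℂ} (hf : IsBoundaryExtension w f) {y : ℝ}
    {M : GL (Fin 2) ℂ} (hM : Crossing w y M) :
    antiMob M (f (bdry (y : OnePoint ℝ))) = f (bdry (y : OnePoint ℝ)) := by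
  obtain ⟨φ, hφ, h0, hi, hup, hs⟩ := h.crossing_symm hM
  have e : f (bdry (y : OnePoint ℝ)) = vr (φ y) :=
    hf.eq_vr (z := (y : ℂ)) (by simp) hφ.continuousAt h0 hup
  have h1 := hs.self_of_nhds
  rw [CircularPolygon.sharp, Complex.conj_ofReal] at h1
  rw [e, antiMob_apply, conjS_vr, smul_vr _ (star_ne_zero_vec h0), ← h1]

lemma Extendable.isReflection_antiMob {V : Set ℝ} {w : ℂ → Fin 2 → ℂ} (h : Extendable V w)
    {f : OnePoint ℂ → OnePoint ℂ} (hf : IsBoundaryExtension w f) {y : ℝ}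
    {M : GL (Fin 2) ℂ} (hM : Crossing w y M) : IsReflection (antiMob M) := by
  refine ⟨⟨M, fun z => rfl⟩, fun z => ?_, ⟨_, h.antiMob_fixes hf hM⟩⟩
  rw [antiMob_apply, antiMob_apply, conjS_smul, conjS_conjS, ← mul_smul, h.crossing_mul_conj hM,
    one_smul]

/-- The reflection in a circle that contains the image of a neighbourhood of `y` in the real axis
is determined by the crossing at `y`. -/
lemma Extendable.eq_antiMob {V : Set ℝ} {w : ℂ → Fin 2 → ℂ} (h : Extendable V w)
    {f : OnePoint ℂ → OnePoint ℂ} (hf : IsBoundaryExtension w f) {y : ℝ}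
    {M : GL (Fin 2) ℂ} (hM : Crossing w y M) {σ : Equiv.Perm (OnePoint ℂ)}
    (hσ : IsReflection σ) (hy : ∀ᶠ y' : ℝ in 𝓝 y,
      σ (f (bdry (y' : OnePoint ℝ))) = f (bdry (y' : OnePoint ℝ))) : σ = antiMob M := by
  obtain ⟨φ, hφ, h0, hi, hup, hs⟩ := h.crossing_symm hM
  obtain ⟨⟨g, hg⟩, -, -⟩ := hσ
  have hi' : IndepAt (CircularPolygon.sharp φ) y := IndepAt.sharp (by simpa using hi)
  have ha' : AnalyticAt ℂ (CircularPolygon.sharp φ) y :=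
    analyticAt_sharp_vec (by simpa using hφ)
  have key : ∃ᶠ z in 𝓝[≠] (y : ℂ), CircularPolygon.sharp φ z ≠ 0 →
      g • vr (CircularPolygon.sharp φ z) = M • vr (CircularPolygon.sharp φ z) := by
    have t : Tendsto (fun t : ℝ => (t : ℂ)) (𝓝[≠] y) (𝓝[≠] (y : ℂ)) := by
      refine tendsto_nhdsWithin_iff.2 ⟨?_, ?_⟩
      · exact (Complex.continuous_ofReal.tendsto y).mono_left nhdsWithin_le_nhds
      · filter_upwards [self_mem_nhdsWithin] with t ht
        simpa using ht
    refine t.frequently (Eventually.frequently (nhdsWithin_le_nhds ?_))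
    have tc := Complex.continuous_ofReal.tendsto y
    filter_upwards [hy, hM.eventually,
      tc.eventually (eventually_eventually_nhds.2 hup), tc.eventually hφ.eventually_analyticAt,
      tc.eventually (hφ.continuousAt.eventually_ne h0)] with y' h1 h2 h3 h4 h5 h6
    have e : f (bdry (y' : OnePoint ℝ)) = vr (φ y') :=
      hf.eq_vr (z := (y' : ℂ)) (by simp) h4.continuousAt h5 h3
    have e' : vr (CircularPolygon.sharp φ y') = conjS (f (bdry (y' : OnePoint ℝ))) := by
      rw [e, conjS_vr, CircularPolygon.sharp, Complex.conj_ofReal]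
    rw [e', ← hg, h1, ← antiMob_apply, h.antiMob_fixes hf h2]
  ext1 p
  rw [hg, antiMob_apply]
  exact hi'.smul_eq_smul ha' key _

/-! ### Sides -/

lemma isOpen_sideBefore {V : Set ℝ} (hV : V.Finite) (c : OnePoint ℝ) :
    IsOpen (sideBefore V c) := by
  induction c using OnePoint.rec with
  | infty =>
    have : sideBefore V ∞ = ⋂ v ∈ V, Set.Ioi v := by ext y; simp [sideBefore]
    rw [this]
    exact hV.isOpen_biInter fun v _ => isOpen_Ioi
  | coe c =>
    have : sideBefore V (c : OnePoint ℝ) = Set.Iio c ∩ ⋂ v ∈ V, {y | v < y ∨ c ≤ v} := by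
      ext y; simp [sideBefore]
    rw [this]
    exact isOpen_Iio.inter (hV.isOpen_biInter fun v _ => isOpen_Ioi.union isOpen_const)

lemma isOpen_sideAfter {V : Set ℝ} (hV : V.Finite) (c : OnePoint ℝ) :
    IsOpen (sideAfter V c) := by
  induction c using OnePoint.rec with
  | infty =>
    have : sideAfter V ∞ = ⋂ v ∈ V, Set.Iio v := by ext y; simp [sideAfter]
    rw [this]
    exact hV.isOpen_biInter fun v _ => isOpen_Iio
  | coe c =>
    have : sideAfter V (c : OnePoint ℝ) = Set.Ioi c ∩ ⋂ v ∈ V, {y | v ≤ c ∨ y < v} := by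
      ext y; simp [sideAfter]
    rw [this]
    exact isOpen_Ioi.inter (hV.isOpen_biInter fun v _ => isOpen_const.union isOpen_Iio)

lemma isPreconnected_sideBefore (V : Set ℝ) (c : OnePoint ℝ) :
    IsPreconnected (sideBefore V c) := by
  apply Set.OrdConnected.isPreconnected
  constructor
  induction c using OnePoint.rec with
  | infty => exact fun a ha b hb y hy v hv => (ha v hv).trans_le hy.1
  | coe c => exact fun a ha b hb y hy => ⟨hy.2.trans_lt hb.1, fun v hv =>
      (ha.2 v hv).imp_left fun h => h.trans_le hy.1⟩

lemma isPreconnected_sideAfter (V : Set ℝ) (c : OnePoint ℝ) :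
    IsPreconnected (sideAfter V c) := by
  apply Set.OrdConnected.isPreconnected
  constructor
  induction c using OnePoint.rec with
  | infty => exact fun a ha b hb y hy v hv => hy.2.trans_lt (hb v hv)
  | coe c => exact fun a ha b hb y hy => ⟨ha.1.trans_le hy.1, fun v hv =>
      (hb.2 v hv).imp_right fun h => hy.2.trans_lt h⟩

lemma sideBefore_nonempty {V : Set ℝ} (hV : V.Finite) (c : OnePoint ℝ) :
    (sideBefore V c).Nonempty := by
  induction c using OnePoint.rec with
  | infty =>
    exact ((hV.eventually_all).2 fun v _ => eventually_gt_atTop v).exists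
  | coe c =>
    have h1 : ∀ᶠ y in 𝓝[<] c, ∀ v ∈ V, v < y ∨ c ≤ v := by
      refine (hV.eventually_all).2 fun v _ => ?_
      rcases lt_or_ge v c with h | h
      · filter_upwards [nhdsWithin_le_nhds (eventually_gt_nhds h)] with y hy using Or.inl hy
      · exact Eventually.of_forall fun _ => Or.inr h
    obtain ⟨y, h2, h3⟩ := (h1.and self_mem_nhdsWithin).exists
    exact ⟨y, h3, h2⟩

lemma sideAfter_nonempty {V : Set ℝ} (hV : V.Finite) (c : OnePoint ℝ) :
    (sideAfter V c).Nonempty := by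
  induction c using OnePoint.rec with
  | infty =>
    exact ((hV.eventually_all).2 fun v _ => eventually_lt_atBot v).exists
  | coe c =>
    have h1 : ∀ᶠ y in 𝓝[>] c, ∀ v ∈ V, v ≤ c ∨ y < v := by
      refine (hV.eventually_all).2 fun v _ => ?_
      rcases lt_or_ge c v with h | h
      · filter_upwards [nhdsWithin_le_nhds (eventually_lt_nhds h)] with y hy using Or.inr hy
      · exact Eventually.of_forall fun _ => Or.inl h
    obtain ⟨y, h2, h3⟩ := (h1.and self_mem_nhdsWithin).exists
    exact ⟨y, h3, h2⟩

lemma notMem_of_mem_sideBefore {V : Set ℝ} {c : OnePoint ℝ} {y : ℝ} (hy : y ∈ sideBefore V c) :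
    y ∉ V := by
  intro hV
  induction c using OnePoint.rec with
  | infty => exact lt_irrefl _ (hy y hV)
  | coe c => exact (hy.2 y hV).elim (lt_irrefl _) hy.1.not_ge

lemma notMem_of_mem_sideAfter {V : Set ℝ} {c : OnePoint ℝ} {y : ℝ} (hy : y ∈ sideAfter V c) :
    y ∉ V := by
  intro hV
  induction c using OnePoint.rec with
  | infty => exact lt_irrefl _ (hy y hV)
  | coe c => exact (hy.2 y hV).elim hy.1.not_ge (lt_irrefl _)

lemma sideBefore_anti {V V' : Set ℝ} (h : V ⊆ V') (c : OnePoint ℝ) :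
    sideBefore V' c ⊆ sideBefore V c := by
  induction c using OnePoint.rec with
  | infty => exact fun y hy v hv => hy v (h hv)
  | coe c => exact fun y hy => ⟨hy.1, fun v hv => hy.2 v (h hv)⟩

lemma sideAfter_anti {V V' : Set ℝ} (h : V ⊆ V') (c : OnePoint ℝ) :
    sideAfter V' c ⊆ sideAfter V c := by
  induction c using OnePoint.rec with
  | infty => exact fun y hy v hv => hy v (h hv)
  | coe c => exact fun y hy => ⟨hy.1, fun v hv => hy.2 v (h hv)⟩

/-- Every regular point of the real line lies on the side that ends at the next corner, which may be
`∞`. -/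
lemma exists_mem_sideBefore {V : Set ℝ} (hV : V.Finite) {y : ℝ} (hy : y ∉ V) :
    ∃ c, IsCorner V c ∧ y ∈ sideBefore V c := by
  by_cases h : ∃ v ∈ V, y < v
  · obtain ⟨c, ⟨hc, hyc⟩, hmin⟩ := (hV.subset (fun v hv => hv.1 : {v | v ∈ V ∧ y < v} ⊆
      V)).exists_minimal (by obtain ⟨v, hv⟩ := h; exact ⟨v, hv⟩)
    refine ⟨(c : OnePoint ℝ), hc, hyc, fun v hv => ?_⟩
    rcases lt_trichotomy v y with h1 | h1 | h1
    · exact Or.inl h1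
    · exact absurd (h1 ▸ hv) hy
    · right
      by_contra h2
      exact h2 (hmin ⟨hv, h1⟩ (not_le.1 h2).le)
  · push Not at h
    exact ⟨∞, trivial, fun v hv => lt_of_le_of_ne (h v hv) fun e => hy (e ▸ hv)⟩

/-! ### Monodromy and the reflections in the sides -/

variable {V V₀ : Set ℝ} {w : ℂ → Fin 2 → ℂ} {f : OnePoint ℂ → OnePoint ℂ}

lemma Extendable.fixes_sideBefore (h : Extendable V₀ w) (hV : V₀ ⊆ V)
    (hf : IsBoundaryExtension w f) {c : OnePoint ℝ} {y : ℝ} (hy : y ∈ sideBefore V₀ c)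
    {M : GL (Fin 2) ℂ} (hM : Crossing w y M) :
    ∀ y' ∈ sideBefore V c, f (bdry (y' : OnePoint ℝ)) ∈ {p | antiMob M p = p} := by
  intro y' hy'
  exact h.antiMob_fixes hf (h.crossing_of_mem (isPreconnected_sideBefore V₀ c)
    (fun _ => notMem_of_mem_sideBefore) hy (sideBefore_anti hV c hy') hM)

lemma Extendable.fixes_sideAfter (h : Extendable V₀ w) (hV : V₀ ⊆ V)
    (hf : IsBoundaryExtension w f) {c : OnePoint ℝ} {y : ℝ} (hy : y ∈ sideAfter V₀ c)
    {M : GL (Fin 2) ℂ} (hM : Crossing w y M) :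
    ∀ y' ∈ sideAfter V c, f (bdry (y' : OnePoint ℝ)) ∈ {p | antiMob M p = p} := by
  intro y' hy'
  exact h.antiMob_fixes hf (h.crossing_of_mem (isPreconnected_sideAfter V₀ c)
    (fun _ => notMem_of_mem_sideAfter) hy (sideAfter_anti hV c hy') hM)

/-- The reflection in a circle that contains the image of the side before `c`. -/
lemma Extendable.eq_antiMob_of_sideBefore (h : Extendable V₀ w) (hV : V₀ ⊆ V) (hVf : V.Finite)
    (hf : IsBoundaryExtension w f) {c : OnePoint ℝ} {y : ℝ} (hy : y ∈ sideBefore V₀ c)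
    {M : GL (Fin 2) ℂ} (hM : Crossing w y M) {σ : Equiv.Perm (OnePoint ℂ)} (hσ : IsReflection σ)
    (hC : ∀ y' ∈ sideBefore V c, f (bdry (y' : OnePoint ℝ)) ∈ {p | σ p = p}) :
    σ = antiMob M := by
  obtain ⟨y₁, hy₁⟩ := sideBefore_nonempty hVf c
  refine h.eq_antiMob hf (h.crossing_of_mem (isPreconnected_sideBefore V₀ c)
    (fun _ => notMem_of_mem_sideBefore) hy (sideBefore_anti hV c hy₁) hM) hσ ?_
  filter_upwards [(isOpen_sideBefore hVf c).mem_nhds hy₁] with y' hy' using hC y' hy'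

lemma Extendable.eq_antiMob_of_sideAfter (h : Extendable V₀ w) (hV : V₀ ⊆ V) (hVf : V.Finite)
    (hf : IsBoundaryExtension w f) {c : OnePoint ℝ} {y : ℝ} (hy : y ∈ sideAfter V₀ c)
    {M : GL (Fin 2) ℂ} (hM : Crossing w y M) {σ : Equiv.Perm (OnePoint ℂ)} (hσ : IsReflection σ)
    (hC : ∀ y' ∈ sideAfter V c, f (bdry (y' : OnePoint ℝ)) ∈ {p | σ p = p}) :
    σ = antiMob M := by
  obtain ⟨y₁, hy₁⟩ := sideAfter_nonempty hVf c
  refine h.eq_antiMob hf (h.crossing_of_mem (isPreconnected_sideAfter V₀ c)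
    (fun _ => notMem_of_mem_sideAfter) hy (sideAfter_anti hV c hy₁) hM) hσ ?_
  filter_upwards [(isOpen_sideAfter hVf c).mem_nhds hy₁] with y' hy' using hC y' hy'

/-- Since the reflection of `M'` is an involution, `M'⁻¹` is `conjGL M'`. -/
lemma Extendable.mob_mul_inv (h : Extendable V₀ w) {y' : ℝ} (M : GL (Fin 2) ℂ)
    {M' : GL (Fin 2) ℂ} (hM' : Crossing w y' M') : mob (M * M'⁻¹) = antiMob M * antiMob M' := by
  rw [antiMob_mul_antiMob, (eq_inv_of_mul_eq_one_right (h.crossing_mul_conj hM')).symm]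

/-- The monodromy around the corner `c` is the product of the reflections in the two sides that
meet at `c`; it is trivial if and only if the two sides lie on the same circle. -/
lemma Extendable.mob_eq_one_iff (h : Extendable V₀ w) (hV : V₀ ⊆ V) (hVf : V.Finite)
    (hf : IsBoundaryExtension w f) {c : OnePoint ℝ} {y y' : ℝ} (hy : y ∈ sideBefore V₀ c)
    (hy' : y' ∈ sideAfter V₀ c) {M M' : GL (Fin 2) ℂ} (hM : Crossing w y M)
    (hM' : Crossing w y' M') : mob (M * M'⁻¹) = 1 ↔ SameCircleAt V f c := by
  have hinv : antiMob M' * antiMob M' = 1 := by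
    rw [antiMob_mul_antiMob, h.crossing_mul_conj hM', mob_one]
  rw [h.mob_mul_inv M hM']
  constructor
  · intro h1
    have e : antiMob M = antiMob M' := mul_right_cancel (h1.trans hinv.symm)
    refine ⟨_, ⟨antiMob M, h.isReflection_antiMob hf hM, rfl⟩, ?_⟩
    rintro z (hz | hz)
    · exact h.fixes_sideBefore hV hf hy hM z hz
    · rw [e]; exact h.fixes_sideAfter hV hf hy' hM' z hz
  · rintro ⟨C, ⟨σ, hσ, rfl⟩, hC⟩
    rw [← h.eq_antiMob_of_sideBefore hV hVf hf hy hM hσ fun z hz => hC z (Or.inl hz),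
      h.eq_antiMob_of_sideAfter hV hVf hf hy' hM' hσ fun z hz => hC z (Or.inr hz), hinv]

/-- The reflection that belongs to a crossing is the reflection in a side. The set `V` of corners may be
larger than the set `V₀` of singular points, so the crossing point is moved off `V`. -/
lemma Extendable.isSideReflection (h : Extendable V₀ w) (hV : V₀ ⊆ V) (hVf : V.Finite)
    (hf : IsBoundaryExtension w f) {y : ℝ} {M : GL (Fin 2) ℂ} (hM : Crossing w y M) :
    IsSideReflection V f (antiMob M) := by
  obtain ⟨y₁, hy₁V, hy₁⟩ : ∃ y₁, y₁ ∉ V ∧ Crossing w y₁ M := by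
    have h1 : ∃ᶠ y₁ in 𝓝 y, y₁ ∉ V := by
      have hd : Dense (Vᶜ) := hVf.countable.dense_compl ℝ
      exact mem_closure_iff_frequently.1 (hd y)
    obtain ⟨y₁, a, b⟩ := (h1.and_eventually hM.eventually).exists
    exact ⟨y₁, a, b⟩
  obtain ⟨c, hc, hyc⟩ := exists_mem_sideBefore hVf hy₁V
  exact ⟨c, _, hc, ⟨h.isReflection_antiMob hf hM, rfl⟩,
    h.fixes_sideBefore hV hf (sideBefore_anti hV c hyc) hy₁⟩

/-- The side reflections are the reflections that belong to the crossings. -/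
lemma Extendable.exists_crossing_of_isSideReflection (h : Extendable V₀ w) (hV : V₀ ⊆ V)
    (hVf : V.Finite) (hf : IsBoundaryExtension w f) {σ : Equiv.Perm (OnePoint ℂ)}
    (hσ : IsSideReflection V f σ) : ∃ y M, y ∉ V₀ ∧ Crossing w y M ∧ σ = antiMob M := by
  obtain ⟨c, C, hc, ⟨hσ, rfl⟩, hC⟩ := hσ
  obtain ⟨y, hy⟩ := sideBefore_nonempty hVf c
  have hy0 := notMem_of_mem_sideBefore (sideBefore_anti hV c hy)
  obtain ⟨M, hM⟩ := h.cross y hy0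
  exact ⟨y, M, hy0, hM,
    h.eq_antiMob_of_sideBefore hV hVf hf (sideBefore_anti hV c hy) hM hσ hC⟩

/-- The projective monodromy group consists of the products of even numbers of reflections: each
passage from one half-plane to the other contributes the reflection in one of the sides. -/
lemma Extendable.projMonodromyGroup_eq (h : Extendable V₀ w) (hV : V₀ ⊆ V) (hVf : V.Finite)
    (hf : IsBoundaryExtension w f) {x₀ : ℂ} (hx₀ : 0 < x₀.im) :
    projMonodromyGroup V₀ (fun z => w z 0) (fun z => w z 1) x₀ = evenProducts V f := by
  ext T
  constructor
  · rintro ⟨γ, hγ, hT⟩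
    -- In the upper half-plane a continuation is `A • w` with an even product `mob A`, in the lower
    -- one it is `B • sharp w` with an odd product `antiMob B`.
    let O : Set (GL (Fin 2) ℂ) := {B | ∃ l : List (Equiv.Perm (OnePoint ℂ)),
      Odd l.length ∧ (∀ σ ∈ l, IsSideReflection V f σ) ∧ antiMob B = l.prod}
    have hEO : ∀ y ∉ V₀, ∀ M, Crossing w y M →
        (∀ A ∈ {A | mob A ∈ evenProducts V f}, A * M ∈ O) ∧
        ∀ B ∈ O, B * M⁻¹ ∈ {A | mob A ∈ evenProducts V f} := by
      intro y hy M hM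
      have hs := h.isSideReflection hV hVf hf hM
      constructor
      · rintro A ⟨l, hl, hl', hA⟩
        refine ⟨l ++ [antiMob M], ?_, ?_, ?_⟩
        · simpa using hl.add_one
        · intro σ hσ
          rcases List.mem_append.1 hσ with h1 | h1
          · exact hl' σ h1
          · rw [List.mem_singleton.1 h1]; exact hs
        · rw [← mob_mul_antiMob, hA, List.prod_append, List.prod_singleton]
      · rintro B ⟨l, hl, hl', hB⟩
        refine ⟨l ++ [antiMob M], ?_, ?_, ?_⟩
        · simpa using hl.add_one
        · intro σ hσ
          rcases List.mem_append.1 hσ with h1 | h1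
          · exact hl' σ h1
          · rw [List.mem_singleton.1 h1]; exact hs
        · rw [h.mob_mul_inv B hM, hB, List.prod_append, List.prod_singleton]
    have hO : O.Nonempty := by
      obtain ⟨y, hy⟩ := sideBefore_nonempty (hVf.subset hV) ∞
      obtain ⟨M, hM⟩ := h.cross y (notMem_of_mem_sideBefore hy)
      exact ⟨M, [antiMob M], by simp, by simpa using h.isSideReflection hV hVf hf hM, by simp⟩
    obtain ⟨W, hW, h0, A, hA, h1⟩ := h.exists_continuation hEO
      ⟨[], by simp, by simp, by simp [mob_one]⟩ hO hx₀ γ hγ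
    rw [(h.isProjMonodromy_iff hx₀ ⟨W, hW, by rw [h0], h1⟩ T).1 hT]
    exact hA
  · rintro ⟨l, ⟨n, hn⟩, hl, rfl⟩
    -- Conversely, each pair of successive reflections is realized by a loop that crosses the real
    -- line at one point of each of the two sides.
    suffices H : ∃ γ : Path x₀ x₀, (∀ s, ∀ v ∈ V₀, γ s ≠ (v : ℂ)) ∧ ∃ A, Transport w γ A ∧
        mob A = l.prod by
      obtain ⟨γ, hγ, A, hA, e⟩ := H
      exact ⟨γ, hγ, (h.isProjMonodromy_iff hx₀ hA _).2 e.symm⟩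
    induction n generalizing l with
    | zero =>
      have : l = [] := List.eq_nil_of_length_eq_zero (by simpa using hn)
      subst this
      refine ⟨Path.refl x₀, fun s v hv e => ?_, 1, transport_refl h hx₀, by simp [mob_one]⟩
      rw [Path.refl_apply] at e
      rw [e] at hx₀
      simp at hx₀
    | succ n ih =>
      match l, hn with
      | [_], hn => simp at hn; omega
      | σ :: τ :: l', hn =>
        obtain ⟨γ', hγ', A', hA', e'⟩ := ih l' (by simp at hn; omega) fun ρ hρ =>
          hl ρ (by simp [hρ])
        obtain ⟨y, M, hy, hM, hσ⟩ := h.exists_crossing_of_isSideReflection hV hVf hf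
          (hl σ (by simp))
        obtain ⟨y', M', hy', hM', hτ⟩ := h.exists_crossing_of_isSideReflection hV hVf hf
          (hl τ (by simp))
        obtain ⟨γ, hγ⟩ := exists_crossLoop y y' hx₀
        have ht := h.transport_trans hx₀ (hγ.avoids hy hy') hγ'
          (h.transport_crossLoop hx₀ hγ hM hM') hA'
        refine ⟨_, ht.1, _, ht.2, ?_⟩
        rw [mob_mul, e', h.mob_mul_inv M hM', List.prod_cons, List.prod_cons, ← hσ, ← hτ,
          mul_assoc]

lemma Extendable.existsUnique_projMonodromy (h : Extendable V₀ w) {x₀ : ℂ} (hx₀ : 0 < x₀.im)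
    (γ : Path x₀ x₀) (hγ : ∀ s, ∀ v ∈ V₀, γ s ≠ (v : ℂ)) :
    ∃! T, IsProjMonodromy (fun z => w z 0) (fun z => w z 1) γ T := by
  obtain ⟨A, hA⟩ := h.exists_transport hx₀ γ hγ
  exact ⟨mob A, (h.isProjMonodromy_iff hx₀ hA _).2 rfl, fun T hT =>
    (h.isProjMonodromy_iff hx₀ hA _).1 hT⟩

/-- The monodromy along a loop around the corner `c`. -/
lemma Extendable.isProjMonodromy_loopAround (h : Extendable V₀ w) (hV : V₀ ⊆ V) (hVf : V.Finite)
    (hf : IsBoundaryExtension w f) {x₀ : ℂ} (hx₀ : 0 < x₀.im) {c : OnePoint ℝ} {γ : Path x₀ x₀}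
    (hγ : LoopAround V₀ c γ) : ∃ A, Transport w γ A ∧ (mob A = 1 ↔ SameCircleAt V f c) := by
  obtain ⟨y, hy, y', hy', hc⟩ := hγ.crossLoop
  obtain ⟨M, hM⟩ := h.cross y (notMem_of_mem_sideBefore hy)
  obtain ⟨M', hM'⟩ := h.cross y' (notMem_of_mem_sideAfter hy')
  exact ⟨_, h.transport_crossLoop hx₀ hc hM hM', h.mob_eq_one_iff hV hVf hf hy hy' hM hM'⟩

lemma exists_loopAround (hVf : V.Finite) (c : OnePoint ℝ) {x₀ : ℂ} (hx₀ : 0 < x₀.im) :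
    ∃ γ : Path x₀ x₀, LoopAround V c γ := by
  obtain ⟨y, hy⟩ := sideBefore_nonempty hVf c
  obtain ⟨y', hy'⟩ := sideAfter_nonempty hVf c
  obtain ⟨γ, hγ⟩ := exists_crossLoop y y' hx₀
  exact ⟨γ, hγ.loopAround hy hy'⟩

/-- The monodromy along some loop around `c` is nontrivial if and only if the sides that meet at
`c` lie on different circles. -/
lemma Extendable.exists_loopAround_ne_one_iff (h : Extendable V₀ w) (hV : V₀ ⊆ V)
    (hVf : V.Finite) (hf : IsBoundaryExtension w f) {x₀ : ℂ} (hx₀ : 0 < x₀.im) (c : OnePoint ℝ) :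
    (∃ (γ : Path x₀ x₀) (T : Equiv.Perm (OnePoint ℂ)), LoopAround V₀ c γ ∧
      IsProjMonodromy (fun z => w z 0) (fun z => w z 1) γ T ∧ T ≠ 1) ↔ ¬ SameCircleAt V f c := by
  constructor
  · rintro ⟨γ, T, hγ, hT, hT1⟩ hs
    obtain ⟨A, hA, hA'⟩ := h.isProjMonodromy_loopAround hV hVf hf hx₀ hγ
    exact hT1 (((h.isProjMonodromy_iff hx₀ hA _).1 hT).trans (hA'.2 hs))
  · intro hs
    obtain ⟨γ, hγ⟩ := exists_loopAround (hVf.subset hV) c hx₀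
    obtain ⟨A, hA, hA'⟩ := h.isProjMonodromy_loopAround hV hVf hf hx₀ hγ
    exact ⟨γ, mob A, hγ, (h.isProjMonodromy_iff hx₀ hA _).2 rfl, fun e => hs (hA'.1 e)⟩

/-! ### Power series solutions of Fuchsian equations -/

/-- `f` is the sum of the power series with coefficients `c`, absolutely convergent in the disc of
radius `R`. -/
def HasPS (c : ℕ → ℂ) (R : ℝ) (f : ℂ → ℂ) : Prop :=
  (∀ ρ, 0 < ρ → ρ < R → Summable fun n => ‖c n‖ * ρ ^ n) ∧
    ∀ z ∈ Metric.ball (0 : ℂ) R, HasSum (fun n => c n * z ^ n) (f z)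

lemma exists_between_norm {R : ℝ} {z : ℂ} (hz : z ∈ Metric.ball (0 : ℂ) R) :
    ∃ ρ, 0 < ρ ∧ ‖z‖ < ρ ∧ ρ < R := by
  rw [mem_ball_zero_iff] at hz
  obtain ⟨ρ, h1, h2⟩ := exists_between hz
  exact ⟨ρ, (norm_nonneg z).trans_lt h1, h1, h2⟩

lemma summable_norm_of_ball {c : ℕ → ℂ} {R : ℝ}
    (hc : ∀ ρ, 0 < ρ → ρ < R → Summable fun n => ‖c n‖ * ρ ^ n) {z : ℂ}
    (hz : z ∈ Metric.ball (0 : ℂ) R) : Summable fun n => ‖c n * z ^ n‖ := by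
  obtain ⟨ρ, h0, h1, h2⟩ := exists_between_norm hz
  refine (hc ρ h0 h2).of_nonneg_of_le (fun n => norm_nonneg _) fun n => ?_
  rw [norm_mul, norm_pow]
  gcongr

lemma hasPS_tsum {c : ℕ → ℂ} {R : ℝ}
    (hc : ∀ ρ, 0 < ρ → ρ < R → Summable fun n => ‖c n‖ * ρ ^ n) :
    HasPS c R fun z => ∑' n, c n * z ^ n :=
  ⟨hc, fun _ hz => (summable_norm_of_ball hc hz).of_norm.hasSum⟩

lemma exists_hasPS {f : ℂ → ℂ} {R : ℝ} (hf : DifferentiableOn ℂ f (Metric.ball 0 R)) :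
    ∃ c, HasPS c R f := by
  have h : ∀ z ∈ Metric.ball (0 : ℂ) R,
      HasSum (fun n => ((n.factorial : ℂ)⁻¹ * iteratedDeriv n f 0) * z ^ n) (f z) := by
    intro z hz
    have := Complex.hasSum_taylorSeries_on_ball hf hz
    simp only [sub_zero, smul_eq_mul] at this
    convert! this using 2 with n
    ring
  refine ⟨_, fun ρ h0 h1 => ?_, h⟩
  have := (h (ρ : ℂ) (by simpa [abs_of_pos h0] using h1)).summable.norm
  refine this.congr fun n => ?_
  rw [norm_mul, norm_pow, Complex.norm_real, Real.norm_of_nonneg h0.le]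

lemma summable_deriv_coeff {c : ℕ → ℂ} {R : ℝ}
    (hc : ∀ ρ, 0 < ρ → ρ < R → Summable fun n => ‖c n‖ * ρ ^ n) {ρ : ℝ} (h0 : 0 < ρ)
    (h1 : ρ < R) : Summable fun n : ℕ => ‖c n‖ * (n * ρ ^ (n - 1)) := by
  obtain ⟨ρ', h2, h3⟩ := exists_between h1
  have hρ' : 0 < ρ' := h0.trans h2
  obtain ⟨K, hK⟩ : ∃ K, ∀ n, ‖c n‖ * ρ' ^ n ≤ K := by
    obtain ⟨K, hK⟩ := (hc ρ' hρ' h3).tendsto_atTop_zero.bddAbove_range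
    exact ⟨K, fun n => hK ⟨n, rfl⟩⟩
  have ht : ‖ρ / ρ'‖ < 1 := by
    rw [Real.norm_of_nonneg (by positivity), div_lt_one hρ']; exact h2
  have hs := (summable_pow_mul_geometric_of_norm_lt_one 1 ht).mul_left (K / ρ)
  refine hs.of_nonneg_of_le (fun n => by positivity) fun n => ?_
  rcases Nat.eq_zero_or_pos n with rfl | hn
  · simp
  · have e : ρ ^ n = ρ ^ (n - 1) * ρ := by rw [← pow_succ, Nat.sub_add_cancel hn]
    have h5 : ‖c n‖ * (n * ρ ^ (n - 1)) = (‖c n‖ * ρ' ^ n) / ρ * (n * (ρ / ρ') ^ n) := by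
      rw [div_pow, e]; field_simp
    rw [h5, pow_one]
    have := hK n
    gcongr

lemma HasPS.hasDerivAt {c : ℕ → ℂ} {R : ℝ} {f : ℂ → ℂ} (h : HasPS c R f) {z : ℂ}
    (hz : z ∈ Metric.ball (0 : ℂ) R) :
    HasDerivAt f (∑' n : ℕ, c n * (n * z ^ (n - 1))) z := by
  obtain ⟨ρ, h0, h1, h2⟩ := exists_between_norm hz
  have key := hasDerivAt_tsum_of_isPreconnected (𝕜 := ℂ) (F := ℂ)
    (g := fun n z => c n * z ^ n) (g' := fun n z => c n * (n * z ^ (n - 1)))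
    (summable_deriv_coeff h.1 h0 h2) (Metric.isOpen_ball (x := (0 : ℂ)) (ε := ρ))
    (convex_ball _ _).isPreconnected (fun n y _ => (hasDerivAt_pow n y).const_mul (c n))
    (fun n y hy => by
      rw [mem_ball_zero_iff] at hy
      simp only [norm_mul, norm_pow, Complex.norm_natCast]
      gcongr)
    (Metric.mem_ball_self h0) (h.2 0 (Metric.mem_ball_self (h0.trans h2))).summable
    (y := z) (by simpa using h1)
  refine key.congr_of_eventuallyEq ?_
  filter_upwards [Metric.isOpen_ball.mem_nhds hz] with w hw using (h.2 w hw).tsum_eq.symm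

lemma HasPS.differentiableOn {c : ℕ → ℂ} {R : ℝ} {f : ℂ → ℂ} (h : HasPS c R f) :
    DifferentiableOn ℂ f (Metric.ball 0 R) :=
  fun _ hz => (h.hasDerivAt hz).differentiableAt.differentiableWithinAt

lemma HasPS.deriv {c : ℕ → ℂ} {R : ℝ} {f : ℂ → ℂ} (h : HasPS c R f) :
    HasPS (fun n => (n + 1) * c (n + 1)) R (deriv f) := by
  have hc : ∀ ρ, 0 < ρ → ρ < R → Summable fun n : ℕ => ‖((n : ℂ) + 1) * c (n + 1)‖ * ρ ^ n := by
    intro ρ h0 h1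
    have := (summable_nat_add_iff 1).2 (summable_deriv_coeff h.1 h0 h1)
    refine this.congr fun n => ?_
    have : ‖(n : ℂ) + 1‖ = n + 1 := by
      rw [← Nat.cast_add_one, Complex.norm_natCast]; push_cast; ring
    rw [norm_mul, this]
    rw [Nat.add_sub_cancel]
    push_cast
    ring
  refine ⟨hc, fun z hz => ?_⟩
  have hs := (summable_norm_of_ball hc hz).of_norm
  rw [(h.hasDerivAt hz).deriv]
  have e : ∀ n : ℕ, c (n + 1) * (((n + 1 : ℕ) : ℂ) * z ^ (n + 1 - 1)) =
      ((n : ℂ) + 1) * c (n + 1) * z ^ n := fun n => by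
    rw [Nat.add_sub_cancel]; push_cast; ring
  have hs' : Summable fun n : ℕ => c n * (n * z ^ (n - 1)) := by
    rw [← summable_nat_add_iff 1]
    exact hs.congr fun n => (e n).symm
  rw [hs'.tsum_eq_zero_add]
  simp only [e, Nat.cast_zero, zero_mul, mul_zero, zero_add]
  exact hs.hasSum

lemma HasPS.mul_deriv {c : ℕ → ℂ} {R : ℝ} {f : ℂ → ℂ} (h : HasPS c R f) :
    HasPS (fun n => n * c n) R (fun z => z * _root_.deriv f z) := by
  refine ⟨fun ρ h0 h1 => ?_, fun z hz => ?_⟩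
  · refine ((summable_deriv_coeff h.1 h0 h1).mul_left ρ).congr fun n => ?_
    rcases Nat.eq_zero_or_pos n with rfl | hn
    · simp
    · have e : ρ ^ n = ρ ^ (n - 1) * ρ := by rw [← pow_succ, Nat.sub_add_cancel hn]
      rw [norm_mul, Complex.norm_natCast, e]; ring
  · have h1 := (h.deriv.2 z hz).mul_left z
    rw [← hasSum_nat_add_iff' 1]
    simp only [Finset.range_one, Finset.sum_singleton, Nat.cast_zero, zero_mul, sub_zero]
    refine h1.congr_fun ?_ |> fun x => x
    intro n
    push_cast
    ring

lemma HasPS.apply_zero {c : ℕ → ℂ} {R : ℝ} {f : ℂ → ℂ} (h : HasPS c R f) (hR : 0 < R) :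
    f 0 = c 0 := by
  refine (h.2 0 (Metric.mem_ball_self hR)).unique ?_
  convert! hasSum_single (f := fun n => c n * (0 : ℂ) ^ n) 0 (fun n hn => by simp [hn]) using 1
  simp

/-- The Cauchy product of two power series. -/
lemma HasPS.mul {c d : ℕ → ℂ} {R : ℝ} {f g : ℂ → ℂ} (hf : HasPS c R f) (hg : HasPS d R g) {z : ℂ}
    (hz : z ∈ Metric.ball (0 : ℂ) R) :
    HasSum (fun n => (∑ k ∈ Finset.range (n + 1), c (n - k) * d k) * z ^ n) (f z * g z) := by
  have h1 := summable_norm_of_ball hf.1 hz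
  have h2 := summable_norm_of_ball hg.1 hz
  have key := tsum_mul_tsum_eq_tsum_sum_range_of_summable_norm h2 h1
  have hs := (summable_norm_sum_mul_range_of_summable_norm h2 h1).of_norm.hasSum
  rw [← key, (hg.2 z hz).tsum_eq, (hf.2 z hz).tsum_eq, mul_comm] at hs
  convert! hs using 2 with n
  rw [Finset.sum_mul]
  refine Finset.sum_congr rfl fun k hk => ?_
  have : k ≤ n := Nat.lt_succ_iff.1 (Finset.mem_range.1 hk)
  have e : z ^ n = z ^ k * z ^ (n - k) := by rw [← pow_add, Nat.add_sub_cancel' this]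
  rw [e]; ring

/-- Recursive definition of a sequence, where `G n f` depends only on the values of `f` below `n`. -/
lemma exists_strong_rec (G : ℕ → (ℕ → ℂ) → ℂ)
    (hG : ∀ n f g, (∀ k < n, f k = g k) → G n f = G n g) : ∃ h : ℕ → ℂ, ∀ n, h n = G n h := by
  let F : (n : ℕ) → ((m : ℕ) → m < n → ℂ) → ℂ :=
    fun n ih => G n fun k => if hk : k < n then ih k hk else 0
  refine ⟨fun n => WellFounded.fix Nat.lt_wfRel.wf F n, fun n => ?_⟩
  change WellFounded.fix Nat.lt_wfRel.wf F n = _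
  rw [WellFounded.fix_eq]
  refine hG n _ _ fun k hk => ?_
  simp [hk]

/-- The recursion for the coefficients of a power series solution produces a series that converges
in every disc in which the coefficients of the equation are analytic. -/
lemma summable_of_recursion {a b h : ℕ → ℂ} {c R : ℝ} (hc : 0 ≤ c)
    (ha : ∀ ρ, 0 < ρ → ρ < R → Summable fun n => ‖a n‖ * ρ ^ n)
    (hb : ∀ ρ, 0 < ρ → ρ < R → Summable fun n => ‖b n‖ * ρ ^ n)
    (hrec : ∀ n : ℕ, 1 ≤ n → ((n : ℂ) + 1) * (n + c) * h (n + 1) =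
      -∑ k ∈ Finset.range (n + 1), (k * a (n - k) + b (n - k)) * h k) :
    ∀ ρ, 0 < ρ → ρ < R → Summable fun n => ‖h n‖ * ρ ^ n := by
  intro ρ h0 h1
  obtain ⟨ρ', h2, h3⟩ := exists_between h1
  have hρ' : 0 < ρ' := h0.trans h2
  obtain ⟨K₁, hK₁⟩ : ∃ K, ∀ n, ‖a n‖ * ρ' ^ n ≤ K := by
    obtain ⟨K, hK⟩ := (ha ρ' hρ' h3).tendsto_atTop_zero.bddAbove_range
    exact ⟨K, fun n => hK ⟨n, rfl⟩⟩
  obtain ⟨K₂, hK₂⟩ : ∃ K, ∀ n, ‖b n‖ * ρ' ^ n ≤ K := by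
    obtain ⟨K, hK⟩ := (hb ρ' hρ' h3).tendsto_atTop_zero.bddAbove_range
    exact ⟨K, fun n => hK ⟨n, rfl⟩⟩
  set K := max K₁ K₂ with hK
  have hK0 : 0 ≤ K := le_trans (by positivity) ((hK₁ 0).trans (le_max_left _ _))
  set s : ℕ → ℝ := fun n => ∑ k ∈ Finset.range n, ‖h k‖ * ρ' ^ k with hs
  have hs0 : ∀ n, 0 ≤ s n := fun n => Finset.sum_nonneg fun k _ => by positivity
  have hs1 : ∀ n, s (n + 1) = s n + ‖h n‖ * ρ' ^ n := fun n => Finset.sum_range_succ _ _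
  -- The new term is small compared with the partial sum `s` of the preceding ones.
  have bound : ∀ n ≥ 1, ‖h (n + 1)‖ * ρ' ^ (n + 1) ≤ K * ρ' / n * s (n + 1) := by
    intro n hn
    have hn0 : (0 : ℝ) < n := by exact_mod_cast hn
    have e1 : ‖((n : ℂ) + 1) * (n + c) * h (n + 1)‖ = (n + 1) * (n + c) * ‖h (n + 1)‖ := by
      have : ((n : ℂ) + 1) * (n + c) = (((n + 1) * (n + c) : ℝ) : ℂ) := by push_cast; ring
      rw [norm_mul, this, Complex.norm_real, Real.norm_of_nonneg (by positivity)]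
    have e2 : ‖∑ k ∈ Finset.range (n + 1), (k * a (n - k) + b (n - k)) * h k‖ * ρ' ^ n ≤
        (n + 1) * K * s (n + 1) := by
      have : ‖∑ k ∈ Finset.range (n + 1), (k * a (n - k) + b (n - k)) * h k‖ ≤
          ∑ k ∈ Finset.range (n + 1), (k * ‖a (n - k)‖ + ‖b (n - k)‖) * ‖h k‖ := by
        refine (norm_sum_le _ _).trans (Finset.sum_le_sum fun k _ => ?_)
        rw [norm_mul]
        gcongr
        refine (norm_add_le _ _).trans ?_
        rw [norm_mul, Complex.norm_natCast]
      refine (mul_le_mul_of_nonneg_right this (by positivity)).trans ?_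
      rw [Finset.sum_mul, hs, Finset.mul_sum]
      refine Finset.sum_le_sum fun k hk => ?_
      have hkn : k ≤ n := Nat.lt_succ_iff.1 (Finset.mem_range.1 hk)
      have e : ρ' ^ n = ρ' ^ (n - k) * ρ' ^ k := by rw [← pow_add, Nat.sub_add_cancel hkn]
      have hkn' : (k : ℝ) ≤ n := by exact_mod_cast hkn
      have i1 := (hK₁ (n - k)).trans (le_max_left K₁ K₂)
      have i2 := (hK₂ (n - k)).trans (le_max_right K₁ K₂)
      rw [← hK] at i1 i2
      calc (k * ‖a (n - k)‖ + ‖b (n - k)‖) * ‖h k‖ * ρ' ^ n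
          = (k * (‖a (n - k)‖ * ρ' ^ (n - k)) + ‖b (n - k)‖ * ρ' ^ (n - k)) *
            (‖h k‖ * ρ' ^ k) := by rw [e]; ring
        _ ≤ (n * K + K) * (‖h k‖ * ρ' ^ k) := by gcongr
        _ = (n + 1) * K * (‖h k‖ * ρ' ^ k) := by ring
    have e3 : (n + 1) * (n + c) * ‖h (n + 1)‖ * ρ' ^ n ≤ (n + 1) * K * s (n + 1) := by
      rw [← e1, hrec n hn, norm_neg]; exact e2
    have e4 : n * (‖h (n + 1)‖ * ρ' ^ n) ≤ K * s (n + 1) := by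
      have h5 : (n + 1) * (n * (‖h (n + 1)‖ * ρ' ^ n)) ≤ (n + 1) * (K * s (n + 1)) := by
        calc (n + 1) * (n * (‖h (n + 1)‖ * ρ' ^ n))
            ≤ (n + 1) * ((n + c) * (‖h (n + 1)‖ * ρ' ^ n)) := by gcongr; linarith
          _ ≤ (n + 1) * (K * s (n + 1)) := by linarith
      exact le_of_mul_le_mul_left h5 (by positivity)
    rw [pow_succ, div_mul_eq_mul_div, le_div_iff₀ hn0]
    calc ‖h (n + 1)‖ * (ρ' ^ n * ρ') * n = (n * (‖h (n + 1)‖ * ρ' ^ n)) * ρ' := by ring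
      _ ≤ (K * s (n + 1)) * ρ' := by gcongr
      _ = K * ρ' * s (n + 1) := by ring
  set t := ρ / ρ' with ht
  have ht0 : 0 < t := by positivity
  have ht1 : t < 1 := by rw [ht, div_lt_one hρ']; exact h2
  -- By `bound` the partial sums grow at most by the factors `1 + K ρ' / n`, so that the ratio test
  -- applies after the passage from the radius `ρ'` to the smaller radius `ρ`.
  have hsum : Summable fun n => s (n + 1) * t ^ n := by
    refine summable_of_ratio_norm_eventually_le (r := (1 + t) / 2) (by linarith) ?_
    have hlim : Tendsto (fun n : ℕ => (1 + K * ρ' / n) * t) atTop (𝓝 ((1 + 0) * t)) :=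
      (tendsto_const_nhds.add (tendsto_const_div_atTop_nhds_zero_nat _)).mul_const _
    filter_upwards [hlim.eventually (eventually_lt_nhds (b := (1 + t) / 2) (by linarith)),
      eventually_ge_atTop 1] with n hn hn1
    rw [Real.norm_of_nonneg (mul_nonneg (hs0 _) (by positivity)),
      Real.norm_of_nonneg (mul_nonneg (hs0 _) (by positivity)), hs1 (n + 1), pow_succ]
    have := bound n hn1
    calc (s (n + 1) + ‖h (n + 1)‖ * ρ' ^ (n + 1)) * (t ^ n * t)
        ≤ (s (n + 1) + K * ρ' / n * s (n + 1)) * (t ^ n * t) := by gcongr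
      _ = ((1 + K * ρ' / n) * t) * (s (n + 1) * t ^ n) := by ring
      _ ≤ (1 + t) / 2 * (s (n + 1) * t ^ n) := by
        have := hs0 (n + 1)
        gcongr
  refine hsum.of_nonneg_of_le (fun n => by positivity) fun n => ?_
  have e : ‖h n‖ * ρ ^ n = (‖h n‖ * ρ' ^ n) * t ^ n := by
    rw [ht, div_pow]; field_simp
  rw [e, hs1]
  have := hs0 n
  gcongr
  linarith

/-- The equation `z h'' + (c + z a) h' + b h = 0` with analytic `a`, `b` has an analytic solution
with `h 0 = h₀`, if `c > 0`; if `c = 0` and `b 0 = 0`, then `0` is an ordinary point and also the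
value of `h' 0` can be prescribed. -/
lemma exists_analytic_solution {a b : ℂ → ℂ} {c R : ℝ} (hR : 0 < R)
    (ha : DifferentiableOn ℂ a (Metric.ball 0 R)) (hb : DifferentiableOn ℂ b (Metric.ball 0 R))
    (hc : 0 < c ∨ (c = 0 ∧ b 0 = 0)) (h₀ h₁ : ℂ) :
    ∃ h : ℂ → ℂ, DifferentiableOn ℂ h (Metric.ball 0 R) ∧ h 0 = h₀ ∧ (c = 0 → deriv h 0 = h₁) ∧
      ∀ z ∈ Metric.ball (0 : ℂ) R,
        z * deriv (deriv h) z + (c + z * a z) * deriv h z + b z * h z = 0 := by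
  obtain ⟨a', ha'⟩ := exists_hasPS ha
  obtain ⟨b', hb'⟩ := exists_hasPS hb
  obtain ⟨h, hh⟩ := exists_strong_rec (fun n f => if n = 0 then h₀ else if n = 1 ∧ c = 0 then h₁
    else -(∑ k ∈ Finset.range n, (k * a' (n - 1 - k) + b' (n - 1 - k)) * f k) /
      (n * (n - 1 + c))) (fun n f g hfg => by
      have : ∑ k ∈ Finset.range n, (k * a' (n - 1 - k) + b' (n - 1 - k)) * f k =
          ∑ k ∈ Finset.range n, (k * a' (n - 1 - k) + b' (n - 1 - k)) * g k :=
        Finset.sum_congr rfl fun k hk => by rw [hfg k (Finset.mem_range.1 hk)]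
      simp only [this])
  have hc0 : 0 ≤ c := hc.elim le_of_lt fun h => h.1.ge
  have hz0 : h 0 = h₀ := by rw [hh]; simp
  have hrec : ∀ n : ℕ, ((n : ℂ) + 1) * (n + c) * h (n + 1) =
      -∑ k ∈ Finset.range (n + 1), (k * a' (n - k) + b' (n - k)) * h k := by
    intro n
    by_cases h1 : n = 0 ∧ c = 0
    · obtain ⟨rfl, hc1⟩ := h1
      have hb0 : b' 0 = 0 := by
        rw [← hb'.apply_zero hR]; exact (hc.resolve_left (by rw [hc1]; exact lt_irrefl _)).2
      simp [hc1, hb0]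
    · have e := hh (n + 1)
      have h1' : ¬ (n + 1 = 1 ∧ c = 0) := by simpa using h1
      simp only [Nat.add_eq_zero_iff, one_ne_zero, and_false, if_false, h1', Nat.add_sub_cancel]
        at e
      have hne : ((n : ℂ) + 1) * (n + c) ≠ 0 := by
        have : ((n : ℂ) + 1) * (n + c) = (((n + 1) * (n + c) : ℝ) : ℂ) := by push_cast; ring
        rw [this, Complex.ofReal_ne_zero]
        have : (n : ℝ) + c ≠ 0 := by
          intro h2
          have hn : (0 : ℝ) ≤ n := n.cast_nonneg
          have : (n : ℝ) = 0 := by linarith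
          exact h1 ⟨by exact_mod_cast this, by linarith⟩
        positivity
      have e' : (((n + 1 : ℕ) : ℂ) * (((n + 1 : ℕ) : ℂ) - 1 + c)) = ((n : ℂ) + 1) * (n + c) := by
        push_cast; ring
      rw [e, e', mul_div_cancel₀ _ hne]
  have hP : HasPS h R fun z => ∑' n, h n * z ^ n :=
    hasPS_tsum (summable_of_recursion hc0 ha'.1 hb'.1 fun n _ => hrec n)
  refine ⟨_, hP.differentiableOn, by rw [hP.apply_zero hR, hz0], fun hc1 => ?_, fun z hz => ?_⟩
  · rw [hP.deriv.apply_zero hR, hh]; simp [hc1]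
  · have s1 := hP.deriv.mul_deriv.2 z hz
    have s2 := (hP.deriv.2 z hz).mul_left (c : ℂ)
    have s3 := ha'.mul hP.mul_deriv hz
    have s4 := hb'.mul hP hz
    have s := ((s1.add s2).add s3).add s4
    have hzero : ∀ n : ℕ, (n : ℂ) * ((n + 1) * h (n + 1)) * z ^ n +
        c * ((n + 1) * h (n + 1) * z ^ n) +
        (∑ k ∈ Finset.range (n + 1), a' (n - k) * (k * h k)) * z ^ n +
        (∑ k ∈ Finset.range (n + 1), b' (n - k) * h k) * z ^ n = 0 := by
      intro n
      have e : ∑ k ∈ Finset.range (n + 1), (k * a' (n - k) + b' (n - k)) * h k =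
          ∑ k ∈ Finset.range (n + 1), a' (n - k) * (k * h k) +
          ∑ k ∈ Finset.range (n + 1), b' (n - k) * h k := by
        rw [← Finset.sum_add_distrib]
        exact Finset.sum_congr rfl fun k _ => by ring
      have := hrec n
      rw [e] at this
      linear_combination z ^ n * this
    have := s.unique ((hasSum_zero).congr_fun fun n => (hzero n))
    linear_combination this

/-- The equation `z F' - κ F = u - e z ^ κ`, where the last term occurs only if `κ` is an integer,
has an analytic solution. -/
lemma exists_primitive_series {u : ℂ → ℂ} {κ R : ℝ} (hR : 0 < R)
    (hu : DifferentiableOn ℂ u (Metric.ball 0 R)) :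
    ∃ (F : ℂ → ℂ) (e : ℂ) (m : ℕ), DifferentiableOn ℂ F (Metric.ball 0 R) ∧
      (e ≠ 0 → κ = m) ∧ (0 < κ → F 0 = -u 0 / κ) ∧ (κ = 0 → e = u 0) ∧
      ∀ z ∈ Metric.ball (0 : ℂ) R, z * deriv F z - κ * F z = u z - e * z ^ m := by
  obtain ⟨c, hc⟩ := exists_hasPS hu
  -- The coefficient of `z ^ n` in `z F' - κ F` is `(n - κ) d n`; the one with `n = κ` vanishes, and the
  -- constant `e` compensates for it.
  let d : ℕ → ℂ := fun n => if (n : ℝ) = κ then 0 else c n / (n - κ)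
  have hd : ∀ ρ, 0 < ρ → ρ < R → Summable fun n => ‖d n‖ * ρ ^ n := by
    intro ρ h0 h1
    refine Summable.of_norm_bounded_eventually_nat (hc.1 ρ h0 h1) ?_
    filter_upwards [eventually_ge_atTop (⌈κ⌉₊ + 1)] with n hn
    have hn1 : κ + 1 ≤ n := by
      have : ((⌈κ⌉₊ + 1 : ℕ) : ℝ) ≤ n := by exact_mod_cast hn
      have := Nat.le_ceil κ
      push_cast at *
      linarith
    rw [Real.norm_of_nonneg (by positivity)]
    gcongr
    have hne : (n : ℝ) ≠ κ := by linarith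
    simp only [d, hne, if_false]
    have e : ‖(n : ℂ) - κ‖ = n - κ := by
      have : (n : ℂ) - κ = ((n - κ : ℝ) : ℂ) := by push_cast; ring
      rw [this, Complex.norm_real, Real.norm_of_nonneg (by linarith)]
    rw [norm_div, e]
    exact div_le_self (norm_nonneg _) (by linarith)
  have hP := hasPS_tsum hd
  have coef : ∀ n : ℕ, (n : ℂ) * d n - κ * d n = if (n : ℝ) = κ then 0 else c n := by
    intro n
    by_cases h : (n : ℝ) = κ
    · simp [d, h]
    · have : (n : ℂ) - κ ≠ 0 := by
        rw [sub_ne_zero]; exact_mod_cast h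
      simp only [d, h, if_false]
      field_simp
  have hF0 : 0 < κ → d 0 = -u 0 / κ := by
    intro h
    have : ((0 : ℕ) : ℝ) ≠ κ := by simpa using h.ne
    simp only [d, this, if_false, hc.apply_zero hR]
    rw [Nat.cast_zero, zero_sub, div_neg, neg_div]
  have main : ∀ z ∈ Metric.ball (0 : ℂ) R,
      HasSum (fun n : ℕ => (if (n : ℝ) = κ then 0 else c n) * z ^ n)
        (z * deriv (fun z => ∑' n, d n * z ^ n) z - κ * ∑' n, d n * z ^ n) := by
    intro z hz
    convert! (hP.mul_deriv.2 z hz).sub ((hP.2 z hz).mul_left (κ : ℂ)) using 2 with n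
    rw [← coef]; ring
  by_cases hm : ∃ m : ℕ, κ = m
  · obtain ⟨m, hm⟩ := hm
    refine ⟨_, c m, m, hP.differentiableOn, fun _ => hm, fun h => ?_, fun h => ?_,
      fun z hz => ?_⟩
    · rw [hP.apply_zero hR, hF0 h]
    · have : m = 0 := by rw [h] at hm; exact_mod_cast hm.symm
      rw [hc.apply_zero hR, this]
    · refine (main z hz).unique ?_
      have h1 := (hc.2 z hz).sub (hasSum_ite_eq m (c m * z ^ m))
      convert! h1 using 2 with n
      by_cases hn : n = m
      · simp [hn, hm]
      · have : (n : ℝ) ≠ κ := by rw [hm]; exact_mod_cast hn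
        simp [hn, this]
  · refine ⟨_, 0, 0, hP.differentiableOn, fun h => absurd rfl h, fun h => ?_, fun h => ?_,
      fun z hz => ?_⟩
    · rw [hP.apply_zero hR, hF0 h]
    · exact absurd ⟨0, by simpa using h⟩ hm
    · refine (main z hz).unique ?_
      rw [zero_mul, sub_zero]
      convert! hc.2 z hz using 2 with n
      have : (n : ℝ) ≠ κ := fun h => hm ⟨n, h.symm⟩
      simp [this]

/-! ### Linear differential equations of second order -/

/-- `y` is a solution of `y'' - P y' + Q y = 0` in `U`. -/
def Solves (P Q : ℂ → ℂ) (U : Set ℂ) (y : ℂ → ℂ) : Prop :=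
  DifferentiableOn ℂ y U ∧ ∀ z ∈ U, deriv (deriv y) z - P z * deriv y z + Q z * y z = 0

/-- Both components of `v` are solutions of `y'' - P y' + Q y = 0` in `U`. -/
def SolvesV (P Q : ℂ → ℂ) (U : Set ℂ) (v : ℂ → Fin 2 → ℂ) : Prop :=
  ∀ i, Solves P Q U fun z => v z i

/-- The Wronskian of the components of `v`. -/
noncomputable def wr (v : ℂ → Fin 2 → ℂ) (z : ℂ) : ℂ :=
  deriv (fun z => v z 0) z * v z 1 - v z 0 * deriv (fun z => v z 1) z

lemma Solves.mono {P Q : ℂ → ℂ} {U U' : Set ℂ} {y : ℂ → ℂ} (h : Solves P Q U y) (hU : U' ⊆ U) :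
    Solves P Q U' y := ⟨h.1.mono hU, fun z hz => h.2 z (hU hz)⟩

lemma SolvesV.mono {P Q : ℂ → ℂ} {U U' : Set ℂ} {v : ℂ → Fin 2 → ℂ} (h : SolvesV P Q U v)
    (hU : U' ⊆ U) : SolvesV P Q U' v := fun i => (h i).mono hU

lemma Solves.congr {P Q : ℂ → ℂ} {U : Set ℂ} {y y' : ℂ → ℂ} (h : Solves P Q U y) (hU : IsOpen U)
    (hy : Set.EqOn y' y U) : Solves P Q U y' := by
  refine ⟨h.1.congr hy, fun z hz => ?_⟩
  have e : y' =ᶠ[𝓝 z] y := by filter_upwards [hU.mem_nhds hz] with z hz using hy hz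
  rw [e.deriv.deriv_eq, e.deriv_eq, hy hz]
  exact h.2 z hz

lemma SolvesV.congr {P Q : ℂ → ℂ} {U : Set ℂ} {v v' : ℂ → Fin 2 → ℂ} (h : SolvesV P Q U v)
    (hU : IsOpen U) (hv : Set.EqOn v' v U) : SolvesV P Q U v' := fun i =>
  (h i).congr hU fun z hz => by simp only [hv hz]

lemma Solves.congr_coeff {P Q P' Q' : ℂ → ℂ} {U : Set ℂ} {y : ℂ → ℂ} (h : Solves P Q U y)
    (hP : Set.EqOn P P' U) (hQ : Set.EqOn Q Q' U) : Solves P' Q' U y :=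
  ⟨h.1, fun z hz => by rw [← hP hz, ← hQ hz]; exact h.2 z hz⟩

lemma Solves.linComb {P Q : ℂ → ℂ} {U : Set ℂ} (hU : IsOpen U) {y y' : ℂ → ℂ}
    (h : Solves P Q U y) (h' : Solves P Q U y') (a b : ℂ) :
    Solves P Q U fun z => a * y z + b * y' z := by
  refine ⟨(h.1.const_mul a).add (h'.1.const_mul b), fun z hz => ?_⟩
  have d1 : ∀ z ∈ U, deriv (fun z => a * y z + b * y' z) z = a * deriv y z + b * deriv y' z := by
    intro z hz
    have e1 := (h.1.differentiableAt (hU.mem_nhds hz)).hasDerivAt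
    have e2 := (h'.1.differentiableAt (hU.mem_nhds hz)).hasDerivAt
    exact ((e1.const_mul a).add (e2.const_mul b)).deriv
  have d2 : deriv (deriv fun z => a * y z + b * y' z) z =
      a * deriv (deriv y) z + b * deriv (deriv y') z := by
    have e : deriv (fun z => a * y z + b * y' z) =ᶠ[𝓝 z]
        fun z => a * deriv y z + b * deriv y' z := by
      filter_upwards [hU.mem_nhds hz] with z hz using d1 z hz
    rw [e.deriv_eq]
    have e1 := ((h.1.deriv hU).differentiableAt (hU.mem_nhds hz)).hasDerivAt
    have e2 := ((h'.1.deriv hU).differentiableAt (hU.mem_nhds hz)).hasDerivAt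
    exact ((e1.const_mul a).add (e2.const_mul b)).deriv
  rw [d1 z hz, d2]
  linear_combination a * h.2 z hz + b * h'.2 z hz

lemma SolvesV.GL_smul {P Q : ℂ → ℂ} {U : Set ℂ} (hU : IsOpen U) {v : ℂ → Fin 2 → ℂ}
    (h : SolvesV P Q U v) (g : GL (Fin 2) ℂ) : SolvesV P Q U fun z => g • v z := by
  intro i
  fin_cases i
  · simpa using Solves.linComb hU (h 0) (h 1) (g 0 0) (g 0 1)
  · simpa using Solves.linComb hU (h 0) (h 1) (g 1 0) (g 1 1)

lemma Solves.sharp {P Q : ℂ → ℂ} {U : Set ℂ} {y : ℂ → ℂ} (h : Solves P Q U y) (hU : IsOpen U)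
    (hP : ∀ z, P (conj z) = conj (P z)) (hQ : ∀ z, Q (conj z) = conj (Q z)) :
    Solves P Q (conj ⁻¹' U) (CircularPolygon.sharp y) := by
  refine ⟨fun z hz => (differentiableAt_sharp
    (h.1.differentiableAt (hU.mem_nhds hz))).differentiableWithinAt, fun z hz => ?_⟩
  have := congrArg conj (h.2 (conj z) hz)
  rw [deriv_sharp, deriv_sharp]
  simpa [CircularPolygon.sharp, hP, hQ] using this

lemma SolvesV.sharp {P Q : ℂ → ℂ} {U : Set ℂ} {v : ℂ → Fin 2 → ℂ} (h : SolvesV P Q U v)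
    (hU : IsOpen U) (hP : ∀ z, P (conj z) = conj (P z)) (hQ : ∀ z, Q (conj z) = conj (Q z)) :
    SolvesV P Q (conj ⁻¹' U) (CircularPolygon.sharp v) := fun i => (h i).sharp hU hP hQ

lemma wr_sharp (v : ℂ → Fin 2 → ℂ) (z : ℂ) : wr (sharp v) z = conj (wr v (conj z)) := by
  have e : ∀ i, deriv (fun z => sharp v z i) z = conj (deriv (fun z => v z i) (conj z)) := fun i =>
    congrFun (deriv_sharp fun z => v z i) z
  simp only [wr, e]
  simp [sharp]

lemma SolvesV.analyticAt {P Q : ℂ → ℂ} {U : Set ℂ} {v : ℂ → Fin 2 → ℂ} (h : SolvesV P Q U v)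
    (hU : IsOpen U) {z : ℂ} (hz : z ∈ U) : AnalyticAt ℂ v z :=
  analyticAt_pi_iff.2 fun i => (h i).1.analyticAt (hU.mem_nhds hz)

lemma wr_GL_smul {v : ℂ → Fin 2 → ℂ} {z : ℂ} (hv : AnalyticAt ℂ v z) (g : GL (Fin 2) ℂ) :
    wr (fun z => g • v z) z = (g 0 0 * g 1 1 - g 0 1 * g 1 0) * wr v z := by
  have hv' := analyticAt_pi_iff.1 hv
  have h0 := (hv' 0).differentiableAt.hasDerivAt
  have h1 := (hv' 1).differentiableAt.hasDerivAt
  have e0 : deriv (fun z => (g • v z) 0) z = g 0 0 * deriv (fun z => v z 0) z +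
      g 0 1 * deriv (fun z => v z 1) z := by
    simp only [GL_smul_zero_apply]
    exact ((h0.const_mul _).add (h1.const_mul _)).deriv
  have e1 : deriv (fun z => (g • v z) 1) z = g 1 0 * deriv (fun z => v z 0) z +
      g 1 1 * deriv (fun z => v z 1) z := by
    simp only [GL_smul_one_apply]
    exact ((h0.const_mul _).add (h1.const_mul _)).deriv
  simp only [wr, e0, e1]
  rw [GL_smul_zero_apply, GL_smul_one_apply]
  ring

/-- The cross-Wronskian of two solutions satisfies `W' = P W`. -/
lemma Solves.hasDerivAt_wronskian {P Q : ℂ → ℂ} {U : Set ℂ} (hU : IsOpen U) {y y' : ℂ → ℂ}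
    (h : Solves P Q U y) (h' : Solves P Q U y') {z : ℂ} (hz : z ∈ U) :
    HasDerivAt (fun z => deriv y z * y' z - y z * deriv y' z)
      (P z * (deriv y z * y' z - y z * deriv y' z)) z := by
  have e1 := (h.1.differentiableAt (hU.mem_nhds hz)).hasDerivAt
  have e2 := (h'.1.differentiableAt (hU.mem_nhds hz)).hasDerivAt
  have f1 := ((h.1.deriv hU).differentiableAt (hU.mem_nhds hz)).hasDerivAt
  have f2 := ((h'.1.deriv hU).differentiableAt (hU.mem_nhds hz)).hasDerivAt
  convert! (f1.mul e2).sub (e1.mul f2) using 1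
  linear_combination (-y' z) * h.2 z hz + y z * h'.2 z hz

lemma SolvesV.hasDerivAt_wr {P Q : ℂ → ℂ} {U : Set ℂ} (hU : IsOpen U) {v : ℂ → Fin 2 → ℂ}
    (h : SolvesV P Q U v) {z : ℂ} (hz : z ∈ U) : HasDerivAt (wr v) (P z * wr v z) z :=
  (h 0).hasDerivAt_wronskian hU (h 1) hz

lemma eq_of_hasDerivAt_zero {f : ℂ → ℂ} {U : Set ℂ} (hU : IsOpen U) (hUc : IsPreconnected U)
    (hd : ∀ z ∈ U, HasDerivAt f 0 z) {z w : ℂ} (hz : z ∈ U) (hw : w ∈ U) : f z = f w :=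
  hU.is_const_of_deriv_eq_zero hUc
    (fun z hz => (hd z hz).differentiableAt.differentiableWithinAt)
    (fun z hz => (hd z hz).deriv) hz hw

/-- A solution of `g' = P g` that vanishes at one point vanishes identically. -/
lemma eq_zero_of_deriv_eq_mul {P g : ℂ → ℂ} {U : Set ℂ} (hU : IsOpen U) (hUc : IsPreconnected U)
    (hP : DifferentiableOn ℂ P U) (hg : ∀ z ∈ U, HasDerivAt g (P z * g z) z) {z₀ : ℂ}
    (hz₀ : z₀ ∈ U) (h0 : g z₀ = 0) : ∀ z ∈ U, g z = 0 := by
  obtain ⟨r, hr, hb⟩ := Metric.isOpen_iff.1 hU z₀ hz₀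
  obtain ⟨G, hG⟩ := (hP.mono hb).isExactOn_ball
  have hgU : DifferentiableOn ℂ g U := fun z hz => (hg z hz).differentiableAt.differentiableWithinAt
  have hd : ∀ z ∈ Metric.ball z₀ r, HasDerivAt (fun z => g z * Complex.exp (-G z)) 0 z := by
    intro z hz
    convert! (hg z (hb hz)).mul (hG z hz).neg.cexp using 1
    ring
  have hloc : ∀ z ∈ Metric.ball z₀ r, g z = 0 := by
    intro z hz
    have := eq_of_hasDerivAt_zero Metric.isOpen_ball (convex_ball _ _).isPreconnected hd hz
      (Metric.mem_ball_self hr)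
    simpa [h0, Complex.exp_ne_zero] using this
  intro z hz
  exact (hgU.analyticOnNhd hU).eqOn_zero_of_preconnected_of_eventuallyEq_zero hUc hz₀
    (by filter_upwards [Metric.ball_mem_nhds z₀ hr] with w hw using hloc w hw) hz

lemma IndepAt.of_wr_ne_zero {v : ℂ → Fin 2 → ℂ} {z : ℂ} (hv : AnalyticAt ℂ v z)
    (h : wr v z ≠ 0) : IndepAt v z := by
  intro a b hab
  have hv' := analyticAt_pi_iff.1 hv
  have h0 := (hv' 0).differentiableAt.hasDerivAt
  have h1 := (hv' 1).differentiableAt.hasDerivAt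
  have e1 : a * v z 0 + b * v z 1 = 0 := hab.self_of_nhds
  have e2 : a * deriv (fun z => v z 0) z + b * deriv (fun z => v z 1) z = 0 := by
    have := ((h0.const_mul a).add (h1.const_mul b)).deriv
    rw [← this]
    have e : (fun z => a * v z 0 + b * v z 1) =ᶠ[𝓝 z] fun _ => 0 := hab
    exact e.deriv_eq.trans (deriv_const z (0 : ℂ))
  constructor
  · have : a * wr v z = 0 := by
      unfold wr
      linear_combination v z 1 * e2 - deriv (fun z => v z 1) z * e1
    simpa [h] using this
  · have : b * wr v z = 0 := by
      unfold wr
      linear_combination -v z 0 * e2 + deriv (fun z => v z 0) z * e1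
    simpa [h] using this

lemma ne_zero_of_wr_ne_zero {v : ℂ → Fin 2 → ℂ} {z : ℂ} (h : wr v z ≠ 0) : v z ≠ 0 := by
  intro h0
  apply h
  simp [wr, h0]

/-- Linearly independent solutions have a Wronskian without zeros. -/
lemma SolvesV.wr_ne_zero {P Q : ℂ → ℂ} {U : Set ℂ} (hU : IsOpen U) (hUc : IsPreconnected U)
    (hP : DifferentiableOn ℂ P U) {v : ℂ → Fin 2 → ℂ} (h : SolvesV P Q U v)
    (hi : ∀ a b : ℂ, (∀ z ∈ U, a * v z 0 + b * v z 1 = 0) → a = 0 ∧ b = 0) {z : ℂ} (hz : z ∈ U) :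
    wr v z ≠ 0 := by
  intro h0
  have hW := eq_zero_of_deriv_eq_mul hU hUc hP (fun z hz => h.hasDerivAt_wr hU hz) hz h0
  by_cases h1 : ∀ z ∈ U, v z 1 = 0
  · have := (hi 0 1 fun z hz => by simp [h1 z hz]).2
    exact one_ne_zero this
  push Not at h1
  obtain ⟨z₁, hz₁, hne⟩ := h1
  have a0 : DifferentiableOn ℂ (fun z => v z 0) U := (h 0).1
  have a1 : DifferentiableOn ℂ (fun z => v z 1) U := (h 1).1
  have hev : ∀ᶠ z in 𝓝 z₁, z ∈ U ∧ v z 1 ≠ 0 := (hU.eventually_mem hz₁).and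
    (((a1.differentiableAt (hU.mem_nhds hz₁)).continuousAt).eventually_ne hne)
  obtain ⟨r, hr, hb⟩ := Metric.eventually_nhds_iff_ball.1 hev
  have hd : ∀ z ∈ Metric.ball z₁ r, HasDerivAt (fun z => v z 0 / v z 1) 0 z := by
    intro z hz
    have e0 := (a0.differentiableAt (hU.mem_nhds (hb z hz).1)).hasDerivAt
    have e1 := (a1.differentiableAt (hU.mem_nhds (hb z hz).1)).hasDerivAt
    convert! e0.div e1 (hb z hz).2 using 1
    have := hW z (hb z hz).1
    unfold wr at this
    rw [this, zero_div]
  have hrel : ∀ z ∈ U, v z₁ 1 * v z 0 + (-v z₁ 0) * v z 1 = 0 := by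
    intro z hz
    have han : AnalyticOnNhd ℂ (fun z => v z₁ 1 * v z 0 + (-v z₁ 0) * v z 1) U :=
      ((a0.const_mul _).add (a1.const_mul _)).analyticOnNhd hU
    refine han.eqOn_zero_of_preconnected_of_eventuallyEq_zero hUc hz₁ ?_ hz
    filter_upwards [Metric.ball_mem_nhds z₁ hr] with w hw
    have := eq_of_hasDerivAt_zero Metric.isOpen_ball (convex_ball _ _).isPreconnected hd hw
      (Metric.mem_ball_self hr)
    rw [div_eq_div_iff (hb w hw).2 hne] at this
    simp only [Pi.zero_apply]
    linear_combination this
  exact hne (hi _ _ hrel).1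

/-- Every solution is a linear combination of two solutions with nonvanishing Wronskian. -/
lemma SolvesV.exists_linComb {P Q : ℂ → ℂ} {U : Set ℂ} (hU : IsOpen U) (hUc : IsPreconnected U)
    {v : ℂ → Fin 2 → ℂ} (h : SolvesV P Q U v) (hW : ∀ z ∈ U, wr v z ≠ 0) {y : ℂ → ℂ}
    (hy : Solves P Q U y) : ∃ a b : ℂ, ∀ z ∈ U, y z = a * v z 0 + b * v z 1 := by
  have hquot : ∀ {g : ℂ → ℂ}, (∀ z ∈ U, HasDerivAt g (P z * g z) z) →
      ∃ a : ℂ, ∀ z ∈ U, g z = a * wr v z := by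
    intro g hg
    have hd : ∀ z ∈ U, HasDerivAt (fun z => g z / wr v z) 0 z := by
      intro z hz
      convert! (hg z hz).div (h.hasDerivAt_wr hU hz) (hW z hz) using 1
      rw [eq_comm, div_eq_zero_iff]; left; ring
    obtain ⟨a, ha⟩ := hU.exists_is_const_of_deriv_eq_zero hUc
      (fun z hz => (hd z hz).differentiableAt.differentiableWithinAt) (fun z hz => (hd z hz).deriv)
    exact ⟨a, fun z hz => by rw [← ha z hz, div_mul_cancel₀ _ (hW z hz)]⟩
  obtain ⟨a, ha⟩ := hquot fun z hz => hy.hasDerivAt_wronskian hU (h 1) hz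
  obtain ⟨b, hb⟩ := hquot fun z hz => (h 0).hasDerivAt_wronskian hU hy hz
  refine ⟨a, b, fun z hz => mul_left_cancel₀ (hW z hz) ?_⟩
  have h1 := ha z hz
  have h2 := hb z hz
  unfold wr at *
  linear_combination v z 0 * h1 + v z 1 * h2

/-- Two pairs of solutions with nonvanishing Wronskians differ by an invertible matrix. -/
lemma SolvesV.exists_GL {P Q : ℂ → ℂ} {U : Set ℂ} (hU : IsOpen U) (hUc : IsPreconnected U)
    (hne : U.Nonempty) {v u : ℂ → Fin 2 → ℂ} (h : SolvesV P Q U v) (hW : ∀ z ∈ U, wr v z ≠ 0)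
    (hu : SolvesV P Q U u) (hWu : ∀ z ∈ U, wr u z ≠ 0) :
    ∃ M : GL (Fin 2) ℂ, ∀ z ∈ U, u z = M • v z := by
  obtain ⟨a, b, h0⟩ := h.exists_linComb hU hUc hW (hu 0)
  obtain ⟨c, d, h1⟩ := h.exists_linComb hU hUc hW (hu 1)
  obtain ⟨z, hz⟩ := hne
  have hdet : a * d - b * c ≠ 0 := by
    intro hdet
    apply hWu z hz
    have e0 := ((h 0).1.differentiableAt (hU.mem_nhds hz)).hasDerivAt
    have e1 := ((h 1).1.differentiableAt (hU.mem_nhds hz)).hasDerivAt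
    have d0 : deriv (fun z => u z 0) z = a * deriv (fun z => v z 0) z +
        b * deriv (fun z => v z 1) z := by
      have e : (fun z => u z 0) =ᶠ[𝓝 z] fun z => a * v z 0 + b * v z 1 := by
        filter_upwards [hU.mem_nhds hz] with z hz using h0 z hz
      rw [e.deriv_eq]
      exact ((e0.const_mul a).add (e1.const_mul b)).deriv
    have d1 : deriv (fun z => u z 1) z = c * deriv (fun z => v z 0) z +
        d * deriv (fun z => v z 1) z := by
      have e : (fun z => u z 1) =ᶠ[𝓝 z] fun z => c * v z 0 + d * v z 1 := by
        filter_upwards [hU.mem_nhds hz] with z hz using h1 z hz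
      rw [e.deriv_eq]
      exact ((e0.const_mul c).add (e1.const_mul d)).deriv
    have h0' := h0 z hz
    have h1' := h1 z hz
    unfold wr
    rw [d0, d1, h0', h1']
    linear_combination (deriv (fun z => v z 0) z * v z 1 - v z 0 * deriv (fun z => v z 1) z) * hdet
  refine ⟨mkGL a b c d hdet, fun z hz => ?_⟩
  ext i
  fin_cases i
  · simpa using h0 z hz
  · simpa using h1 z hz

/-- An equation with coefficients analytic in a disc has in this disc a solution with prescribed
initial values at the centre. -/
lemma exists_solves_ball {P Q : ℂ → ℂ} {z₀ : ℂ} {r : ℝ} (hr : 0 < r)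
    (hP : DifferentiableOn ℂ P (Metric.ball z₀ r)) (hQ : DifferentiableOn ℂ Q (Metric.ball z₀ r))
    (h₀ h₁ : ℂ) : ∃ y, Solves P Q (Metric.ball z₀ r) y ∧ y z₀ = h₀ ∧ deriv y z₀ = h₁ := by
  have maps : Set.MapsTo (fun ζ : ℂ => z₀ + ζ) (Metric.ball 0 r) (Metric.ball z₀ r) := by
    intro ζ hζ; simpa [Metric.mem_ball, dist_eq_norm] using hζ
  have hP' : DifferentiableOn ℂ (fun ζ => -P (z₀ + ζ)) (Metric.ball 0 r) :=
    (hP.comp (by fun_prop) maps).neg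
  have hQ' : DifferentiableOn ℂ (fun ζ => ζ * Q (z₀ + ζ)) (Metric.ball 0 r) :=
    differentiableOn_id.mul (hQ.comp (by fun_prop) maps)
  obtain ⟨h, hd, e0, e1, hode⟩ := exists_analytic_solution (c := 0) hr hP' hQ'
    (Or.inr ⟨rfl, by simp⟩) h₀ h₁
  -- the equation was multiplied by `ζ`; divide, and recover the centre by the identity theorem
  have hode' : ∀ ζ ∈ Metric.ball (0 : ℂ) r,
      deriv (deriv h) ζ - P (z₀ + ζ) * deriv h ζ + Q (z₀ + ζ) * h ζ = 0 := by
    have o := Metric.isOpen_ball (x := (0 : ℂ)) (ε := r)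
    have hdd := hd.deriv o
    have hddd := hdd.deriv o
    have han : AnalyticOnNhd ℂ (fun ζ => deriv (deriv h) ζ - P (z₀ + ζ) * deriv h ζ +
        Q (z₀ + ζ) * h ζ) (Metric.ball 0 r) := by
      refine DifferentiableOn.analyticOnNhd ?_ o
      exact (hddd.sub ((hP.comp (by fun_prop) maps).mul hdd)).add
        ((hQ.comp (by fun_prop) maps).mul hd)
    intro ζ hζ
    refine han.eqOn_zero_of_preconnected_of_frequently_eq_zero (convex_ball _ _).isPreconnected
      (Metric.mem_ball_self hr) ?_ hζ
    apply Eventually.frequently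
    filter_upwards [self_mem_nhdsWithin, nhdsWithin_le_nhds (Metric.ball_mem_nhds (0 : ℂ) hr)]
      with ζ hne hζ
    have := hode ζ hζ
    have hne' : ζ ≠ 0 := hne
    refine mul_left_cancel₀ hne' ?_
    push_cast at this
    linear_combination this
  have maps' : Set.MapsTo (fun z : ℂ => z - z₀) (Metric.ball z₀ r) (Metric.ball 0 r) := by
    intro z hz; simpa [Metric.mem_ball, dist_eq_norm] using hz
  have dd : deriv (fun z => h (z - z₀)) = fun z => deriv h (z - z₀) := by
    ext z; exact deriv_comp_sub_const (f := h) _ _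
  refine ⟨fun z => h (z - z₀), ⟨hd.comp (by fun_prop) maps', fun z hz => ?_⟩, by simp [e0], ?_⟩
  · have := hode' (z - z₀) (maps' hz)
    rw [add_sub_cancel] at this
    rw [dd, deriv_comp_sub_const (f := deriv h)]
    exact this
  · rw [dd]; simp [e1 rfl]

/-- An equation with coefficients analytic in a disc has a fundamental pair of solutions there. -/
lemma exists_solvesV_ball {P Q : ℂ → ℂ} {z₀ : ℂ} {r : ℝ} (hr : 0 < r)
    (hP : DifferentiableOn ℂ P (Metric.ball z₀ r)) (hQ : DifferentiableOn ℂ Q (Metric.ball z₀ r)) :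
    ∃ v, SolvesV P Q (Metric.ball z₀ r) v ∧ ∀ z ∈ Metric.ball z₀ r, wr v z ≠ 0 := by
  obtain ⟨y₀, h0, a0, b0⟩ := exists_solves_ball hr hP hQ 0 1
  obtain ⟨y₁, h1, a1, b1⟩ := exists_solves_ball hr hP hQ 1 0
  have hv : SolvesV P Q (Metric.ball z₀ r) fun z => ![y₀ z, y₁ z] :=
    Fin.forall_fin_two.2 ⟨h0, h1⟩
  refine ⟨_, hv, fun z hz hw => ?_⟩
  have := eq_zero_of_deriv_eq_mul Metric.isOpen_ball (convex_ball _ _).isPreconnected hP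
    (fun z hz => hv.hasDerivAt_wr Metric.isOpen_ball hz) hz hw z₀ (Metric.mem_ball_self hr)
  simp [wr, a0, a1, b0, b1] at this

/-! ### Local form of the solutions at a regular singular point -/

/-- The intersection of the disc of radius `r` about `0` with the upper half-plane. -/
def halfDisc (r : ℝ) : Set ℂ := {z | z ∈ Metric.ball (0 : ℂ) r ∧ 0 < z.im}

lemma isOpen_halfDisc (r : ℝ) : IsOpen (halfDisc r) :=
  Metric.isOpen_ball.inter (isOpen_lt continuous_const Complex.continuous_im)

lemma convex_halfDisc (r : ℝ) : Convex ℝ (halfDisc r) :=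
  (convex_ball _ _).inter (convex_halfSpace_im_gt 0)

lemma halfDisc_nonempty {r : ℝ} (hr : 0 < r) : (halfDisc r).Nonempty := by
  refine ⟨Complex.I * (r / 2 : ℝ), ?_, ?_⟩
  · rw [mem_ball_zero_iff, norm_mul, Complex.norm_I, one_mul, Complex.norm_real,
      Real.norm_of_nonneg (by linarith)]
    linarith
  · simp; linarith

lemma halfDisc_mono {r r' : ℝ} (h : r ≤ r') : halfDisc r ⊆ halfDisc r' :=
  fun _ hz => ⟨Metric.ball_subset_ball h hz.1, hz.2⟩

lemma mem_slitPlane_of_im_pos {z : ℂ} (hz : 0 < z.im) : z ∈ Complex.slitPlane :=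
  Or.inr hz.ne'

lemma ne_zero_of_im_pos {z : ℂ} (hz : 0 < z.im) : z ≠ 0 := by
  rintro rfl; simp at hz

lemma sub_mul_dslope (f : ℂ → ℂ) (z : ℂ) : z * dslope f 0 z = f z - f 0 := by
  have := sub_smul_dslope f 0 z
  simpa using this

lemma hasDerivAt_cpow_const_of_im_pos {z : ℂ} (hz : 0 < z.im) (ρ : ℂ) :
    HasDerivAt (fun z : ℂ => z ^ ρ) (ρ / z * z ^ ρ) z := by
  have h := (hasDerivAt_id z).cpow_const (c := ρ) (mem_slitPlane_of_im_pos hz)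
  have h0 := ne_zero_of_im_pos hz
  convert! h using 1
  rw [id, Complex.cpow_sub _ _ h0, Complex.cpow_one]
  ring

/-- The Frobenius solution that belongs to an exponent `ρ`, such that the other exponent is
`ρ - κ` with `κ ≥ 0`. -/
lemma exists_frobenius {p q : ℂ → ℂ} {R κ : ℝ} (hR : 0 < R) (hκ : 0 ≤ κ)
    (hp : DifferentiableOn ℂ p (Metric.ball 0 R)) (hq : DifferentiableOn ℂ q (Metric.ball 0 R))
    {ρ : ℂ} (hρ : ρ * (ρ - 1) - p 0 * ρ + q 0 = 0) (hρκ : 2 * ρ - p 0 = 1 + κ) :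
    ∃ h : ℂ → ℂ, DifferentiableOn ℂ h (Metric.ball 0 R) ∧ h 0 = 1 ∧
      Solves (fun ζ => p ζ / ζ) (fun ζ => q ζ / ζ ^ 2) (halfDisc R) fun ζ => ζ ^ ρ * h ζ := by
  have hnhds : Metric.ball (0 : ℂ) R ∈ 𝓝 0 := Metric.ball_mem_nhds _ hR
  have ha : DifferentiableOn ℂ (fun ζ => -dslope p 0 ζ) (Metric.ball 0 R) :=
    ((Complex.differentiableOn_dslope hnhds).2 hp).neg
  set N : ℂ → ℂ := fun ζ => ρ * (ρ - 1) - ρ * p ζ + q ζ with hN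
  have hNd : DifferentiableOn ℂ N (Metric.ball 0 R) :=
    ((differentiableOn_const _).sub (hp.const_mul ρ)).add hq
  have hN0 : N 0 = 0 := by simp only [hN]; linear_combination hρ
  have hb : DifferentiableOn ℂ (dslope N 0) (Metric.ball 0 R) :=
    (Complex.differentiableOn_dslope hnhds).2 hNd
  obtain ⟨h, hd, h0, -, hode⟩ := exists_analytic_solution (c := 1 + κ) hR ha hb
    (Or.inl (by linarith)) 1 0
  have o := Metric.isOpen_ball (x := (0 : ℂ)) (ε := R)
  have hdd := hd.deriv o
  refine ⟨h, hd, h0, fun ζ hζ => ?_, fun ζ hζ => ?_⟩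
  · exact ((hasDerivAt_cpow_const_of_im_pos hζ.2 ρ).differentiableAt.mul
      (hd.differentiableAt (o.mem_nhds hζ.1))).differentiableWithinAt
  have d1 : ∀ ζ ∈ halfDisc R, HasDerivAt (fun ζ => ζ ^ ρ * h ζ)
      (ζ ^ ρ * (ρ / ζ * h ζ + deriv h ζ)) ζ := by
    intro ζ hζ
    convert! (hasDerivAt_cpow_const_of_im_pos hζ.2 ρ).mul
      (hd.differentiableAt (o.mem_nhds hζ.1)).hasDerivAt using 1
    ring
  have hζ0 := ne_zero_of_im_pos hζ.2
  have d2 : deriv (deriv fun ζ => ζ ^ ρ * h ζ) ζ = ζ ^ ρ * (ρ / ζ * (ρ / ζ * h ζ + deriv h ζ) +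
      (-ρ / ζ ^ 2 * h ζ + ρ / ζ * deriv h ζ + deriv (deriv h) ζ)) := by
    have e : deriv (fun ζ => ζ ^ ρ * h ζ) =ᶠ[𝓝 ζ]
        fun ζ => ζ ^ ρ * (ρ / ζ * h ζ + deriv h ζ) := by
      filter_upwards [(isOpen_halfDisc R).mem_nhds hζ] with ζ hζ using (d1 ζ hζ).deriv
    rw [e.deriv_eq]
    have i1 : HasDerivAt (fun ζ : ℂ => ρ / ζ) (-ρ / ζ ^ 2) ζ := by
      convert! (hasDerivAt_inv hζ0).const_mul ρ using 1
      field_simp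
    have i2 := (i1.mul (hd.differentiableAt (o.mem_nhds hζ.1)).hasDerivAt).add
      (hdd.differentiableAt (o.mem_nhds hζ.1)).hasDerivAt
    have i3 := (hasDerivAt_cpow_const_of_im_pos hζ.2 ρ).mul i2
    have i4 := i3.deriv
    refine (Eq.trans ?_ i4).trans ?_
    · rfl
    · simp only [Pi.add_apply, Pi.mul_apply]; ring
  rw [(d1 ζ hζ).deriv, d2]
  have e1 := sub_mul_dslope p ζ
  have e2 := sub_mul_dslope N ζ
  rw [hN0, sub_zero] at e2
  have e3 := hode ζ hζ.1
  have e4 : N ζ = ρ * (ρ - 1) - ρ * p ζ + q ζ := rfl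
  push_cast at e3
  have e5 : ζ * (ζ * deriv (deriv h) ζ + (2 * ρ - p ζ) * deriv h ζ) +
      (ρ * (ρ - 1) - ρ * p ζ + q ζ) * h ζ = 0 := by
    rw [← e4, ← e2]
    linear_combination ζ * e3 + ζ * deriv h ζ * e1 + ζ * deriv h ζ * hρκ
  have e6 : ζ ^ ρ * (ρ / ζ * (ρ / ζ * h ζ + deriv h ζ) +
      (-ρ / ζ ^ 2 * h ζ + ρ / ζ * deriv h ζ + deriv (deriv h) ζ)) -
      p ζ / ζ * (ζ ^ ρ * (ρ / ζ * h ζ + deriv h ζ)) + q ζ / ζ ^ 2 * (ζ ^ ρ * h ζ) =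
      ζ ^ ρ / ζ ^ 2 * (ζ * (ζ * deriv (deriv h) ζ + (2 * ρ - p ζ) * deriv h ζ) +
      (ρ * (ρ - 1) - ρ * p ζ + q ζ) * h ζ) := by
    field_simp
    ring
  rw [e6, e5, mul_zero]

/-- The local form of a fundamental pair at a regular singular point. The Wronskian is explicit, so
the second solution is the Frobenius solution times a primitive of `ζ ^ (-κ - 1) u(ζ)`. -/
lemma exists_cornerForm {p q : ℂ → ℂ} {R κ : ℝ} (hR : 0 < R) (hκ : 0 ≤ κ)
    (hp : DifferentiableOn ℂ p (Metric.ball 0 R)) (hq : DifferentiableOn ℂ q (Metric.ball 0 R))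
    {ρ : ℂ} (hρ : ρ * (ρ - 1) - p 0 * ρ + q 0 = 0) (hρκ : 2 * ρ - p 0 = 1 + κ)
    {v : ℂ → Fin 2 → ℂ} (hv : SolvesV (fun ζ => p ζ / ζ) (fun ζ => q ζ / ζ ^ 2) (halfDisc R) v)
    (hW : ∀ ζ ∈ halfDisc R, wr v ζ ≠ 0) :
    ∃ r > 0, ∃ (g : GL (Fin 2) ℂ) (F h : ℂ → ℂ) (e : ℂ), r ≤ R ∧
    DifferentiableOn ℂ F (Metric.ball 0 r) ∧ DifferentiableOn ℂ h (Metric.ball 0 r) ∧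
    (∀ ζ ∈ Metric.ball (0 : ℂ) r, h ζ ≠ 0) ∧ (0 < κ → F 0 ≠ 0) ∧ (κ = 0 → e ≠ 0) ∧
    ∀ ζ ∈ halfDisc r, g • v ζ =
      (ζ ^ ρ * h ζ) • ![ζ ^ (-κ : ℂ) * F ζ + e * Complex.log ζ, 1] := by
  obtain ⟨h, hd, h0, hy⟩ := exists_frobenius hR hκ hp hq hρ hρκ
  have hUo := isOpen_halfDisc R
  have hUc := (convex_halfDisc R).isPreconnected
  obtain ⟨α, β, hαβ⟩ := hv.exists_linComb hUo hUc hW hy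
  have hnhds : Metric.ball (0 : ℂ) R ∈ 𝓝 0 := Metric.ball_mem_nhds _ hR
  -- the disc in which `h` has no zeros
  obtain ⟨r, hr, hrb⟩ := Metric.eventually_nhds_iff_ball.1
    (((hd.differentiableAt hnhds).continuousAt.eventually_ne (by rw [h0]; exact one_ne_zero)).and
      hnhds)
  have hrR : r ≤ R := by
    by_contra hlt
    push Not at hlt
    have : ((R : ℂ)) ∈ Metric.ball (0 : ℂ) R := (hrb R (by simpa [abs_of_pos hR] using hlt)).2
    simp [abs_of_pos hR] at this
  have hsub : Metric.ball (0 : ℂ) r ⊆ Metric.ball 0 R := Metric.ball_subset_ball hrR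
  have hy0 : ∀ ζ ∈ halfDisc r, ζ ^ ρ * h ζ ≠ 0 := fun ζ hζ =>
    mul_ne_zero (by rw [Ne, Complex.cpow_eq_zero_iff]; exact fun h =>
      ne_zero_of_im_pos hζ.2 h.1) (hrb ζ hζ.1).1
  -- a matrix that puts the Frobenius solution into the second component
  obtain ⟨g₀, hg₀⟩ : ∃ g₀ : GL (Fin 2) ℂ, ∀ ζ ∈ halfDisc r, (g₀ • v ζ) 1 = ζ ^ ρ * h ζ := by
    by_cases hα : α = 0
    · have hβ : β ≠ 0 := by
        rintro rfl
        obtain ⟨ζ, hζ⟩ := halfDisc_nonempty hr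
        apply hy0 ζ hζ
        rw [hαβ ζ (halfDisc_mono hrR hζ), hα]; ring
      refine ⟨mkGL 1 0 α β (by simpa using hβ), fun ζ hζ => ?_⟩
      rw [GL_smul_one_apply, hαβ ζ (halfDisc_mono hrR hζ)]; simp
    · refine ⟨mkGL 0 1 α β (by simpa using hα), fun ζ hζ => ?_⟩
      rw [GL_smul_one_apply, hαβ ζ (halfDisc_mono hrR hζ)]; simp
  set u : ℂ → Fin 2 → ℂ := fun ζ => g₀ • v ζ with hu
  have hu1 : ∀ ζ ∈ halfDisc r, u ζ 1 = ζ ^ ρ * h ζ := hg₀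
  have huS : SolvesV (fun ζ => p ζ / ζ) (fun ζ => q ζ / ζ ^ 2) (halfDisc R) u := hv.GL_smul hUo g₀
  have huW : ∀ ζ ∈ halfDisc R, wr u ζ ≠ 0 := fun ζ hζ => by
    rw [hu, wr_GL_smul (hv.analyticAt hUo hζ)]
    exact mul_ne_zero (GL_det_ne_zero g₀) (hW ζ hζ)
  -- Since the Wronskian satisfies `W' = (p / ζ) W`, it is a multiple of `ζ ^ p(0) * exp G`, where
  -- `G' = (p - p(0)) / ζ`.
  obtain ⟨G, hG⟩ := ((Complex.differentiableOn_dslope hnhds).2 hp).isExactOn_ball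
  have hGd : DifferentiableOn ℂ G (Metric.ball 0 R) := fun ζ hζ =>
    (hG ζ hζ).differentiableAt.differentiableWithinAt
  have hK : ∀ ζ ∈ halfDisc R,
      HasDerivAt (fun ζ => wr u ζ * (ζ ^ (-p 0) * Complex.exp (-G ζ))) 0 ζ := by
    intro ζ hζ
    have hζ0 := ne_zero_of_im_pos hζ.2
    have e1 := sub_mul_dslope p ζ
    convert! (huS.hasDerivAt_wr hUo hζ).mul ((hasDerivAt_cpow_const_of_im_pos hζ.2 (-p 0)).mul
      (hG ζ hζ.1).neg.cexp) using 1
    have e2 : p ζ = p 0 + ζ * dslope p 0 ζ := by rw [e1]; ring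
    rw [e2]
    simp only [Pi.mul_apply]
    field_simp
    ring
  obtain ⟨ζ₀, hζ₀⟩ := halfDisc_nonempty hR
  set C := wr u ζ₀ * (ζ₀ ^ (-p 0) * Complex.exp (-G ζ₀)) with hC
  have hC0 : C ≠ 0 := by
    refine mul_ne_zero (huW ζ₀ hζ₀) (mul_ne_zero ?_ (Complex.exp_ne_zero _))
    rw [Ne, Complex.cpow_eq_zero_iff]; exact fun h => ne_zero_of_im_pos hζ₀.2 h.1
  have hWr : ∀ ζ ∈ halfDisc R, wr u ζ = C * (ζ ^ (p 0) * Complex.exp (G ζ)) := by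
    intro ζ hζ
    have e := eq_of_hasDerivAt_zero hUo hUc hK hζ hζ₀
    rw [hC, ← e, Complex.cpow_neg, Complex.exp_neg]
    have : ζ ^ p 0 ≠ 0 := by
      rw [Ne, Complex.cpow_eq_zero_iff]; exact fun h => ne_zero_of_im_pos hζ.2 h.1
    have := Complex.exp_ne_zero (G ζ)
    field_simp
  -- the ratio
  set U : ℂ → ℂ := fun ζ => C * Complex.exp (G ζ) / h ζ ^ 2 with hU
  have hUd : DifferentiableOn ℂ U (Metric.ball 0 r) :=
    (((hGd.mono hsub).cexp).const_mul C).div ((hd.mono hsub).pow 2)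
      fun ζ hζ => pow_ne_zero 2 (hrb ζ hζ).1
  have hU0 : U 0 ≠ 0 := by
    simp only [hU, h0]
    simp [hC0, Complex.exp_ne_zero]
  obtain ⟨F, e, m, hF, hem, hFκ, heκ, hFe⟩ := exists_primitive_series (κ := κ) hr hUd
  have oR := Metric.isOpen_ball (x := (0 : ℂ)) (ε := r)
  have hψ : ∀ ζ ∈ halfDisc r, HasDerivAt
      (fun ζ => u ζ 0 / u ζ 1 - (ζ ^ (-κ : ℂ) * F ζ + e * Complex.log ζ)) 0 ζ := by
    intro ζ hζ
    have hζR := halfDisc_mono hrR hζ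
    have hζ0 := ne_zero_of_im_pos hζ.2
    have u0 := ((huS 0).1.differentiableAt (hUo.mem_nhds hζR)).hasDerivAt
    have u1 := ((huS 1).1.differentiableAt (hUo.mem_nhds hζR)).hasDerivAt
    have hne : u ζ 1 ≠ 0 := by rw [hu1 ζ hζ]; exact hy0 ζ hζ
    have hFd := (hF.differentiableAt (oR.mem_nhds hζ.1)).hasDerivAt
    have hlog := (Complex.hasDerivAt_log (mem_slitPlane_of_im_pos hζ.2)).const_mul e
    convert! (u0.div u1 hne).sub (((hasDerivAt_cpow_const_of_im_pos hζ.2 (-κ : ℂ)).mul hFd).add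
      hlog) using 1
    have hnum : deriv (fun ζ => u ζ 0) ζ * u ζ 1 - u ζ 0 * deriv (fun ζ => u ζ 1) ζ =
      C * (ζ ^ (p 0) * Complex.exp (G ζ)) := hWr ζ hζR
    rw [hnum, hu1 ζ hζ]
    have c1 : ζ ^ (p 0) / (ζ ^ ρ) ^ 2 = ζ ^ (-κ : ℂ) * ζ⁻¹ := by
      have : p 0 = (-κ : ℂ) + (-1) + (ρ + ρ) := by linear_combination -hρκ
      have hρ0 : ζ ^ ρ ≠ 0 := by
        rw [Ne, Complex.cpow_eq_zero_iff]; exact fun h => hζ0 h.1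
      rw [this, Complex.cpow_add _ _ hζ0, Complex.cpow_add _ _ hζ0, Complex.cpow_add _ _ hζ0,
        Complex.cpow_neg_one]
      field_simp
    have c2 : C * (ζ ^ (p 0) * Complex.exp (G ζ)) / (ζ ^ ρ * h ζ) ^ 2 =
        ζ ^ (-κ : ℂ) * ζ⁻¹ * U ζ := by
      rw [← c1]
      simp only [hU]
      rw [mul_pow, div_mul_div_comm]
      ring
    rw [c2]
    have c3 := hFe ζ hζ.1
    have c4 : e * (ζ ^ (-κ : ℂ) * ζ ^ m) = e := by
      by_cases he : e = 0
      · simp [he]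
      · rw [hem he, ← Complex.cpow_natCast, ← Complex.cpow_add _ _ hζ0]
        simp
    have c5 : U ζ = ζ * deriv F ζ - κ * F ζ + e * ζ ^ m := by linear_combination -c3
    rw [c5]
    have c6 : ζ ^ (-κ : ℂ) * ζ⁻¹ * (ζ * deriv F ζ - κ * F ζ + e * ζ ^ m) =
        ζ ^ (-κ : ℂ) * deriv F ζ - κ * ζ⁻¹ * ζ ^ (-κ : ℂ) * F ζ +
        e * (ζ ^ (-κ : ℂ) * ζ ^ m) * ζ⁻¹ := by
      field_simp
    rw [c6, c4]
    ring
  obtain ⟨ζ₁, hζ₁⟩ := halfDisc_nonempty hr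
  set k := u ζ₁ 0 / u ζ₁ 1 - (ζ₁ ^ (-κ : ℂ) * F ζ₁ + e * Complex.log ζ₁) with hk
  refine ⟨r, hr, mkGL 1 (-k) 0 1 (by simp) * g₀, F, h, e, hrR, hF, hd.mono hsub,
    fun ζ hζ => (hrb ζ hζ).1, fun h1 => ?_, fun h1 => by rw [heκ h1]; exact hU0, fun ζ hζ => ?_⟩
  · rw [hFκ h1]
    exact div_ne_zero (neg_ne_zero.2 hU0) (by exact_mod_cast h1.ne')
  · have e1 := eq_of_hasDerivAt_zero (isOpen_halfDisc r) (convex_halfDisc r).isPreconnected hψ hζ hζ₁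
    rw [← hk] at e1
    have hne : u ζ 1 ≠ 0 := by rw [hu1 ζ hζ]; exact hy0 ζ hζ
    have e2 : u ζ 0 = (ζ ^ (-κ : ℂ) * F ζ + e * Complex.log ζ + k) * u ζ 1 := by
      rw [← div_eq_iff hne]; linear_combination e1
    have e3 : (mkGL 1 (-k) 0 1 (by simp) * g₀) • v ζ = mkGL 1 (-k) 0 1 (by simp) • u ζ :=
      mul_smul _ _ _
    rw [e3]
    ext i
    fin_cases i
    · simp only [Fin.zero_eta, Fin.isValue]
      rw [GL_smul_zero_apply, e2, hu1 ζ hζ]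
      simp
      ring
    · simp only [Fin.mk_one, Fin.isValue]
      rw [GL_smul_one_apply, hu1 ζ hζ]
      simp

/-- The pair `w` has at the boundary point `c`, up to a constant matrix, the form
`ζ ^ ρ h (ζ ^ (-κ) F + e log ζ, 1)` in the local coordinate `ζ`, with analytic `F` and `h`. -/
def HasCornerForm (w : ℂ → Fin 2 → ℂ) (c : OnePoint ℝ) (κ : ℝ) (ρ : ℂ) : Prop :=
  ∃ r > 0, ∃ (g : GL (Fin 2) ℂ) (F h : ℂ → ℂ) (e : ℂ),
    DifferentiableOn ℂ F (Metric.ball 0 r) ∧ DifferentiableOn ℂ h (Metric.ball 0 r) ∧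
    (∀ ζ ∈ Metric.ball (0 : ℂ) r, h ζ ≠ 0) ∧ (0 < κ → F 0 ≠ 0) ∧ (κ = 0 → e ≠ 0) ∧
    ∀ ζ ∈ halfDisc r, g • w (localParam c ζ) =
      (ζ ^ ρ * h ζ) • ![ζ ^ (-κ : ℂ) * F ζ + e * Complex.log ζ, 1]

/-! ### Real rational functions with simple poles -/

/-- The rational function with residues `c i` at the simple poles `τ i`, which vanishes at `∞`. -/
noncomputable def pf (c τ : Fin 4 → ℝ) (z : ℂ) : ℂ := ∑ i, (c i : ℂ) / (z - τ i)

section PartialFractions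
variable {c τ : Fin 4 → ℝ}

lemma pf_conj (z : ℂ) : pf c τ (conj z) = conj (pf c τ z) := by
  simp [pf, map_sum]

lemma differentiableAt_pf {z : ℂ} (hz : ∀ i, z ≠ τ i) : DifferentiableAt ℂ (pf c τ) z := by
  unfold pf
  have h : ∀ i, z - (τ i : ℂ) ≠ 0 := fun i => sub_ne_zero.2 (hz i)
  simp only [Fin.sum_univ_four]
  exact DifferentiableAt.add (DifferentiableAt.add (DifferentiableAt.add
    ((differentiableAt_const _).div (by fun_prop) (h 0))
    ((differentiableAt_const _).div (by fun_prop) (h 1)))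
    ((differentiableAt_const _).div (by fun_prop) (h 2)))
    ((differentiableAt_const _).div (by fun_prop) (h 3))

lemma ne_ofReal_of_im_pos {z : ℂ} (hz : 0 < z.im) (y : ℝ) : z ≠ y := by
  rintro rfl; simp at hz

lemma differentiableOn_pf : DifferentiableOn ℂ (pf c τ) {z | 0 < z.im} := fun _ hz =>
  (differentiableAt_pf fun _ => ne_ofReal_of_im_pos hz _).differentiableWithinAt

/-- `z (pf z)` near the pole `τ i`. -/
lemma exists_pf_residue (c : Fin 4 → ℝ) (hτ : Function.Injective τ) (i : Fin 4) :
    ∃ R > 0, ∃ p : ℂ → ℂ, DifferentiableOn ℂ p (Metric.ball 0 R) ∧ p 0 = c i ∧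
      ∀ ζ ∈ Metric.ball (0 : ℂ) R, ζ ≠ 0 → pf c τ (τ i + ζ) = p ζ / ζ := by
  have hev : ∀ᶠ ζ : ℂ in 𝓝 0, ∀ j, j ≠ i → (τ i : ℂ) + ζ - τ j ≠ 0 := by
    refine eventually_all.2 fun j => ?_
    by_cases hj : j = i
    · simp [hj]
    · have : ContinuousAt (fun ζ : ℂ => (τ i : ℂ) + ζ - τ j) 0 := by fun_prop
      have h0 : (τ i : ℂ) + 0 - τ j ≠ 0 := by
        rw [add_zero, sub_ne_zero]
        exact_mod_cast fun h => hj (hτ h).symm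
      filter_upwards [this.eventually_ne h0] with ζ hζ _ using hζ
  obtain ⟨R, hR, hb⟩ := Metric.eventually_nhds_iff_ball.1 hev
  refine ⟨R, hR, fun ζ => c i + ζ * ∑ j ∈ Finset.univ.erase i, (c j : ℂ) / (τ i + ζ - τ j),
    ?_, by simp, fun ζ hζ h0 => ?_⟩
  · refine DifferentiableOn.add (by fun_prop) (DifferentiableOn.mul (by fun_prop) ?_)
    refine DifferentiableOn.fun_sum fun j hj => ?_
    exact (differentiableOn_const _).div (by fun_prop) fun ζ hζ =>
      hb ζ hζ j (Finset.ne_of_mem_erase hj)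
  · rw [pf, ← Finset.add_sum_erase _ _ (Finset.mem_univ i), add_div, mul_div_cancel_left₀ _ h0]
    congr 2
    ring

/-- The partial fractions, written in the coordinate `-1/z`, are analytic near `∞`. -/
lemma exists_one_add_mul_ne_zero (τ : Fin 4 → ℝ) :
    ∃ R > 0, ∀ ζ ∈ Metric.ball (0 : ℂ) R, ∀ i, 1 + τ i * ζ ≠ 0 := by
  have hev : ∀ᶠ ζ : ℂ in 𝓝 0, ∀ i, 1 + (τ i : ℂ) * ζ ≠ 0 := by
    refine eventually_all.2 fun i => ?_
    have : ContinuousAt (fun ζ : ℂ => 1 + (τ i : ℂ) * ζ) 0 := by fun_prop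
    exact this.eventually_ne (by simp)
  exact Metric.eventually_nhds_iff_ball.1 hev

lemma pf_at_infinity {ζ : ℂ} (h0 : ζ ≠ 0) (h : ∀ i, 1 + (τ i : ℂ) * ζ ≠ 0) :
    pf c τ (-ζ⁻¹) = -ζ * ∑ i, (c i : ℂ) / (1 + τ i * ζ) := by
  rw [pf, Finset.mul_sum]
  refine Finset.sum_congr rfl fun i _ => ?_
  have h1 : -ζ⁻¹ - (τ i : ℂ) = -((1 + τ i * ζ) / ζ) := by field_simp; ring
  rw [h1]
  have := h i
  field_simp

lemma pf_at_infinity_of_sum_eq_zero (hc : ∑ i, c i = 0) {ζ : ℂ} (h0 : ζ ≠ 0)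
    (h : ∀ i, 1 + (τ i : ℂ) * ζ ≠ 0) :
    pf c τ (-ζ⁻¹) = ζ ^ 2 * ∑ i, (c i * τ i : ℂ) / (1 + τ i * ζ) := by
  have hc' : ∑ i, (c i : ℂ) = 0 := by exact_mod_cast congrArg ((↑) : ℝ → ℂ) hc
  have : ∑ i, (c i : ℂ) / (1 + τ i * ζ) =
      ∑ i, (c i : ℂ) - ζ * ∑ i, (c i * τ i : ℂ) / (1 + τ i * ζ) := by
    rw [Finset.mul_sum, ← Finset.sum_sub_distrib]
    refine Finset.sum_congr rfl fun i _ => ?_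
    have := h i
    field_simp
    ring
  rw [pf_at_infinity h0 h, this, hc']
  ring

lemma differentiableOn_sum_div (a : Fin 4 → ℂ) {R : ℝ}
    (h : ∀ ζ ∈ Metric.ball (0 : ℂ) R, ∀ i, 1 + (τ i : ℂ) * ζ ≠ 0) :
    DifferentiableOn ℂ (fun ζ => ∑ i, a i / (1 + τ i * ζ)) (Metric.ball 0 R) :=
  DifferentiableOn.fun_sum fun i _ =>
    (differentiableOn_const _).div (by fun_prop) fun ζ hζ => h ζ hζ i

lemma tendsto_neg_inv_cobounded :
    Tendsto (fun ζ : ℂ => -ζ⁻¹) (𝓝[≠] 0) (Bornology.cobounded ℂ) := by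
  have := (tendsto_neg_cobounded (E := ℂ)).comp (tendsto_inv₀_nhdsNE_zero (α := ℂ))
  exact this

lemma tendsto_neg_inv_nhdsNE :
    Tendsto (fun z : ℂ => -z⁻¹) (Bornology.cobounded ℂ) (𝓝[≠] 0) := by
  have h := tendsto_inv₀_cobounded' (α := ℂ)
  have h2 : Tendsto (fun z : ℂ => -z) (𝓝[≠] 0) (𝓝[≠] 0) := by
    refine tendsto_nhdsWithin_iff.2 ⟨?_, ?_⟩
    · have : Tendsto (fun z : ℂ => -z) (𝓝 0) (𝓝 (-0)) := continuous_neg.tendsto 0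
      rw [neg_zero] at this
      exact this.mono_left nhdsWithin_le_nhds
    · filter_upwards [self_mem_nhdsWithin] with z hz using neg_ne_zero.2 hz
  exact h2.comp h

/-- Limits at `∞` in terms of the coordinate `ζ = -1/z`. -/
lemma tendsto_cobounded_iff {g : ℂ → ℂ} {l : Filter ℂ} :
    Tendsto g (Bornology.cobounded ℂ) l ↔ Tendsto (fun ζ => g (-ζ⁻¹)) (𝓝[≠] 0) l := by
  refine ⟨fun h => h.comp tendsto_neg_inv_cobounded, fun h => ?_⟩
  have := h.comp tendsto_neg_inv_nhdsNE
  refine this.congr fun z => ?_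
  simp

lemma tendsto_mul_pf (c τ : Fin 4 → ℝ) :
    Tendsto (fun z => z * pf c τ z) (Bornology.cobounded ℂ) (𝓝 (∑ i, c i : ℝ)) := by
  rw [tendsto_cobounded_iff]
  obtain ⟨R, hR, h⟩ := exists_one_add_mul_ne_zero τ
  have hd := ((differentiableOn_sum_div (fun i => (c i : ℂ)) h).differentiableAt
    (Metric.ball_mem_nhds _ hR)).continuousAt.tendsto
  simp only [mul_zero, add_zero, div_one] at hd
  push_cast
  refine (hd.mono_left nhdsWithin_le_nhds).congr' ?_
  filter_upwards [self_mem_nhdsWithin, nhdsWithin_le_nhds (Metric.ball_mem_nhds _ hR)] with ζ h0 hζ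
  rw [pf_at_infinity h0 (h ζ hζ)]
  rw [← mul_assoc, neg_mul_neg, inv_mul_cancel₀ h0, one_mul]

lemma tendsto_sq_mul_pf (hc : ∑ i, c i = 0) :
    Tendsto (fun z => z ^ 2 * pf c τ z) (Bornology.cobounded ℂ) (𝓝 (∑ i, c i * τ i : ℝ)) := by
  rw [tendsto_cobounded_iff]
  obtain ⟨R, hR, h⟩ := exists_one_add_mul_ne_zero τ
  have hd := ((differentiableOn_sum_div (fun i => (c i * τ i : ℂ)) h).differentiableAt
    (Metric.ball_mem_nhds _ hR)).continuousAt.tendsto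
  simp only [mul_zero, add_zero, div_one] at hd
  push_cast
  refine (hd.mono_left nhdsWithin_le_nhds).congr' ?_
  filter_upwards [self_mem_nhdsWithin, nhdsWithin_le_nhds (Metric.ball_mem_nhds _ hR)] with ζ h0 hζ
  rw [pf_at_infinity_of_sum_eq_zero hc h0 (h ζ hζ)]
  rw [← mul_assoc, ← mul_pow, neg_mul, inv_mul_cancel₀ h0, neg_one_sq, one_mul]

lemma sum_eq_zero_of_tendsto_sq_mul_pf {B : ℂ}
    (h : Tendsto (fun z => z ^ 2 * pf c τ z) (Bornology.cobounded ℂ) (𝓝 B)) : ∑ i, c i = 0 := by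
  have h1 := h.mul (tendsto_inv₀_cobounded (α := ℂ))
  rw [mul_zero] at h1
  have h2 : Tendsto (fun z => z * pf c τ z) (Bornology.cobounded ℂ) (𝓝 0) := by
    refine h1.congr fun z => ?_
    by_cases hz : z = 0
    · simp [hz]
    · field_simp
  have := tendsto_nhds_unique h2 (tendsto_mul_pf c τ)
  exact_mod_cast this.symm

end PartialFractions

/-! ### Changes of the independent variable -/

lemma Solves.translate {P Q : ℂ → ℂ} {U : Set ℂ} {y : ℂ → ℂ} (h : Solves P Q U y) (hU : IsOpen U)
    (a : ℂ) : Solves (fun ζ => P (a + ζ)) (fun ζ => Q (a + ζ)) ((fun ζ => a + ζ) ⁻¹' U)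
      fun ζ => y (a + ζ) := by
  refine ⟨fun ζ hζ => ?_, fun ζ hζ => ?_⟩
  · exact ((h.1.differentiableAt (hU.mem_nhds hζ)).comp ζ
      (differentiableAt_id.const_add a)).differentiableWithinAt
  · have e : deriv (fun ζ => y (a + ζ)) = fun ζ => deriv y (a + ζ) := by
      ext ζ; exact deriv_comp_const_add y a ζ
    rw [e, deriv_comp_const_add]
    exact h.2 _ hζ

/-- The equation in the coordinate `ζ = -1/z`. -/
lemma Solves.comp_neg_inv {P Q : ℂ → ℂ} {y : ℂ → ℂ} (h : Solves P Q {z | 0 < z.im} y) :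
    Solves (fun ζ => P (-ζ⁻¹) / ζ ^ 2 - 2 / ζ) (fun ζ => Q (-ζ⁻¹) / ζ ^ 4) {z | 0 < z.im}
      fun ζ => y (-ζ⁻¹) := by
  have hU : IsOpen {z : ℂ | 0 < z.im} := isOpen_lt continuous_const Complex.continuous_im
  have hmap : ∀ ζ : ℂ, 0 < ζ.im → 0 < (-ζ⁻¹).im := by
    intro ζ hζ
    rw [Complex.neg_im, Complex.inv_im]
    have := Complex.normSq_pos.2 (ne_zero_of_im_pos hζ)
    rw [neg_div, neg_neg]
    positivity
  have hm : ∀ ζ : ℂ, 0 < ζ.im → HasDerivAt (fun ζ : ℂ => -ζ⁻¹) (1 / ζ ^ 2) ζ := by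
    intro ζ hζ
    convert! (hasDerivAt_inv (ne_zero_of_im_pos hζ)).neg using 1
    ring
  have d1 : ∀ ζ : ℂ, 0 < ζ.im →
      HasDerivAt (fun ζ => y (-ζ⁻¹)) (deriv y (-ζ⁻¹) * (1 / ζ ^ 2)) ζ := fun ζ hζ =>
    (h.1.differentiableAt (hU.mem_nhds (hmap ζ hζ))).hasDerivAt.comp ζ (hm ζ hζ)
  refine ⟨fun ζ hζ => (d1 ζ hζ).differentiableAt.differentiableWithinAt, fun ζ hζ => ?_⟩
  have hζ0 := ne_zero_of_im_pos hζ
  have e : deriv (fun ζ => y (-ζ⁻¹)) =ᶠ[𝓝 ζ] fun ζ => deriv y (-ζ⁻¹) * (1 / ζ ^ 2) := by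
    filter_upwards [hU.mem_nhds hζ] with ζ hζ using (d1 ζ hζ).deriv
  have d2 : HasDerivAt (fun ζ => deriv y (-ζ⁻¹) * (1 / ζ ^ 2))
      (deriv (deriv y) (-ζ⁻¹) * (1 / ζ ^ 2) * (1 / ζ ^ 2) + deriv y (-ζ⁻¹) * (-2 / ζ ^ 3)) ζ := by
    have i1 : HasDerivAt (fun ζ : ℂ => 1 / ζ ^ 2) (-2 / ζ ^ 3) ζ := by
      have := ((hasDerivAt_pow 2 ζ).inv (pow_ne_zero 2 hζ0))
      simp only [one_div]
      convert! this using 1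
      field_simp
      ring
    exact (((h.1.deriv hU).differentiableAt (hU.mem_nhds (hmap ζ hζ))).hasDerivAt.comp ζ
      (hm ζ hζ)).mul i1
  rw [e.deriv_eq, d2.deriv, (d1 ζ hζ).deriv]
  have := h.2 (-ζ⁻¹) (hmap ζ hζ)
  linear_combination (1 / ζ ^ 4) * this

lemma wr_comp {v : ℂ → Fin 2 → ℂ} {m : ℂ → ℂ} {ζ m' : ℂ} (hv : AnalyticAt ℂ v (m ζ))
    (hm : HasDerivAt m m' ζ) : wr (fun ζ => v (m ζ)) ζ = m' * wr v (m ζ) := by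
  have e : ∀ i, deriv (fun ζ => v (m ζ) i) ζ = deriv (fun z => v z i) (m ζ) * m' := fun i =>
    ((analyticAt_pi_iff.1 hv i).differentiableAt.hasDerivAt.comp ζ hm).deriv
  simp only [wr, e]
  ring

/-! ### Local form of the solutions at the singular points -/

section Corners
variable {c d τ : Fin 4 → ℝ} {w : ℂ → Fin 2 → ℂ}

lemma isOpen_im_pos : IsOpen {z : ℂ | 0 < z.im} := isOpen_lt continuous_const Complex.continuous_im

/-- At a finite singular point the exponents are `0` and `κ`, where `κ - 1` is the residue of `P`. -/
lemma SolvesV.hasCornerForm (hw : SolvesV (pf c τ) (pf d τ) {z | 0 < z.im} w)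
    (hW : ∀ z : ℂ, 0 < z.im → wr w z ≠ 0) (hτ : Function.Injective τ) {i : Fin 4} {κ : ℝ}
    (hκ : 0 ≤ κ) (hc : c i = κ - 1) : HasCornerForm w (τ i : OnePoint ℝ) κ κ := by
  obtain ⟨R₁, hR₁, p, hp, hp0, hpf⟩ := exists_pf_residue c hτ i
  obtain ⟨R₂, hR₂, q, hq, hq0, hqf⟩ := exists_pf_residue d hτ i
  set R := min R₁ R₂
  have hR : 0 < R := lt_min hR₁ hR₂
  have hRp := hp.mono (Metric.ball_subset_ball (min_le_left R₁ R₂))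
  have hRq := hq.mono (Metric.ball_subset_ball (min_le_right R₁ R₂))
  have hv : SolvesV (fun ζ => p ζ / ζ) (fun ζ => (ζ * q ζ) / ζ ^ 2) (halfDisc R)
      fun ζ => w (τ i + ζ) := by
    intro j
    refine (((hw j).translate isOpen_im_pos (τ i)).mono ?_).congr_coeff ?_ ?_
    · intro ζ hζ
      simpa using hζ.2
    · intro ζ hζ
      exact hpf ζ (Metric.ball_subset_ball (min_le_left R₁ R₂) hζ.1) (ne_zero_of_im_pos hζ.2)
    · intro ζ hζ
      have h0 := ne_zero_of_im_pos hζ.2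
      refine (hqf ζ (Metric.ball_subset_ball (min_le_right R₁ R₂) hζ.1) h0).trans ?_
      field_simp
  obtain ⟨r, hr, g, F, h, e, -, hF, hh, hh0, hF0, he, hform⟩ := exists_cornerForm (ρ := κ) hR hκ hRp
    (q := fun ζ => ζ * q ζ) (differentiableOn_id.mul hRq)
    (by rw [hp0, hc]; push_cast; ring) (by rw [hp0, hc]; push_cast; ring) hv (fun ζ hζ => by
      have him : 0 < ((τ i : ℂ) + ζ).im := by simpa using hζ.2
      rw [wr_comp (hw.analyticAt isOpen_im_pos him) ((hasDerivAt_id ζ).const_add _), one_mul]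
      exact hW _ him)
  exact ⟨r, hr, g, F, h, e, hF, hh, hh0, hF0, he, hform⟩

/-- At `∞` the exponents are the roots of `ρ (ρ + 1) + A ρ + B`, where `A` and `B` are the limits of
`z P` and `z² Q`. The number `ρ` is the larger one, if `κ` is the difference of the exponents. -/
lemma SolvesV.hasCornerForm_infty (hw : SolvesV (pf c τ) (pf d τ) {z | 0 < z.im} w)
    (hW : ∀ z : ℂ, 0 < z.im → wr w z ≠ 0) (hd : ∑ i, d i = 0) {κ : ℝ} (hκ : 0 ≤ κ) {ρ : ℂ}
    (hρ : ρ * (ρ + 1) + (∑ i, c i : ℝ) * ρ + (∑ i, d i * τ i : ℝ) = 0)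
    (hρκ : 2 * ρ + 1 + (∑ i, c i : ℝ) = κ) : HasCornerForm w ∞ κ ρ := by
  obtain ⟨R, hR, hne⟩ := exists_one_add_mul_ne_zero τ
  have him : ∀ ζ : ℂ, 0 < ζ.im → 0 < (-ζ⁻¹).im := by
    intro ζ hζ
    rw [Complex.neg_im, Complex.inv_im]
    have := Complex.normSq_pos.2 (ne_zero_of_im_pos hζ)
    rw [neg_div, neg_neg]
    positivity
  set p : ℂ → ℂ := fun ζ => -2 - ∑ i, (c i : ℂ) / (1 + τ i * ζ)
  set q : ℂ → ℂ := fun ζ => ∑ i, (d i * τ i : ℂ) / (1 + τ i * ζ)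
  have hp0 : p 0 = -2 - (∑ i, c i : ℝ) := by simp [p]
  have hq0 : q 0 = (∑ i, d i * τ i : ℝ) := by simp [q]
  have hv : SolvesV (fun ζ => p ζ / ζ) (fun ζ => q ζ / ζ ^ 2) (halfDisc R)
      fun ζ => w (-ζ⁻¹) := by
    intro j
    refine ((hw j).comp_neg_inv.mono fun ζ hζ => hζ.2).congr_coeff ?_ ?_
    · intro ζ hζ
      have h0 := ne_zero_of_im_pos hζ.2
      simp only [pf_at_infinity h0 (hne ζ hζ.1), p]
      field_simp
      ring
    · intro ζ hζ
      have h0 := ne_zero_of_im_pos hζ.2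
      simp only [pf_at_infinity_of_sum_eq_zero hd h0 (hne ζ hζ.1), q]
      field_simp
  obtain ⟨r, hr, g, F, h, e, -, hF, hh, hh0, hF0, he, hform⟩ := exists_cornerForm (ρ := ρ) hR hκ
    (p := p) (q := q) ((differentiableOn_const _).sub (differentiableOn_sum_div _ hne))
    (differentiableOn_sum_div _ hne)
    (by rw [hp0, hq0]; linear_combination hρ) (by rw [hp0]; linear_combination hρκ) hv
    (fun ζ hζ => by
      have h0 := ne_zero_of_im_pos hζ.2
      have hm : HasDerivAt (fun ζ : ℂ => -ζ⁻¹) (1 / ζ ^ 2) ζ := by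
        convert! (hasDerivAt_inv h0).neg using 1
        ring
      rw [wr_comp (m := fun ζ => -ζ⁻¹) (hw.analyticAt isOpen_im_pos (him ζ hζ.2)) hm]
      exact mul_ne_zero (one_div_ne_zero (pow_ne_zero 2 h0)) (hW _ (him ζ hζ.2)))
  exact ⟨r, hr, g, F, h, e, hF, hh, hh0, hF0, he, hform⟩

lemma finite_range_avoid (τ : Fin 4 → ℝ) {y : ℝ} (hy : y ∉ Set.range τ) :
    ∃ r > 0, ∀ z ∈ Metric.ball (y : ℂ) r, ∀ i, z ≠ τ i := by
  have hev : ∀ᶠ z : ℂ in 𝓝 (y : ℂ), ∀ i, z ≠ τ i :=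
    eventually_all.2 fun i =>
      eventually_ne_nhds fun h => hy ⟨i, (Complex.ofReal_injective h).symm⟩
  exact Metric.eventually_nhds_iff_ball.1 hev

/-- Continuation of the solutions through a regular point of the real line. -/
lemma SolvesV.exists_extension (hw : SolvesV (pf c τ) (pf d τ) {z | 0 < z.im} w)
    (hW : ∀ z : ℂ, 0 < z.im → wr w z ≠ 0) {y : ℝ} (hy : y ∉ Set.range τ) :
    ∃ r > 0, ∃ φ, SolvesV (pf c τ) (pf d τ) (Metric.ball (y : ℂ) r) φ ∧
      (∀ z ∈ Metric.ball (y : ℂ) r, wr φ z ≠ 0) ∧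
      ∀ z ∈ Metric.ball (y : ℂ) r, 0 < z.im → φ z = w z := by
  obtain ⟨r, hr, hb⟩ := finite_range_avoid τ hy
  have hD : ∀ a : Fin 4 → ℝ, DifferentiableOn ℂ (pf a τ) (Metric.ball (y : ℂ) r) := fun a z hz =>
    (differentiableAt_pf (hb z hz)).differentiableWithinAt
  obtain ⟨φ₀, hφ₀, hWφ₀⟩ := exists_solvesV_ball hr (hD c) (hD d)
  have ob := Metric.isOpen_ball (x := (y : ℂ)) (ε := r)
  set D := Metric.ball (y : ℂ) r ∩ {z | 0 < z.im}
  have hDn : D.Nonempty := by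
    obtain ⟨z, hz, hz'⟩ := ((frequently_im_pos (z := (y : ℂ)) (by simp)).and_eventually
      (nhdsWithin_le_nhds (Metric.ball_mem_nhds _ hr))).exists
    exact ⟨z, hz', hz⟩
  obtain ⟨A, hA⟩ := (hφ₀.mono (Set.inter_subset_left : D ⊆ _)).exists_GL (ob.inter isOpen_im_pos)
    ((convex_ball _ _).inter (convex_halfSpace_im_gt 0)).isPreconnected hDn
    (fun z hz => hWφ₀ z hz.1) (hw.mono Set.inter_subset_right) (fun z hz => hW z hz.2)
  refine ⟨r, hr, _, hφ₀.GL_smul ob A, fun z hz => ?_, fun z hz hz' => (hA z ⟨hz, hz'⟩).symm⟩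
  rw [wr_GL_smul (hφ₀.analyticAt ob hz)]
  exact mul_ne_zero (GL_det_ne_zero A) (hWφ₀ z hz)

/-- Solutions with real coefficients can be continued through all regular points of the real line,
and the continuation is a linear combination of the conjugate solutions. -/
lemma SolvesV.extendable (hw : SolvesV (pf c τ) (pf d τ) {z | 0 < z.im} w)
    (hW : ∀ z : ℂ, 0 < z.im → wr w z ≠ 0) : Extendable (Set.range τ) w := by
  have hA : ∀ z : ℂ, 0 < z.im → AnalyticAt ℂ w z := fun z hz => hw.analyticAt isOpen_im_pos hz
  refine ⟨hA, fun z hz => ne_zero_of_wr_ne_zero (hW z hz),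
    fun z hz => IndepAt.of_wr_ne_zero (hA z hz) (hW z hz), fun y hy => ?_⟩
  obtain ⟨r, hr, φ, hφ, hWφ, hφw⟩ := hw.exists_extension hW hy
  have ob := Metric.isOpen_ball (x := (y : ℂ)) (ε := r)
  set D' := Metric.ball (y : ℂ) r ∩ {z | z.im < 0}
  have hDn' : D'.Nonempty := by
    obtain ⟨z, hz, hz'⟩ := ((frequently_im_neg (z := (y : ℂ)) (by simp)).and_eventually
      (nhdsWithin_le_nhds (Metric.ball_mem_nhds _ hr))).exists
    exact ⟨z, hz', hz⟩
  have hsharp := hw.sharp isOpen_im_pos (fun z => pf_conj z) (fun z => pf_conj z)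
  obtain ⟨M, hM⟩ := (hsharp.mono (U' := D') fun z hz => by simpa using hz.2).exists_GL
    (ob.inter (isOpen_lt Complex.continuous_im continuous_const))
    ((convex_ball _ _).inter (convex_halfSpace_im_lt 0)).isPreconnected hDn'
    (fun z hz => by
      rw [wr_sharp]
      simpa using hW (conj z) (by simpa using hz.2))
    (hφ.mono Set.inter_subset_left) (fun z hz => hWφ z hz.1)
  exact ⟨M, r, hr, φ, fun z hz => ⟨hφ.analyticAt ob hz, ne_zero_of_wr_ne_zero (hWφ z hz)⟩,
    hφw, fun z hz hz' => hM z ⟨hz, hz'⟩⟩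

end Corners

/-! ### Apparent singularities -/

lemma log_neg_add_of_im_pos {z : ℂ} (hz : 0 < z.im) :
    Complex.log (-z) + Real.pi * Complex.I = Complex.log z := by
  rw [Complex.log, Complex.log, norm_neg, Complex.arg_neg_eq_arg_sub_pi_of_im_pos hz]
  push_cast
  ring

lemma log_neg_add_of_im_neg {z : ℂ} (hz : z.im < 0) :
    Complex.log (-z) + Real.pi * Complex.I = Complex.log z + 2 * Real.pi * Complex.I := by
  rw [Complex.log, Complex.log, norm_neg, Complex.arg_neg_eq_arg_add_pi_of_im_neg hz]
  push_cast
  ring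

/-- The continuation of a local form with a logarithm into the lower half-plane. The function `ℓ` is
a branch of the logarithm near the crossing point. -/
lemma eq_of_crossing {V : Set ℝ} {w : ℂ → Fin 2 → ℂ} (hw : Extendable V w) {q r η : ℝ}
    {g M : GL (Fin 2) ℂ} {F h ℓ : ℂ → ℂ} {e c : ℂ}
    (hF : DifferentiableOn ℂ F (Metric.ball 0 r)) (hh : DifferentiableOn ℂ h (Metric.ball 0 r))
    (hg : ∀ ζ ∈ halfDisc r, g • w (q + ζ) =
      h ζ • ![F ζ + e * ζ ^ 2 * Complex.log ζ, ζ ^ 2])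
    (hη : |η| < r) (hM : Crossing w (q + η) M) (hℓ : AnalyticAt ℂ ℓ η)
    (hℓp : ∀ ζ : ℂ, 0 < ζ.im → ℓ ζ = Complex.log ζ)
    (hℓm : ∀ ζ : ℂ, ζ.im < 0 → ℓ ζ = Complex.log ζ + c) :
    ∀ ζ ∈ Metric.ball (0 : ℂ) r, ζ.im < 0 → g • M • sharp w (q + ζ) =
      h ζ • ![F ζ + e * ζ ^ 2 * (Complex.log ζ + c), ζ ^ 2] := by
  obtain ⟨ρ, hρ, φ, hφ, hφw, hφM⟩ := hM
  have o := Metric.isOpen_ball (x := (0 : ℂ)) (ε := r)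
  have hηb : (η : ℂ) ∈ Metric.ball (0 : ℂ) r := by simpa using hη
  have hshift : ∀ᶠ ζ : ℂ in 𝓝 (η : ℂ), (q : ℂ) + ζ ∈ Metric.ball ((q + η : ℝ) : ℂ) ρ := by
    have : ContinuousAt (fun ζ : ℂ => (q : ℂ) + ζ) η := by fun_prop
    refine this.eventually_mem ?_
    push_cast
    exact Metric.ball_mem_nhds _ hρ
  have han : ∀ {ζ : ℂ} {k : ℂ → ℂ}, ζ ∈ Metric.ball (0 : ℂ) r → AnalyticAt ℂ k ζ →
      AnalyticAt ℂ (fun ζ => h ζ • ![F ζ + e * ζ ^ 2 * k ζ, ζ ^ 2]) ζ := by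
    intro ζ k hζ hk
    refine (hh.analyticAt (o.mem_nhds hζ)).smul (analyticAt_pi_iff.2 (Fin.forall_fin_two.2 ⟨?_, ?_⟩))
    · exact (hF.analyticAt (o.mem_nhds hζ)).add
        ((analyticAt_const.mul (analyticAt_id.pow 2)).mul hk)
    · exact analyticAt_id.pow 2
  have e1 : ∀ᶠ ζ : ℂ in 𝓝 (η : ℂ),
      g • φ (q + ζ) = h ζ • ![F ζ + e * ζ ^ 2 * ℓ ζ, ζ ^ 2] := by
    refine (AnalyticAt.frequently_eq_iff_eventually_eq ?_ (han hηb hℓ)).1 ?_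
    · refine AnalyticAt.GL_smul ?_ g
      have h1 : AnalyticAt ℂ (fun ζ : ℂ => (q : ℂ) + ζ) η := by fun_prop
      have h2 := (hφ (q + η) (by simpa using hρ)).1
      exact h2.comp h1
    · refine ((frequently_im_pos (z := (η : ℂ)) (by simp)).and_eventually
        (nhdsWithin_le_nhds (hshift.and (o.eventually_mem hηb)))).mono ?_
      rintro ζ ⟨hζ, hζ1, hζ2⟩
      rw [hφw _ hζ1 (by simpa using hζ), hg ζ ⟨hζ2, hζ⟩, hℓp ζ hζ]
  have hLo : IsOpen (Metric.ball (0 : ℂ) r ∩ {z | z.im < 0}) :=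
    o.inter (isOpen_lt Complex.continuous_im continuous_const)
  have hLc : IsPreconnected (Metric.ball (0 : ℂ) r ∩ {z | z.im < 0}) :=
    ((convex_ball _ _).inter (convex_halfSpace_im_lt 0)).isPreconnected
  obtain ⟨ζ₀, hζ₀, hζ₀1, hζ₀2⟩ := ((frequently_im_neg (z := (η : ℂ)) (by simp)).and_eventually
    (nhdsWithin_le_nhds ((e1.and hshift).eventually_nhds.and (o.eventually_mem hηb)))).exists
  · have hL : ∀ ζ ∈ Metric.ball (0 : ℂ) r ∩ {z | z.im < 0}, g • M • sharp w (q + ζ) =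
        h ζ • ![F ζ + e * ζ ^ 2 * (Complex.log ζ + c), ζ ^ 2] := by
      refine AnalyticOnNhd.eqOn_of_preconnected_of_eventuallyEq
        (f := fun ζ => g • M • sharp w (q + ζ))
        (g := fun ζ => h ζ • ![F ζ + e * ζ ^ 2 * (Complex.log ζ + c), ζ ^ 2])
        (fun ζ hζ => ?_) (fun ζ hζ => han hζ.1 ?_) hLc (z₀ := ζ₀) ⟨hζ₀2, hζ₀⟩ ?_
      · refine AnalyticAt.GL_smul (AnalyticAt.GL_smul ?_ M) g
        have h1 : AnalyticAt ℂ (fun ζ : ℂ => (q : ℂ) + ζ) ζ := by fun_prop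
        have h2 := hw.sharp_analytic (z := q + ζ) (by simpa using hζ.2)
        exact h2.comp h1
      · exact (analyticAt_clog (Or.inr (ne_of_lt hζ.2))).add analyticAt_const
      · filter_upwards [hζ₀1, eventually_im_neg hζ₀] with ζ hζ hζn
        rw [← hφM _ hζ.2 (by simpa using hζn), hζ.1, hℓm ζ hζn]
    exact fun ζ hζ hζn => hL ζ ⟨hζ, hζn⟩

/-- A singular point with exponents `0` and `2` whose local projective monodromy is trivial is a
regular point of the solutions: the two continuations into the lower half-plane differ by the
coefficient of the logarithm. -/
lemma Extendable.exists_crossing_of_mob_eq_one {V : Set ℝ} {w : ℂ → Fin 2 → ℂ}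
    (hw : Extendable V w) {q y y' : ℝ} (hform : HasCornerForm w (q : OnePoint ℝ) 2 2)
    (hy : y ∈ sideBefore V q) (hy' : y' ∈ sideAfter V q) {M M' : GL (Fin 2) ℂ}
    (hM : Crossing w y M) (hM' : Crossing w y' M') (h1 : mob (M * M'⁻¹) = 1) :
    ∃ M, Crossing w q M := by
  obtain ⟨r, hr, g, F, h, e, hF, hh, hh0, hF0, -, hg⟩ := hform
  have hF0 := hF0 two_pos
  have hg' : ∀ ζ ∈ halfDisc r, g • w (q + ζ) =
      h ζ • ![F ζ + e * ζ ^ 2 * Complex.log ζ, ζ ^ 2] := by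
    intro ζ hζ
    have h0 := ne_zero_of_im_pos hζ.2
    have e2 : ζ ^ (-(2 : ℝ) : ℂ) = (ζ ^ 2)⁻¹ := by
      rw [Complex.cpow_neg]; push_cast; rw [Complex.cpow_ofNat]
    refine (hg ζ hζ).trans ?_
    rw [Complex.cpow_ofNat, e2]
    ext i
    fin_cases i
    · simp; field_simp
    · simp; ring
  -- crossing points close to `q`
  have hyq : y < q ∧ ∀ v ∈ V, v < y ∨ q ≤ v := hy
  have hyq' : q < y' ∧ ∀ v ∈ V, v ≤ q ∨ y' < v := hy'
  set η := max (y - q) (-(r / 2))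
  set η' := min (y' - q) (r / 2)
  have hη0 : η < 0 := max_lt (by linarith) (by linarith)
  have hη0' : 0 < η' := lt_min (by linarith) (by linarith)
  have hηr : |η| < r := by
    rw [abs_of_neg hη0]; have := le_max_right (y - q) (-(r / 2)); linarith
  have hηr' : |η'| < r := by
    rw [abs_of_pos hη0']; have := min_le_right (y' - q) (r / 2); linarith
  have hcη : Crossing w (q + η) M := by
    refine hw.crossing_of_mem (isPreconnected_sideBefore V q)
      (fun _ => notMem_of_mem_sideBefore) hy ?_ hM
    have hle := le_max_left (y - q) (-(r / 2))
    refine ⟨by linarith, fun v hv => (hyq.2 v hv).imp (fun h => ?_) id⟩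
    linarith
  have hcη' : Crossing w (q + η') M' := by
    refine hw.crossing_of_mem (isPreconnected_sideAfter V q)
      (fun _ => notMem_of_mem_sideAfter) hy' ?_ hM'
    have hle := min_le_left (y' - q) (r / 2)
    refine ⟨by linarith, fun v hv => (hyq'.2 v hv).imp id (fun h => ?_)⟩
    linarith
  -- The principal logarithm jumps on the negative half-line; there `log (-ζ) + π i` is analytic, and it
  -- agrees with `log ζ` in the upper half-plane only.
  have k1 := eq_of_crossing hw (ℓ := fun ζ => Complex.log (-ζ) + Real.pi * Complex.I)
    (c := 2 * Real.pi * Complex.I) hF hh hg' hηr hcη (by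
      refine AnalyticAt.add (AnalyticAt.clog (by fun_prop) (Or.inl ?_)) analyticAt_const
      simpa using hη0) (fun ζ hζ => log_neg_add_of_im_pos hζ) (fun ζ hζ => log_neg_add_of_im_neg hζ)
  have k2 := eq_of_crossing hw (ℓ := Complex.log) (c := 0) hF hh hg' hηr' hcη'
    (analyticAt_clog (Or.inl (by simpa using hη0'))) (fun ζ _ => rfl) (fun ζ _ => (add_zero _).symm)
  -- The two continuations have the same ratio, although their logarithms differ by `2 π i`.
  have he : e = 0 := by
    obtain ⟨ζ, hζ, hζb⟩ := ((frequently_im_neg (z := 0) (by simp)).and_eventually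
      (nhdsWithin_le_nhds (Metric.ball_mem_nhds _ hr))).exists
    have hζ0 : ζ ≠ 0 := by rintro rfl; simp at hζ
    have hu : sharp w (q + ζ) ≠ 0 := star_ne_zero_vec (hw.ne_zero _ (by simpa using hζ))
    have hmm : ∀ p : OnePoint ℂ, M • p = M' • p := by
      intro p
      have := congrArg (fun T => T (M' • p)) h1
      simpa [mob, mul_smul] using this
    have e1 : vr (g • M • sharp w (q + ζ)) = vr (g • M' • sharp w (q + ζ)) := by
      rw [← smul_vr _ (GL_smul_ne_zero hu), ← smul_vr _ hu, hmm, smul_vr _ hu,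
        smul_vr _ (GL_smul_ne_zero hu)]
    have hne : ∀ a, ![a, ζ ^ 2] ≠ (0 : Fin 2 → ℂ) := fun a h => by
      have := congrFun h 1
      simp [hζ0] at this
    rw [k1 ζ hζb hζ, k2 ζ hζb hζ, vr_smul_of_ne_zero (hh0 ζ hζb), vr_smul_of_ne_zero (hh0 ζ hζb),
      vr_eq_iff (hne _) (hne _)] at e1
    have e2 : e * (ζ ^ 2 * ζ ^ 2 * (2 * Real.pi * Complex.I)) = 0 := by
      simp only [Matrix.cons_val_zero, Matrix.cons_val_one] at e1
      linear_combination e1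
    refine (mul_eq_zero.1 e2).resolve_right ?_
    have := Complex.two_pi_I_ne_zero
    exact mul_ne_zero (mul_ne_zero (pow_ne_zero _ hζ0) (pow_ne_zero _ hζ0)) this
  subst he
  have ob := Metric.isOpen_ball (x := (0 : ℂ)) (ε := r)
  have hb : ∀ z ∈ Metric.ball (q : ℂ) r, z - q ∈ Metric.ball (0 : ℂ) r := fun z hz => by
    simpa [Metric.mem_ball, dist_eq_norm] using hz
  refine ⟨M, r, hr, fun z => g⁻¹ • (h (z - q) • ![F (z - q), (z - q) ^ 2]), fun z hz => ⟨?_, ?_⟩,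
    fun z hz hz' => ?_, fun z hz hz' => ?_⟩
  · refine AnalyticAt.GL_smul ?_ _
    have hs : AnalyticAt ℂ (fun z : ℂ => z - q) z := by fun_prop
    have a1 : AnalyticAt ℂ (fun z => h (z - q)) z :=
      AnalyticAt.comp (f := fun z : ℂ => z - q) (hh.analyticAt (ob.mem_nhds (hb z hz))) hs
    have a2 : AnalyticAt ℂ (fun z => F (z - q)) z :=
      AnalyticAt.comp (f := fun z : ℂ => z - q) (hF.analyticAt (ob.mem_nhds (hb z hz))) hs
    exact a1.smul (analyticAt_pi_iff.2 (Fin.forall_fin_two.2 ⟨a2, hs.pow 2⟩))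
  · refine GL_smul_ne_zero (smul_ne_zero (hh0 _ (hb z hz)) fun h0 => ?_)
    have h2 := congrFun h0 1
    have h3 := congrFun h0 0
    simp only [Matrix.cons_val_zero, Matrix.cons_val_one, Pi.zero_apply] at h2 h3
    rw [pow_eq_zero_iff two_ne_zero] at h2
    rw [h2] at h3
    exact hF0 h3
  · have := hg' (z - q) ⟨hb z hz, by simpa using hz'⟩
    simp only [zero_mul, add_zero, add_sub_cancel] at this
    simp only [← this, inv_smul_smul]
  · have := k1 (z - q) (hb z hz) (by simpa using hz')
    simp only [zero_mul, add_zero, add_sub_cancel] at this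
    simp only [← this, inv_smul_smul]

/-! ### The equation -/

namespace FuchsEquation
variable (E : FuchsEquation)

/-- The finite singular points. -/
def τ : Fin 4 → ℝ := ![0, 1, E.x, E.q]

/-- The residues of the coefficient `P`. -/
def resP : Fin 4 → ℝ := ![E.κ 0 - 1, E.κ 1 - 1, E.κ 2 - 1, 1]

/-- The residues of the coefficient `Q`. -/
def resQ : Fin 4 → ℝ := ![-E.h 0, -E.h 1, -E.h 2, E.p]

lemma P_eq : E.P = pf E.resP E.τ := by
  ext z
  simp [P, pf, Fin.sum_univ_three, Fin.sum_univ_four, resP, τ, sing]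
  ring

lemma Q_eq : E.Q = pf E.resQ E.τ := by
  ext z
  simp [Q, pf, Fin.sum_univ_three, Fin.sum_univ_four, resQ, τ, sing]
  ring

lemma range_τ : Set.range E.τ = {0, 1, E.x, E.q} := by
  simp only [τ, Matrix.range_cons, Matrix.range_empty]
  ext; simp; tauto

/-- The singular points are different, and the exponent differences are not negative. -/
structure Admissible : Prop where
  κ_nonneg : ∀ j, 0 ≤ E.κ j
  one_lt_x : 1 < E.x
  q_ne_zero : E.q ≠ 0
  q_ne_one : E.q ≠ 1
  q_ne_x : E.q ≠ E.x

variable {E}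

lemma Admissible.injective_τ (hE : E.Admissible) : Function.Injective E.τ := by
  have h1 := hE.one_lt_x
  have h2 := hE.q_ne_zero
  have h3 := hE.q_ne_one
  have h4 := hE.q_ne_x
  intro i j hij
  fin_cases i <;> fin_cases j <;> simp [τ] at hij ⊢ <;>
    first | exact absurd hij (by linarith) | exact absurd hij ‹_› | exact absurd hij.symm h2 | exact absurd hij.symm h3 |
      exact absurd hij.symm h4

variable {w : ℂ → Fin 2 → ℂ}

lemma IsFundamentalPair.solvesV {w₁ w₂ : ℂ → ℂ} (h : E.IsFundamentalPair w₁ w₂) :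
    SolvesV (pf E.resP E.τ) (pf E.resQ E.τ) {z | 0 < z.im} fun z => ![w₁ z, w₂ z] := by
  rw [← P_eq, ← Q_eq]
  exact Fin.forall_fin_two.2 ⟨h.1, h.2.1⟩

lemma IsFundamentalPair.wr_ne_zero {w₁ w₂ : ℂ → ℂ} (h : E.IsFundamentalPair w₁ w₂) {z : ℂ}
    (hz : 0 < z.im) : wr (fun z => ![w₁ z, w₂ z]) z ≠ 0 :=
  h.solvesV.wr_ne_zero isOpen_im_pos (convex_halfSpace_im_gt 0).isPreconnected differentiableOn_pf
    (fun a b hab => h.2.2 a b fun z hz => by simpa using hab z hz) hz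

lemma isFundamentalPair_of_wr_ne_zero
    (h : SolvesV (pf E.resP E.τ) (pf E.resQ E.τ) {z | 0 < z.im} w)
    (hW : ∀ z : ℂ, 0 < z.im → wr w z ≠ 0) :
    E.IsFundamentalPair (fun z => w z 0) fun z => w z 1 := by
  rw [← P_eq, ← Q_eq] at h
  refine ⟨h 0, h 1, fun a b hab => ?_⟩
  have him : 0 < Complex.I.im := by simp
  refine IndepAt.of_wr_ne_zero (h.analyticAt isOpen_im_pos him) (hW Complex.I him) a b ?_
  filter_upwards [eventually_im_pos him] with z hz using hab z hz

lemma IsFundamentalPair.extendable {w₁ w₂ : ℂ → ℂ} (h : E.IsFundamentalPair w₁ w₂) :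
    Extendable {0, 1, E.x, E.q} fun z => ![w₁ z, w₂ z] := by
  rw [← range_τ]
  exact h.solvesV.extendable fun z hz => h.wr_ne_zero hz

lemma IsFundamentalPair.hasCornerForm (hE : E.Admissible) {w₁ w₂ : ℂ → ℂ}
    (h : E.IsFundamentalPair w₁ w₂) (hR : E.RegularAtInfinity) (j : Fin 4) :
    ∃ ρ, HasCornerForm (fun z => ![w₁ z, w₂ z]) (corner E.x j) (E.κ j) ρ := by
  have hW : ∀ z : ℂ, 0 < z.im → wr (fun z => ![w₁ z, w₂ z]) z ≠ 0 := fun z hz => h.wr_ne_zero hz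
  have hf : ∀ i : Fin 4, E.resP i = E.κ i - 1 →
      HasCornerForm (fun z => ![w₁ z, w₂ z]) (E.τ i : OnePoint ℝ) (E.κ i) (E.κ i) := fun i hi =>
    h.solvesV.hasCornerForm hW hE.injective_τ (hE.κ_nonneg i) hi
  fin_cases j
  · exact ⟨_, hf 0 rfl⟩
  · exact ⟨_, hf 1 rfl⟩
  · exact ⟨_, hf 2 rfl⟩
  · obtain ⟨A, B, hA, hB, ρ₁, ρ₂, hρ, hd⟩ := hR
    rw [P_eq] at hA
    rw [Q_eq] at hB
    have hs := sum_eq_zero_of_tendsto_sq_mul_pf hB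
    have hA' := tendsto_nhds_unique hA (tendsto_mul_pf _ _)
    have hB' := tendsto_nhds_unique hB (tendsto_sq_mul_pf hs)
    refine ⟨ρ₁, h.solvesV.hasCornerForm_infty hW hs (hE.κ_nonneg 3) ?_ ?_⟩
    · rw [← hA', ← hB', hρ ρ₁]; ring
    · rw [← hA', ← hd]
      linear_combination hρ 1 - hρ 0

lemma IsFundamentalPair.hasCornerForm_q (hE : E.Admissible) {w₁ w₂ : ℂ → ℂ}
    (h : E.IsFundamentalPair w₁ w₂) :
    HasCornerForm (fun z => ![w₁ z, w₂ z]) (E.q : OnePoint ℝ) 2 2 := by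
  have := h.solvesV.hasCornerForm (i := 3) (κ := 2) (fun z hz => h.wr_ne_zero hz) hE.injective_τ
    zero_le_two (by simp [resP]; norm_num)
  exact_mod_cast this

lemma finite_singular (a b c d : ℝ) : ({a, b, c, d} : Set ℝ).Finite := Set.toFinite _

/-- If `q` is apparent, the solutions can be continued through `q`. -/
lemma IsFundamentalPair.extendable_of_isApparentAt (hE : E.Admissible) {w₁ w₂ : ℂ → ℂ}
    (h : E.IsFundamentalPair w₁ w₂) (ha : E.IsApparentAt (E.q : OnePoint ℝ)) :
    Extendable {0, 1, E.x} fun z => ![w₁ z, w₂ z] := by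
  have hext := h.extendable
  refine ⟨hext.analytic, hext.ne_zero, hext.indep, fun y hy => ?_⟩
  by_cases hyq : y = E.q
  · rw [hyq]
    have hVf := finite_singular 0 1 E.x E.q
    obtain ⟨y, hy⟩ := sideBefore_nonempty hVf (E.q : OnePoint ℝ)
    obtain ⟨y', hy'⟩ := sideAfter_nonempty hVf (E.q : OnePoint ℝ)
    obtain ⟨M, hM⟩ := hext.cross y (notMem_of_mem_sideBefore hy)
    obtain ⟨M', hM'⟩ := hext.cross y' (notMem_of_mem_sideAfter hy')
    have hI : 0 < Complex.I.im := by simp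
    obtain ⟨γ, hγ⟩ := exists_crossLoop y y' hI
    have hT := hext.transport_crossLoop hI hγ hM hM'
    have hmono := ha w₁ w₂ h Complex.I hI γ (hγ.loopAround hy hy')
    exact hext.exists_crossing_of_mob_eq_one (h.hasCornerForm_q hE) hy hy' hM hM'
      ((hext.isProjMonodromy_iff hI hT 1).1 hmono).symm
  · exact hext.cross y fun hy' => by
      simp only [Set.mem_insert_iff, Set.mem_singleton_iff] at hy hy'
      tauto

/-- A singular point is apparent if and only if the sides that meet there are in the same circle. -/
lemma IsFundamentalPair.isApparentAt_iff {w₁ w₂ : ℂ → ℂ} (h : E.IsFundamentalPair w₁ w₂)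
    {f : OnePoint ℂ → OnePoint ℂ} (hf : IsBoundaryExtension (fun z => ![w₁ z, w₂ z]) f)
    (c : OnePoint ℝ) : E.IsApparentAt c ↔ SameCircleAt {0, 1, E.x, E.q} f c := by
  have hext := h.extendable
  have hVf := finite_singular 0 1 E.x E.q
  constructor
  · intro ha
    have hI : 0 < Complex.I.im := by simp
    obtain ⟨γ, hγ⟩ := exists_loopAround hVf c hI
    obtain ⟨A, hA, hiff⟩ := hext.isProjMonodromy_loopAround subset_rfl hVf hf hI hγ
    exact hiff.1 ((hext.isProjMonodromy_iff hI hA 1).1 (ha w₁ w₂ h _ hI γ hγ)).symm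
  · intro hs u₁ u₂ hu x₀ hx₀ γ hγ
    obtain ⟨A, hA, hiff⟩ := hext.isProjMonodromy_loopAround subset_rfl hVf hf hx₀ hγ
    obtain ⟨B, hB⟩ := h.solvesV.exists_GL isOpen_im_pos (convex_halfSpace_im_gt 0).isPreconnected
      ⟨x₀, hx₀⟩ (fun z hz => h.wr_ne_zero hz) hu.solvesV (fun z hz => hu.wr_ne_zero hz)
    have hT : Transport (fun z => ![u₁ z, u₂ z]) γ (B * A * B⁻¹) := by
      obtain ⟨W, hW, h0, h1⟩ := hA.GL_smul B
      have hev : ∀ᶠ z in 𝓝 x₀, ![u₁ z, u₂ z] = B • ![w₁ z, w₂ z] := by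
        filter_upwards [eventually_im_pos hx₀] with z hz using hB z hz
      refine ⟨W, hW, ?_, ?_⟩
      · filter_upwards [h0, hev] with z h0 hz
        rw [h0, hz]
      · filter_upwards [h1, hev] with z h1 hz
        rw [h1, hz]
    refine (hu.extendable.isProjMonodromy_iff hx₀ hT 1).2 ?_
    have hinv : mob B * mob B⁻¹ = 1 := by rw [← mob_mul, mul_inv_cancel, mob_one]
    rw [mob_mul, mob_mul, hiff.2 hs, mul_one, hinv]

end FuchsEquation

/-! ### The logarithm in the closed upper half-plane -/

/-- The branch of the logarithm which is analytic outside of the negative imaginary axis and agrees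
with the principal branch in the closed upper half-plane. -/
noncomputable def ulog (z : ℂ) : ℂ := Complex.log (-Complex.I * z) + Real.pi / 2 * Complex.I

lemma log_eq_ulog {z : ℂ} (hz : 0 ≤ z.im) (h0 : z ≠ 0) : Complex.log z = ulog z := by
  have h1 : Complex.log (-Complex.I * z) = Complex.log (-Complex.I) + Complex.log z := by
    refine (Complex.log_mul_eq_add_log_iff (by simp) h0).2 ?_
    rw [Complex.arg_neg_I]
    have h2 := Complex.arg_nonneg_iff.2 hz
    have h3 := Complex.arg_le_pi z
    have := Real.pi_pos
    constructor <;> linarith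
  rw [ulog, h1, Complex.log_neg_I]
  ring

lemma mul_mem_slitPlane_of_im_nonneg {z : ℂ} (hz : 0 ≤ z.im) (h0 : z ≠ 0) :
    -Complex.I * z ∈ Complex.slitPlane := by
  rw [Complex.mem_slitPlane_iff]
  simp only [neg_mul, Complex.neg_re, Complex.I_mul_re, neg_neg, Complex.neg_im, Complex.I_mul_im]
  rcases hz.lt_or_eq with h | h
  · exact Or.inl h
  · right
    intro h'
    exact h0 (Complex.ext (by simpa using h') h.symm)

lemma analyticAt_ulog {z : ℂ} (hz : -Complex.I * z ∈ Complex.slitPlane) : AnalyticAt ℂ ulog z :=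
  (AnalyticAt.clog (by fun_prop) hz).add analyticAt_const

/-- The closed upper half-plane without the origin. -/
def punctH : Set ℂ := {ζ : ℂ | 0 ≤ ζ.im ∧ ζ ≠ 0}

lemma tendsto_norm_punctH : Tendsto (fun ζ : ℂ => ‖ζ‖) (𝓝[punctH] 0) (𝓝[>] 0) := by
  refine tendsto_nhdsWithin_iff.2 ⟨?_, ?_⟩
  · have : Tendsto (fun ζ : ℂ => ‖ζ‖) (𝓝 0) (𝓝 ‖(0 : ℂ)‖) := continuous_norm.tendsto 0
    rw [norm_zero] at this
    exact this.mono_left nhdsWithin_le_nhds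
  · filter_upwards [self_mem_nhdsWithin] with ζ hζ using norm_pos_iff.2 hζ.2

lemma norm_log_le (ζ : ℂ) : ‖Complex.log ζ‖ ≤ |Real.log ‖ζ‖| + Real.pi := by
  refine (Complex.norm_le_abs_re_add_abs_im _).trans ?_
  rw [Complex.log_re, Complex.log_im]
  exact add_le_add_right (Complex.abs_arg_le_pi ζ) _

lemma tendsto_cpow_mul_log {κ : ℝ} (hκ : 0 < κ) :
    Tendsto (fun ζ : ℂ => ζ ^ (κ : ℂ) * Complex.log ζ) (𝓝[punctH] 0) (𝓝 0) := by
  rw [tendsto_zero_iff_norm_tendsto_zero]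
  have h1 : Tendsto (fun t : ℝ => |Real.log t * t ^ κ| + Real.pi * t ^ κ) (𝓝[>] 0) (𝓝 0) := by
    have a := (tendsto_log_mul_rpow_nhdsGT_zero hκ).abs
    have b : Tendsto (fun t : ℝ => Real.pi * t ^ κ) (𝓝[>] 0) (𝓝 0) := by
      have := ((Real.continuousAt_rpow_const 0 κ (Or.inr hκ.le)).tendsto.const_mul Real.pi)
      rw [Real.zero_rpow hκ.ne', mul_zero] at this
      exact this.mono_left nhdsWithin_le_nhds
    simpa using a.add b
  refine squeeze_zero' (Eventually.of_forall fun _ => norm_nonneg _) ?_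
    (h1.comp tendsto_norm_punctH)
  filter_upwards with ζ
  have hp : 0 ≤ ‖ζ‖ ^ κ := Real.rpow_nonneg (norm_nonneg _) _
  simp only [Function.comp]
  rw [norm_mul, Complex.norm_cpow_real, abs_mul, abs_of_nonneg hp]
  have := mul_le_mul_of_nonneg_left (norm_log_le ζ) hp
  linarith

lemma tendsto_inv_log : Tendsto (fun ζ : ℂ => (Complex.log ζ)⁻¹) (𝓝[punctH] 0) (𝓝 0) := by
  refine tendsto_inv₀_cobounded.comp ?_
  rw [← tendsto_norm_atTop_iff_cobounded]
  have h1 : Tendsto (fun t : ℝ => |Real.log t|) (𝓝[>] 0) atTop :=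
    tendsto_abs_atBot_atTop.comp Real.tendsto_log_nhdsGT_zero
  refine tendsto_atTop_mono (fun ζ => ?_) (h1.comp tendsto_norm_punctH)
  simp only [Function.comp]
  rw [← Complex.log_re]
  exact Complex.abs_re_le_norm _

/-! ### Boundary points in local coordinates -/

lemma im_neg_inv (ζ : ℂ) : (-ζ⁻¹).im = ζ.im / Complex.normSq ζ := by
  rw [Complex.neg_im, Complex.inv_im]
  ring

lemma localParam_im_nonneg (c : OnePoint ℝ) {ζ : ℂ} (hζ : 0 ≤ ζ.im) : 0 ≤ (localParam c ζ).im := by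
  induction c using OnePoint.rec with
  | infty =>
    change 0 ≤ (-ζ⁻¹).im
    rw [im_neg_inv]
    exact div_nonneg hζ (Complex.normSq_nonneg _)
  | coe y =>
    change 0 ≤ ((y : ℂ) + ζ).im
    simpa using hζ

lemma localParam_im_pos (c : OnePoint ℝ) {ζ : ℂ} (hζ : 0 < ζ.im) : 0 < (localParam c ζ).im := by
  induction c using OnePoint.rec with
  | infty =>
    change 0 < (-ζ⁻¹).im
    rw [im_neg_inv]
    exact div_pos hζ (Complex.normSq_pos.2 (ne_zero_of_im_pos hζ))
  | coe y =>
    change 0 < ((y : ℂ) + ζ).im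
    simpa using hζ

lemma hasDerivAt_localParam (c : OnePoint ℝ) {ζ : ℂ} (h0 : ζ ≠ 0) :
    HasDerivAt (localParam c) (c.elim ((ζ ^ 2)⁻¹) fun _ => 1) ζ := by
  induction c using OnePoint.rec with
  | infty =>
    have := (hasDerivAt_inv h0).neg
    rw [neg_neg] at this
    exact this
  | coe y => exact (hasDerivAt_id ζ).const_add _

lemma analyticAt_localParam (c : OnePoint ℝ) {ζ : ℂ} (h0 : ζ ≠ 0) :
    AnalyticAt ℂ (localParam c) ζ := by
  induction c using OnePoint.rec with
  | infty => exact (analyticAt_inv h0).neg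
  | coe y => exact analyticAt_const.add analyticAt_id

lemma tendsto_localParam (c : OnePoint ℝ) :
    Tendsto (fun ζ => (localParam c ζ : OnePoint ℂ)) (𝓝[punctH] 0) (𝓝[closedH] (bdry c)) := by
  refine tendsto_nhdsWithin_iff.2 ⟨?_, ?_⟩
  · induction c using OnePoint.rec with
    | infty =>
      have : Tendsto (fun ζ : ℂ => -ζ⁻¹) (𝓝[punctH] 0) (Bornology.cobounded ℂ) :=
        tendsto_neg_inv_cobounded.mono_left (nhdsWithin_mono _ fun ζ hζ => hζ.2)
      exact tendsto_coe_infty_iff.2 this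
    | coe y =>
      have h : Continuous fun ζ : ℂ => (y : ℂ) + ζ := by fun_prop
      have h1 := (OnePoint.continuous_coe.comp h).tendsto 0
      have h2 : Tendsto (fun ζ : ℂ => (((y : ℂ) + ζ : ℂ) : OnePoint ℂ)) (𝓝 0)
          (𝓝 ((y : ℂ) : OnePoint ℂ)) := by
        simp only [Function.comp_apply, add_zero] at h1
        exact h1
      exact h2.mono_left nhdsWithin_le_nhds
  · filter_upwards [self_mem_nhdsWithin] with ζ hζ using
      coe_mem_closedH (localParam_im_nonneg c hζ.1)

lemma tendsto_localParam_of_ne_zero (c : OnePoint ℝ) {ζ : ℂ} (hζ : ζ ∈ punctH) :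
    Tendsto (fun ζ => (localParam c ζ : OnePoint ℂ)) (𝓝[{ζ | 0 ≤ ζ.im}] ζ)
      (𝓝[closedH] (localParam c ζ : OnePoint ℂ)) := by
  refine tendsto_nhdsWithin_iff.2 ⟨?_, ?_⟩
  · exact (OnePoint.continuous_coe.continuousAt.comp
      (analyticAt_localParam c hζ.2).continuousAt).tendsto.mono_left nhdsWithin_le_nhds
  · filter_upwards [self_mem_nhdsWithin] with ζ hζ using
      coe_mem_closedH (localParam_im_nonneg c hζ)

/-- The image of the upper half-plane in the sphere. -/
def openH : Set (OnePoint ℂ) := (fun z : ℂ => (z : OnePoint ℂ)) '' {z | 0 < z.im}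

lemma nhdsWithin_openH (p : OnePoint ℂ) : 𝓝[openH] p =
    map (fun z : ℂ => (z : OnePoint ℂ))
      (𝓟 {z : ℂ | 0 < z.im} ⊓ comap (fun z : ℂ => (z : OnePoint ℂ)) (𝓝 p)) := by
  rw [Filter.push_pull, Filter.map_principal, inf_comm]
  rfl

lemma nhdsWithin_openH_bdry (c : OnePoint ℝ) : 𝓝[openH] (bdry c) =
    map (fun ζ => (localParam c ζ : OnePoint ℂ)) (𝓝[{ζ : ℂ | 0 < ζ.im}] 0) := by
  have hsub : 𝓝[{ζ : ℂ | 0 < ζ.im}] (0 : ℂ) ≤ 𝓝[punctH] 0 :=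
    nhdsWithin_mono _ fun ζ hζ => ⟨le_of_lt hζ, ne_zero_of_im_pos hζ⟩
  refine le_antisymm ?_ ?_
  · -- the inverse of the local coordinate
    have key : ∃ m : ℂ → ℂ, (∀ z : ℂ, 0 < z.im → localParam c (m z) = z) ∧
        Tendsto m (𝓟 {z : ℂ | 0 < z.im} ⊓ comap (fun z : ℂ => (z : OnePoint ℂ)) (𝓝 (bdry c)))
          (𝓝[{ζ : ℂ | 0 < ζ.im}] 0) := by
      induction c using OnePoint.rec with
      | infty =>
        refine ⟨fun z => -z⁻¹, fun z hz => ?_, tendsto_nhdsWithin_iff.2 ⟨?_, ?_⟩⟩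
        · change -(-z⁻¹)⁻¹ = z
          simp
        · have h1 : comap (fun z : ℂ => (z : OnePoint ℂ)) (𝓝 (bdry ∞)) =
              Bornology.cobounded ℂ := by
            change comap _ (𝓝 ∞) = _
            rw [OnePoint.comap_coe_nhds_infty, Metric.cobounded_eq_cocompact,
              coclosedCompact_eq_cocompact]
          rw [h1]
          exact (tendsto_neg_inv_nhdsNE.mono_right nhdsWithin_le_nhds).mono_left inf_le_right
        · filter_upwards [mem_inf_of_left (mem_principal_self _)] with z hz
          exact localParam_im_pos ∞ hz
      | coe y =>
        refine ⟨fun z => z - y, fun z hz => ?_, tendsto_nhdsWithin_iff.2 ⟨?_, ?_⟩⟩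
        · change (y : ℂ) + (z - y) = z
          ring
        · have h1 : comap (fun z : ℂ => (z : OnePoint ℂ)) (𝓝 (bdry y)) = 𝓝 (y : ℂ) :=
            OnePoint.comap_coe_nhds (y : ℂ)
          rw [h1]
          have h2 : Continuous fun z : ℂ => z - y := by fun_prop
          have h3 := h2.tendsto (y : ℂ)
          rw [sub_self] at h3
          exact h3.mono_left inf_le_right
        · filter_upwards [mem_inf_of_left (mem_principal_self _)] with z hz
          simpa using hz
    obtain ⟨m, hm, ht⟩ := key
    rw [nhdsWithin_openH]
    have e1 : (fun z : ℂ => (z : OnePoint ℂ)) =ᶠ[𝓟 {z : ℂ | 0 < z.im} ⊓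
        comap (fun z : ℂ => (z : OnePoint ℂ)) (𝓝 (bdry c))]
        (fun ζ => (localParam c ζ : OnePoint ℂ)) ∘ m := by
      filter_upwards [mem_inf_of_left (mem_principal_self _)] with z hz
      simp only [Function.comp]
      rw [hm z hz]
    rw [Filter.map_congr e1, ← Filter.map_map]
    exact Filter.map_mono ht
  · refine tendsto_nhdsWithin_iff.2 ⟨?_, ?_⟩
    · exact ((tendsto_localParam c).mono_left hsub).mono_right nhdsWithin_le_nhds
    · filter_upwards [self_mem_nhdsWithin] with ζ hζ using ⟨_, localParam_im_pos c hζ, rfl⟩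

/-! ### The developing map defined by a fundamental pair -/

section
variable {w : ℂ → Fin 2 → ℂ} {c : OnePoint ℝ} {κ : ℝ} {ρ : ℂ} {f : OnePoint ℂ → OnePoint ℂ}

lemma im_pos_subset_punctH : {ζ : ℂ | 0 < ζ.im} ⊆ punctH :=
  fun _ hζ => ⟨le_of_lt hζ, ne_zero_of_im_pos hζ⟩

lemma ball_mem_nhdsWithin_zero {r : ℝ} (hr : 0 < r) (s : Set ℂ) :
    Metric.ball (0 : ℂ) r ∈ 𝓝[s] 0 := nhdsWithin_le_nhds (Metric.ball_mem_nhds _ hr)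

lemma tendsto_cpow_punctH (hκ : 0 < κ) :
    Tendsto (fun ζ : ℂ => ζ ^ (κ : ℂ)) (𝓝[punctH] 0) (𝓝 0) := by
  rw [tendsto_zero_iff_norm_tendsto_zero]
  simp only [Complex.norm_cpow_real]
  have := (Real.continuousAt_rpow_const 0 κ (Or.inr hκ.le)).tendsto
  rw [Real.zero_rpow hκ.ne'] at this
  exact (this.mono_left nhdsWithin_le_nhds).comp tendsto_norm_punctH

/-- At a corner, the ratio of the solutions is, in a suitable coordinate of the sphere, asymptotic
to a power or to the inverse of a logarithm. -/
lemma HasCornerForm.exists_asymptotics (h : HasCornerForm w c κ ρ) (hκ : 0 ≤ κ) :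
    ∃ (g : GL (Fin 2) ℂ) (Ψ : ℂ → ℂ) (k : ℂ), k ≠ 0 ∧ (∀ᶠ ζ in 𝓝[punctH] 0, ContinuousAt Ψ ζ) ∧
      (∀ᶠ ζ in 𝓝[{ζ : ℂ | 0 < ζ.im}] 0, w (localParam c ζ) ≠ 0 →
        g • vr (w (localParam c ζ)) = (Ψ ζ : OnePoint ℂ)) ∧
      Tendsto Ψ (𝓝[punctH] 0) (𝓝 0) ∧
      ((0 < κ ∧ Tendsto (fun ζ => Ψ ζ / ζ ^ (κ : ℂ)) (𝓝[punctH] 0) (𝓝 k)) ∨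
        (κ = 0 ∧ Tendsto (fun ζ => Ψ ζ * Complex.log ζ) (𝓝[punctH] 0) (𝓝 k))) := by
  obtain ⟨r, hr, g, F, h, e, hF, hh, hh0, hF0, he, hg⟩ := h
  have o := Metric.isOpen_ball (x := (0 : ℂ)) (ε := r)
  have hFt : Tendsto F (𝓝[punctH] 0) (𝓝 (F 0)) :=
    (hF.continuousOn.continuousAt (Metric.ball_mem_nhds _ hr)).tendsto.mono_left nhdsWithin_le_nhds
  -- `ψ` is the ratio in the coordinate `g`, continuous up to the real line. It tends to infinity, so that
  -- its inverse, in the coordinate obtained by the inversion `mkGL 0 1 1 0`, is the function needed.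
  set ψ : ℂ → ℂ := fun ζ => Complex.exp (ulog ζ * -κ) * F ζ + e * ulog ζ with hψ
  have hψeq : ∀ ζ ∈ punctH, ψ ζ = ζ ^ (-κ : ℂ) * F ζ + e * Complex.log ζ := fun ζ hζ => by
    rw [Complex.cpow_def_of_ne_zero hζ.2, log_eq_ulog hζ.1 hζ.2]
  have hψc : ∀ ζ ∈ punctH, ζ ∈ Metric.ball (0 : ℂ) r → ContinuousAt ψ ζ := fun ζ hζ hb => by
    have h1 := (analyticAt_ulog (mul_mem_slitPlane_of_im_nonneg hζ.1 hζ.2)).continuousAt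
    exact ((h1.mul continuousAt_const).cexp.mul (hF.continuousOn.continuousAt (o.mem_nhds hb))).add
      (h1.const_mul e)
  have hcpow : ∀ ζ ∈ punctH, ζ ^ (κ : ℂ) ≠ 0 := fun ζ hζ => by
    rw [Ne, Complex.cpow_eq_zero_iff]; exact fun h => hζ.2 h.1
  have hmem : ∀ᶠ ζ in 𝓝[punctH] (0 : ℂ), ζ ∈ punctH := self_mem_nhdsWithin
  obtain ⟨k, hk, hlim, hzero⟩ : ∃ k : ℂ, k ≠ 0 ∧
      ((0 < κ ∧ Tendsto (fun ζ => (ψ ζ)⁻¹ / ζ ^ (κ : ℂ)) (𝓝[punctH] 0) (𝓝 k)) ∨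
        (κ = 0 ∧ Tendsto (fun ζ => (ψ ζ)⁻¹ * Complex.log ζ) (𝓝[punctH] 0) (𝓝 k))) ∧
      Tendsto (fun ζ => (ψ ζ)⁻¹) (𝓝[punctH] 0) (𝓝 0) := by
    rcases hκ.lt_or_eq with hκ | hκ
    · have h1 : Tendsto (fun ζ => (ψ ζ)⁻¹ / ζ ^ (κ : ℂ)) (𝓝[punctH] 0) (𝓝 (F 0)⁻¹) := by
        have h2 := (hFt.add ((tendsto_cpow_mul_log hκ).const_mul e))
        rw [mul_zero, add_zero] at h2
        refine (h2.inv₀ (hF0 hκ)).congr' ?_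
        filter_upwards [hmem] with ζ hζ
        have := hcpow ζ hζ
        rw [hψeq ζ hζ, Complex.cpow_neg, div_eq_mul_inv, ← mul_inv]
        congr 1
        field_simp
      refine ⟨_, inv_ne_zero (hF0 hκ), Or.inl ⟨hκ, h1⟩, ?_⟩
      have h2 := h1.mul (tendsto_cpow_punctH hκ)
      rw [mul_zero] at h2
      refine h2.congr' ?_
      filter_upwards [hmem] with ζ hζ
      exact div_mul_cancel₀ _ (hcpow ζ hζ)
    · have h1 : Tendsto (fun ζ => (ψ ζ)⁻¹ * Complex.log ζ) (𝓝[punctH] 0) (𝓝 e⁻¹) := by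
        have h2 := (tendsto_inv_log.mul hFt).add_const e
        rw [zero_mul, zero_add] at h2
        refine (h2.inv₀ (he hκ.symm)).congr' ?_
        have hne : ∀ᶠ ζ in 𝓝[punctH] (0 : ℂ), Complex.log ζ ≠ 0 := by
          have := (Metric.ball_mem_nhds (0 : ℂ) one_pos)
          filter_upwards [hmem, nhdsWithin_le_nhds this] with ζ hζ hb h0
          have h3 : Real.log ‖ζ‖ = 0 := by rw [← Complex.log_re, h0, Complex.zero_re]
          have h4 : 0 < ‖ζ‖ := norm_pos_iff.2 hζ.2
          have h5 : ‖ζ‖ < 1 := by simpa using hb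
          exact absurd h3 (Real.log_neg h4 h5).ne
        filter_upwards [hmem, hne] with ζ hζ hne
        rw [hψeq ζ hζ, ← hκ]
        simp only [Complex.ofReal_zero, neg_zero, Complex.cpow_zero, one_mul]
        rw [← inv_inv (Complex.log ζ), ← mul_inv, inv_inv]
        congr 1
        field_simp
      refine ⟨_, inv_ne_zero (he hκ.symm), Or.inr ⟨hκ.symm, h1⟩, ?_⟩
      have h2 := h1.mul tendsto_inv_log
      rw [mul_zero] at h2
      refine h2.congr' ?_
      have := (Metric.ball_mem_nhds (0 : ℂ) one_pos)
      filter_upwards [hmem, nhdsWithin_le_nhds this] with ζ hζ hb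
      refine mul_inv_cancel_right₀ (fun h0 => ?_) _
      have h3 : Real.log ‖ζ‖ = 0 := by rw [← Complex.log_re, h0, Complex.zero_re]
      have h4 : 0 < ‖ζ‖ := norm_pos_iff.2 hζ.2
      have h5 : ‖ζ‖ < 1 := by simpa using hb
      exact absurd h3 (Real.log_neg h4 h5).ne
  have hψ0 : ∀ᶠ ζ in 𝓝[punctH] (0 : ℂ), ψ ζ ≠ 0 := by
    rcases hlim with ⟨-, hl⟩ | ⟨-, hl⟩
    · filter_upwards [hl.eventually_ne hk] with ζ hζ h0
      simp [h0] at hζ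
    · filter_upwards [hl.eventually_ne hk] with ζ hζ h0
      simp [h0] at hζ
  refine ⟨mkGL 0 1 1 0 (by simp) * g, fun ζ => (ψ ζ)⁻¹, k, hk, ?_, ?_, hzero, hlim⟩
  · filter_upwards [hψ0, hmem, ball_mem_nhdsWithin_zero hr _] with ζ h0 hζ hb using
      (hψc ζ hζ hb).inv₀ h0
  · have hsub := nhdsWithin_mono (0 : ℂ) im_pos_subset_punctH
    filter_upwards [hsub hψ0, self_mem_nhdsWithin, ball_mem_nhdsWithin_zero hr _] with ζ h0 hζ hb hw
    rw [smul_vr _ hw, mul_smul, hg ζ ⟨hb, hζ⟩, ← hψeq ζ (im_pos_subset_punctH hζ)]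
    have hy0 : ζ ^ ρ * h ζ ≠ 0 := mul_ne_zero (by
      rw [Ne, Complex.cpow_eq_zero_iff]; exact fun h => ne_zero_of_im_pos hζ h.1) (hh0 ζ hb)
    have e1 : mkGL 0 1 1 0 (by simp) • (ζ ^ ρ * h ζ) • ![ψ ζ, 1] =
        (ζ ^ ρ * h ζ * ψ ζ) • ![(ψ ζ)⁻¹, 1] := by
      ext i
      fin_cases i
      · simp only [Fin.zero_eta, Fin.isValue]
        rw [GL_smul_zero_apply]
        simp
        field_simp
      · simp only [Fin.mk_one, Fin.isValue]
        rw [GL_smul_one_apply]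
        simp
    rw [e1, vr_smul_of_ne_zero (mul_ne_zero hy0 h0), vr_coe]

/-- A continuous extension of the ratio has the angle `κ` at a corner. -/
lemma HasCornerForm.hasAngle (h : HasCornerForm w c κ ρ) (hκ : 0 ≤ κ)
    (hw : ∀ z : ℂ, 0 < z.im → w z ≠ 0) (hf : IsBoundaryExtension w f) : HasAngle f c κ := by
  obtain ⟨g, Ψ, k, hk, hΨc, hΨ, hΨ0, hlim⟩ := h.exists_asymptotics hκ
  have hΨf : ∀ᶠ ζ in 𝓝[{ζ : ℂ | 0 < ζ.im}] (0 : ℂ),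
      g • f (localParam c ζ : OnePoint ℂ) = (Ψ ζ : OnePoint ℂ) := by
    filter_upwards [hΨ, self_mem_nhdsWithin] with ζ hζ hp
    rw [hf.2 _ (localParam_im_pos c hp)]
    exact hζ (hw _ (localParam_im_pos c hp))
  refine ⟨g, Ψ, k, hk, ?_, ?_, hlim⟩
  · have hne := nhdsWithin_im_pos_neBot (z := 0) (by simp)
    have hsub := nhdsWithin_mono (0 : ℂ) im_pos_subset_punctH
    have hbm : bdry c ∈ closedH := by
      induction c using OnePoint.rec with
      | infty => exact Or.inl rfl
      | coe y => exact coe_mem_closedH (z := (y : ℂ)) (by simp)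
    have t1 := (continuous_mobius g).continuousAt.tendsto.comp
      ((hf.1 _ hbm).tendsto.comp ((tendsto_localParam c).mono_left hsub))
    have t2 : Tendsto (fun ζ => (Ψ ζ : OnePoint ℂ)) (𝓝[{ζ : ℂ | 0 < ζ.im}] 0)
        (𝓝 ((0 : ℂ) : OnePoint ℂ)) :=
      (OnePoint.continuous_coe.tendsto 0).comp (hΨ0.mono_left hsub)
    exact tendsto_nhds_unique t1 (t2.congr' (hΨf.mono fun ζ hζ => hζ.symm))
  · obtain ⟨r, hr, hb⟩ := Metric.mem_nhdsWithin_iff.1 hΨf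
    filter_upwards [hΨc, self_mem_nhdsWithin, ball_mem_nhdsWithin_zero hr _] with ζ hc hζ hζb
    have hne := nhdsWithin_im_pos_neBot (z := ζ) hζ.1
    have hsub : 𝓝[{ζ : ℂ | 0 < ζ.im}] ζ ≤ 𝓝[{ζ : ℂ | 0 ≤ ζ.im}] ζ :=
      nhdsWithin_mono _ fun ζ (hζ : 0 < ζ.im) => hζ.le
    have t1 := (continuous_mobius g).continuousAt.tendsto.comp
      ((hf.1 _ (coe_mem_closedH (localParam_im_nonneg c hζ.1))).tendsto.comp
        ((tendsto_localParam_of_ne_zero c hζ).mono_left hsub))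
    have t2 : Tendsto (fun ζ => (Ψ ζ : OnePoint ℂ)) (𝓝[{ζ : ℂ | 0 < ζ.im}] ζ)
        (𝓝 (Ψ ζ : OnePoint ℂ)) :=
      (OnePoint.continuous_coe.continuousAt.comp hc).tendsto.mono_left nhdsWithin_le_nhds
    refine tendsto_nhds_unique t1 (t2.congr' ?_)
    filter_upwards [self_mem_nhdsWithin, nhdsWithin_le_nhds (Metric.isOpen_ball.mem_nhds hζb)]
      with ζ' h1 h2
    exact (hb ⟨h2, h1⟩).symm

/-- The ratio of the solutions has a continuous extension to the closure of the upper half-plane. -/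
lemma Extendable.exists_boundaryExtension {V : Set ℝ} (hw : Extendable V w)
    (hV : ∀ c, IsCorner V c → ∃ κ ρ, 0 ≤ κ ∧ HasCornerForm w c κ ρ) :
    ∃ f, IsBoundaryExtension w f := by
  set f₀ : OnePoint ℂ → OnePoint ℂ := fun p => p.elim ∞ fun z => vr (w z) with hf₀
  have hcl : closedH ⊆ closure openH := by
    have h1 : ∀ c, bdry c ∈ closure openH := fun c => by
      rw [mem_closure_iff_nhdsWithin_neBot, nhdsWithin_openH_bdry]
      have := nhdsWithin_im_pos_neBot (z := 0) (by simp)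
      exact this.map _
    rintro p (rfl | ⟨z, hz, rfl⟩)
    · exact h1 ∞
    · have h2 : (0 : ℝ) ≤ z.im := hz
      rcases h2.lt_or_eq with h | h
      · exact subset_closure ⟨z, h, rfl⟩
      · have := h1 (z.re : ℝ)
        have e : ((z.re : ℝ) : ℂ) = z := Complex.ext rfl (by simpa using h)
        change ((z.re : ℂ) : OnePoint ℂ) ∈ _ at this
        rwa [e] at this
  -- The limit at an interior point or at a regular boundary point, where `w` extends to `φ`.
  have hint : ∀ (φ : ℂ → Fin 2 → ℂ) (z : ℂ), ContinuousAt φ z → φ z ≠ 0 →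
      (∀ᶠ z' in 𝓝 z, 0 < z'.im → φ z' = w z') →
      Tendsto f₀ (𝓝[openH] (z : OnePoint ℂ)) (𝓝 (vr (φ z))) := by
    intro φ z hφ h0 hw
    rw [nhdsWithin_openH, OnePoint.comap_coe_nhds, tendsto_map'_iff]
    have h1 : Tendsto (fun z => vr (φ z)) (𝓝 z) (𝓝 (vr (φ z))) :=
      (continuousAt_vr h0).tendsto.comp hφ
    refine (h1.mono_left inf_le_right).congr' ?_
    filter_upwards [mem_inf_of_left (mem_principal_self _), mem_inf_of_right hw] with z' h1 h2
    change vr (φ z') = vr (w z')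
    rw [h2 h1]
  have hcorner : ∀ c, IsCorner V c → ∃ p, Tendsto f₀ (𝓝[openH] (bdry c)) (𝓝 p) := by
    intro c hc
    obtain ⟨κ, ρ, hκ, hform⟩ := hV c hc
    obtain ⟨g, Ψ, k, hk, hΨc, hΨ, hΨ0, hlim⟩ := hform.exists_asymptotics hκ
    refine ⟨g⁻¹ • ((0 : ℂ) : OnePoint ℂ), ?_⟩
    rw [nhdsWithin_openH_bdry, tendsto_map'_iff]
    have hsub := nhdsWithin_mono (0 : ℂ) im_pos_subset_punctH
    have t2 := (continuous_mobius g⁻¹).continuousAt.tendsto.comp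
      ((OnePoint.continuous_coe.tendsto 0).comp (hΨ0.mono_left hsub))
    refine t2.congr' ?_
    filter_upwards [hΨ, self_mem_nhdsWithin] with ζ hζ hp
    have h1 := hζ (hw.ne_zero _ (localParam_im_pos c hp))
    simp only [Function.comp]
    rw [← h1, inv_smul_smul]
    rfl
  have hlim : ∀ p ∈ closedH, ∃ l, Tendsto f₀ (𝓝[openH] p) (𝓝 l) := by
    rintro p (rfl | ⟨z, hz, rfl⟩)
    · exact hcorner ∞ trivial
    · have h2 : (0 : ℝ) ≤ z.im := hz
      rcases h2.lt_or_eq with h | h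
      · exact ⟨_, hint w z (hw.analytic z h).continuousAt (hw.ne_zero z h)
          (Eventually.of_forall fun _ _ => rfl)⟩
      · have e : ((z.re : ℝ) : ℂ) = z := Complex.ext rfl (by simpa using h)
        by_cases hV : z.re ∈ V
        · obtain ⟨l, hl⟩ := hcorner (z.re : ℝ) hV
          refine ⟨l, ?_⟩
          change Tendsto f₀ (𝓝[openH] ((z.re : ℂ) : OnePoint ℂ)) _ at hl
          rwa [e] at hl
        · obtain ⟨M, r, hr, φ, hφ, hφw, -⟩ := hw.cross _ hV
          rw [e] at hφ hφw
          refine ⟨_, hint φ z (hφ z (Metric.mem_ball_self hr)).1.continuousAt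
            (hφ z (Metric.mem_ball_self hr)).2 ?_⟩
          filter_upwards [Metric.ball_mem_nhds z hr] with z' hz' hp using hφw z' hz' hp
  refine ⟨extendFrom openH f₀, continuousOn_extendFrom hcl hlim, fun z hz => ?_⟩
  exact extendFrom_eq (hcl (coe_mem_closedH hz.le))
    (hint w z (hw.analytic z hz).continuousAt (hw.ne_zero z hz)
      (Eventually.of_forall fun _ _ => rfl))

/-- The ratio of two functions with a Wronskian that does not vanish is conformal. -/
lemma IsBoundaryExtension.conformalAt (hf : IsBoundaryExtension w f) {φ : ℂ → Fin 2 → ℂ} {z : ℂ}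
    {U : Set ℂ} (hU : IsOpen U) (hzU : z ∈ U) (hφ : ∀ z ∈ U, AnalyticAt ℂ φ z)
    (hW : ∀ z ∈ U, wr φ z ≠ 0) (hw : ∀ z ∈ U, 0 < z.im → φ z = w z) : ConformalAt f z := by
  obtain ⟨g, hg⟩ : ∃ g : GL (Fin 2) ℂ, (g • φ z) 1 ≠ 0 := by
    rcases (vec_ne_zero_iff _).1 (ne_zero_of_wr_ne_zero (hW z hzU)) with h | h
    · exact ⟨mkGL 0 1 1 0 (by simp), by rw [GL_smul_one_apply]; simpa using h⟩
    · exact ⟨1, by simpa using h⟩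
  have ha := analyticAt_pi_iff.1 ((hφ z hzU).GL_smul g)
  refine ⟨g, fun z => (g • φ z) 0 / (g • φ z) 1, (ha 0).div (ha 1) hg, ?_, ?_⟩
  · have h1 := (ha 0).differentiableAt.hasDerivAt.div (ha 1).differentiableAt.hasDerivAt hg
    have h2 := wr_GL_smul (hφ z hzU) g
    rw [wr] at h2
    refine (h1.deriv.trans_ne ?_)
    rw [h2]
    exact div_ne_zero (mul_ne_zero (GL_det_ne_zero g) (hW z hzU)) (pow_ne_zero 2 hg)
  · filter_upwards [self_mem_nhdsWithin, nhdsWithin_le_nhds (hU.mem_nhds hzU),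
      nhdsWithin_le_nhds ((ha 1).continuousAt.eventually_ne hg)] with z' h0 h1 h2
    have h3 := ne_zero_of_wr_ne_zero (hW z' h1)
    have h4 : f (z' : OnePoint ℂ) = vr (φ z') :=
      hf.eq_vr h0 (hφ z' h1).continuousAt h3 (by
        filter_upwards [hU.mem_nhds h1] with z hz hp using hw z hz hp)
    rw [h4, smul_vr _ h3, vr, ratio, if_neg h2]

end

namespace FuchsEquation
variable {E : FuchsEquation}

lemma isCorner_cases {c : OnePoint ℝ} (hc : IsCorner {0, 1, E.x, E.q} c) :
    (∃ j, c = corner E.x j) ∨ c = (E.q : OnePoint ℝ) := by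
  induction c using OnePoint.rec with
  | infty => exact Or.inl ⟨3, rfl⟩
  | coe y =>
    have hc' : y = 0 ∨ y = 1 ∨ y = E.x ∨ y = E.q := hc
    rcases hc' with rfl | rfl | rfl | rfl
    · exact Or.inl ⟨0, rfl⟩
    · exact Or.inl ⟨1, rfl⟩
    · exact Or.inl ⟨2, rfl⟩
    · exact Or.inr rfl

/-- The ratio of two solutions is the developing map of a pentagon with a slit at `q`: the corner forms
give the angles, the crossings give the circles, and at the apparent singularity `q` the two circles
coincide. -/
lemma IsFundamentalPair.isSlitPentagon (hE : E.Admissible) {w₁ w₂ : ℂ → ℂ}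
    (h : E.IsFundamentalPair w₁ w₂) (hR : E.RegularAtInfinity)
    (ha : E.IsApparentAt (E.q : OnePoint ℝ)) :
    ∃ f, IsSlitPentagon E.κ E.x E.q f ∧ IsBoundaryExtension (fun z => ![w₁ z, w₂ z]) f := by
  have hext := h.extendable
  have hforms : ∀ c, IsCorner {0, 1, E.x, E.q} c →
      ∃ κ ρ, 0 ≤ κ ∧ HasCornerForm (fun z => ![w₁ z, w₂ z]) c κ ρ := by
    intro c hc
    rcases isCorner_cases hc with ⟨j, rfl⟩ | rfl
    · obtain ⟨ρ, hρ⟩ := h.hasCornerForm hE hR j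
      exact ⟨_, ρ, hE.κ_nonneg j, hρ⟩
    · exact ⟨2, 2, zero_le_two, h.hasCornerForm_q hE⟩
  obtain ⟨f, hf⟩ := hext.exists_boundaryExtension hforms
  refine ⟨f, ⟨⟨hf.1, fun z hz hV => ?_, fun c hc => ?_, fun c hc => ?_⟩, fun j => ?_, ?_, ?_⟩, hf⟩
  · rcases hz.lt_or_eq with hz | hz
    · exact hf.conformalAt isOpen_im_pos hz (fun z hz => hext.analytic z hz)
        (fun z hz => h.wr_ne_zero hz) fun _ _ _ => rfl
    · have e : ((z.re : ℝ) : ℂ) = z := Complex.ext rfl (by simpa using hz)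
      have hn : z.re ∉ Set.range E.τ := by
        rw [range_τ]
        exact fun hm => hV _ hm e.symm
      obtain ⟨r, hr, φ, hφ, hWφ, hφw⟩ := h.solvesV.exists_extension
        (fun z hz => h.wr_ne_zero hz) hn
      rw [e] at hφ hWφ hφw
      exact hf.conformalAt Metric.isOpen_ball (Metric.mem_ball_self hr)
        (fun z hz => hφ.analyticAt Metric.isOpen_ball hz) hWφ hφw
  · obtain ⟨κ, ρ, hκ, hform⟩ := hforms c hc
    exact ⟨κ, hform.hasAngle hκ hext.ne_zero hf⟩
  · obtain ⟨y, hy⟩ := sideBefore_nonempty (finite_singular 0 1 E.x E.q) c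
    obtain ⟨M, hM⟩ := hext.cross y (notMem_of_mem_sideBefore hy)
    exact ⟨_, ⟨antiMob M, hext.isReflection_antiMob hf hM, rfl⟩,
      hext.fixes_sideBefore subset_rfl hf hy hM⟩
  · obtain ⟨ρ, hρ⟩ := h.hasCornerForm hE hR j
    exact hρ.hasAngle (hE.κ_nonneg j) hext.ne_zero hf
  · exact (h.hasCornerForm_q hE).hasAngle zero_le_two hext.ne_zero hf
  · exact (h.isApparentAt_iff hf _).1 ha

end FuchsEquation

/-! ### The monodromy group of the equation -/

namespace FuchsEquation
variable {E : FuchsEquation}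

/-- The projective monodromy of the ratio of two solutions. -/
lemma IsFundamentalPair.monodromy (hE : E.Admissible) {w₁ w₂ : ℂ → ℂ}
    (h : E.IsFundamentalPair w₁ w₂) (ha : E.IsApparentAt (E.q : OnePoint ℝ))
    {f : OnePoint ℂ → OnePoint ℂ} (hf : IsBoundaryExtension (fun z => ![w₁ z, w₂ z]) f) {x₀ : ℂ}
    (hx₀ : 0 < x₀.im) :
    (∀ γ : Path x₀ x₀, (∀ s, ∀ v ∈ ({0, 1, E.x} : Set ℝ), γ s ≠ (v : ℂ)) →
      ∃! T, IsProjMonodromy w₁ w₂ γ T) ∧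
    projMonodromyGroup {0, 1, E.x} w₁ w₂ x₀ = evenProducts {0, 1, E.x, E.q} f ∧
    (GeneratorsNontrivial E.x w₁ w₂ x₀ ↔
      ∀ j, ¬ SameCircleAt {0, 1, E.x, E.q} f (corner E.x j)) := by
  -- The solutions are continued through `q`, so the loops have to avoid only `0`, `1` and `x`, whereas
  -- the sides of the pentagon also end at `q`.
  have hext := h.extendable_of_isApparentAt hE ha
  have hV : ({0, 1, E.x} : Set ℝ) ⊆ {0, 1, E.x, E.q} := by
    intro y hy
    simp only [Set.mem_insert_iff, Set.mem_singleton_iff] at hy ⊢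
    tauto
  have hVf := finite_singular 0 1 E.x E.q
  exact ⟨fun γ hγ => hext.existsUnique_projMonodromy hx₀ γ hγ,
    hext.projMonodromyGroup_eq hV hVf hf hx₀,
    forall_congr' fun j => hext.exists_loopAround_ne_one_iff hV hVf hf hx₀ _⟩

end FuchsEquation

/-! ### The Schwarzian derivative -/

/-- The Schwarzian derivative `N' - N² / 2`, where `N = F'' / F'`. -/
noncomputable def sch (F : ℂ → ℂ) (z : ℂ) : ℂ :=
  deriv (fun z => deriv (deriv F) z / deriv F z) z - (deriv (deriv F) z / deriv F z) ^ 2 / 2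

lemma sch_congr {F G : ℂ → ℂ} {z : ℂ} (h : F =ᶠ[𝓝 z] G) : sch F z = sch G z := by
  have h1 := h.deriv
  have h2 := h1.deriv
  have h3 : (fun z => deriv (deriv F) z / deriv F z) =ᶠ[𝓝 z]
      fun z => deriv (deriv G) z / deriv G z := by
    filter_upwards [h1, h2] with z h1 h2
    rw [h1, h2]
  rw [sch, sch, h3.deriv_eq, h1.eq_of_nhds, h2.eq_of_nhds]

lemma sch_sharp (F : ℂ → ℂ) (z : ℂ) : sch (sharp F) z = conj (sch F (conj z)) := by
  have e : (fun z => deriv (deriv (sharp F)) z / deriv (sharp F) z) =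
      sharp fun z => deriv (deriv F) z / deriv F z := by
    ext z
    rw [deriv_sharp, deriv_sharp]
    simp [sharp]
  have e' := congrFun e z
  rw [sch, e', e, deriv_sharp]
  simp [sch, sharp, map_ofNat]

lemma AnalyticAt.sch {F : ℂ → ℂ} {z : ℂ} (hF : AnalyticAt ℂ F z) (h0 : deriv F z ≠ 0) :
    AnalyticAt ℂ (sch F) z := by
  have h := hF.deriv.deriv.div hF.deriv h0
  exact h.deriv.sub ((h.pow 2).div_const)

/-- The Schwarzian derivative is invariant under linear-fractional transformations. -/
lemma sch_mobius {F : ℂ → ℂ} {z a b c d : ℂ} (hF : AnalyticAt ℂ F z) (h0 : deriv F z ≠ 0)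
    (hden : c * F z + d ≠ 0) (hdet : a * d - b * c ≠ 0) :
    sch (fun z => (a * F z + b) / (c * F z + d)) z = sch F z := by
  set G : ℂ → ℂ := fun z => (a * F z + b) / (c * F z + d)
  have hev : ∀ᶠ z in 𝓝 z, AnalyticAt ℂ F z ∧ deriv F z ≠ 0 ∧ c * F z + d ≠ 0 :=
    hF.eventually_analyticAt.and ((hF.deriv.continuousAt.eventually_ne h0).and
      (((hF.continuousAt.const_mul c).add continuousAt_const).eventually_ne hden))
  have hG1 : ∀ z, AnalyticAt ℂ F z → c * F z + d ≠ 0 →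
      deriv G z = (a * d - b * c) * deriv F z / (c * F z + d) ^ 2 := by
    intro z hz hne
    have hF1 := hz.differentiableAt.hasDerivAt
    have := (((hF1.const_mul a).add_const b).div ((hF1.const_mul c).add_const d) hne).deriv
    refine this.trans ?_
    congr 1
    ring
  have hN : (fun z => deriv (deriv G) z / deriv G z) =ᶠ[𝓝 z]
      fun z => deriv (deriv F) z / deriv F z - 2 * c * (deriv F z / (c * F z + d)) := by
    filter_upwards [hev.eventually_nhds] with z hz
    obtain ⟨z1, z2, z3⟩ := hz.self_of_nhds
    have e : deriv G =ᶠ[𝓝 z] fun z => (a * d - b * c) * deriv F z / (c * F z + d) ^ 2 := by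
      filter_upwards [hz] with z hz using hG1 z hz.1 hz.2.2
    have hF1 := z1.differentiableAt.hasDerivAt
    have hF2 := z1.deriv.differentiableAt.hasDerivAt
    have h2 := ((hF2.const_mul (a * d - b * c)).div (((hF1.const_mul c).add_const d).pow 2)
      (pow_ne_zero 2 z3)).deriv
    have h3 : deriv (deriv G) z = _ := e.deriv_eq.trans h2
    rw [h3, hG1 z z1 z3]
    simp only [Pi.pow_apply]
    field_simp
    ring
  have hF1 := hF.differentiableAt.hasDerivAt
  have hF2 := hF.deriv.differentiableAt.hasDerivAt
  have hNd := (hF.deriv.deriv.div hF.deriv h0).differentiableAt.hasDerivAt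
  have hd : deriv (fun z => deriv (deriv F) z / deriv F z - 2 * c * (deriv F z / (c * F z + d))) z =
      deriv (fun z => deriv (deriv F) z / deriv F z) z -
      2 * c * ((deriv (deriv F) z * (c * F z + d) - deriv F z * (c * deriv F z)) /
        (c * F z + d) ^ 2) :=
    (hNd.sub ((hF2.div ((hF1.const_mul c).add_const d) hden).const_mul (2 * c))).deriv
  rw [sch, hN.deriv_eq, hN.eq_of_nhds, hd, sch]
  field_simp
  ring

lemma coe_eq_mobius_iff (m : GL (Fin 2) ℂ) (a b : ℂ) :
    (a : OnePoint ℂ) = m • (b : OnePoint ℂ) ↔ a * (m 1 0 * b + m 1 1) = m 0 0 * b + m 0 1 := by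
  have hv : ![b, 1] ≠ 0 := fun h => by simpa using congrFun h 1
  rw [← vr_coe, ← vr_coe, smul_vr _ hv, vr_eq_iff (fun h => by simpa using congrFun h 1)
    (GL_smul_ne_zero hv)]
  simp

/-- The denominator of a linear-fractional transformation does not vanish where the value is finite. -/
lemma den_ne_zero_of_coe_eq {m : GL (Fin 2) ℂ} {a b : ℂ}
    (h : (a : OnePoint ℂ) = m • (b : OnePoint ℂ)) : m 1 0 * b + m 1 1 ≠ 0 := by
  rw [coe_eq_mobius_iff] at h
  intro h0
  rw [h0, mul_zero] at h
  apply GL_det_ne_zero m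
  by_cases h2 : m 1 0 = 0
  · have h3 : m 1 1 = 0 := by rw [h2] at h0; simpa using h0
    rw [h2, h3]; ring
  · have : m 1 0 * (m 0 0 * m 1 1 - m 0 1 * m 1 0) = 0 := by
      linear_combination (m 0 0 * m 1 0) * h0 - (m 1 0 * m 1 0) * h.symm
    exact (mul_eq_zero.1 this).resolve_left h2

/-- If `F` is a linear-fractional transform of `G`, at infinitely many points near `z`, then they
have the same Schwarzian derivative. -/
lemma sch_eq_of_frequently {F G : ℂ → ℂ} {z : ℂ} (hF : AnalyticAt ℂ F z) (hG : AnalyticAt ℂ G z)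
    (hG' : deriv G z ≠ 0) (m : GL (Fin 2) ℂ)
    (h : ∃ᶠ z' in 𝓝[≠] z, (F z' : OnePoint ℂ) = m • (G z' : OnePoint ℂ)) :
    ∀ᶠ z' in 𝓝 z, sch F z' = sch G z' := by
  have hdet := GL_det_ne_zero m
  have hrel : ∀ᶠ z' in 𝓝 z, F z' * (m 1 0 * G z' + m 1 1) = m 0 0 * G z' + m 0 1 := by
    refine (AnalyticAt.frequently_eq_iff_eventually_eq
      (hF.mul ((analyticAt_const.mul hG).add analyticAt_const))
      ((analyticAt_const.mul hG).add analyticAt_const)).1 (h.mono fun z' hz' => ?_)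
    exact (coe_eq_mobius_iff _ _ _).1 hz'
  have hne : m 1 0 * G z + m 1 1 ≠ 0 :=
    den_ne_zero_of_coe_eq ((coe_eq_mobius_iff _ _ _).2 hrel.self_of_nhds)
  have hne' : ∀ᶠ z' in 𝓝 z, m 1 0 * G z' + m 1 1 ≠ 0 :=
    ((hG.continuousAt.const_mul _).add continuousAt_const).eventually_ne hne
  have hFG : F =ᶠ[𝓝 z] fun z => (m 0 0 * G z + m 0 1) / (m 1 0 * G z + m 1 1) := by
    filter_upwards [hrel, hne'] with z' h1 h2
    rw [eq_div_iff h2, h1]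
  filter_upwards [hFG.eventually_nhds, hne', hG.eventually_analyticAt,
    hG.deriv.continuousAt.eventually_ne hG'] with z' h1 h2 h3 h4
  rw [sch_congr h1, sch_mobius h3 h4 h2 hdet]

/-- The chain rule for the Schwarzian derivative. The local parameter is a linear-fractional function, so
its own Schwarzian derivative does not contribute. -/
lemma sch_comp_localParam (c : OnePoint ℝ) {F : ℂ → ℂ} {ζ : ℂ} (h0 : ζ ≠ 0)
    (hF : AnalyticAt ℂ F (localParam c ζ)) (hF' : deriv F (localParam c ζ) ≠ 0) :
    sch (fun ζ => F (localParam c ζ)) ζ =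
      (deriv (localParam c) ζ) ^ 2 * sch F (localParam c ζ) := by
  induction c using OnePoint.rec with
  | coe y =>
    have e : ∀ G : ℂ → ℂ, deriv (fun ζ => G (y + ζ)) = fun ζ => deriv G (y + ζ) := fun G => by
      ext ζ; exact deriv_comp_const_add G _ ζ
    have e1 : deriv (localParam (y : OnePoint ℝ)) ζ = 1 := (hasDerivAt_localParam y h0).deriv
    rw [e1, one_pow, one_mul]
    change sch (fun ζ => F (y + ζ)) ζ = sch F (y + ζ)
    simp only [sch, e]
    rw [deriv_comp_const_add (fun z => deriv (deriv F) z / deriv F z)]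
  | infty =>
    have hm : ∀ ζ : ℂ, ζ ≠ 0 → HasDerivAt (localParam ∞) ((ζ ^ 2)⁻¹) ζ := fun ζ h =>
      hasDerivAt_localParam ∞ h
    set m := localParam ∞
    rw [(hm ζ h0).deriv]
    have hev : ∀ᶠ ζ' in 𝓝 ζ, ζ' ≠ 0 ∧ AnalyticAt ℂ F (m ζ') ∧ deriv F (m ζ') ≠ 0 :=
      (eventually_ne_nhds h0).and ((hm ζ h0).continuousAt.eventually
        (hF.eventually_analyticAt.and (hF.deriv.continuousAt.eventually_ne hF')))
    have d1 : ∀ ζ, ζ ≠ 0 → AnalyticAt ℂ F (m ζ) →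
        deriv (fun ζ => F (m ζ)) ζ = deriv F (m ζ) * (ζ ^ 2)⁻¹ := fun ζ h1 h2 =>
      (h2.differentiableAt.hasDerivAt.comp ζ (hm ζ h1)).deriv
    have i2 : ∀ ζ : ℂ, ζ ≠ 0 → HasDerivAt (fun ζ : ℂ => (ζ ^ 2)⁻¹) (-2 / ζ ^ 3) ζ := by
      intro ζ h0
      have := ((hasDerivAt_pow 2 ζ).inv (pow_ne_zero 2 h0))
      convert! this using 1
      field_simp
      ring
    have hN : (fun ζ => deriv (deriv fun ζ => F (m ζ)) ζ / deriv (fun ζ => F (m ζ)) ζ) =ᶠ[𝓝 ζ]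
        fun ζ => deriv (deriv F) (m ζ) / deriv F (m ζ) * (ζ ^ 2)⁻¹ - 2 * ζ⁻¹ := by
      filter_upwards [hev.eventually_nhds] with ζ hζ
      obtain ⟨z1, z2, z3⟩ := hζ.self_of_nhds
      have e : (deriv fun ζ => F (m ζ)) =ᶠ[𝓝 ζ] fun ζ => deriv F (m ζ) * (ζ ^ 2)⁻¹ := by
        filter_upwards [hζ] with ζ hζ using d1 ζ hζ.1 hζ.2.1
      have h2 : deriv (fun ζ => deriv F (m ζ) * (ζ ^ 2)⁻¹) ζ =
          deriv (deriv F) (m ζ) * (ζ ^ 2)⁻¹ * (ζ ^ 2)⁻¹ + deriv F (m ζ) * (-2 / ζ ^ 3) :=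
        ((z2.deriv.differentiableAt.hasDerivAt.comp ζ (hm ζ z1)).mul (i2 ζ z1)).deriv
      rw [e.deriv_eq, h2, d1 ζ z1 z2]
      field_simp
      ring
    have hNd := (hF.deriv.deriv.div hF.deriv hF').differentiableAt.hasDerivAt
    have hd : deriv (fun ζ => deriv (deriv F) (m ζ) / deriv F (m ζ) * (ζ ^ 2)⁻¹ - 2 * ζ⁻¹) ζ =
        deriv (fun z => deriv (deriv F) z / deriv F z) (m ζ) * (ζ ^ 2)⁻¹ * (ζ ^ 2)⁻¹ +
        deriv (deriv F) (m ζ) / deriv F (m ζ) * (-2 / ζ ^ 3) - 2 * (-(ζ ^ 2)⁻¹) :=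
      (((hNd.comp ζ (hm ζ h0)).mul (i2 ζ h0)).sub ((hasDerivAt_inv h0).const_mul 2)).deriv
    rw [sch, hN.deriv_eq, hN.eq_of_nhds, hd, sch]
    field_simp
    ring

/-! ### The Schwarzian derivative of a developing map -/

/-- `F` is an analytic extension to a neighbourhood of `z` of the function `φ`, given in the closed
upper half-plane, in the coordinate `g` of the sphere, and it is conformal. -/
def IsChart (φ : ℂ → OnePoint ℂ) (z : ℂ) (g : GL (Fin 2) ℂ) (F : ℂ → ℂ) : Prop :=
  AnalyticAt ℂ F z ∧ deriv F z ≠ 0 ∧ ∀ᶠ w : ℂ in 𝓝[{w : ℂ | 0 ≤ w.im}] z, g • φ w = (F w : OnePoint ℂ)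

open Classical in
/-- The Schwarzian derivative of a map into the sphere, computed in any of its charts. -/
noncomputable def schw (φ : ℂ → OnePoint ℂ) (z : ℂ) : ℂ :=
  if h : ∃ g F, IsChart φ z g F then sch h.choose_spec.choose z else 0

section Charts
variable {φ : ℂ → OnePoint ℂ} {z : ℂ} {g g' : GL (Fin 2) ℂ} {F F' : ℂ → ℂ}

lemma frequently_of_eventually_nhdsWithin {p : ℂ → Prop} (hz : 0 ≤ z.im)
    (h : ∀ᶠ w : ℂ in 𝓝[{w : ℂ | 0 ≤ w.im}] z, p w) : ∃ᶠ w in 𝓝[≠] z, p w := by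
  rw [eventually_nhdsWithin_iff] at h
  refine ((frequently_im_pos hz).and_eventually (nhdsWithin_le_nhds h)).mono ?_
  rintro w ⟨h1, h2⟩
  exact h2 (le_of_lt h1)

lemma IsChart.sch_eq (h : IsChart φ z g F) (h' : IsChart φ z g' F') (hz : 0 ≤ z.im) :
    sch F z = sch F' z := by
  refine (sch_eq_of_frequently h.1 h'.1 h'.2.1 (g * g'⁻¹) ?_).self_of_nhds
  refine frequently_of_eventually_nhdsWithin hz ?_
  filter_upwards [h.2.2, h'.2.2] with w h1 h2
  rw [← h1, ← h2, mul_smul, inv_smul_smul]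

lemma IsChart.schw_eq (h : IsChart φ z g F) (hz : 0 ≤ z.im) : schw φ z = sch F z := by
  have hex : ∃ g F, IsChart φ z g F := ⟨g, F, h⟩
  rw [schw, dif_pos hex]
  exact hex.choose_spec.choose_spec.sch_eq h hz

lemma IsChart.eventually (h : IsChart φ z g F) :
    ∀ᶠ w in 𝓝[{w : ℂ | 0 ≤ w.im}] z, IsChart φ w g F := by
  filter_upwards [nhdsWithin_le_nhds h.1.eventually_analyticAt,
    nhdsWithin_le_nhds (h.1.deriv.continuousAt.eventually_ne h.2.1),
    eventually_eventually_nhdsWithin.2 h.2.2] with w h1 h2 h3 using ⟨h1, h2, h3⟩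

lemma IsChart.eventually_schw (h : IsChart φ z g F) :
    ∀ᶠ w in 𝓝[{w : ℂ | 0 ≤ w.im}] z, schw φ w = sch F w := by
  filter_upwards [h.eventually, self_mem_nhdsWithin] with w h1 h2 using h1.schw_eq h2

lemma IsChart.apply_self (h : IsChart φ z g F) (hz : 0 ≤ z.im) : g • φ z = (F z : OnePoint ℂ) :=
  h.2.2.self_of_nhdsWithin hz

lemma IsChart.comp_localParam {f : OnePoint ℂ → OnePoint ℂ} {c : OnePoint ℝ} {ζ : ℂ}
    (hζ : ζ ∈ punctH) (h : IsChart (fun z => f z) (localParam c ζ) g F) :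
    IsChart (fun ζ => f (localParam c ζ)) ζ g fun ζ => F (localParam c ζ) := by
  have hm := analyticAt_localParam c hζ.2
  refine ⟨h.1.comp hm, ?_, ?_⟩
  · have h1 := (h.1.differentiableAt.hasDerivAt.comp ζ (hasDerivAt_localParam c hζ.2)).deriv
    refine h1.trans_ne (mul_ne_zero h.2.1 ?_)
    induction c using OnePoint.rec with
    | infty => exact inv_ne_zero (pow_ne_zero 2 hζ.2)
    | coe y => exact one_ne_zero
  · have ht : Tendsto (localParam c) (𝓝[{w : ℂ | 0 ≤ w.im}] ζ)
        (𝓝[{w : ℂ | 0 ≤ w.im}] (localParam c ζ)) :=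
      tendsto_nhdsWithin_iff.2 ⟨hm.continuousAt.tendsto.mono_left nhdsWithin_le_nhds, by
        filter_upwards [self_mem_nhdsWithin] with w hw using localParam_im_nonneg c hw⟩
    exact ht.eventually h.2.2

lemma schw_comp_localParam {f : OnePoint ℂ → OnePoint ℂ} {c : OnePoint ℝ} {ζ : ℂ}
    (hζ : ζ ∈ punctH) (h : ∃ g F, IsChart (fun z => f z) (localParam c ζ) g F) :
    schw (fun ζ => f (localParam c ζ)) ζ =
      deriv (localParam c) ζ ^ 2 * schw (fun z => f z) (localParam c ζ) := by
  obtain ⟨g, F, h⟩ := h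
  rw [(h.comp_localParam hζ).schw_eq hζ.1, h.schw_eq (localParam_im_nonneg c hζ.1),
    sch_comp_localParam c hζ.2 h.1 h.2.1]

/-- If `φ` takes finite values in the coordinate `g'`, there is a chart in this coordinate. -/
lemma IsChart.change (h : IsChart φ z g F) (hz : 0 ≤ z.im) (g' : GL (Fin 2) ℂ) {a : ℂ}
    (ha : g' • φ z = (a : OnePoint ℂ)) : ∃ F', IsChart φ z g' F' := by
  set m := g' * g⁻¹
  have hmg : ∀ p : OnePoint ℂ, g' • p = m • g • p := fun p => by
    rw [← mul_smul, inv_mul_cancel_right]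
  have h1 : (a : OnePoint ℂ) = m • (F z : OnePoint ℂ) := by
    rw [← ha, hmg, h.apply_self hz]
  have hne := den_ne_zero_of_coe_eq h1
  have hF := h.1.differentiableAt.hasDerivAt
  refine ⟨fun z => (m 0 0 * F z + m 0 1) / (m 1 0 * F z + m 1 1),
    ((analyticAt_const.mul h.1).add analyticAt_const).div
    ((analyticAt_const.mul h.1).add analyticAt_const) hne, ?_, ?_⟩
  · have := (((hF.const_mul (m 0 0)).add_const (m 0 1)).div
      ((hF.const_mul (m 1 0)).add_const (m 1 1)) hne).deriv
    refine this.trans_ne (div_ne_zero ?_ (pow_ne_zero 2 hne))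
    have e : m 0 0 * deriv F z * (m 1 0 * F z + m 1 1) -
        (m 0 0 * F z + m 0 1) * (m 1 0 * deriv F z) =
        (m 0 0 * m 1 1 - m 0 1 * m 1 0) * deriv F z := by ring
    rw [e]
    exact mul_ne_zero (GL_det_ne_zero m) h.2.1
  · have hne' : ∀ᶠ w in 𝓝 z, m 1 0 * F w + m 1 1 ≠ 0 :=
      ((h.1.continuousAt.const_mul _).add continuousAt_const).eventually_ne hne
    filter_upwards [h.2.2, nhdsWithin_le_nhds hne'] with w h1 h2
    rw [hmg, h1, eq_comm, coe_eq_mobius_iff, div_mul_cancel₀ _ h2]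

end Charts

/-- The Schwarzian derivative of a developing map, continued to the lower half-plane by
symmetry. -/
noncomputable def symSchw (f : OnePoint ℂ → OnePoint ℂ) (z : ℂ) : ℂ :=
  if 0 ≤ z.im then schw (fun z => f z) z else conj (schw (fun z => f z) (conj z))

section
variable {V : Set ℝ} {f : OnePoint ℂ → OnePoint ℂ}

lemma symSchw_of_nonneg {z : ℂ} (hz : 0 ≤ z.im) : symSchw f z = schw (fun z => f z) z := if_pos hz

/-- In the coordinate `g` of the sphere, a reflection is a linear-fractional function of the conjugate. -/
lemma IsReflection.exists_mobius {σ : Equiv.Perm (OnePoint ℂ)} (h : IsReflection σ)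
    (g : GL (Fin 2) ℂ) : ∃ m : GL (Fin 2) ℂ, ∀ (p : OnePoint ℂ) (a : ℂ), σ p = p →
      g • p = (a : OnePoint ℂ) → (a : OnePoint ℂ) = m • ((conj a : ℂ) : OnePoint ℂ) := by
  obtain ⟨A, hA⟩ := h.1
  refine ⟨g * A * conjGL g⁻¹, fun p a hp ha => ?_⟩
  have h1 : p = g⁻¹ • (a : OnePoint ℂ) := by rw [← ha, inv_smul_smul]
  rw [← conjS_coe, mul_smul, ← conjS_smul, ← h1, mul_smul, ← hA, hp, ha]

lemma IsDevelopingMap.exists_chart (hf : IsDevelopingMap V f) {z : ℂ} (hz : 0 ≤ z.im)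
    (hV : ∀ v ∈ V, z ≠ (v : ℂ)) : ∃ g F, IsChart (fun z => f z) z g F := hf.conformal z hz hV

lemma frequently_ofReal {y : ℝ} {p : ℂ → Prop} (h : ∀ᶠ y' : ℝ in 𝓝 y, p y') :
    ∃ᶠ z in 𝓝[≠] (y : ℂ), p z := by
  have t : Tendsto (fun y' : ℝ => (y' : ℂ)) (𝓝[≠] y) (𝓝[≠] (y : ℂ)) :=
    tendsto_nhdsWithin_iff.2 ⟨(Complex.continuous_ofReal.tendsto y).mono_left nhdsWithin_le_nhds, by
      filter_upwards [self_mem_nhdsWithin] with y' hy' h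
      exact hy' (Complex.ofReal_injective h)⟩
  exact t.frequently (Eventually.frequently (nhdsWithin_le_nhds h))

/-- A chart at a boundary point satisfies the reflection principle, so its Schwarzian derivative is
real on the real line. -/
lemma IsDevelopingMap.sch_eq_conj (hf : IsDevelopingMap V f) (hVf : V.Finite) {y : ℝ} (hy : y ∉ V)
    {g : GL (Fin 2) ℂ} {F : ℂ → ℂ} (h : IsChart (fun z => f z) y g F) :
    ∀ᶠ z in 𝓝 (y : ℂ), sch F z = conj (sch F (conj z)) := by
  obtain ⟨c, hc, hyc⟩ := exists_mem_sideBefore hVf hy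
  obtain ⟨C, ⟨σ, hσ, rfl⟩, hC⟩ := hf.side c hc
  obtain ⟨m, hm⟩ := hσ.exists_mobius g
  have ha : AnalyticAt ℂ (sharp F) y := analyticAt_sharp (by simpa using h.1)
  have hd : deriv (sharp F) y ≠ 0 := by
    rw [deriv_sharp]
    simpa [sharp] using h.2.1
  refine (sch_eq_of_frequently h.1 ha hd m ?_).mono fun z hz => by rw [hz, sch_sharp]
  refine frequently_ofReal ?_
  have ht : Tendsto (fun y' : ℝ => (y' : ℂ)) (𝓝 y) (𝓝[{w : ℂ | 0 ≤ w.im}] (y : ℂ)) :=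
    tendsto_nhdsWithin_iff.2 ⟨Complex.continuous_ofReal.tendsto y, by simp⟩
  filter_upwards [ht.eventually h.2.2, (isOpen_sideBefore hVf c).mem_nhds hyc] with y' h1 h2
  have := hm _ _ (hC y' h2) h1
  simpa [sharp] using this

lemma IsDevelopingMap.symSchw_eventuallyEq (hf : IsDevelopingMap V f) (hVf : V.Finite) {y : ℝ}
    (hy : y ∉ V) {g : GL (Fin 2) ℂ} {F : ℂ → ℂ} (h : IsChart (fun z => f z) y g F) :
    symSchw f =ᶠ[𝓝 (y : ℂ)] sch F := by
  have h1 := eventually_nhdsWithin_iff.1 h.eventually_schw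
  have h2 : Tendsto (fun z : ℂ => conj z) (𝓝 (y : ℂ)) (𝓝 (y : ℂ)) := by
    simpa using Complex.continuous_conj.tendsto (y : ℂ)
  filter_upwards [h1, h2.eventually h1, hf.sch_eq_conj hVf hy h] with z a b c
  by_cases hz : 0 ≤ z.im
  · rw [symSchw_of_nonneg hz, a hz]
  · rw [symSchw, if_neg hz, b (by simp; linarith), c]

lemma IsDevelopingMap.symSchw_conj (hf : IsDevelopingMap V f) (hVf : V.Finite) {z : ℂ}
    (hV : ∀ v ∈ V, z ≠ (v : ℂ)) : symSchw f (conj z) = conj (symSchw f z) := by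
  rcases lt_trichotomy z.im 0 with hz | hz | hz
  · rw [symSchw, if_pos (by simp; linarith), symSchw, if_neg (by linarith), Complex.conj_conj]
  · have e : ((z.re : ℝ) : ℂ) = z := Complex.ext rfl (by simpa using hz.symm)
    obtain ⟨g, F, h⟩ := hf.exists_chart hz.ge hV
    rw [← e] at h ⊢
    have hn : z.re ∉ V := fun hm => hV _ hm e.symm
    rw [Complex.conj_ofReal, (hf.symSchw_eventuallyEq hVf hn h).eq_of_nhds]
    have := (hf.sch_eq_conj hVf hn h).self_of_nhds
    rwa [Complex.conj_ofReal] at this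
  · rw [symSchw, if_neg (by simp; linarith), symSchw, if_pos hz.le, Complex.conj_conj]

lemma IsDevelopingMap.symSchw_eventuallyEq_of_im_pos {z : ℂ} (hz : 0 < z.im)
    {g : GL (Fin 2) ℂ} {F : ℂ → ℂ} (h : IsChart (fun z => f z) z g F) :
    symSchw f =ᶠ[𝓝 z] sch F := by
  have h1 := eventually_nhdsWithin_iff.1 h.eventually_schw
  filter_upwards [h1, eventually_im_pos hz] with w a b
  rw [symSchw_of_nonneg b.le, a b.le]

/-- The continued Schwarzian derivative is analytic also on the sides, where both definitions agree with
the Schwarzian derivative of a chart. -/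
lemma IsDevelopingMap.analyticAt_symSchw (hf : IsDevelopingMap V f) (hVf : V.Finite) {z : ℂ}
    (hV : ∀ v ∈ V, z ≠ (v : ℂ)) : AnalyticAt ℂ (symSchw f) z := by
  have hpos : ∀ z : ℂ, 0 < z.im → AnalyticAt ℂ (symSchw f) z := by
    intro z hz
    obtain ⟨g, F, h⟩ := hf.exists_chart hz.le fun v _ => ne_ofReal_of_im_pos hz v
    exact (h.1.sch h.2.1).congr (symSchw_eventuallyEq_of_im_pos hz h).symm
  rcases lt_trichotomy z.im 0 with hz | hz | hz
  · have h1 : AnalyticAt ℂ (sharp (symSchw f)) z :=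
      analyticAt_sharp (hpos _ (by simpa using hz))
    refine h1.congr ?_
    filter_upwards [eventually_im_neg hz] with w hw
    change conj (symSchw f (conj w)) = symSchw f w
    have h2 : (0 : ℝ) < (conj w).im := by simpa using hw
    rw [symSchw_of_nonneg h2.le, symSchw, if_neg (by linarith)]
  · have e : ((z.re : ℝ) : ℂ) = z := Complex.ext rfl (by simpa using hz.symm)
    obtain ⟨g, F, h⟩ := hf.exists_chart hz.ge hV
    rw [← e] at h ⊢
    have hn : z.re ∉ V := fun hm => hV _ hm e.symm
    exact (h.1.sch h.2.1).congr (hf.symSchw_eventuallyEq hVf hn h).symm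
  · exact hpos z hz

end

/-! ### Growth of derivatives near a corner -/

/-- A conical neighbourhood of the closed upper half-plane without the origin. -/
def sector (δ : ℝ) : Set ℂ := {ζ | ∃ ζ₀ ∈ punctH, ‖ζ - ζ₀‖ < δ * ‖ζ₀‖}

lemma punctH_subset_sector {δ : ℝ} (hδ : 0 < δ) : punctH ⊆ sector δ := fun ζ hζ =>
  ⟨ζ, hζ, by simpa using mul_pos hδ (norm_pos_iff.2 hζ.2)⟩

lemma sector_mono {δ δ' : ℝ} (h : δ ≤ δ') : sector δ ⊆ sector δ' := fun _ ⟨ζ₀, h0, h1⟩ =>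
  ⟨ζ₀, h0, h1.trans_le (mul_le_mul_of_nonneg_right h (norm_nonneg _))⟩

lemma isOpen_sector (δ : ℝ) : IsOpen (sector δ) := by
  have : sector δ = ⋃ ζ₀ ∈ punctH, {ζ | ‖ζ - ζ₀‖ < δ * ‖ζ₀‖} := by
    ext ζ; simp [sector]
  rw [this]
  exact isOpen_biUnion fun ζ₀ _ =>
    isOpen_lt (by fun_prop : Continuous fun ζ : ℂ => ‖ζ - ζ₀‖) continuous_const

lemma sector_subset {ζ : ℂ} (h : ζ ∈ sector 1) : -Complex.I * ζ ∈ Complex.slitPlane := by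
  obtain ⟨ζ₀, h0, h1⟩ := h
  by_contra hn
  rw [Complex.mem_slitPlane_iff] at hn
  simp only [neg_mul, Complex.neg_re, Complex.I_mul_re, neg_neg, Complex.neg_im, Complex.I_mul_im,
    not_or, not_lt, ne_eq, not_not, neg_eq_zero] at hn
  rw [one_mul] at h1
  have h2 := pow_lt_pow_left₀ h1 (norm_nonneg _) two_ne_zero
  rw [Complex.sq_norm, Complex.sq_norm, Complex.normSq_apply, Complex.normSq_apply] at h2
  simp only [Complex.sub_re, Complex.sub_im, hn.2] at h2
  nlinarith [h0.1, hn.1, mul_nonneg h0.1 (neg_nonneg.2 hn.1), sq_nonneg ζ.im]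

lemma ne_zero_of_mem_sector {ζ : ℂ} (h : ζ ∈ sector 1) : ζ ≠ 0 := by
  rintro rfl
  have := sector_subset h
  simp at this

/-- If `Φ` has a limit at `0` in a sector, then `ζ Φ'` tends to `0` in smaller sectors. -/
lemma tendsto_mul_deriv {Φ : ℂ → ℂ} {l : ℂ} {δ : ℝ} (hδ : 0 < δ) (hδ1 : δ ≤ 1)
    (hd : ∀ᶠ ζ in 𝓝[sector δ] 0, AnalyticAt ℂ Φ ζ) (hl : Tendsto Φ (𝓝[sector δ] 0) (𝓝 l)) :
    Tendsto (fun ζ => ζ * deriv Φ ζ) (𝓝[sector (δ / 2)] 0) (𝓝 0) := by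
  rw [Metric.tendsto_nhds]
  intro ε hε
  have hε' : 0 < ε * δ / 8 := by positivity
  have h1 : ∀ᶠ ζ in 𝓝[sector δ] 0, AnalyticAt ℂ Φ ζ ∧ dist (Φ ζ) l < ε * δ / 8 :=
    hd.and (Metric.tendsto_nhds.1 hl _ hε')
  obtain ⟨r, hr, hb⟩ := Metric.mem_nhdsWithin_iff.1 h1
  filter_upwards [self_mem_nhdsWithin, nhdsWithin_le_nhds (Metric.ball_mem_nhds 0 (half_pos hr))]
    with ζ ⟨ζ₀, h0, hζ⟩ hζr
  have hζr' : ‖ζ‖ < r / 2 := by simpa using hζr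
  have hpos : 0 < ‖ζ₀‖ := norm_pos_iff.2 h0.2
  have e1 : ‖ζ₀‖ ≤ 2 * ‖ζ‖ := by
    have := norm_sub_norm_le ζ₀ ζ
    rw [norm_sub_rev] at this
    nlinarith
  have e2 : ‖ζ‖ ≤ 3 / 2 * ‖ζ₀‖ := by
    have := norm_sub_norm_le ζ ζ₀
    nlinarith
  -- The Cauchy estimate in a disc about `ζ` whose radius is comparable to `‖ζ‖` and which is contained in
  -- the larger sector.
  set R := δ / 4 * ‖ζ₀‖
  have hR : 0 < R := by positivity
  have hcl : Metric.closedBall ζ R ⊆ {ζ | AnalyticAt ℂ Φ ζ ∧ dist (Φ ζ) l < ε * δ / 8} := by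
    intro z hz
    rw [Metric.mem_closedBall, dist_eq_norm] at hz
    refine hb ⟨?_, ζ₀, h0, ?_⟩
    · rw [mem_ball_zero_iff]
      have := norm_sub_norm_le z ζ
      have : R ≤ 1 / 2 * ‖ζ‖ := by simp only [R]; nlinarith
      linarith
    · calc ‖z - ζ₀‖ ≤ ‖z - ζ‖ + ‖ζ - ζ₀‖ := norm_sub_le_norm_sub_add_norm_sub _ _ _
        _ < δ * ‖ζ₀‖ := by simp only [R] at hz; nlinarith
  have hcauchy := Complex.norm_deriv_le_of_forall_mem_sphere_norm_le (f := fun z => Φ z - l) hR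
    (DifferentiableOn.diffContOnCl (by
      rw [closure_ball _ hR.ne']
      exact fun z hz => ((hcl hz).1.differentiableAt.sub_const l).differentiableWithinAt))
    (C := ε * δ / 8) (fun z hz => by
      rw [← dist_eq_norm]
      exact (hcl (Metric.sphere_subset_closedBall hz)).2.le)
  rw [deriv_sub_const] at hcauchy
  rw [dist_zero_right, norm_mul]
  calc ‖ζ‖ * ‖deriv Φ ζ‖ ≤ (3 / 2 * ‖ζ₀‖) * (ε * δ / 8 / R) :=
        mul_le_mul e2 hcauchy (norm_nonneg _) (by positivity)
    _ = 3 / 4 * ε := by simp only [R]; field_simp; ring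
    _ < ε := by linarith

lemma eventually_nhds_of_sector {δ : ℝ} {p : ℂ → Prop} (h : ∀ᶠ ζ in 𝓝[sector δ] 0, p ζ) :
    ∀ᶠ ζ in 𝓝[sector δ] 0, ∀ᶠ ζ' in 𝓝 ζ, p ζ' := by
  filter_upwards [eventually_eventually_nhdsWithin.2 h, self_mem_nhdsWithin] with ζ h1 h2
  rwa [(isOpen_sector δ).nhdsWithin_eq h2] at h1

lemma hasDerivAt_ulog {ζ : ℂ} (h : -Complex.I * ζ ∈ Complex.slitPlane) :
    HasDerivAt ulog ζ⁻¹ ζ := by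
  have h0 : ζ ≠ 0 := by rintro rfl; simp at h
  have h1 := (((hasDerivAt_id ζ).const_mul (-Complex.I)).clog h).add_const (Real.pi / 2 * Complex.I)
  convert! h1 using 1
  simp only [id, mul_one]
  field_simp

/-- The Schwarzian derivative of a function that is asymptotic to a power. -/
lemma tendsto_sq_mul_sch {F : ℂ → ℂ} {α k : ℂ} (hα : α ≠ 0) (hk : k ≠ 0)
    (hd : ∀ᶠ ζ in 𝓝[sector 1] 0, AnalyticAt ℂ F ζ)
    (hl : Tendsto (fun ζ => F ζ * Complex.exp (-α * ulog ζ)) (𝓝[sector 1] 0) (𝓝 k)) :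
    Tendsto (fun ζ => ζ ^ 2 * sch F ζ) (𝓝[punctH] 0) (𝓝 ((1 - α ^ 2) / 2)) := by
  have hs : ∀ᶠ ζ in 𝓝[sector 1] (0 : ℂ), ζ ∈ sector 1 := self_mem_nhdsWithin
  set u : ℂ → ℂ := fun ζ => F ζ * Complex.exp (-α * ulog ζ)
  have hu : ∀ᶠ ζ in 𝓝[sector 1] 0, AnalyticAt ℂ u ζ := by
    filter_upwards [hd, hs] with ζ h1 h2
    exact h1.mul (analyticAt_const.mul (analyticAt_ulog (sector_subset h2))).cexp
  have l12 : 𝓝[sector (1 / 2)] (0 : ℂ) ≤ 𝓝[sector 1] 0 :=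
    nhdsWithin_mono _ (sector_mono (by norm_num))
  have l24 : 𝓝[sector (1 / 4)] (0 : ℂ) ≤ 𝓝[sector (1 / 2)] 0 :=
    nhdsWithin_mono _ (sector_mono (by norm_num))
  have l48 : 𝓝[sector (1 / 8)] (0 : ℂ) ≤ 𝓝[sector (1 / 4)] 0 :=
    nhdsWithin_mono _ (sector_mono (by norm_num))
  -- Each differentiation costs half of the opening of the sector. The function `u₁` is
  -- `ζ F' ζ ^ (-α)`.
  set u₁ : ℂ → ℂ := fun ζ => ζ * deriv u ζ + α * u ζ with hu₁
  have hu₁l : Tendsto u₁ (𝓝[sector (1 / 2)] 0) (𝓝 (α * k)) := by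
    have := (tendsto_mul_deriv one_pos le_rfl hu hl).add ((hl.mono_left l12).const_mul α)
    rwa [zero_add] at this
  have hu₁a : ∀ᶠ ζ in 𝓝[sector (1 / 2)] 0, AnalyticAt ℂ u₁ ζ := by
    filter_upwards [l12 hu] with ζ h
    exact (analyticAt_id.mul h.deriv).add (analyticAt_const.mul h)
  have hF' : ∀ᶠ ζ in 𝓝[sector 1] 0,
      deriv F ζ = u₁ ζ * ζ⁻¹ * Complex.exp (α * ulog ζ) := by
    filter_upwards [hu, hs] with ζ h1 h2
    have e : F = fun ζ => u ζ * Complex.exp (α * ulog ζ) := by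
      ext ζ
      simp only [u]
      rw [mul_assoc, ← Complex.exp_add]
      simp
    have h3 := hasDerivAt_ulog (sector_subset h2)
    have h4 := (h1.differentiableAt.hasDerivAt.mul (h3.const_mul α).cexp).deriv
    have h0 := ne_zero_of_mem_sector h2
    have h5 : deriv F ζ = _ := (congrArg (fun G => deriv G ζ) e).trans h4
    rw [h5]
    simp only [hu₁]
    field_simp
  -- `n = ζ F'' / F'`, which tends to `α - 1`
  set n : ℂ → ℂ := fun ζ => ζ * deriv u₁ ζ / u₁ ζ + (α - 1) with hn
  have hu₁0 : ∀ᶠ ζ in 𝓝[sector (1 / 2)] 0, u₁ ζ ≠ 0 :=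
    hu₁l.eventually_ne (mul_ne_zero hα hk)
  have hnl : Tendsto n (𝓝[sector (1 / 4)] 0) (𝓝 (α - 1)) := by
    have h1 := tendsto_mul_deriv (by norm_num) (by norm_num) hu₁a hu₁l
    rw [show (1 / 2 / 2 : ℝ) = 1 / 4 by norm_num] at h1
    have := (h1.div (hu₁l.mono_left l24) (mul_ne_zero hα hk)).add_const (α - 1)
    rwa [zero_div, zero_add] at this
  have hna : ∀ᶠ ζ in 𝓝[sector (1 / 4)] 0, AnalyticAt ℂ n ζ := by
    filter_upwards [l24 hu₁a, l24 hu₁0] with ζ h h0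
    exact ((analyticAt_id.mul h.deriv).div h h0).add analyticAt_const
  have hN : ∀ᶠ ζ in 𝓝[sector (1 / 2)] 0, deriv (deriv F) ζ / deriv F ζ = n ζ * ζ⁻¹ := by
    filter_upwards [l12 (eventually_nhds_of_sector hF'), hu₁a, hu₁0, l12 hs] with ζ h1 h2 h3 h4
    have h5 := hasDerivAt_ulog (sector_subset h4)
    have h0 := ne_zero_of_mem_sector h4
    have h6 := ((h2.differentiableAt.hasDerivAt.mul (hasDerivAt_inv h0)).mul
      (h5.const_mul α).cexp).deriv
    have e : deriv F =ᶠ[𝓝 ζ] fun ζ => u₁ ζ * ζ⁻¹ * Complex.exp (α * ulog ζ) := h1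
    have h7 : deriv (deriv F) ζ = _ := e.deriv_eq.trans h6
    rw [h7, e.eq_of_nhds]
    have := Complex.exp_ne_zero (α * ulog ζ)
    simp only [hn, Pi.mul_apply]
    field_simp
    ring
  have hfin : Tendsto (fun ζ => ζ ^ 2 * sch F ζ) (𝓝[sector (1 / 8)] 0) (𝓝 ((1 - α ^ 2) / 2)) := by
    have h1 := tendsto_mul_deriv (by norm_num) (by norm_num) hna hnl
    rw [show (1 / 4 / 2 : ℝ) = 1 / 8 by norm_num] at h1
    have h2 := (h1.sub (hnl.mono_left l48)).sub (((hnl.mono_left l48).pow 2).div_const 2)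
    have e : (0 : ℂ) - (α - 1) - (α - 1) ^ 2 / 2 = (1 - α ^ 2) / 2 := by ring
    rw [e] at h2
    refine h2.congr' ?_
    filter_upwards [l48 (l24 (eventually_nhds_of_sector hN)), l48 hna,
      l48 (l24 (l12 hs))] with ζ h1 h2 h3
    have h0 := ne_zero_of_mem_sector h3
    have e : (fun ζ => deriv (deriv F) ζ / deriv F ζ) =ᶠ[𝓝 ζ] fun ζ => n ζ * ζ⁻¹ := h1
    have h4 := (h2.differentiableAt.hasDerivAt.mul (hasDerivAt_inv h0)).deriv
    have h5 : deriv (fun ζ => deriv (deriv F) ζ / deriv F ζ) ζ = _ := e.deriv_eq.trans h4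
    have e' : deriv (deriv F) ζ / deriv F ζ = n ζ * ζ⁻¹ := e.eq_of_nhds
    rw [sch, h5, e']
    field_simp
    ring
  exact hfin.mono_left (nhdsWithin_mono _ (punctH_subset_sector (by norm_num)))

/-! ### Extension by reflection in both sides at a corner -/

/-- The function `F` on the closed upper half-plane, extended to the two quadrants of the lower
half-plane by the reflections `w ↦ μ₁ (conj w)` and `w ↦ μ₂ (conj w)`. -/
noncomputable def reflExt (F μ₁ μ₂ : ℂ → ℂ) (ζ : ℂ) : ℂ :=
  if 0 ≤ ζ.im then F ζ else if 0 < ζ.re then μ₁ (conj (F (conj ζ))) else μ₂ (conj (F (conj ζ)))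

/-- The Schwarz reflection principle: a function that maps a real interval into the curve `w = μ (conj w)`
is continued by `μ (conj (F (conj ζ)))`. -/
lemma reflection_principle {F μ F' : ℂ → ℂ} {η : ℝ} (hF' : AnalyticAt ℂ F' η)
    (hF : ∀ᶠ w in 𝓝[{w : ℂ | 0 ≤ w.im}] (η : ℂ), F w = F' w)
    (hμ : AnalyticAt ℂ μ (conj (F η))) (h : ∀ᶠ y : ℝ in 𝓝 η, F y = μ (conj (F y))) :
    ∀ᶠ ζ in 𝓝 (η : ℂ), (if 0 ≤ ζ.im then F ζ else μ (conj (F (conj ζ)))) = F' ζ := by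
  have hη : F η = F' η := hF.self_of_nhdsWithin (by simp)
  have ha : AnalyticAt ℂ (sharp F') η := analyticAt_sharp (by simpa using hF')
  have hs : sharp F' η = conj (F η) := by simp [sharp, hη]
  have hG : AnalyticAt ℂ (fun ζ => μ (sharp F' ζ)) η :=
    AnalyticAt.comp (f := sharp F') (by rwa [hs]) ha
  have ht : Tendsto (fun y' : ℝ => (y' : ℂ)) (𝓝 η) (𝓝[{w : ℂ | 0 ≤ w.im}] (η : ℂ)) :=
    tendsto_nhdsWithin_iff.2 ⟨Complex.continuous_ofReal.tendsto η, by simp⟩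
  have heq : ∀ᶠ ζ in 𝓝 (η : ℂ), F' ζ = μ (sharp F' ζ) := by
    refine (AnalyticAt.frequently_eq_iff_eventually_eq hF' hG).1 (frequently_ofReal ?_)
    filter_upwards [h, ht.eventually hF] with y h1 h2
    have : sharp F' y = conj (F y) := by simp [sharp, h2]
    rw [this, ← h1, h2]
  have h1 := eventually_nhdsWithin_iff.1 hF
  have h2 : Tendsto (fun z : ℂ => conj z) (𝓝 (η : ℂ)) (𝓝 (η : ℂ)) := by
    simpa using Complex.continuous_conj.tendsto (η : ℂ)
  filter_upwards [heq, h1, h2.eventually h1] with ζ a b c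
  split_ifs with hζ
  · exact b hζ
  · have hc : (0 : ℝ) ≤ (conj ζ).im := by simp; linarith
    rw [c hc, a]
    rfl

/-- The extension by reflections is analytic off the negative imaginary axis, where the two reflections
need not agree. -/
lemma analyticAt_reflExt {F μ₁ μ₂ : ℂ → ℂ} {r : ℝ}
    (hF : ∀ ζ ∈ punctH, ‖ζ‖ < r →
      ∃ F', AnalyticAt ℂ F' ζ ∧ ∀ᶠ w in 𝓝[{w : ℂ | 0 ≤ w.im}] ζ, F w = F' w)
    (hμ₁ : ∀ ζ ∈ punctH, ‖ζ‖ < r → AnalyticAt ℂ μ₁ (conj (F ζ)))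
    (hμ₂ : ∀ ζ ∈ punctH, ‖ζ‖ < r → AnalyticAt ℂ μ₂ (conj (F ζ)))
    (h₁ : ∀ η : ℝ, 0 < η → η < r → F η = μ₁ (conj (F η)))
    (h₂ : ∀ η : ℝ, η < 0 → -r < η → F η = μ₂ (conj (F η))) {ζ : ℂ} (hζ : ‖ζ‖ < r)
    (hs : -Complex.I * ζ ∈ Complex.slitPlane) : AnalyticAt ℂ (reflExt F μ₁ μ₂) ζ := by
  have h0 : ζ ≠ 0 := by rintro rfl; simp at hs
  have hneg : ∀ μ : ℂ → ℂ, (∀ ζ ∈ punctH, ‖ζ‖ < r → AnalyticAt ℂ μ (conj (F ζ))) → ζ.im < 0 →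
      AnalyticAt ℂ (fun ζ => μ (conj (F (conj ζ)))) ζ := by
    intro μ hμ him
    have hc : conj ζ ∈ punctH := ⟨by simp; linarith, by simpa using h0⟩
    have hcr : ‖conj ζ‖ < r := by simpa using hζ
    obtain ⟨F', hF', hFF⟩ := hF _ hc hcr
    have hFF' : ∀ᶠ w in 𝓝 (conj ζ), F w = F' w := by
      have him' : 0 < (conj ζ).im := by simpa using him
      filter_upwards [eventually_nhdsWithin_iff.1 hFF, eventually_im_pos him'] with w a b
        using a (le_of_lt b)
    have hFa : AnalyticAt ℂ F (conj ζ) := hF'.congr (EventuallyEq.symm hFF')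
    exact AnalyticAt.comp (f := sharp F) (hμ _ hc hcr) (analyticAt_sharp hFa)
  rcases lt_trichotomy ζ.im 0 with him | him | him
  · have hre : ζ.re ≠ 0 := by
      intro hre
      rw [Complex.mem_slitPlane_iff] at hs
      simp [hre] at hs
      linarith
    rcases hre.lt_or_gt with hre | hre
    · refine (hneg μ₂ hμ₂ him).congr ?_
      filter_upwards [eventually_im_neg him,
        Complex.continuous_re.continuousAt.eventually (gt_mem_nhds hre)] with w a b
      rw [reflExt, if_neg (by linarith), if_neg (by linarith)]
    · refine (hneg μ₁ hμ₁ him).congr ?_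
      filter_upwards [eventually_im_neg him,
        Complex.continuous_re.continuousAt.eventually (lt_mem_nhds hre)] with w a b
      rw [reflExt, if_neg (by linarith), if_pos b]
  · obtain ⟨η, rfl⟩ : ∃ η : ℝ, ζ = η := ⟨ζ.re, Complex.ext rfl (by simpa using him)⟩
    have hη0 : η ≠ 0 := by simpa using h0
    have hηr : |η| < r := by simpa using hζ
    have hp : (η : ℂ) ∈ punctH := ⟨by simp, h0⟩
    obtain ⟨F', hF', hFF⟩ := hF _ hp hζ
    rcases hη0.lt_or_gt with hη | hη
    · have hr : ∀ᶠ y : ℝ in 𝓝 η, y < 0 ∧ -r < y :=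
        (gt_mem_nhds hη).and (lt_mem_nhds (by rw [abs_of_neg hη] at hηr; linarith))
      have := reflection_principle hF' hFF (hμ₂ _ hp hζ) (hr.mono fun y hy => h₂ y hy.1 hy.2)
      refine hF'.congr ?_
      have hre : (η : ℂ).re < 0 := by simpa using hη
      filter_upwards [this, Complex.continuous_re.continuousAt.eventually (gt_mem_nhds hre)] with w a b
      rw [← a, reflExt]
      simp only [if_neg (show ¬ 0 < w.re by linarith)]
    · have hr : ∀ᶠ y : ℝ in 𝓝 η, 0 < y ∧ y < r :=
        (lt_mem_nhds hη).and (gt_mem_nhds (by rwa [abs_of_pos hη] at hηr))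
      have := reflection_principle hF' hFF (hμ₁ _ hp hζ) (hr.mono fun y hy => h₁ y hy.1 hy.2)
      refine hF'.congr ?_
      have hre : 0 < (η : ℂ).re := by simpa using hη
      filter_upwards [this, Complex.continuous_re.continuousAt.eventually (lt_mem_nhds hre)] with w a b
      rw [← a, reflExt]
      simp only [if_pos b]
  · obtain ⟨F', hF', hFF⟩ := hF _ ⟨him.le, h0⟩ hζ
    refine hF'.congr ?_
    filter_upwards [eventually_nhdsWithin_iff.1 hFF, eventually_im_pos him] with w a b
    rw [reflExt, if_pos b.le, a b.le]

/-! ### Matching of the limits in the half-plane and in the quadrants -/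

/-- The closed lower right quadrant without the imaginary axis. -/
def quadR : Set ℂ := {ζ | ζ.im ≤ 0 ∧ 0 < ζ.re}

/-- The closed lower left quadrant without the imaginary axis. -/
def quadL : Set ℂ := {ζ | ζ.im ≤ 0 ∧ ζ.re < 0}

lemma ulog_of_re_pos {ζ : ℂ} (h : 0 < ζ.re) : ulog ζ = Complex.log ζ := by
  have h0 : ζ ≠ 0 := by rintro rfl; simp at h
  have h1 : Complex.log (-Complex.I * ζ) = Complex.log (-Complex.I) + Complex.log ζ := by
    refine (Complex.log_mul_eq_add_log_iff (by simp) h0).2 ?_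
    rw [Complex.arg_neg_I]
    have h2 := abs_lt.1 (Complex.abs_arg_lt_pi_div_two_iff.2 (Or.inl h))
    have := Real.pi_pos
    constructor <;> linarith [h2.1, h2.2]
  rw [ulog, h1, Complex.log_neg_I]
  ring

lemma ulog_of_re_neg {ζ : ℂ} (h : ζ.re < 0) :
    ulog ζ = Complex.log (-ζ) + Real.pi * Complex.I := by
  have h0 : -ζ ≠ 0 := by rintro h'; rw [neg_eq_zero] at h'; simp [h'] at h
  have h1 : Complex.log (Complex.I * -ζ) = Complex.log Complex.I + Complex.log (-ζ) := by
    refine (Complex.log_mul_eq_add_log_iff (by simp) h0).2 ?_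
    rw [Complex.arg_I]
    have h2 := abs_lt.1 (Complex.abs_arg_lt_pi_div_two_iff.2 (Or.inl (show 0 < (-ζ).re by simpa)))
    have := Real.pi_pos
    constructor <;> linarith [h2.1, h2.2]
  rw [ulog, show -Complex.I * ζ = Complex.I * -ζ by ring, h1, Complex.log_I]
  ring

lemma conj_log_conj_of_re_pos {ζ : ℂ} (h : 0 < ζ.re) :
    conj (Complex.log (conj ζ)) = Complex.log ζ := by
  have h2 := (abs_lt.1 (Complex.abs_arg_lt_pi_div_two_iff.2 (Or.inl h))).2
  rw [Complex.log_conj _ (by have := Real.pi_pos; linarith), Complex.conj_conj]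

lemma conj_ulog_of_re_pos {ζ : ℂ} (h : 0 < ζ.re) : conj (ulog (conj ζ)) = ulog ζ := by
  rw [ulog_of_re_pos h, ulog_of_re_pos (by simpa using h), conj_log_conj_of_re_pos h]

lemma conj_ulog_of_re_neg {ζ : ℂ} (h : ζ.re < 0) :
    conj (ulog (conj ζ)) = ulog ζ - 2 * Real.pi * Complex.I := by
  have h1 := conj_log_conj_of_re_pos (ζ := -ζ) (by simpa using h)
  rw [map_neg] at h1
  rw [ulog_of_re_neg h, ulog_of_re_neg (by simpa using h), map_add, h1]
  simp
  ring

lemma tendsto_conj_quad {s : Set ℂ} (hs : ∀ ζ ∈ s, conj ζ ∈ punctH) :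
    Tendsto (fun ζ : ℂ => conj ζ) (𝓝[s] 0) (𝓝[punctH] 0) := by
  refine tendsto_nhdsWithin_iff.2 ⟨?_, ?_⟩
  · have := Complex.continuous_conj.tendsto 0
    rw [map_zero] at this
    exact this.mono_left nhdsWithin_le_nhds
  · filter_upwards [self_mem_nhdsWithin] with ζ hζ using hs ζ hζ

lemma conj_mem_of_quadR {ζ : ℂ} (hζ : ζ ∈ quadR) : conj ζ ∈ punctH :=
  ⟨by simpa using hζ.1, fun h => by
    have h0 : ζ = 0 := by simpa using h
    have := hζ.2
    simp [h0] at this⟩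

lemma conj_mem_of_quadL {ζ : ℂ} (hζ : ζ ∈ quadL) : conj ζ ∈ punctH :=
  ⟨by simpa using hζ.1, fun h => by
    have h0 : ζ = 0 := by simpa using h
    have := hζ.2
    simp [h0] at this⟩

lemma tendsto_ofReal_right : Tendsto (fun η : ℝ => (η : ℂ)) (𝓝[>] 0) (𝓝[punctH ∩ quadR] 0) := by
  refine tendsto_nhdsWithin_iff.2 ⟨?_, ?_⟩
  · have := Complex.continuous_ofReal.tendsto 0
    rw [Complex.ofReal_zero] at this
    exact this.mono_left nhdsWithin_le_nhds
  · filter_upwards [self_mem_nhdsWithin] with η hη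
    have h1 : (0 : ℝ) < η := hη
    exact ⟨⟨by simp, by simpa using h1.ne'⟩, by simp, by simpa using h1⟩

lemma tendsto_ofReal_left : Tendsto (fun η : ℝ => (η : ℂ)) (𝓝[<] 0) (𝓝[punctH ∩ quadL] 0) := by
  refine tendsto_nhdsWithin_iff.2 ⟨?_, ?_⟩
  · have := Complex.continuous_ofReal.tendsto 0
    rw [Complex.ofReal_zero] at this
    exact this.mono_left nhdsWithin_le_nhds
  · filter_upwards [self_mem_nhdsWithin] with η hη
    have h1 : η < 0 := hη
    exact ⟨⟨by simp, by simpa using h1.ne⟩, by simp, by simpa using h1⟩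

/-- Limits in the half-plane and in the right quadrant agree if the functions agree on the positive
half-line. -/
lemma limit_eq_of_right {Φ Φ₁ : ℂ → ℂ} {k k₁ : ℂ} (h : Tendsto Φ (𝓝[punctH] 0) (𝓝 k))
    (h₁ : Tendsto Φ₁ (𝓝[quadR] 0) (𝓝 k₁)) (e₁ : ∀ᶠ η : ℝ in 𝓝[>] 0, Φ η = Φ₁ η) : k₁ = k := by
  have t1 := (h.mono_left (nhdsWithin_mono _ Set.inter_subset_left)).comp tendsto_ofReal_right
  have t2 := (h₁.mono_left (nhdsWithin_mono _ Set.inter_subset_right)).comp tendsto_ofReal_right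
  exact tendsto_nhds_unique t2 (t1.congr' e₁)

/-- Limits in the half-plane and in the left quadrant agree if the functions agree on the negative
half-line. -/
lemma limit_eq_of_left {Φ Φ₂ : ℂ → ℂ} {k k₂ : ℂ} (h : Tendsto Φ (𝓝[punctH] 0) (𝓝 k))
    (h₂ : Tendsto Φ₂ (𝓝[quadL] 0) (𝓝 k₂)) (e₂ : ∀ᶠ η : ℝ in 𝓝[<] 0, Φ η = Φ₂ η) : k₂ = k := by
  have t1 := (h.mono_left (nhdsWithin_mono _ Set.inter_subset_left)).comp tendsto_ofReal_left
  have t2 := (h₂.mono_left (nhdsWithin_mono _ Set.inter_subset_right)).comp tendsto_ofReal_left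
  exact tendsto_nhds_unique t2 (t1.congr' e₂)

/-- A function on the sector has a limit if it has the same limit in the half-plane and in the two
quadrants. -/
lemma tendsto_sector {Φ : ℂ → ℂ} {k : ℂ} (h : Tendsto Φ (𝓝[punctH] 0) (𝓝 k))
    (h₁ : Tendsto Φ (𝓝[{ζ | ζ.im < 0 ∧ 0 < ζ.re}] 0) (𝓝 k))
    (h₂ : Tendsto Φ (𝓝[{ζ | ζ.im < 0 ∧ ζ.re < 0}] 0) (𝓝 k)) :
    Tendsto Φ (𝓝[sector 1] 0) (𝓝 k) := by
  have h3 := (h.sup h₁).sup h₂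
  rw [← nhdsWithin_union, ← nhdsWithin_union] at h3
  refine h3.mono_left (nhdsWithin_mono _ fun ζ hζ => ?_)
  rcases le_or_gt 0 ζ.im with him | him
  · exact Or.inl (Or.inl ⟨him, ne_zero_of_mem_sector hζ⟩)
  · have hre : ζ.re ≠ 0 := by
      intro hre
      have hs := sector_subset hζ
      rw [Complex.mem_slitPlane_iff] at hs
      simp [hre] at hs
      linarith
    rcases hre.lt_or_gt with hre | hre
    · exact Or.inr ⟨him, hre⟩
    · exact Or.inl (Or.inr ⟨him, hre⟩)

/-! ### The Schwarzian derivative at a corner -/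

section
variable {F μ₁ μ₂ : ℂ → ℂ} {r : ℝ}

lemma im_neg_re_pos_subset : {ζ : ℂ | ζ.im < 0 ∧ 0 < ζ.re} ⊆ quadR := fun _ h => ⟨h.1.le, h.2⟩

lemma im_neg_re_neg_subset : {ζ : ℂ | ζ.im < 0 ∧ ζ.re < 0} ⊆ quadL := fun _ h => ⟨h.1.le, h.2⟩

lemma reflExt_of_re_pos {ζ : ℂ} (h : ζ.im < 0 ∧ 0 < ζ.re) :
    reflExt F μ₁ μ₂ ζ = μ₁ (conj (F (conj ζ))) := by
  rw [reflExt, if_neg (not_le.2 h.1), if_pos h.2]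

lemma reflExt_of_re_neg {ζ : ℂ} (h : ζ.im < 0 ∧ ζ.re < 0) :
    reflExt F μ₁ μ₂ ζ = μ₂ (conj (F (conj ζ))) := by
  rw [reflExt, if_neg (not_le.2 h.1), if_neg (not_lt.2 h.2.le)]

lemma reflExt_of_nonneg {ζ : ℂ} (h : 0 ≤ ζ.im) : reflExt F μ₁ μ₂ ζ = F ζ := if_pos h

lemma eventually_sector_of_ball {p : ℂ → Prop} (hr : 0 < r)
    (h : ∀ ζ : ℂ, ‖ζ‖ < r → -Complex.I * ζ ∈ Complex.slitPlane → p ζ) :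
    ∀ᶠ ζ in 𝓝[sector 1] 0, p ζ := by
  filter_upwards [self_mem_nhdsWithin, ball_mem_nhdsWithin_zero hr _] with ζ h1 h2
  exact h ζ (by simpa using h2) (sector_subset h1)

lemma eventually_punctH_iff {p : ℂ → Prop} :
    (∀ᶠ ζ in 𝓝[punctH] 0, p ζ) ↔ ∃ r > 0, ∀ ζ ∈ punctH, ‖ζ‖ < r → p ζ := by
  rw [eventually_nhdsWithin_iff, Metric.eventually_nhds_iff_ball]
  refine exists_congr fun r => and_congr_right fun _ => ?_
  simp only [mem_ball_zero_iff]
  exact ⟨fun h ζ h1 h2 => h ζ h2 h1, fun h ζ h1 h2 => h ζ h2 h1⟩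

/-- The limit in a quadrant of the lower half-plane of a reflection of a function which is
asymptotic to a power. -/
lemma tendsto_reflection_cpow {μ : ℂ → ℂ} {s : Set ℂ} (hs : ∀ ζ ∈ s, conj ζ ∈ punctH) {α k c : ℂ}
    (hα : conj α = α) (hF : Tendsto F (𝓝[punctH] 0) (𝓝 0))
    (hl : Tendsto (fun ζ => F ζ * Complex.exp (-α * ulog ζ)) (𝓝[punctH] 0) (𝓝 k))
    (hμ : AnalyticAt ℂ μ 0) (hμ0 : μ 0 = 0) (hc : ∀ ζ ∈ s, conj (ulog (conj ζ)) = ulog ζ - c) :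
    Tendsto (fun ζ => μ (conj (F (conj ζ))) * Complex.exp (-α * ulog ζ)) (𝓝[s] 0)
      (𝓝 (deriv μ 0 * (conj k * Complex.exp (-α * c)))) := by
  have hconj := tendsto_conj_quad hs
  have h1 : Tendsto (fun ζ => conj (F (conj ζ))) (𝓝[s] 0) (𝓝 0) := by
    have := (Complex.continuous_conj.tendsto 0).comp (hF.comp hconj)
    rwa [map_zero] at this
  have h2 : Tendsto (fun ζ => dslope μ 0 (conj (F (conj ζ)))) (𝓝[s] 0) (𝓝 (deriv μ 0)) := by
    have h3 : ContinuousAt (dslope μ 0) 0 := continuousAt_dslope_same.2 hμ.differentiableAt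
    have := h3.tendsto.comp h1
    rwa [dslope_same] at this
  have h3 := ((Complex.continuous_conj.tendsto k).comp (hl.comp hconj)).mul_const
    (Complex.exp (-α * c))
  refine (h2.mul h3).congr' ?_
  filter_upwards [self_mem_nhdsWithin] with ζ hζ
  have e := sub_mul_dslope μ (conj (F (conj ζ)))
  rw [hμ0, sub_zero] at e
  rw [← e]
  simp only [Function.comp, map_mul, ← Complex.exp_conj, map_neg, hα, hc ζ hζ]
  have e2 : Complex.exp (-α * ulog ζ) =
      Complex.exp (-α * (ulog ζ - c)) * Complex.exp (-α * c) := by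
    rw [← Complex.exp_add]; congr 1; ring
  rw [e2]
  ring

/-- The Schwarzian derivative at a corner with a positive angle. -/
lemma tendsto_sch_of_pos {α : ℝ} {k : ℂ} (hα : 0 < α) (hk : k ≠ 0)
    (hF : ∀ ζ ∈ punctH, ‖ζ‖ < r →
      ∃ F', AnalyticAt ℂ F' ζ ∧ ∀ᶠ w in 𝓝[{w : ℂ | 0 ≤ w.im}] ζ, F w = F' w)
    (hr : 0 < r) (hμ₁ : AnalyticAt ℂ μ₁ 0) (hμ₂ : AnalyticAt ℂ μ₂ 0) (h0₁ : μ₁ 0 = 0)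
    (h0₂ : μ₂ 0 = 0) (h₁ : ∀ η : ℝ, 0 < η → η < r → F η = μ₁ (conj (F η)))
    (h₂ : ∀ η : ℝ, η < 0 → -r < η → F η = μ₂ (conj (F η)))
    (hl : Tendsto (fun ζ => F ζ / ζ ^ (α : ℂ)) (𝓝[punctH] 0) (𝓝 k)) :
    (∀ᶠ ζ in 𝓝[punctH] 0, AnalyticAt ℂ (reflExt F μ₁ μ₂) ζ) ∧
    Tendsto (fun ζ => ζ ^ 2 * sch (reflExt F μ₁ μ₂) ζ) (𝓝[punctH] 0)
      (𝓝 ((1 - (α : ℂ) ^ 2) / 2)) := by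
  have hmem : ∀ᶠ ζ in 𝓝[punctH] (0 : ℂ), ζ ∈ punctH := self_mem_nhdsWithin
  have hF0 : Tendsto F (𝓝[punctH] 0) (𝓝 0) := by
    have := hl.mul (tendsto_cpow_punctH hα)
    rw [mul_zero] at this
    refine this.congr' ?_
    filter_upwards [hmem] with ζ hζ
    refine div_mul_cancel₀ _ ?_
    rw [Ne, Complex.cpow_eq_zero_iff]
    exact fun h => hζ.2 h.1
  have hl' : Tendsto (fun ζ => F ζ * Complex.exp (-α * ulog ζ)) (𝓝[punctH] 0) (𝓝 k) := by
    refine hl.congr' ?_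
    filter_upwards [hmem] with ζ hζ
    rw [Complex.cpow_def_of_ne_zero hζ.2, log_eq_ulog hζ.1 hζ.2, div_eq_mul_inv, ← Complex.exp_neg]
    congr 2
    ring
  have hcF : Tendsto (fun ζ => conj (F ζ)) (𝓝[punctH] 0) (𝓝 0) := by
    have := (Complex.continuous_conj.tendsto 0).comp hF0
    rwa [map_zero] at this
  obtain ⟨r', hr', hb⟩ := eventually_punctH_iff.1
    ((hcF.eventually hμ₁.eventually_analyticAt).and (hcF.eventually hμ₂.eventually_analyticAt))
  have hrr : 0 < min r r' := lt_min hr hr'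
  have han : ∀ ζ : ℂ, ‖ζ‖ < min r r' → -Complex.I * ζ ∈ Complex.slitPlane →
      AnalyticAt ℂ (reflExt F μ₁ μ₂) ζ := fun ζ hζ hs =>
    analyticAt_reflExt (r := min r r') (fun ζ h1 h2 => hF ζ h1 (h2.trans_le (min_le_left _ _)))
      (fun ζ h1 h2 => (hb ζ h1 (h2.trans_le (min_le_right _ _))).1)
      (fun ζ h1 h2 => (hb ζ h1 (h2.trans_le (min_le_right _ _))).2)
      (fun η h1 h2 => h₁ η h1 (h2.trans_le (min_le_left _ _)))
      (fun η h1 h2 => h₂ η h1 ((neg_le_neg (min_le_left _ _)).trans_lt h2)) hζ hs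
  have hsec := eventually_sector_of_ball hrr han
  refine ⟨nhdsWithin_mono _ (punctH_subset_sector one_pos) hsec, ?_⟩
  have hα' : conj (α : ℂ) = α := Complex.conj_ofReal α
  -- The limits in the two quadrants agree with `k`, because they agree on the real half-lines.
  have t1 := tendsto_reflection_cpow (s := quadR) (c := 0) (fun _ => conj_mem_of_quadR) hα' hF0 hl'
    hμ₁ h0₁ (fun ζ hζ => by rw [conj_ulog_of_re_pos hζ.2, sub_zero])
  have t2 := tendsto_reflection_cpow (s := quadL) (c := 2 * Real.pi * Complex.I)
    (fun _ => conj_mem_of_quadL) hα' hF0 hl' hμ₂ h0₂ (fun ζ hζ => conj_ulog_of_re_neg hζ.2)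
  rw [limit_eq_of_right hl' t1 (by
    filter_upwards [self_mem_nhdsWithin, nhdsWithin_le_nhds (gt_mem_nhds hr)] with η a b
    rw [Complex.conj_ofReal, ← h₁ η a b])] at t1
  rw [limit_eq_of_left hl' t2 (by
    filter_upwards [self_mem_nhdsWithin,
      nhdsWithin_le_nhds (lt_mem_nhds (show -r < 0 by linarith))] with η a b
    rw [Complex.conj_ofReal, ← h₂ η a b])] at t2
  refine tendsto_sq_mul_sch (by exact_mod_cast hα.ne') hk hsec (tendsto_sector ?_ ?_ ?_)
  · refine hl'.congr' ?_
    filter_upwards [hmem] with ζ hζ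
    rw [reflExt_of_nonneg hζ.1]
  · refine (t1.mono_left (nhdsWithin_mono _ im_neg_re_pos_subset)).congr' ?_
    filter_upwards [self_mem_nhdsWithin] with ζ hζ
    rw [reflExt_of_re_pos hζ]
  · refine (t2.mono_left (nhdsWithin_mono _ im_neg_re_neg_subset)).congr' ?_
    filter_upwards [self_mem_nhdsWithin] with ζ hζ
    rw [reflExt_of_re_neg hζ]

lemma tendsto_inv_ulog : Tendsto (fun ζ : ℂ => (ulog ζ)⁻¹) (𝓝[≠] 0) (𝓝 0) := by
  refine tendsto_inv₀_cobounded.comp ?_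
  rw [← tendsto_norm_atTop_iff_cobounded]
  have hn : Tendsto (fun ζ : ℂ => ‖ζ‖) (𝓝[≠] 0) (𝓝[>] 0) := tendsto_norm_nhdsNE_zero
  have h1 : Tendsto (fun t : ℝ => |Real.log t|) (𝓝[>] 0) atTop :=
    tendsto_abs_atBot_atTop.comp Real.tendsto_log_nhdsGT_zero
  refine tendsto_atTop_mono (fun ζ => ?_) (h1.comp hn)
  have e : (ulog ζ).re = Real.log ‖ζ‖ := by
    simp [ulog, Complex.log_re]
  simp only [Function.comp]
  rw [← e]
  exact Complex.abs_re_le_norm _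

/-- The limit in a quadrant of the lower half-plane of a reflection of a function which is
asymptotic to the logarithm. -/
lemma tendsto_reflection_log {s : Set ℂ} (hs : ∀ ζ ∈ s, conj ζ ∈ punctH) {a b l c : ℂ}
    (hl : Tendsto (fun ζ => F ζ / ulog ζ) (𝓝[punctH] 0) (𝓝 l))
    (hc : ∀ ζ ∈ s, conj (ulog (conj ζ)) = ulog ζ - c) :
    Tendsto (fun ζ => (a * conj (F (conj ζ)) + b) / ulog ζ) (𝓝[s] 0) (𝓝 (a * conj l)) := by
  have hconj := tendsto_conj_quad hs
  have hs0 : s ⊆ {0}ᶜ := fun ζ hζ h => (hs ζ hζ).2 (by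
    have h0 : ζ = 0 := h
    simp [h0])
  have hinv : Tendsto (fun ζ : ℂ => (ulog ζ)⁻¹) (𝓝[s] 0) (𝓝 0) :=
    tendsto_inv_ulog.mono_left (nhdsWithin_mono _ hs0)
  have h1 := ((Complex.continuous_conj.tendsto l).comp (hl.comp hconj)).const_mul a
  -- the quotient of two branches of the logarithm
  have hne : ∀ᶠ ζ in 𝓝[s] (0 : ℂ), ulog ζ ≠ 0 ∧ ulog (conj ζ) ≠ 0 := by
    have key : ∀ᶠ ζ : ℂ in 𝓝[≠] 0, ulog ζ ≠ 0 := by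
      have hball := Metric.ball_mem_nhds (0 : ℂ) one_pos
      filter_upwards [self_mem_nhdsWithin, nhdsWithin_le_nhds hball] with ζ h0 h1 h2
      have e : (ulog ζ).re = Real.log ‖ζ‖ := by simp [ulog, Complex.log_re]
      rw [h2, Complex.zero_re] at e
      have h0' : ζ ≠ 0 := h0
      exact absurd e.symm (Real.log_neg (norm_pos_iff.2 h0') (by simpa using h1)).ne
    have k1 := nhdsWithin_mono (0 : ℂ) hs0 key
    have k2 := hconj.eventually
      (nhdsWithin_mono (0 : ℂ) (show punctH ⊆ {0}ᶜ from fun ζ hζ => hζ.2) key)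
    filter_upwards [k1, k2] with ζ a b using ⟨a, b⟩
  have h2 : Tendsto (fun ζ => 1 - c * (ulog ζ)⁻¹) (𝓝[s] 0) (𝓝 1) := by
    have := (hinv.const_mul c).const_sub 1
    rwa [mul_zero, sub_zero] at this
  have h3 := (h1.mul h2).add (hinv.const_mul b)
  rw [mul_one, mul_zero, add_zero] at h3
  refine h3.congr' ?_
  filter_upwards [self_mem_nhdsWithin, hne] with ζ hζ hne
  have e := hc ζ hζ
  have e1 : conj (ulog (conj ζ)) ≠ 0 := by simpa using hne.2
  have e2 : 1 - c * (ulog ζ)⁻¹ = conj (ulog (conj ζ)) / ulog ζ := by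
    rw [e]
    have := hne.1
    field_simp
  rw [e2]
  simp only [Function.comp, map_div₀]
  have := hne.1
  field_simp

/-- A singularity weaker than a simple pole, in the form required by the removable singularity theorem. -/
lemma isLittleO_inv_of_tendsto {k : ℂ → ℂ} {s : ℂ}
    (h : Tendsto (fun z => (z - s) * k z) (𝓝[≠] s) (𝓝 0)) :
    (fun z => k z - k s) =o[𝓝[≠] s] fun z => (z - s)⁻¹ := by
  rw [Asymptotics.isLittleO_iff_tendsto']
  · have h1 : Tendsto (fun z => (z - s) * k s) (𝓝[≠] s) (𝓝 0) := by
      have h2 : Continuous fun z : ℂ => (z - s) * k s := by fun_prop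
      have h3 := h2.tendsto s
      rw [sub_self, zero_mul] at h3
      exact h3.mono_left nhdsWithin_le_nhds
    have h4 := h.sub h1
    rw [sub_zero] at h4
    refine h4.congr fun z => ?_
    rw [div_inv_eq_mul]
    ring
  · filter_upwards [self_mem_nhdsWithin] with z hz h0
    exact absurd (inv_eq_zero.1 h0) (sub_ne_zero.2 hz)

/-- The Schwarzian derivative at a corner with the angle `0`. The derivative of the logarithmic
coordinate is single-valued up to the symmetry, so `ζ F'` has a removable singularity. -/
lemma tendsto_sch_of_log {a₁ b₁ a₂ b₂ l : ℂ} (hl0 : l ≠ 0)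
    (hF : ∀ ζ ∈ punctH, ‖ζ‖ < r →
      ∃ F', AnalyticAt ℂ F' ζ ∧ ∀ᶠ w in 𝓝[{w : ℂ | 0 ≤ w.im}] ζ, F w = F' w)
    (hr : 0 < r) (h₁ : ∀ η : ℝ, 0 < η → η < r → F η = a₁ * conj (F η) + b₁)
    (h₂ : ∀ η : ℝ, η < 0 → -r < η → F η = a₂ * conj (F η) + b₂)
    (hl : Tendsto (fun ζ => F ζ / ulog ζ) (𝓝[punctH] 0) (𝓝 l)) :
    (∀ᶠ ζ in 𝓝[punctH] 0, AnalyticAt ℂ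
      (reflExt F (fun w => a₁ * w + b₁) fun w => a₂ * w + b₂) ζ) ∧
    Tendsto (fun ζ => ζ ^ 2 * sch (reflExt F (fun w => a₁ * w + b₁) fun w => a₂ * w + b₂) ζ)
      (𝓝[punctH] 0) (𝓝 (1 / 2)) := by
  have hmem : ∀ᶠ ζ in 𝓝[punctH] (0 : ℂ), ζ ∈ punctH := self_mem_nhdsWithin
  set Y := reflExt F (fun w => a₁ * w + b₁) fun w => a₂ * w + b₂ with hY
  have han : ∀ ζ : ℂ, ‖ζ‖ < r → -Complex.I * ζ ∈ Complex.slitPlane → AnalyticAt ℂ Y ζ :=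
    fun ζ hζ hs => analyticAt_reflExt hF (fun _ _ _ => by fun_prop) (fun _ _ _ => by fun_prop)
      h₁ h₂ hζ hs
  have hsec := eventually_sector_of_ball hr han
  refine ⟨nhdsWithin_mono _ (punctH_subset_sector one_pos) hsec, ?_⟩
  have t1 := tendsto_reflection_log (s := quadR) (c := 0) (a := a₁) (b := b₁)
    (fun _ => conj_mem_of_quadR) hl (fun ζ hζ => by rw [conj_ulog_of_re_pos hζ.2, sub_zero])
  have t2 := tendsto_reflection_log (s := quadL) (c := 2 * Real.pi * Complex.I) (a := a₂) (b := b₂)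
    (fun _ => conj_mem_of_quadL) hl (fun ζ hζ => conj_ulog_of_re_neg hζ.2)
  have k1 : a₁ * conj l = l := limit_eq_of_right hl t1 (by
    filter_upwards [self_mem_nhdsWithin, nhdsWithin_le_nhds (gt_mem_nhds hr)] with η a b
    rw [Complex.conj_ofReal, ← h₁ η a b])
  have k2 : a₂ * conj l = l := limit_eq_of_left hl t2 (by
    filter_upwards [self_mem_nhdsWithin,
      nhdsWithin_le_nhds (lt_mem_nhds (show -r < 0 by linarith))] with η a b
    rw [Complex.conj_ofReal, ← h₂ η a b])
  have hcl : conj l ≠ 0 := by simpa using hl0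
  -- Both reflections have the same linear part: both sides end at the same point, with angle `0`.
  have haa : a₂ = a₁ := mul_right_cancel₀ hcl (k2.trans k1.symm)
  rw [k1] at t1
  rw [k2] at t2
  have hYl : Tendsto (fun ζ => Y ζ / ulog ζ) (𝓝[sector 1] 0) (𝓝 l) := by
    refine tendsto_sector ?_ ?_ ?_
    · refine hl.congr' ?_
      filter_upwards [hmem] with ζ hζ
      rw [hY, reflExt_of_nonneg hζ.1]
    · refine (t1.mono_left (nhdsWithin_mono _ im_neg_re_pos_subset)).congr' ?_
      filter_upwards [self_mem_nhdsWithin] with ζ hζ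
      rw [hY, reflExt_of_re_pos hζ]
    · refine (t2.mono_left (nhdsWithin_mono _ im_neg_re_neg_subset)).congr' ?_
      filter_upwards [self_mem_nhdsWithin] with ζ hζ
      rw [hY, reflExt_of_re_neg hζ]
  subst haa
  -- the estimate of the derivative
  have hs : ∀ᶠ ζ in 𝓝[sector 1] (0 : ℂ), ζ ∈ sector 1 := self_mem_nhdsWithin
  have hsec0 : sector 1 ⊆ {0}ᶜ := fun ζ hζ => ne_zero_of_mem_sector hζ
  have hlog0 : ∀ᶠ ζ in 𝓝[sector 1] (0 : ℂ), ulog ζ ≠ 0 := by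
    filter_upwards [hYl.eventually_ne hl0] with ζ hζ h
    simp [h] at hζ
  have hua : ∀ᶠ ζ in 𝓝[sector 1] 0, AnalyticAt ℂ (fun ζ => Y ζ / ulog ζ) ζ := by
    filter_upwards [hsec, hs, hlog0] with ζ a b c
    exact a.div (analyticAt_ulog (sector_subset b)) c
  have hp12 : 𝓝[punctH] (0 : ℂ) ≤ 𝓝[sector (1 / 2)] 0 :=
    nhdsWithin_mono _ (punctH_subset_sector (by norm_num))
  have hp1 : 𝓝[punctH] (0 : ℂ) ≤ 𝓝[sector 1] 0 :=
    nhdsWithin_mono _ (punctH_subset_sector one_pos)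
  have hdY : Tendsto (fun ζ => ζ * (ζ * deriv Y ζ)) (𝓝[punctH] 0) (𝓝 0) := by
    have g1 := (tendsto_mul_deriv one_pos le_rfl hua hYl).mono_left hp12
    have g2 : Tendsto (fun ζ : ℂ => ζ * ulog ζ) (𝓝[punctH] 0) (𝓝 0) := by
      have := tendsto_cpow_mul_log one_pos
      refine this.congr' ?_
      filter_upwards [hmem] with ζ hζ
      rw [log_eq_ulog hζ.1 hζ.2]
      simp
    have g3 : Tendsto (fun ζ : ℂ => ζ) (𝓝[punctH] 0) (𝓝 0) :=
      tendsto_id.mono_left nhdsWithin_le_nhds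
    have g4 := (g2.mul g1).add (g3.mul (hYl.mono_left hp1))
    rw [mul_zero, zero_mul, add_zero] at g4
    refine g4.congr' ?_
    filter_upwards [hp1 hsec, hmem, hp1 hlog0] with ζ a b c
    have hs1 := sector_subset (punctH_subset_sector one_pos b)
    have e1 := (a.differentiableAt.hasDerivAt.div (hasDerivAt_ulog hs1) c).deriv
    have e2 : deriv (fun ζ => Y ζ / ulog ζ) ζ = _ := e1
    rw [e2]
    have := b.2
    field_simp
    ring
  -- Since `a₁ = a₂`, the function `ζ Y'` is reflected in the same way in both sides, so that `D` is its
  -- single-valued continuation to a punctured disc, and `E` the extension of `D` to the centre.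
  set D : ℂ → ℂ := fun ζ =>
    if 0 ≤ ζ.im then ζ * deriv Y ζ else a₂ * conj (conj ζ * deriv Y (conj ζ)) with hD
  have hDY : ∀ ζ ∈ punctH, ‖ζ‖ < r → ∀ᶠ w in 𝓝 ζ, D w = w * deriv Y w := by
    intro ζ hζ hζr
    rcases hζ.1.lt_or_eq with him | him
    · filter_upwards [eventually_im_pos him] with w hw
      simp only [hD, if_pos hw.le]
    · have hre : ζ.re ≠ 0 := fun hre => hζ.2 (Complex.ext hre him.symm)
      have hev : ∀ b : ℂ, (∀ᶠ w in 𝓝 ζ, w.im < 0 → Y w = a₂ * conj (F (conj w)) + b) →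
          ∀ᶠ w in 𝓝 ζ, D w = w * deriv Y w := by
        intro b hb
        filter_upwards [hb.eventually_nhds, Metric.isOpen_ball.mem_nhds
          (show ζ ∈ Metric.ball 0 r by simpa using hζr)] with w hw hwr
        by_cases hwi : 0 ≤ w.im
        · simp only [hD, if_pos hwi]
        · push Not at hwi
          have e1 : Y =ᶠ[𝓝 w] fun w => a₂ * sharp Y w + b := by
            filter_upwards [hw, eventually_im_neg hwi] with w h1 h2
            have h3 : (0 : ℝ) ≤ (conj w).im := by simp; linarith
            rw [h1 h2]
            change _ = a₂ * conj (Y (conj w)) + b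
            rw [hY, reflExt_of_nonneg h3]
          have hc : (0 : ℝ) < (conj w).im := by simpa using hwi
          have hcY : AnalyticAt ℂ Y (conj w) := han _ (by simpa using hwr)
            (mul_mem_slitPlane_of_im_nonneg hc.le (ne_zero_of_im_pos hc))
          have e2 := (((analyticAt_sharp hcY).differentiableAt.hasDerivAt.const_mul a₂).add_const
            b).deriv
          have e3 : deriv Y w = a₂ * deriv (sharp Y) w := e1.deriv_eq.trans e2
          rw [deriv_sharp] at e3
          simp only [hD, if_neg (not_le.2 hwi)]
          rw [e3]
          simp [sharp]
          ring
      rcases hre.lt_or_gt with hre | hre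
      · refine hev b₂ ?_
        filter_upwards [Complex.continuous_re.continuousAt.eventually (gt_mem_nhds hre)] with w a b
        rw [hY, reflExt_of_re_neg ⟨b, a⟩]
      · refine hev b₁ ?_
        filter_upwards [Complex.continuous_re.continuousAt.eventually (lt_mem_nhds hre)] with w a b
        rw [hY, reflExt_of_re_pos ⟨b, a⟩]
  have hDp : ∀ ζ ∈ punctH, ‖ζ‖ < r → AnalyticAt ℂ D ζ := by
    intro ζ hζ hζr
    have h1 := han ζ hζr (mul_mem_slitPlane_of_im_nonneg hζ.1 hζ.2)
    exact (analyticAt_id.mul h1.deriv).congr (EventuallyEq.symm (hDY ζ hζ hζr))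
  have hDn : ∀ w : ℂ, w.im < 0 → D w = a₂ * conj (D (conj w)) := by
    intro w hw
    have h3 : (0 : ℝ) ≤ (conj w).im := by simp; linarith
    simp only [hD, if_neg (not_le.2 hw), if_pos h3]
  have hDd : DifferentiableOn ℂ D (Metric.ball 0 r \ {0}) := by
    rintro ζ ⟨hζ, h0⟩
    have h0' : ζ ≠ 0 := h0
    have hζr : ‖ζ‖ < r := by simpa using hζ
    rcases le_or_gt 0 ζ.im with him | him
    · exact (hDp ζ ⟨him, h0'⟩ hζr).differentiableAt.differentiableWithinAt
    · have h1 : AnalyticAt ℂ D (conj ζ) := hDp _ ⟨by simp; linarith, by simpa using h0'⟩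
        (by simpa using hζr)
      have h2 : AnalyticAt ℂ (fun w => a₂ * sharp D w) ζ := analyticAt_const.mul (analyticAt_sharp h1)
      refine (h2.congr ?_).differentiableAt.differentiableWithinAt
      filter_upwards [eventually_im_neg him] with w hw using (hDn w hw).symm
  have hD0 : Tendsto (fun ζ => ζ * D ζ) (𝓝[≠] 0) (𝓝 0) := by
    have g1 : Tendsto (fun ζ => ζ * D ζ) (𝓝[punctH] 0) (𝓝 0) := by
      refine hdY.congr' ?_
      filter_upwards [hmem] with ζ hζ
      simp only [hD, if_pos hζ.1]
    have hneg : ∀ ζ ∈ {ζ : ℂ | ζ.im < 0}, conj ζ ∈ punctH := fun ζ (hζ : ζ.im < 0) =>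
      ⟨by simp; linarith, by
        intro h
        have h0 : ζ = 0 := by simpa using h
        simp [h0] at hζ⟩
    have g2 : Tendsto (fun ζ => ζ * D ζ) (𝓝[{ζ : ℂ | ζ.im < 0}] 0) (𝓝 0) := by
      have := ((Complex.continuous_conj.tendsto 0).comp (g1.comp (tendsto_conj_quad hneg))).const_mul
        a₂
      rw [map_zero, mul_zero] at this
      refine this.congr' ?_
      filter_upwards [self_mem_nhdsWithin] with ζ hζ
      rw [hDn ζ hζ]
      simp only [Function.comp, map_mul, Complex.conj_conj]
      ring
    have := g1.sup g2
    rw [← nhdsWithin_union] at this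
    refine this.mono_left (nhdsWithin_mono _ fun ζ (hζ : ζ ≠ 0) => ?_)
    rcases le_or_gt 0 ζ.im with h | h
    · exact Or.inl ⟨h, hζ⟩
    · exact Or.inr h
  have hDo : (fun z => D z - D 0) =o[𝓝[≠] 0] fun z => (z - 0)⁻¹ :=
    isLittleO_inv_of_tendsto (by simpa using hD0)
  have hEd := Complex.differentiableOn_update_limUnder_of_isLittleO
    (Metric.ball_mem_nhds (0 : ℂ) hr) hDd hDo
  set E := Function.update D 0 (limUnder (𝓝[≠] 0) D) with hE
  have hED : ∀ ζ, ζ ≠ 0 → E ζ = D ζ := fun ζ h => Function.update_of_ne h _ _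
  have hEY : ∀ ζ ∈ punctH, ‖ζ‖ < r → ∀ᶠ w in 𝓝 ζ, deriv Y w = E w * w⁻¹ := by
    intro ζ hζ hζr
    filter_upwards [hDY ζ hζ hζr, eventually_ne_nhds hζ.2] with w h1 h2
    rw [hED w h2, h1]
    field_simp
  have hEa : AnalyticAt ℂ E 0 := hEd.analyticAt (Metric.ball_mem_nhds 0 hr)
  have hE0 : E 0 ≠ 0 := by
    intro h0
    -- otherwise `Y` would be bounded
    obtain ⟨G, hG⟩ := ((Complex.differentiableOn_dslope (Metric.ball_mem_nhds 0 hr)).2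
      hEd).isExactOn_ball
    obtain ⟨ζ₁, hζ₁⟩ := halfDisc_nonempty hr
    have hd0 : ∀ ζ ∈ halfDisc r, HasDerivAt (fun ζ => Y ζ - G ζ) 0 ζ := by
      intro ζ hζ
      have hζr : ‖ζ‖ < r := by simpa using hζ.1
      have hp := im_pos_subset_punctH hζ.2
      have e1 := (hEY ζ hp hζr).self_of_nhds
      have e2 := sub_mul_dslope E ζ
      rw [h0, sub_zero] at e2
      have e3 := (han ζ hζr (mul_mem_slitPlane_of_im_nonneg hp.1 hp.2)).differentiableAt.hasDerivAt
      convert! e3.sub (hG ζ hζ.1) using 1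
      rw [e1, ← e2]
      have := hp.2
      field_simp
      ring
    have hconst : ∀ ζ ∈ halfDisc r, Y ζ = G ζ + (Y ζ₁ - G ζ₁) := fun ζ hζ => by
      have := eq_of_hasDerivAt_zero (isOpen_halfDisc r) (convex_halfDisc r).isPreconnected hd0 hζ hζ₁
      linear_combination this
    have hsub := nhdsWithin_mono (0 : ℂ) im_pos_subset_punctH
    have hGc : Tendsto G (𝓝[{ζ : ℂ | 0 < ζ.im}] 0) (𝓝 (G 0)) :=
      (hG 0 (Metric.mem_ball_self hr)).continuousAt.tendsto.mono_left nhdsWithin_le_nhds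
    have q1 := (hGc.add_const (Y ζ₁ - G ζ₁)).mul
      (tendsto_inv_ulog.mono_left (hsub.trans (nhdsWithin_mono _ fun ζ hζ => hζ.2)))
    rw [mul_zero] at q1
    have q2 : Tendsto (fun ζ => Y ζ / ulog ζ) (𝓝[{ζ : ℂ | 0 < ζ.im}] 0) (𝓝 0) := by
      refine q1.congr' ?_
      filter_upwards [self_mem_nhdsWithin, ball_mem_nhdsWithin_zero hr _] with ζ a b
      rw [hconst ζ ⟨b, a⟩, div_eq_mul_inv]
    have hne := nhdsWithin_im_pos_neBot (z := 0) (by simp)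
    exact hl0 (tendsto_nhds_unique (hYl.mono_left (hsub.trans hp1)) q2)
  have hEev : ∀ᶠ ζ in 𝓝 (0 : ℂ), AnalyticAt ℂ E ζ ∧ E ζ ≠ 0 :=
    hEa.eventually_analyticAt.and (hEa.continuousAt.eventually_ne hE0)
  have hq : AnalyticAt ℂ (fun ζ => deriv E ζ / E ζ) 0 := hEa.deriv.div hEa hE0
  have hfin : Tendsto (fun ζ => ζ ^ 2 * deriv (fun ζ => deriv E ζ / E ζ) ζ + 1 -
      (ζ * (deriv E ζ / E ζ) - 1) ^ 2 / 2) (𝓝[punctH] 0) (𝓝 (1 / 2)) := by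
    have c1 : ContinuousAt (fun ζ : ℂ => ζ ^ 2 * deriv (fun ζ => deriv E ζ / E ζ) ζ + 1 -
        (ζ * (deriv E ζ / E ζ) - 1) ^ 2 / 2) 0 :=
      (((continuousAt_id.pow 2).mul hq.deriv.continuousAt).add continuousAt_const).sub
        ((((continuousAt_id.mul hq.continuousAt).sub continuousAt_const).pow 2).div_const 2)
    have c2 := c1.tendsto
    have e : (0 : ℂ) ^ 2 * deriv (fun ζ => deriv E ζ / E ζ) 0 + 1 -
        (0 * (deriv E 0 / E 0) - 1) ^ 2 / 2 = 1 / 2 := by ring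
    rw [e] at c2
    exact c2.mono_left nhdsWithin_le_nhds
  refine hfin.congr' ?_
  filter_upwards [hmem, ball_mem_nhdsWithin_zero hr _,
    nhdsWithin_le_nhds hEev.eventually_nhds] with ζ hζ hζb hEζ
  have hζr : ‖ζ‖ < r := by simpa using hζb
  have h0 := hζ.2
  have hN : (fun w => deriv (deriv Y) w / deriv Y w) =ᶠ[𝓝 ζ] fun w => deriv E w / E w - w⁻¹ := by
    filter_upwards [(hEY ζ hζ hζr).eventually_nhds, hEζ, eventually_ne_nhds h0] with w a b c
    have e1 : deriv Y =ᶠ[𝓝 w] fun w => E w * w⁻¹ := a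
    have e2 := (b.1.differentiableAt.hasDerivAt.mul (hasDerivAt_inv c)).deriv
    have e3 : deriv (deriv Y) w = _ := e1.deriv_eq.trans e2
    rw [e3, e1.eq_of_nhds]
    have := b.2
    field_simp
    ring
  have hEself := hEζ.self_of_nhds
  have e4 := ((hEself.1.deriv.div hEself.1 hEself.2).differentiableAt.hasDerivAt.sub
    (hasDerivAt_inv h0)).deriv
  have e5 : deriv (fun w => deriv (deriv Y) w / deriv Y w) ζ = _ := hN.deriv_eq.trans e4
  have e6 : deriv (deriv Y) ζ / deriv Y ζ = _ := hN.eq_of_nhds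
  rw [sch, e5, e6]
  have e7 : deriv (deriv E / E) ζ = deriv (fun ζ => deriv E ζ / E ζ) ζ := rfl
  rw [e7]
  field_simp
  ring

end

/-! ### Sides and charts at a corner -/

section
variable {V : Set ℝ} {f : OnePoint ℂ → OnePoint ℂ} {c : OnePoint ℝ}

/-- The side that begins at a corner ends at some corner. -/
lemma exists_sideAfter_subset_sideBefore (hVf : V.Finite) (c : OnePoint ℝ) :
    ∃ c', IsCorner V c' ∧ sideAfter V c ⊆ sideBefore V c' := by
  obtain ⟨y, hy⟩ := sideAfter_nonempty hVf c
  obtain ⟨c', hc', hyc'⟩ := exists_mem_sideBefore hVf (notMem_of_mem_sideAfter hy)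
  refine ⟨c', hc', fun z hz => ?_⟩
  induction c using OnePoint.rec with
  | infty =>
    induction c' using OnePoint.rec with
    | infty => exact fun v hv => absurd (hyc' v hv) (lt_asymm (hy v hv))
    | coe c' => exact ⟨hz c' hc', fun v hv =>
        (hyc'.2 v hv).imp_left fun h => absurd h (lt_asymm (hy v hv))⟩
  | coe c =>
    have key : ∀ v ∈ V, v < y → v < z := fun v hv h =>
      ((hy.2 v hv).resolve_right (lt_asymm h)).trans_lt hz.1
    induction c' using OnePoint.rec with
    | infty => exact fun v hv => key v hv (hyc' v hv)
    | coe c' =>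
      have h1 : c < c' := lt_trans hy.1 hyc'.1
      exact ⟨(hz.2 c' hc').resolve_left (not_le.2 h1), fun v hv => (hyc'.2 v hv).imp_left (key v hv)⟩

lemma eventually_mem_sideAfter (hVf : V.Finite) (c : OnePoint ℝ) :
    ∀ᶠ η : ℝ in 𝓝[>] 0, ∃ y ∈ sideAfter V c, localParam c η = (y : ℂ) := by
  induction c using OnePoint.rec with
  | infty =>
    have h : ∀ᶠ y : ℝ in atTop, ∀ v ∈ V, -y < v := hVf.eventually_all.2 fun v _ => by
      filter_upwards [eventually_gt_atTop (-v)] with y hy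
      linarith
    filter_upwards [tendsto_inv_nhdsGT_zero.eventually h] with η hη
    exact ⟨-η⁻¹, hη, by simp [localParam]⟩
  | coe c =>
    have h : ∀ᶠ η : ℝ in 𝓝[>] 0, ∀ v ∈ V, v ≤ c ∨ c + η < v := by
      refine hVf.eventually_all.2 fun v _ => ?_
      rcases le_or_gt v c with h | h
      · exact Eventually.of_forall fun _ => Or.inl h
      · filter_upwards [nhdsWithin_le_nhds (eventually_lt_nhds (sub_pos.2 h))] with η hη
        exact Or.inr (by linarith)
    filter_upwards [h, self_mem_nhdsWithin] with η h1 h2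
    exact ⟨c + η, ⟨lt_add_of_pos_right c h2, h1⟩, by simp [localParam]⟩

lemma eventually_mem_sideBefore (hVf : V.Finite) (c : OnePoint ℝ) :
    ∀ᶠ η : ℝ in 𝓝[<] 0, ∃ y ∈ sideBefore V c, localParam c η = (y : ℂ) := by
  induction c using OnePoint.rec with
  | infty =>
    have h : ∀ᶠ y : ℝ in atBot, ∀ v ∈ V, v < -y := hVf.eventually_all.2 fun v _ => by
      filter_upwards [eventually_lt_atBot (-v)] with y hy
      linarith
    filter_upwards [tendsto_inv_nhdsLT_zero.eventually h] with η hη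
    exact ⟨-η⁻¹, hη, by simp [localParam]⟩
  | coe c =>
    have h : ∀ᶠ η : ℝ in 𝓝[<] 0, ∀ v ∈ V, v < c + η ∨ c ≤ v := by
      refine hVf.eventually_all.2 fun v _ => ?_
      rcases lt_or_ge v c with h | h
      · filter_upwards [nhdsWithin_le_nhds (eventually_gt_nhds (sub_neg.2 h))] with η hη
        exact Or.inl (by linarith)
      · exact Eventually.of_forall fun _ => Or.inr h
    filter_upwards [h, self_mem_nhdsWithin] with η h1 h2
    exact ⟨c + η, ⟨add_lt_of_neg_right c h2, h1⟩, by simp [localParam]⟩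

/-- On the side before a corner, the developing map is a linear-fractional function of its conjugate. -/
lemma IsDevelopingMap.exists_mobius_sideBefore (hf : IsDevelopingMap V f) (hVf : V.Finite)
    (hc : IsCorner V c) (g : GL (Fin 2) ℂ) : ∃ m : GL (Fin 2) ℂ, ∀ᶠ η : ℝ in 𝓝[<] 0, ∀ a : ℂ,
      g • f (localParam c η) = (a : OnePoint ℂ) → (a : OnePoint ℂ) = m • ((conj a : ℂ) : OnePoint ℂ) := by
  obtain ⟨C, ⟨σ, hσ, rfl⟩, hC⟩ := hf.side c hc
  obtain ⟨m, hm⟩ := hσ.exists_mobius g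
  refine ⟨m, (eventually_mem_sideBefore hVf c).mono fun η hη a ha => hm _ a ?_ ha⟩
  obtain ⟨y, hy, e⟩ := hη
  rw [e]
  exact hC y hy

/-- On the side after a corner, the developing map is a linear-fractional function of its conjugate. -/
lemma IsDevelopingMap.exists_mobius_sideAfter (hf : IsDevelopingMap V f) (hVf : V.Finite)
    (c : OnePoint ℝ) (g : GL (Fin 2) ℂ) : ∃ m : GL (Fin 2) ℂ, ∀ᶠ η : ℝ in 𝓝[>] 0, ∀ a : ℂ,
      g • f (localParam c η) = (a : OnePoint ℂ) → (a : OnePoint ℂ) = m • ((conj a : ℂ) : OnePoint ℂ) := by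
  obtain ⟨c', hc', hs⟩ := exists_sideAfter_subset_sideBefore hVf c
  obtain ⟨C, ⟨σ, hσ, rfl⟩, hC⟩ := hf.side c' hc'
  obtain ⟨m, hm⟩ := hσ.exists_mobius g
  refine ⟨m, (eventually_mem_sideAfter hVf c).mono fun η hη a ha => hm _ a ?_ ha⟩
  obtain ⟨y, hy, e⟩ := hη
  rw [e]
  exact hC y (hs hy)

lemma tendsto_ofReal_punctH {s : Set ℝ} (hs : (0 : ℝ) ∉ s) :
    Tendsto (fun η : ℝ => (η : ℂ)) (𝓝[s] 0) (𝓝[punctH] 0) :=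
  tendsto_nhdsWithin_iff.2 ⟨by
    simpa using (Complex.continuous_ofReal.tendsto 0).mono_left nhdsWithin_le_nhds, by
    filter_upwards [self_mem_nhdsWithin] with η hη
    refine ⟨by simp, fun h => hs ?_⟩
    rwa [← Complex.ofReal_eq_zero.1 h]⟩

/-- A reflection in a circle through `0` is a function of the conjugate that vanishes at `0`. -/
lemma mobius_zero_one_eq_zero {l : Filter ℝ} [l.NeBot] {F : ℝ → ℂ} {m : GL (Fin 2) ℂ}
    (h : ∀ᶠ η in l, (F η : OnePoint ℂ) = m • ((conj (F η) : ℂ) : OnePoint ℂ))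
    (h0 : Tendsto F l (𝓝 0)) : m 0 1 = 0 := by
  have h1 : Tendsto (fun η => conj (F η)) l (𝓝 0) := by
    have := (Complex.continuous_conj.tendsto 0).comp h0
    rwa [map_zero] at this
  have h2 := h0.mul ((h1.const_mul (m 1 0)).add_const (m 1 1))
  have h3 := (h1.const_mul (m 0 0)).add_const (m 0 1)
  have h4 := tendsto_nhds_unique (h2.congr' (h.mono fun η hη => (coe_eq_mobius_iff _ _ _).1 hη)) h3
  simpa using h4.symm

lemma punctH_le : 𝓝[punctH] (0 : ℂ) ≤ 𝓝[≠] 0 := nhdsWithin_mono _ fun _ h => h.2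

lemma eventually_localParam_ne (hVf : V.Finite) (c : OnePoint ℝ) :
    ∀ᶠ ζ in 𝓝[≠] (0 : ℂ), ∀ v ∈ V, localParam c ζ ≠ (v : ℂ) := by
  refine hVf.eventually_all.2 fun v _ => ?_
  induction c using OnePoint.rec with
  | infty =>
    filter_upwards [tendsto_neg_inv_cobounded.eventually
      (hasBasis_cobounded_norm.mem_of_mem (i := ‖(v : ℂ)‖ + 1) trivial)] with ζ h2 h3
    rw [localParam, OnePoint.elim_infty] at h3
    rw [h3] at h2
    have : ‖(v : ℂ)‖ + 1 ≤ ‖(v : ℂ)‖ := h2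
    linarith
  | coe c =>
    by_cases h : c = v
    · filter_upwards [self_mem_nhdsWithin] with ζ hζ h1
      apply hζ
      simpa [localParam, h] using h1
    · have h1 : ∀ᶠ ζ : ℂ in 𝓝 0, (c : ℂ) + ζ ≠ v :=
        (continuous_const.add continuous_id).continuousAt.eventually_ne (by simpa using h)
      exact nhdsWithin_le_nhds h1

/-- Near a corner, a developing map has charts in every coordinate in which it is finite. -/
lemma IsDevelopingMap.eventually_exists_chart (hf : IsDevelopingMap V f) (hVf : V.Finite)
    {g : GL (Fin 2) ℂ} {F : ℂ → ℂ}
    (hF : ∀ᶠ ζ in 𝓝[punctH] 0, g • f (localParam c ζ) = (F ζ : OnePoint ℂ)) :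
    ∀ᶠ ζ in 𝓝[punctH] 0, ∃ F', IsChart (fun ζ => f (localParam c ζ)) ζ g F' ∧
      ∀ᶠ w in 𝓝[{w : ℂ | 0 ≤ w.im}] ζ, F w = F' w := by
  filter_upwards [punctH_le (eventually_localParam_ne hVf c), eventually_eventually_nhdsWithin.2 hF, hF,
    self_mem_nhdsWithin]
    with ζ h1 h2 h3 hζ
  obtain ⟨g', F', h4⟩ := hf.exists_chart (localParam_im_nonneg c hζ.1) h1
  obtain ⟨F'', h5⟩ := (h4.comp_localParam hζ).change hζ.1 g h3
  refine ⟨F'', h5, ?_⟩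
  have h6 : 𝓝[{w : ℂ | 0 ≤ w.im}] ζ = 𝓝[punctH] ζ := by
    refine (nhdsWithin_inter_of_mem' (nhdsWithin_le_nhds (isOpen_ne.mem_nhds hζ.2))).symm
  filter_upwards [h5.2.2, h6 ▸ h2] with w h7 h8
  exact OnePoint.coe_injective (h8.symm.trans h7)

/-- The Schwarzian derivative of `f` may be computed from its extensions by reflection. -/
lemma eventually_schw_eq_sch_reflExt {φ : ℂ → OnePoint ℂ} {g : GL (Fin 2) ℂ} {F μ₁ μ₂ : ℂ → ℂ}
    (hF : ∀ᶠ ζ in 𝓝[punctH] 0, ∃ F', IsChart φ ζ g F' ∧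
      ∀ᶠ w in 𝓝[{w : ℂ | 0 ≤ w.im}] ζ, F w = F' w)
    (ha : ∀ᶠ ζ in 𝓝[punctH] 0, AnalyticAt ℂ (reflExt F μ₁ μ₂) ζ) :
    ∀ᶠ ζ in 𝓝[punctH] 0, schw φ ζ = sch (reflExt F μ₁ μ₂) ζ := by
  filter_upwards [hF, ha, self_mem_nhdsWithin] with ζ ⟨F', h1, h2⟩ h3 hζ
  rw [h1.schw_eq hζ.1]
  refine (sch_eq_of_frequently h3 h1.1 h1.2.1 1
    (frequently_of_eventually_nhdsWithin hζ.1 ?_)).self_of_nhds.symm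
  filter_upwards [h2, self_mem_nhdsWithin] with w h4 h5
  rw [one_smul, reflExt_of_nonneg h5, h4]

/-- Properties that hold near `0` in the closed half-plane and on the two half-lines hold in a common
half-disc. -/
lemma exists_radius {p : ℂ → Prop} {p₁ p₂ : ℝ → Prop} (h : ∀ᶠ ζ in 𝓝[punctH] 0, p ζ)
    (h₁ : ∀ᶠ η in 𝓝[>] (0 : ℝ), p₁ η) (h₂ : ∀ᶠ η in 𝓝[<] (0 : ℝ), p₂ η) :
    ∃ r > 0, (∀ ζ ∈ punctH, ‖ζ‖ < r → p ζ) ∧ (∀ η : ℝ, 0 < η → η < r → p₁ η) ∧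
      ∀ η : ℝ, η < 0 → -r < η → p₂ η := by
  obtain ⟨r, hr, h⟩ := eventually_punctH_iff.1 h
  obtain ⟨r₁, hr₁, h₁⟩ := mem_nhdsGT_iff_exists_Ioo_subset.1 h₁
  obtain ⟨r₂, hr₂, h₂⟩ := mem_nhdsLT_iff_exists_Ioo_subset.1 h₂
  replace hr₁ : 0 < r₁ := hr₁
  replace hr₂ : r₂ < 0 := hr₂
  refine ⟨min r (min r₁ (-r₂)), by simp [hr, hr₁, hr₂], fun ζ h3 h4 => h ζ h3
    (h4.trans_le (min_le_left _ _)), fun η h3 h4 => h₁ ⟨h3, h4.trans_le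
    ((min_le_right _ _).trans (min_le_left _ _))⟩, fun η h3 h4 => h₂ ⟨?_, h3⟩⟩
  have : min r (min r₁ (-r₂)) ≤ -r₂ := (min_le_right _ _).trans (min_le_right _ _)
  linarith

/-- At a corner with angle `α`, the Schwarzian derivative is asymptotic to
`(1 - α²) / (2 ζ²)` in the local coordinate `ζ`. -/
theorem IsDevelopingMap.tendsto_schw (hf : IsDevelopingMap V f) (hVf : V.Finite)
    (hc : IsCorner V c) {α : ℝ} (h : HasAngle f c α) :
    Tendsto (fun ζ => ζ ^ 2 * schw (fun ζ => f (localParam c ζ)) ζ) (𝓝[punctH] 0)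
      (𝓝 ((1 - (α : ℂ) ^ 2) / 2)) := by
  obtain ⟨g, F, k, hk, -, hF, hα⟩ := h
  replace hF : ∀ᶠ ζ in 𝓝[punctH] 0, g • f (localParam c ζ) = (F ζ : OnePoint ℂ) := hF
  have hpos : ∀ᶠ η : ℝ in 𝓝[>] 0, g • f (localParam c η) = (F η : OnePoint ℂ) :=
    (tendsto_ofReal_punctH Set.self_notMem_Ioi).eventually hF
  have hneg : ∀ᶠ η : ℝ in 𝓝[<] 0, g • f (localParam c η) = (F η : OnePoint ℂ) :=
    (tendsto_ofReal_punctH Set.self_notMem_Iio).eventually hF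
  obtain ⟨m₁, hm₁⟩ := hf.exists_mobius_sideAfter hVf c g
  obtain ⟨m₂, hm₂⟩ := hf.exists_mobius_sideBefore hVf hc g
  have hF₁ : ∀ᶠ η : ℝ in 𝓝[>] 0, (F η : OnePoint ℂ) = m₁ • ((conj (F η) : ℂ) : OnePoint ℂ) := by
    filter_upwards [hm₁, hpos] with η h1 h2 using h1 _ h2
  have hF₂ : ∀ᶠ η : ℝ in 𝓝[<] 0, (F η : OnePoint ℂ) = m₂ • ((conj (F η) : ℂ) : OnePoint ℂ) := by
    filter_upwards [hm₂, hneg] with η h1 h2 using h1 _ h2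
  have hF0 : Tendsto F (𝓝[punctH] 0) (𝓝 0) := by
    rcases hα with ⟨hα, hl⟩ | ⟨-, hl⟩
    · have := hl.mul (tendsto_cpow_punctH hα)
      rw [mul_zero] at this
      refine this.congr' ?_
      filter_upwards [self_mem_nhdsWithin] with ζ hζ
      exact div_mul_cancel₀ _ (by simp [Complex.cpow_eq_zero_iff, hζ.2])
    · have := Tendsto.mul hl tendsto_inv_log
      rw [mul_zero] at this
      refine this.congr' ?_
      filter_upwards [hl.eventually_ne hk] with ζ hζ
      rw [mul_inv_cancel_right₀ (right_ne_zero_of_mul hζ)]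
  have hm₁0 := mobius_zero_one_eq_zero hF₁ (hF0.comp (tendsto_ofReal_punctH Set.self_notMem_Ioi))
  have hm₂0 := mobius_zero_one_eq_zero hF₂ (hF0.comp (tendsto_ofReal_punctH Set.self_notMem_Iio))
  have hd₁ := GL_det_ne_zero m₁
  have hd₂ := GL_det_ne_zero m₂
  rw [hm₁0, zero_mul, sub_zero] at hd₁
  rw [hm₂0, zero_mul, sub_zero] at hd₂
  rcases hα with ⟨hα, hl⟩ | ⟨rfl, hl⟩
  · have hch := hf.eventually_exists_chart hVf hF
    obtain ⟨r, hr, h1, h2, h3⟩ := exists_radius hch hF₁ hF₂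
    have han : ∀ m : GL (Fin 2) ℂ, m 1 1 ≠ 0 →
        AnalyticAt ℂ (fun w => (m 0 0 * w + m 0 1) / (m 1 0 * w + m 1 1)) 0 := fun m hm =>
      ((analyticAt_const.mul analyticAt_id).add analyticAt_const).div
        ((analyticAt_const.mul analyticAt_id).add analyticAt_const) (by simpa using hm)
    have hrel : ∀ {m : GL (Fin 2) ℂ} {a : ℂ}, (a : OnePoint ℂ) = m • ((conj a : ℂ) : OnePoint ℂ) →
        a = (m 0 0 * conj a + m 0 1) / (m 1 0 * conj a + m 1 1) := fun {m a} h => by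
      rw [eq_div_iff (den_ne_zero_of_coe_eq h), (coe_eq_mobius_iff _ _ _).1 h]
    have hmain := tendsto_sch_of_pos hα hk
      (fun ζ h4 h5 => by
        obtain ⟨F', h6, h7⟩ := h1 ζ h4 h5
        exact ⟨F', h6.1, h7⟩) hr (han m₁ (right_ne_zero_of_mul hd₁))
        (han m₂ (right_ne_zero_of_mul hd₂)) (by simp [hm₁0]) (by simp [hm₂0])
      (fun η h4 h5 => hrel (h2 η h4 h5)) (fun η h4 h5 => hrel (h3 η h4 h5)) hl
    refine hmain.2.congr' ?_
    filter_upwards [eventually_schw_eq_sch_reflExt hch hmain.1] with ζ hζ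
    rw [hζ]
  · -- the coordinate is replaced by its inverse, which is asymptotic to `log ζ / k`
    have hF_ne : ∀ᶠ ζ in 𝓝[punctH] 0, F ζ ≠ 0 :=
      (hl.eventually_ne hk).mono fun ζ hζ => left_ne_zero_of_mul hζ
    set s : GL (Fin 2) ℂ := mkGL 0 1 1 0 (by simp)
    have hF' : ∀ᶠ ζ in 𝓝[punctH] 0, (s * g) • f (localParam c ζ) = (((F ζ)⁻¹ : ℂ) : OnePoint ℂ) := by
      filter_upwards [hF, hF_ne] with ζ h1 h2
      rw [mul_smul, h1, eq_comm, coe_eq_mobius_iff]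
      simp [s, h2]
    have hch := hf.eventually_exists_chart hVf hF'
    have hrel : ∀ {m : GL (Fin 2) ℂ} {a : ℂ}, m 0 1 = 0 → m 0 0 * m 1 1 ≠ 0 → a ≠ 0 →
        (a : OnePoint ℂ) = m • ((conj a : ℂ) : OnePoint ℂ) →
        a⁻¹ = m 1 1 / m 0 0 * conj a⁻¹ + m 1 0 / m 0 0 := fun {m a} h0 hm ha h => by
      have h1 := (coe_eq_mobius_iff _ _ _).1 h
      have h2 := left_ne_zero_of_mul hm
      have h3 : conj a ≠ 0 := by simpa using ha
      rw [h0, add_zero] at h1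
      rw [map_inv₀]
      field_simp
      linear_combination -h1
    obtain ⟨r, hr, h1, h2, h3⟩ := exists_radius hch
      (hF₁.and ((tendsto_ofReal_punctH Set.self_notMem_Ioi).eventually hF_ne))
      (hF₂.and ((tendsto_ofReal_punctH Set.self_notMem_Iio).eventually hF_ne))
    have hl' : Tendsto (fun ζ => (F ζ)⁻¹ / ulog ζ) (𝓝[punctH] 0) (𝓝 k⁻¹) := by
      refine (Tendsto.inv₀ hl hk).congr' ?_
      filter_upwards [self_mem_nhdsWithin] with ζ hζ
      rw [log_eq_ulog hζ.1 hζ.2, mul_inv, div_eq_mul_inv]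
    have hmain := tendsto_sch_of_log (F := fun ζ => (F ζ)⁻¹) (inv_ne_zero hk)
      (fun ζ h4 h5 => by
        obtain ⟨F', h6, h7⟩ := h1 ζ h4 h5
        exact ⟨F', h6.1, h7⟩) hr
      (fun η h4 h5 => hrel hm₁0 hd₁ (h2 η h4 h5).2 (h2 η h4 h5).1)
      (fun η h4 h5 => hrel hm₂0 hd₂ (h3 η h4 h5).2 (h3 η h4 h5).1) hl'
    have e : (1 - ((0 : ℝ) : ℂ) ^ 2) / 2 = 1 / 2 := by simp
    rw [e]
    refine hmain.2.congr' ?_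
    filter_upwards [eventually_schw_eq_sch_reflExt hch hmain.1] with ζ hζ
    rw [hζ]

end

/-! ### The symmetric continuation of the Schwarzian derivative at the corners -/

section
variable {V : Set ℝ} {f : OnePoint ℂ → OnePoint ℂ} {c : OnePoint ℝ}

lemma localParam_conj (c : OnePoint ℝ) (ζ : ℂ) : localParam c (conj ζ) = conj (localParam c ζ) := by
  induction c using OnePoint.rec <;> simp [localParam]

lemma deriv_localParam_conj (c : OnePoint ℝ) {ζ : ℂ} (h0 : ζ ≠ 0) :
    deriv (localParam c) (conj ζ) = conj (deriv (localParam c) ζ) := by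
  rw [(hasDerivAt_localParam c h0).deriv, (hasDerivAt_localParam c (by simpa using h0)).deriv]
  induction c using OnePoint.rec <;> simp

/-- The limit in `IsDevelopingMap.tendsto_schw`, for the symmetric continuation of the Schwarzian
derivative to a full punctured neighbourhood of the corner. -/
lemma IsDevelopingMap.tendsto_symSchw (hf : IsDevelopingMap V f) (hVf : V.Finite)
    (hc : IsCorner V c) {α : ℝ} (h : HasAngle f c α) :
    Tendsto (fun ζ => ζ ^ 2 * (deriv (localParam c) ζ ^ 2 * symSchw f (localParam c ζ)))
      (𝓝[≠] 0) (𝓝 ((1 - (α : ℂ) ^ 2) / 2)) := by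
  have h1 : Tendsto (fun ζ => ζ ^ 2 * (deriv (localParam c) ζ ^ 2 * symSchw f (localParam c ζ)))
      (𝓝[punctH] 0) (𝓝 ((1 - (α : ℂ) ^ 2) / 2)) := by
    refine (hf.tendsto_schw hVf hc h).congr' ?_
    filter_upwards [self_mem_nhdsWithin, punctH_le (eventually_localParam_ne hVf c)] with ζ hζ hV
    have h2 := localParam_im_nonneg c hζ.1
    rw [schw_comp_localParam hζ (hf.exists_chart h2 hV), symSchw_of_nonneg h2]
  have hconj : Tendsto (fun ζ : ℂ => conj ζ) (𝓝[{ζ | conj ζ ∈ punctH}] 0) (𝓝[punctH] 0) := by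
    refine tendsto_nhdsWithin_iff.2 ⟨?_, self_mem_nhdsWithin⟩
    simpa using (Complex.continuous_conj.tendsto 0).mono_left nhdsWithin_le_nhds
  have h2 := (Complex.continuous_conj.tendsto _).comp (h1.comp hconj)
  have h3 : 𝓝[≠] (0 : ℂ) = 𝓝[punctH] 0 ⊔ 𝓝[{ζ | conj ζ ∈ punctH}] 0 := by
    rw [← nhdsWithin_union]
    congr 1
    ext ζ
    simp only [punctH, Set.mem_compl_iff, Set.mem_singleton_iff, Set.mem_union, Set.mem_ofPred_eq,
      Complex.conj_im, ne_eq, map_eq_zero]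
    rcases le_total 0 ζ.im with h | h
    · simp [h]
    · simp [h]
  rw [h3]
  refine Tendsto.sup h1 ?_
  have e : conj ((1 - (α : ℂ) ^ 2) / 2) = (1 - (α : ℂ) ^ 2) / 2 := by simp [map_ofNat]
  rw [e] at h2
  refine h2.congr' ?_
  have h4 : 𝓝[{ζ | conj ζ ∈ punctH}] (0 : ℂ) ≤ 𝓝[≠] 0 := h3 ▸ le_sup_right
  filter_upwards [h4 (eventually_localParam_ne hVf c), h4 self_mem_nhdsWithin] with ζ hV h0
  simp only [Function.comp]
  rw [localParam_conj, deriv_localParam_conj c h0, hf.symSchw_conj hVf hV]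
  simp

lemma tendsto_nhdsNE_translate {v : ℂ} {G : ℂ → ℂ} {l : Filter ℂ}
    (h : Tendsto (fun ζ => G (v + ζ)) (𝓝[≠] 0) l) : Tendsto G (𝓝[≠] v) l := by
  have h1 : Tendsto (fun z => z - v) (𝓝[≠] v) (𝓝[≠] 0) := by
    refine tendsto_nhdsWithin_iff.2 ⟨?_, ?_⟩
    · have h2 : Continuous fun z : ℂ => z - v := by fun_prop
      have h3 := h2.tendsto v
      rw [sub_self] at h3
      exact h3.mono_left nhdsWithin_le_nhds
    · filter_upwards [self_mem_nhdsWithin] with z hz using sub_ne_zero.2 hz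
  refine (h.comp h1).congr fun z => ?_
  simp

lemma IsDevelopingMap.tendsto_symSchw_coe (hf : IsDevelopingMap V f) (hVf : V.Finite) {v : ℝ}
    (hv : v ∈ V) {α : ℝ} (h : HasAngle f v α) :
    Tendsto (fun z => (z - v) ^ 2 * symSchw f z) (𝓝[≠] (v : ℂ)) (𝓝 ((1 - (α : ℂ) ^ 2) / 2)) := by
  refine tendsto_nhdsNE_translate ((hf.tendsto_symSchw hVf (c := (v : OnePoint ℝ)) hv h).congr' ?_)
  filter_upwards [self_mem_nhdsWithin] with ζ hζ
  rw [(hasDerivAt_localParam (v : OnePoint ℝ) hζ).deriv]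
  simp [localParam]

lemma IsDevelopingMap.tendsto_symSchw_infty (hf : IsDevelopingMap V f) (hVf : V.Finite)
    {α : ℝ} (h : HasAngle f ∞ α) :
    Tendsto (fun z => z ^ 2 * symSchw f z) (Bornology.cobounded ℂ) (𝓝 ((1 - (α : ℂ) ^ 2) / 2)) := by
  refine tendsto_cobounded_iff.2 ((hf.tendsto_symSchw hVf (c := ∞) trivial h).congr' ?_)
  filter_upwards [self_mem_nhdsWithin] with ζ hζ
  replace hζ : ζ ≠ 0 := hζ
  rw [(hasDerivAt_localParam ∞ hζ).deriv]
  simp only [localParam, OnePoint.elim_infty]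
  field_simp

end

/-! ### Functions with simple poles -/

/-- A function with finitely many removable singularities that tends to `0` at infinity vanishes. -/
lemma eq_zero_of_removable {k : ℂ → ℂ} {S : Set ℂ} (hS : S.Finite)
    (hd : ∀ z ∉ S, DifferentiableAt ℂ k z)
    (ho : ∀ s ∈ S, Tendsto (fun z => (z - s) * k z) (𝓝[≠] s) (𝓝 0))
    (hinf : Tendsto k (Bornology.cobounded ℂ) (𝓝 0)) {z : ℂ} (hz : z ∉ S) : k z = 0 := by
  set K : ℂ → ℂ := fun z => limUnder (𝓝[≠] z) k
  have hK : ∀ z ∉ S, K z = k z := fun z hz =>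
    ((hd z hz).continuousAt.tendsto.mono_left nhdsWithin_le_nhds).limUnder_eq
  have hKd : Differentiable ℂ K := by
    intro z
    by_cases hz : z ∈ S
    · have hs : {w | w = z ∨ w ∉ S} ∈ 𝓝 z := by
        have h1 : (S \ {z})ᶜ ∈ 𝓝 z :=
          (hS.subset Set.sdiff_subset).isClosed.isOpen_compl.mem_nhds (by simp)
        filter_upwards [h1] with w hw
        by_contra h
        rw [not_or, not_not] at h
        exact hw ⟨h.2, h.1⟩
      have h2 := Complex.differentiableOn_update_limUnder_of_isLittleO hs
        (fun w hw => (hd w (hw.1.resolve_left hw.2)).differentiableWithinAt)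
        (isLittleO_inv_of_tendsto (ho z hz))
      refine (h2.differentiableAt hs).congr_of_eventuallyEq ?_
      filter_upwards [hs] with w hw
      by_cases h : w = z
      · rw [h, Function.update_self]
      · rw [Function.update_of_ne h, hK w (hw.resolve_left h)]
    · refine (hd z hz).congr_of_eventuallyEq ?_
      filter_upwards [hS.isClosed.isOpen_compl.mem_nhds hz] with w hw using hK w hw
  have h0 : Tendsto K (cocompact ℂ) (𝓝 0) := by
    rw [← Metric.cobounded_eq_cocompact]
    refine hinf.congr' ?_
    have : Sᶜ ∈ Bornology.cobounded ℂ := hS.isBounded.compl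
    filter_upwards [this] with w hw using (hK w hw).symm
  rw [← hK z hz, hKd.apply_eq_of_tendsto_cocompact z h0]

section
variable {τ : Fin 4 → ℝ}

lemma eventually_avoid (τ : Fin 4 → ℝ) (z : ℂ) : ∀ᶠ w : ℂ in 𝓝[≠] z, ∀ i, w ≠ τ i := by
  refine eventually_all.2 fun i => ?_
  by_cases h : (τ i : ℂ) = z
  · rw [h]; exact self_mem_nhdsWithin
  · exact nhdsWithin_le_nhds (eventually_ne_nhds (Ne.symm h))

lemma eventually_avoid_cobounded (τ : Fin 4 → ℝ) :
    ∀ᶠ w : ℂ in Bornology.cobounded ℂ, ∀ i, w ≠ τ i := by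
  refine eventually_all.2 fun i => ?_
  have : ({(τ i : ℂ)} : Set ℂ)ᶜ ∈ Bornology.cobounded ℂ := (Set.finite_singleton _).isBounded.compl
  exact this

lemma tendsto_sub_mul_pf (c : Fin 4 → ℝ) (hτ : Function.Injective τ) (i : Fin 4) :
    Tendsto (fun z => (z - τ i) * pf c τ z) (𝓝[≠] (τ i : ℂ)) (𝓝 (c i)) := by
  obtain ⟨R, hR, p, hp, hp0, h⟩ := exists_pf_residue c hτ i
  have h1 := (hp.differentiableAt (Metric.ball_mem_nhds _ hR)).continuousAt.tendsto
  rw [hp0] at h1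
  refine tendsto_nhdsNE_translate ((h1.mono_left nhdsWithin_le_nhds).congr' ?_)
  filter_upwards [self_mem_nhdsWithin, nhdsWithin_le_nhds (Metric.ball_mem_nhds _ hR)] with ζ h2 h3
  rw [h ζ h3 h2, add_sub_cancel_left, mul_div_cancel₀ _ h2]

lemma tendsto_pf_cobounded (c τ : Fin 4 → ℝ) :
    Tendsto (pf c τ) (Bornology.cobounded ℂ) (𝓝 0) := by
  have h := (tendsto_inv₀_cobounded (α := ℂ)).mul (tendsto_mul_pf c τ)
  rw [zero_mul] at h
  refine h.congr' ?_
  filter_upwards [eventually_avoid_cobounded fun _ => 0] with z hz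
  have : z ≠ 0 := by simpa using hz 0
  field_simp

/-- A function with at most simple poles at the points `τ i` that is symmetric and vanishes at
infinity is a sum of real partial fractions. -/
lemma exists_eq_pf {h : ℂ → ℂ} (hτ : Function.Injective τ)
    (hd : ∀ z : ℂ, (∀ i, z ≠ τ i) → DifferentiableAt ℂ h z)
    (hp : ∀ i, Tendsto (fun z => (z - τ i) ^ 2 * h z) (𝓝[≠] (τ i : ℂ)) (𝓝 0))
    (hinf : Tendsto h (Bornology.cobounded ℂ) (𝓝 0))
    (hc : ∀ z : ℂ, (∀ i, z ≠ τ i) → h (conj z) = conj (h z)) :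
    ∃ β : Fin 4 → ℝ, ∀ z : ℂ, (∀ i, z ≠ τ i) → h z = pf β τ z := by
  have hlim : ∀ i, ∃ β : ℝ, Tendsto (fun z => (z - τ i) * h z) (𝓝[≠] (τ i : ℂ)) (𝓝 β) := by
    intro i
    have h1 : ∀ᶠ z in 𝓝[≠] (τ i : ℂ), DifferentiableAt ℂ (fun z => (z - τ i) * h z) z := by
      filter_upwards [eventually_avoid τ (τ i)] with z hz
      exact DifferentiableAt.mul (by fun_prop) (hd z hz)
    have h2 := Complex.tendsto_limUnder_of_differentiable_on_punctured_nhds_of_isLittleO h1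
      (isLittleO_inv_of_tendsto ((hp i).congr fun z => by ring))
    set L := limUnder (𝓝[≠] (τ i : ℂ)) fun z => (z - τ i) * h z
    have hcj : Tendsto (fun z : ℂ => conj z) (𝓝[≠] (τ i : ℂ)) (𝓝[≠] (τ i : ℂ)) := by
      refine tendsto_nhdsWithin_iff.2 ⟨?_, ?_⟩
      · simpa using (Complex.continuous_conj.tendsto (τ i : ℂ)).mono_left nhdsWithin_le_nhds
      · filter_upwards [self_mem_nhdsWithin] with z hz h3
        apply hz
        rw [← Complex.conj_conj z, h3]
        exact Complex.conj_ofReal _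
    have h3 := (Complex.continuous_conj.tendsto _).comp (h2.comp hcj)
    have h4 : conj L = L := by
      refine tendsto_nhds_unique (h3.congr' ?_) h2
      filter_upwards [eventually_avoid τ (τ i)] with z hz
      simp only [Function.comp]
      rw [hc z hz]
      simp
    obtain ⟨β, hβ⟩ := Complex.conj_eq_iff_real.1 h4
    exact ⟨β, hβ ▸ h2⟩
  choose β hβ using hlim
  refine ⟨β, fun z hz => sub_eq_zero.1 ?_⟩
  refine eq_zero_of_removable (k := fun z => h z - pf β τ z) (S := Set.range fun i => (τ i : ℂ))
    (Set.finite_range _) (fun z hz => ?_) ?_ ?_ ?_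
  · have hz' : ∀ i, z ≠ (τ i : ℂ) := fun i e => hz ⟨i, e.symm⟩
    exact (hd z hz').sub (differentiableAt_pf hz')
  · rintro _ ⟨i, rfl⟩
    have := (hβ i).sub (tendsto_sub_mul_pf β hτ i)
    rw [sub_self] at this
    exact this.congr fun z => by ring
  · simpa using hinf.sub (tendsto_pf_cobounded β τ)
  · rintro ⟨i, e⟩
    exact hz i e.symm

/-! ### The equation of a pentagon -/

lemma hasDerivAt_pf {c : Fin 4 → ℝ} {z : ℂ} (hz : ∀ i, z ≠ τ i) :
    HasDerivAt (pf c τ) (-∑ i, (c i : ℂ) / (z - τ i) ^ 2) z := by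
  rw [← Finset.sum_neg_distrib]
  unfold pf
  refine HasDerivAt.fun_sum fun i _ => ?_
  have h0 : z - (τ i : ℂ) ≠ 0 := sub_ne_zero.2 (hz i)
  have := (hasDerivAt_const z (c i : ℂ)).div ((hasDerivAt_id z).sub_const (τ i : ℂ)) h0
  convert! this using 1
  simp [neg_div]

lemma tendsto_sq_mul_deriv_pf (c : Fin 4 → ℝ) (hτ : Function.Injective τ) (i : Fin 4) :
    Tendsto (fun z => (z - τ i) ^ 2 * deriv (pf c τ) z) (𝓝[≠] (τ i : ℂ)) (𝓝 (-c i)) := by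
  have hterm : ∀ j, Tendsto (fun z : ℂ => (z - τ i) ^ 2 * ((c j : ℂ) / (z - τ j) ^ 2))
      (𝓝[≠] (τ i : ℂ)) (𝓝 (if j = i then (c i : ℂ) else 0)) := by
    intro j
    by_cases h : j = i
    · rw [if_pos h, h]
      refine tendsto_const_nhds.congr' ?_
      filter_upwards [self_mem_nhdsWithin] with z hz
      rw [mul_div_cancel₀ _ (pow_ne_zero 2 (sub_ne_zero.2 hz))]
    · rw [if_neg h]
      have h0 : ((τ i : ℂ) - τ j) ^ 2 ≠ 0 := pow_ne_zero 2 (sub_ne_zero.2 (by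
        exact_mod_cast fun e => h (hτ e).symm))
      have h1 : ContinuousAt (fun z : ℂ => (z - τ i) ^ 2 * ((c j : ℂ) / (z - τ j) ^ 2)) (τ i : ℂ) :=
        ContinuousAt.mul (by fun_prop) (ContinuousAt.div (by fun_prop) (by fun_prop) h0)
      have h2 := h1.tendsto
      rw [sub_self, zero_pow two_ne_zero, zero_mul] at h2
      exact h2.mono_left nhdsWithin_le_nhds
  have h := (tendsto_finsetSum Finset.univ fun j _ => hterm j).neg
  simp only [Finset.sum_ite_eq', Finset.mem_univ, if_true] at h
  refine h.congr' ?_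
  filter_upwards [eventually_avoid τ (τ i)] with z hz
  rw [(hasDerivAt_pf hz).deriv, mul_neg, Finset.mul_sum]

lemma tendsto_sq_mul_deriv_pf_cobounded (c τ : Fin 4 → ℝ) :
    Tendsto (fun z => z ^ 2 * deriv (pf c τ) z) (Bornology.cobounded ℂ) (𝓝 (-(∑ i, c i : ℝ))) := by
  have hterm : ∀ j, Tendsto (fun z : ℂ => z ^ 2 * ((c j : ℂ) / (z - τ j) ^ 2))
      (Bornology.cobounded ℂ) (𝓝 (c j)) := by
    intro j
    have h1 := (((tendsto_inv₀_cobounded (α := ℂ)).const_mul (τ j : ℂ)).const_sub 1).inv₀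
      (by simp)
    have h2 := (h1.pow 2).const_mul (c j : ℂ)
    simp only [mul_zero, sub_zero, inv_one, one_pow, mul_one] at h2
    refine h2.congr' ?_
    filter_upwards [eventually_avoid_cobounded fun _ => 0, eventually_avoid_cobounded τ] with z h3 h4
    have h5 : z ≠ 0 := by simpa using h3 0
    have h6 : z - τ j ≠ 0 := sub_ne_zero.2 (h4 j)
    rw [← div_eq_mul_inv, one_sub_div h5, inv_div]
    field_simp
  have h := (tendsto_finsetSum Finset.univ fun j _ => hterm j).neg
  push_cast
  refine h.congr' ?_
  filter_upwards [eventually_avoid_cobounded τ] with z hz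
  rw [(hasDerivAt_pf hz).deriv, mul_neg, Finset.mul_sum]

lemma deriv_pf_conj (c : Fin 4 → ℝ) (z : ℂ) :
    deriv (pf c τ) (conj z) = conj (deriv (pf c τ) z) := by
  have e : sharp (pf c τ) = pf c τ := by
    ext w
    change conj (pf c τ (conj w)) = pf c τ w
    rw [pf_conj, Complex.conj_conj]
  conv_lhs => rw [← e, deriv_sharp]
  simp [sharp]

/-- The coefficient `Q` for which the ratios of solutions of `w'' - P w' + Q w = 0`, with `P` a sum
of partial fractions, have the Schwarzian derivative `S` is again a sum of partial fractions,
provided that `S` has the double poles given by the exponents. -/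
lemma exists_pf_of_schwarzian {S : ℂ → ℂ} (hτ : Function.Injective τ) (a : Fin 4 → ℝ) {κ : ℝ}
    (hd : ∀ z : ℂ, (∀ i, z ≠ τ i) → DifferentiableAt ℂ S z)
    (hp : ∀ i, Tendsto (fun z => (z - τ i) ^ 2 * S z) (𝓝[≠] (τ i : ℂ))
      (𝓝 ((1 - ((a i + 1 : ℝ) : ℂ) ^ 2) / 2)))
    (hinf : Tendsto (fun z => z ^ 2 * S z) (Bornology.cobounded ℂ) (𝓝 ((1 - (κ : ℂ) ^ 2) / 2)))
    (hc : ∀ z : ℂ, (∀ i, z ≠ τ i) → S (conj z) = conj (S z)) :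
    ∃ β : Fin 4 → ℝ,
      (∀ z : ℂ, (∀ i, z ≠ τ i) →
        S z = deriv (pf a τ) z - pf a τ z ^ 2 / 2 + 2 * pf β τ z) ∧
      Tendsto (fun z => z ^ 2 * pf β τ z) (Bornology.cobounded ℂ)
        (𝓝 ((((∑ i, a i : ℝ) : ℂ) + 1) ^ 2 / 4 - (κ : ℂ) ^ 2 / 4)) := by
  set h : ℂ → ℂ := fun z => S z / 2 - deriv (pf a τ) z / 2 + pf a τ z ^ 2 / 4 with hh
  have hlim : Tendsto (fun z => z ^ 2 * h z) (Bornology.cobounded ℂ)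
      (𝓝 ((((∑ i, a i : ℝ) : ℂ) + 1) ^ 2 / 4 - (κ : ℂ) ^ 2 / 4)) := by
    have h1 := ((hinf.div_const 2).sub ((tendsto_sq_mul_deriv_pf_cobounded a τ).div_const 2)).add
      (((tendsto_mul_pf a τ).pow 2).div_const 4)
    convert! h1 using 1
    · ext z; simp only [hh]; ring
    · congr 1; ring
  have hinf0 : Tendsto h (Bornology.cobounded ℂ) (𝓝 0) := by
    have h1 := ((tendsto_inv₀_cobounded (α := ℂ)).pow 2).mul hlim
    rw [zero_pow two_ne_zero, zero_mul] at h1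
    refine h1.congr' ?_
    filter_upwards [eventually_avoid_cobounded fun _ => 0] with z hz
    have : z ≠ 0 := by simpa using hz 0
    field_simp
  obtain ⟨β, hβ⟩ := exists_eq_pf (h := h) hτ (fun z hz => by
    have h2 : AnalyticAt ℂ (pf a τ) z := by
      rw [Complex.analyticAt_iff_eventually_differentiableAt]
      filter_upwards [eventually_all.2 fun i => eventually_ne_nhds (hz i)] with w hw
      exact differentiableAt_pf hw
    exact (((hd z hz).div_const 2).sub (h2.deriv.differentiableAt.div_const 2)).add
      ((h2.differentiableAt.pow 2).div_const 4)) (fun i => by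
    have h1 := (((hp i).div_const 2).sub ((tendsto_sq_mul_deriv_pf a hτ i).div_const 2)).add
      (((tendsto_sub_mul_pf a hτ i).pow 2).div_const 4)
    convert! h1 using 1
    · ext z; simp only [hh]; ring
    · congr 1; push_cast; ring) hinf0 (fun z hz => by
    simp only [hh]
    rw [hc z hz, deriv_pf_conj, pf_conj]
    simp [map_ofNat])
  refine ⟨β, fun z hz => ?_, hlim.congr' ?_⟩
  · rw [← hβ z hz]
    simp only [hh]
    ring
  · filter_upwards [eventually_avoid_cobounded τ] with z hz
    rw [hβ z hz]

end

/-! ### Solutions with a given ratio -/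

/-- A function `F` with the right Schwarzian derivative is the ratio of the solutions `F s` and `s`,
where `s' / s = (P - F'' / F') / 2`. -/
lemma exists_solvesV_of_schwarzian {P Q F : ℂ → ℂ} {z₀ : ℂ} {r : ℝ}
    (hP : DifferentiableOn ℂ P (Metric.ball z₀ r)) (hF : DifferentiableOn ℂ F (Metric.ball z₀ r))
    (hF' : ∀ z ∈ Metric.ball z₀ r, deriv F z ≠ 0)
    (hS : ∀ z ∈ Metric.ball z₀ r, sch F z = deriv P z - P z ^ 2 / 2 + 2 * Q z) :
    ∃ v, SolvesV P Q (Metric.ball z₀ r) v ∧ (∀ z ∈ Metric.ball z₀ r, wr v z ≠ 0) ∧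
      ∀ z ∈ Metric.ball z₀ r, vr (v z) = (F z : OnePoint ℂ) := by
  have o := Metric.isOpen_ball (x := z₀) (ε := r)
  set N : ℂ → ℂ := fun z => deriv (deriv F) z / deriv F z with hN
  have hNd : DifferentiableOn ℂ N (Metric.ball z₀ r) :=
    ((hF.deriv o).deriv o).div (hF.deriv o) hF'
  have hA : DifferentiableOn ℂ (fun z => (P z - N z) / 2) (Metric.ball z₀ r) :=
    (hP.sub hNd).div_const 2
  obtain ⟨φ, hφ⟩ := hA.isExactOn_ball
  set s : ℂ → ℂ := fun z => Complex.exp (φ z) with hs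
  have hs0 : ∀ z, s z ≠ 0 := fun z => Complex.exp_ne_zero _
  have hs1 : ∀ z ∈ Metric.ball z₀ r, HasDerivAt s ((P z - N z) / 2 * s z) z := fun z hz => by
    have := (hφ z hz).cexp
    rwa [mul_comm] at this
  have hF1 : ∀ z ∈ Metric.ball z₀ r, HasDerivAt F (deriv F z) z := fun z hz =>
    (hF.differentiableAt (o.mem_nhds hz)).hasDerivAt
  have hF2 : ∀ z ∈ Metric.ball z₀ r, HasDerivAt (deriv F) (deriv (deriv F) z) z := fun z hz =>
    ((hF.deriv o).differentiableAt (o.mem_nhds hz)).hasDerivAt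
  have hs2 : ∀ z ∈ Metric.ball z₀ r, deriv (deriv s) z =
      (deriv P z - deriv N z) / 2 * s z + (P z - N z) / 2 * ((P z - N z) / 2 * s z) := by
    intro z hz
    have e : deriv s =ᶠ[𝓝 z] fun z => (P z - N z) / 2 * s z := by
      filter_upwards [o.mem_nhds hz] with w hw using (hs1 w hw).deriv
    have h1 := (hP.differentiableAt (o.mem_nhds hz)).hasDerivAt
    have h2 := (hNd.differentiableAt (o.mem_nhds hz)).hasDerivAt
    exact e.deriv_eq.trans (((h1.sub h2).div_const 2).mul (hs1 z hz)).deriv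
  have hsol : Solves P Q (Metric.ball z₀ r) s := by
    refine ⟨fun z hz => (hs1 z hz).differentiableAt.differentiableWithinAt, fun z hz => ?_⟩
    have h3 : deriv N z - N z ^ 2 / 2 = deriv P z - P z ^ 2 / 2 + 2 * Q z := hS z hz
    rw [hs2 z hz, (hs1 z hz).deriv]
    linear_combination (-s z / 2) * h3
  have hd : ∀ z ∈ Metric.ball z₀ r, HasDerivAt (fun z => F z * s z)
      (deriv F z * s z + F z * ((P z - N z) / 2 * s z)) z := fun z hz => (hF1 z hz).mul (hs1 z hz)
  have hsol' : Solves P Q (Metric.ball z₀ r) fun z => F z * s z := by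
    refine ⟨fun z hz => (hd z hz).differentiableAt.differentiableWithinAt, fun z hz => ?_⟩
    have e : deriv (fun z => F z * s z) =ᶠ[𝓝 z] fun z => deriv F z * s z + F z * deriv s z := by
      filter_upwards [o.mem_nhds hz] with w hw
      rw [(hd w hw).deriv, (hs1 w hw).deriv]
    have h4 : HasDerivAt (deriv s) (deriv (deriv s) z) z :=
      (((hsol.1.deriv o).differentiableAt (o.mem_nhds hz))).hasDerivAt
    have h5 := (((hF2 z hz).mul (hs1 z hz)).add ((hF1 z hz).mul h4)).deriv
    have h6 : deriv (deriv fun z => F z * s z) z = _ := e.deriv_eq.trans h5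
    have h7 : deriv (deriv F) z = N z * deriv F z := by
      rw [hN]; exact (div_mul_cancel₀ _ (hF' z hz)).symm
    have h8 := hsol.2 z hz
    rw [(hs1 z hz).deriv] at h8
    have h9 := (hs1 z hz).deriv
    clear_value N
    rw [h6, (hd z hz).deriv, h7]
    linear_combination F z * h8 + deriv F z * h9
  refine ⟨fun z => ![F z * s z, s z], Fin.forall_fin_two.2 ⟨hsol', hsol⟩, fun z hz => ?_,
    fun z _ => ?_⟩
  · have : wr (fun z => ![F z * s z, s z]) z = deriv F z * s z ^ 2 := by
      change deriv (fun z => F z * s z) z * s z - F z * s z * deriv s z = _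
      rw [(hd z hz).deriv, (hs1 z hz).deriv]
      ring
    rw [this]
    exact mul_ne_zero (hF' z hz) (pow_ne_zero 2 (hs0 z))
  · rw [← vr_coe, ← vr_smul_of_ne_zero (hs0 z) ![F z, 1]]
    congr 1
    ext i
    fin_cases i <;> simp [mul_comm]

/-- The discs that exhaust the upper half-plane: they are tangent to the real line at `0`. -/
def horoball (n : ℕ) : Set ℂ := Metric.ball ((n + 1 : ℝ) * Complex.I) (n + 1)

lemma mem_horoball {n : ℕ} {z : ℂ} :
    z ∈ horoball n ↔ z.re ^ 2 + z.im ^ 2 < 2 * z.im * (n + 1) := by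
  have h0 : (0 : ℝ) ≤ n + 1 := by positivity
  rw [horoball, Metric.mem_ball, dist_eq_norm, ← sq_lt_sq₀ (norm_nonneg _) h0, Complex.sq_norm,
    Complex.normSq_apply]
  simp only [Complex.sub_re, Complex.sub_im, Complex.mul_re, Complex.mul_im, Complex.ofReal_re,
    Complex.ofReal_im, Complex.I_re, Complex.I_im]
  constructor <;> intro h <;> nlinarith

lemma im_pos_of_mem_horoball {n : ℕ} {z : ℂ} (hz : z ∈ horoball n) : 0 < z.im := by
  rw [mem_horoball] at hz
  have h0 : (0 : ℝ) < n + 1 := by positivity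
  by_contra h
  nlinarith [sq_nonneg z.re, sq_nonneg z.im, mul_nonneg (neg_nonneg.2 (not_lt.1 h)) h0.le]

lemma horoball_mono {m n : ℕ} (h : m ≤ n) : horoball m ⊆ horoball n := by
  intro z hz
  have h1 := im_pos_of_mem_horoball hz
  rw [mem_horoball] at hz ⊢
  have h2 : (m : ℝ) ≤ n := by exact_mod_cast h
  nlinarith

lemma exists_mem_horoball {z : ℂ} (hz : 0 < z.im) : ∃ n, z ∈ horoball n := by
  obtain ⟨n, hn⟩ := exists_nat_gt ((z.re ^ 2 + z.im ^ 2) / (2 * z.im))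
  refine ⟨n, mem_horoball.2 ?_⟩
  rw [div_lt_iff₀ (by positivity)] at hn
  nlinarith

lemma isOpen_horoball (n : ℕ) : IsOpen (horoball n) := Metric.isOpen_ball

lemma isPreconnected_horoball (n : ℕ) : IsPreconnected (horoball n) :=
  (convex_ball _ _).isPreconnected

/-- A fundamental pair of solutions in the upper half-plane. -/
lemma exists_solvesV_upperHalfPlane {P Q : ℂ → ℂ} (hP : DifferentiableOn ℂ P {z | 0 < z.im})
    (hQ : DifferentiableOn ℂ Q {z | 0 < z.im}) :
    ∃ u, SolvesV P Q {z | 0 < z.im} u ∧ ∀ z : ℂ, 0 < z.im → wr u z ≠ 0 := by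
  have hsub : ∀ n, horoball n ⊆ {z | 0 < z.im} := fun n z hz => im_pos_of_mem_horoball hz
  have hne : (horoball 0).Nonempty := ⟨Complex.I, by simp [mem_horoball]⟩
  have hex : ∀ n, ∃ v, SolvesV P Q (horoball n) v ∧ ∀ z ∈ horoball n, wr v z ≠ 0 := fun n =>
    exists_solvesV_ball (by positivity) (hP.mono (hsub n)) (hQ.mono (hsub n))
  choose v hv hWv using hex
  -- the solutions in the discs are normalized to agree in the smallest one
  have hM : ∀ n, ∃ M : GL (Fin 2) ℂ, ∀ z ∈ horoball 0, v 0 z = M • v n z := fun n =>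
    SolvesV.exists_GL (isOpen_horoball 0) (isPreconnected_horoball 0) hne
      ((hv n).mono (horoball_mono n.zero_le)) (fun z hz => hWv n z (horoball_mono n.zero_le hz))
      (hv 0) (hWv 0)
  choose M hM using hM
  set u : ℕ → ℂ → Fin 2 → ℂ := fun n z => M n • v n z with hu_def
  have hu : ∀ n, SolvesV P Q (horoball n) (u n) := fun n => (hv n).GL_smul (isOpen_horoball n) (M n)
  have hWu : ∀ n, ∀ z ∈ horoball n, wr (u n) z ≠ 0 := fun n z hz => by
    rw [hu_def, wr_GL_smul ((hv n).analyticAt (isOpen_horoball n) hz)]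
    exact mul_ne_zero (GL_det_ne_zero _) (hWv n z hz)
  have hcoh : ∀ m n, m ≤ n → Set.EqOn (u m) (u n) (horoball m) := by
    intro m n hmn
    obtain ⟨z₀, hz₀⟩ := hne
    refine AnalyticOnNhd.eqOn_of_preconnected_of_eventuallyEq
      (fun z hz => (hu m).analyticAt (isOpen_horoball m) hz)
      (fun z hz => (hu n).analyticAt (isOpen_horoball n) (horoball_mono hmn hz))
      (isPreconnected_horoball m) (horoball_mono m.zero_le hz₀) ?_
    filter_upwards [(isOpen_horoball 0).mem_nhds hz₀] with z hz
    exact (hM m z hz).symm.trans (hM n z hz)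
  have hcoh' : ∀ m n z, z ∈ horoball m → z ∈ horoball n → u m z = u n z := by
    intro m n z hm hn
    rcases le_total m n with h | h
    · exact hcoh m n h hm
    · exact (hcoh n m h hn).symm
  have hidx : ∀ z : ℂ, ∃ n, 0 < z.im → z ∈ horoball n := fun z => by
    by_cases hz : 0 < z.im
    · obtain ⟨n, hn⟩ := exists_mem_horoball hz
      exact ⟨n, fun _ => hn⟩
    · exact ⟨0, fun h => absurd h hz⟩
  choose k hk using hidx
  have hU : ∀ n, Set.EqOn (fun z => u (k z) z) (u n) (horoball n) := fun n z hz =>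
    hcoh' _ _ z (hk z (im_pos_of_mem_horoball hz)) hz
  have hsolves : ∀ n, SolvesV P Q (horoball n) fun z => u (k z) z := fun n =>
    (hu n).congr (isOpen_horoball n) (hU n)
  refine ⟨fun z => u (k z) z, fun i => ⟨fun z hz => ?_, fun z hz => ?_⟩, fun z hz => ?_⟩
  · exact ((hsolves (k z) i).1.differentiableAt
      ((isOpen_horoball _).mem_nhds (hk z hz))).differentiableWithinAt
  · exact (hsolves (k z) i).2 z (hk z hz)
  · have e : (fun z => u (k z) z) =ᶠ[𝓝 z] u (k z) := by
      filter_upwards [(isOpen_horoball _).mem_nhds (hk z hz)] with w hw using hU _ hw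
    have e1 : wr (fun z => u (k z) z) z = wr (u (k z)) z := by
      have e0 : ∀ i, (fun w => u (k w) w i) =ᶠ[𝓝 z] fun w => u (k z) w i := fun i =>
        e.mono fun w hw => congrFun hw i
      rw [wr, wr, (e0 0).deriv_eq, (e0 1).deriv_eq]
    rw [e1]
    exact hWu _ z (hk z hz)

/-- A map of the upper half-plane which is locally a ratio of solutions is globally a ratio of
solutions. -/
lemma exists_solvesV_of_locally {P Q : ℂ → ℂ} (hP : DifferentiableOn ℂ P {z | 0 < z.im})
    (hQ : DifferentiableOn ℂ Q {z | 0 < z.im}) {φ : ℂ → OnePoint ℂ}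
    (hφ : ∀ z₀ : ℂ, 0 < z₀.im → ∃ r > 0, Metric.ball z₀ r ⊆ {z | 0 < z.im} ∧
      ∃ v, SolvesV P Q (Metric.ball z₀ r) v ∧ (∀ z ∈ Metric.ball z₀ r, wr v z ≠ 0) ∧
        ∀ z ∈ Metric.ball z₀ r, vr (v z) = φ z) :
    ∃ w, SolvesV P Q {z | 0 < z.im} w ∧ (∀ z : ℂ, 0 < z.im → wr w z ≠ 0) ∧
      ∀ z : ℂ, 0 < z.im → vr (w z) = φ z := by
  obtain ⟨u, hu, hW⟩ := exists_solvesV_upperHalfPlane hP hQ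
  have hloc : ∀ z₀ : ℂ, 0 < z₀.im →
      ∃ M : GL (Fin 2) ℂ, ∀ᶠ z in 𝓝 z₀, M • vr (u z) = φ z := by
    intro z₀ hz₀
    obtain ⟨r, hr, hsub, v, hv, hWv, hvφ⟩ := hφ z₀ hz₀
    obtain ⟨M, hM⟩ := SolvesV.exists_GL Metric.isOpen_ball (convex_ball _ _).isPreconnected
      ⟨z₀, Metric.mem_ball_self hr⟩ (hu.mono hsub) (fun z hz => hW z (hsub hz)) hv hWv
    refine ⟨M, ?_⟩
    filter_upwards [Metric.ball_mem_nhds z₀ hr] with z hz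
    rw [smul_vr _ (ne_zero_of_wr_ne_zero (hW z (hsub hz))), ← hM z hz, hvφ z hz]
  have hI : 0 < Complex.I.im := by simp
  obtain ⟨M, hM⟩ := hloc Complex.I hI
  -- The set where the same matrix `M` works is open and relatively closed in the half-plane.
  have hall : {z : ℂ | 0 < z.im} ⊆ {z | ∀ᶠ z' in 𝓝 z, M • vr (u z') = φ z'} := by
    refine IsPreconnected.subset_of_closure_inter_subset
      (convex_halfSpace_im_gt 0).isPreconnected isOpen_setOfPred_eventually_nhds ⟨_, hI, hM⟩ ?_
    rintro z₀ ⟨hcl, hz₀⟩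
    obtain ⟨M', hM'⟩ := hloc z₀ hz₀
    obtain ⟨z, ⟨h1, h2⟩, h3⟩ := mem_closure_iff_nhds.1 hcl _
      ((hM'.eventually_nhds).and (eventually_im_pos hz₀))
    replace h3 : ∀ᶠ z' in 𝓝 z, M • vr (u z') = φ z' := h3
    have han := hu.analyticAt isOpen_im_pos h2
    have hMM := (IndepAt.of_wr_ne_zero han (hW z h2)).smul_eq_smul han (g := M) (h := M')
      (Eventually.frequently (nhdsWithin_le_nhds (by
        filter_upwards [h1, h3] with z' a b _
        rw [a, b])))
    refine hM'.mono fun z' hz' => ?_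
    rw [hMM, hz']
  refine ⟨fun z => M • u z, hu.GL_smul isOpen_im_pos M, fun z hz => ?_, fun z hz => ?_⟩
  · rw [wr_GL_smul (hu.analyticAt isOpen_im_pos hz)]
    exact mul_ne_zero (GL_det_ne_zero _) (hW z hz)
  · rw [← smul_vr _ (ne_zero_of_wr_ne_zero (hW z hz))]
    exact (hall hz).self_of_nhds

/-- The angles of the pentagon, without the one at `∞`, are `resP + 1`. -/
lemma IsSlitPentagon.hasAngle {κ : Fin 4 → ℝ} {x q : ℝ} {f : OnePoint ℂ → OnePoint ℂ}
    (hf : IsSlitPentagon κ x q f) {p : ℝ} {h : Fin 3 → ℝ} (i : Fin 4) :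
    HasAngle f ((⟨κ, x, q, p, h⟩ : FuchsEquation).τ i : OnePoint ℝ)
      ((⟨κ, x, q, p, h⟩ : FuchsEquation).resP i + 1) := by
  fin_cases i
  · simpa [FuchsEquation.τ, FuchsEquation.resP, corner] using hf.angle 0
  · simpa [FuchsEquation.τ, FuchsEquation.resP, corner] using hf.angle 1
  · simpa [FuchsEquation.τ, FuchsEquation.resP, corner] using hf.angle 2
  · have := hf.angle_q
    norm_num [FuchsEquation.τ, FuchsEquation.resP]
    exact this

/-- The equation whose solutions have the developing map of a pentagon as their ratio. -/
theorem IsSlitPentagon.exists_equation {κ : Fin 4 → ℝ} {x q : ℝ} {f : OnePoint ℂ → OnePoint ℂ}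
    (hf : IsSlitPentagon κ x q f) (hκ : ∀ j, 0 ≤ κ j) (hx : 1 < x) (hq0 : q ≠ 0) (hq1 : q ≠ 1)
    (hqx : q ≠ x) :
    ∃ (p : ℝ) (h : Fin 3 → ℝ) (E : FuchsEquation), E = ⟨κ, x, q, p, h⟩ ∧
      E.RegularAtInfinity ∧ ∃ w₁ w₂ : ℂ → ℂ,
        E.IsFundamentalPair w₁ w₂ ∧ IsBoundaryExtension (fun z => ![w₁ z, w₂ z]) f := by
  set E₀ : FuchsEquation := ⟨κ, x, q, 0, 0⟩ with hE₀
  have hVf := FuchsEquation.finite_singular 0 1 x q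
  have hinj : Function.Injective E₀.τ :=
    FuchsEquation.Admissible.injective_τ ⟨hκ, hx, hq0, hq1, hqx⟩
  have hmem : ∀ i, E₀.τ i ∈ ({0, 1, x, q} : Set ℝ) := fun i => by
    have : E₀.τ i ∈ Set.range E₀.τ := ⟨i, rfl⟩
    rwa [FuchsEquation.range_τ] at this
  have hV : ∀ z : ℂ, (∀ i, z ≠ E₀.τ i) → ∀ v ∈ ({0, 1, x, q} : Set ℝ), z ≠ (v : ℂ) := by
    intro z hz v hv
    have : v ∈ Set.range E₀.τ := by rwa [FuchsEquation.range_τ]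
    obtain ⟨i, rfl⟩ := this
    exact hz i
  obtain ⟨β, hβ, hB⟩ := exists_pf_of_schwarzian (S := symSchw f) hinj E₀.resP (κ := κ 3)
    (fun z hz => (hf.developing.analyticAt_symSchw hVf (hV z hz)).differentiableAt)
    (fun i => hf.developing.tendsto_symSchw_coe hVf (hmem i) (hf.hasAngle i))
    (hf.developing.tendsto_symSchw_infty hVf (hf.angle 3))
    (fun z hz => hf.developing.symSchw_conj hVf (hV z hz))
  set E : FuchsEquation := ⟨κ, x, q, β 3, fun j => -β j.castSucc⟩ with hE
  have hτ : E.τ = E₀.τ := rfl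
  have hresP : E.resP = E₀.resP := rfl
  have hresQ : E.resQ = β := by
    ext i
    fin_cases i <;> simp [FuchsEquation.resQ, hE]
  refine ⟨_, _, E, rfl, ?_, ?_⟩
  -- The constant `B` has been found such that the exponents at `∞` differ by `κ 3`.
  · set A : ℂ := ((∑ i, E₀.resP i : ℝ) : ℂ)
    refine ⟨A, (A + 1) ^ 2 / 4 - (κ 3 : ℂ) ^ 2 / 4, ?_, ?_, (-(A + 1) + κ 3) / 2, (-(A + 1) - κ 3) / 2, fun ρ => ?_, ?_⟩
    · rw [FuchsEquation.P_eq]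
      exact tendsto_mul_pf _ _
    · rw [FuchsEquation.Q_eq, hresQ]
      exact hB
    · ring
    · change _ = (κ 3 : ℂ)
      ring
  · obtain ⟨w, hw, hW, hwf⟩ := exists_solvesV_of_locally (P := pf E.resP E.τ) (Q := pf E.resQ E.τ)
      differentiableOn_pf differentiableOn_pf (φ := fun z => f z) fun z₀ hz₀ => by
        obtain ⟨g, F, hF⟩ := hf.developing.exists_chart hz₀.le fun v _ => ne_ofReal_of_im_pos hz₀ v
        have h1 := eventually_nhdsWithin_iff.1 hF.2.2
        have h2 := IsDevelopingMap.symSchw_eventuallyEq_of_im_pos hz₀ hF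
        obtain ⟨r, hr, hb⟩ := Metric.eventually_nhds_iff_ball.1 (((h1.and h2).and
          (eventually_im_pos hz₀)).and (hF.1.eventually_analyticAt.and
            (hF.1.deriv.continuousAt.eventually_ne hF.2.1)))
        have hsub : Metric.ball z₀ r ⊆ {z | 0 < z.im} := fun z hz => (hb z hz).1.2
        obtain ⟨v, hv, hWv, hvF⟩ := exists_solvesV_of_schwarzian (P := pf E.resP E.τ)
          (Q := pf E.resQ E.τ) (F := F) (differentiableOn_pf.mono hsub)
          (fun z hz => (hb z hz).2.1.differentiableAt.differentiableWithinAt)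
          (fun z hz => (hb z hz).2.2) (fun z hz => by
            rw [← (hb z hz).1.1.2, hresQ]
            exact hβ z fun i => ne_ofReal_of_im_pos (hsub hz) _)
        refine ⟨r, hr, hsub, fun z => g⁻¹ • v z, hv.GL_smul Metric.isOpen_ball _, fun z hz => ?_,
          fun z hz => ?_⟩
        · rw [wr_GL_smul (hv.analyticAt Metric.isOpen_ball hz)]
          exact mul_ne_zero (GL_det_ne_zero _) (hWv z hz)
        · have hz' : (0 : ℝ) ≤ z.im := le_of_lt (hsub hz)
          rw [← smul_vr _ (ne_zero_of_wr_ne_zero (hWv z hz)), hvF z hz,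
            ← (hb z hz).1.1.1 hz', inv_smul_smul]
    exact ⟨_, _, FuchsEquation.isFundamentalPair_of_wr_ne_zero hw hW, hf.developing.continuousOn,
      fun z hz => (hwf z hz).symm⟩

end CircularPolygon

theorem proposition1 (κ : Fin 4 → ℝ) (hκ : ∀ j, 0 ≤ κ j) (x q : ℝ) (hx : 1 < x)
    (hq0 : q ≠ 0) (hq1 : q ≠ 1) (hqx : q ≠ x) :
    -- from equations to pentagons
    (∀ (p : ℝ) (h : Fin 3 → ℝ) (E : FuchsEquation), E = ⟨κ, x, q, p, h⟩ →
      E.RegularAtInfinity → E.IsApparentAt (q : OnePoint ℝ) →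
      ∀ w₁ w₂ : ℂ → ℂ, E.IsFundamentalPair w₁ w₂ →
        ∃ f : OnePoint ℂ → OnePoint ℂ, IsSlitPentagon κ x q f ∧
          ∀ z : ℂ, 0 < z.im → f (z : OnePoint ℂ) = ratio (w₁ z) (w₂ z)) ∧
    -- from pentagons to equations
    (∀ f : OnePoint ℂ → OnePoint ℂ, IsSlitPentagon κ x q f →
      ∃ (p : ℝ) (h : Fin 3 → ℝ) (E : FuchsEquation), E = ⟨κ, x, q, p, h⟩ ∧
        E.RegularAtInfinity ∧ E.IsApparentAt (q : OnePoint ℝ) ∧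
        (E.ConditionB ↔ ∀ j, ¬ SameCircleAt {0, 1, x, q} f (corner x j)) ∧
        ∃ w₁ w₂ : ℂ → ℂ, E.IsFundamentalPair w₁ w₂ ∧
          ∀ z : ℂ, 0 < z.im → f (z : OnePoint ℂ) = ratio (w₁ z) (w₂ z)) ∧
    -- the projective monodromy
    (∀ (p : ℝ) (h : Fin 3 → ℝ) (E : FuchsEquation), E = ⟨κ, x, q, p, h⟩ →
      E.RegularAtInfinity → E.IsApparentAt (q : OnePoint ℝ) →
      ∀ w₁ w₂ : ℂ → ℂ, E.IsFundamentalPair w₁ w₂ →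
      ∀ f : OnePoint ℂ → OnePoint ℂ, IsSlitPentagon κ x q f →
        (∀ z : ℂ, 0 < z.im → f (z : OnePoint ℂ) = ratio (w₁ z) (w₂ z)) →
      ∀ x₀ : ℂ, 0 < x₀.im →
        (∀ γ : Path x₀ x₀, (∀ s, ∀ v ∈ ({0, 1, x} : Set ℝ), γ s ≠ (v : ℂ)) →
          ∃! T, IsProjMonodromy w₁ w₂ γ T) ∧
        projMonodromyGroup {0, 1, x} w₁ w₂ x₀ = evenProducts {0, 1, x, q} f ∧
        (GeneratorsNontrivial x w₁ w₂ x₀ ↔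
          ∀ j, ¬ SameCircleAt {0, 1, x, q} f (corner x j))) := by
  refine ⟨fun p h E hEq hR ha w₁ w₂ hw => ?_, fun f hf => ?_,
    fun p h E hEq hR ha w₁ w₂ hw f hf hfw x₀ hx₀ => ?_⟩
  · have hE : E.Admissible := by subst hEq; exact ⟨hκ, hx, hq0, hq1, hqx⟩
    subst hEq
    obtain ⟨f, hf, hfe⟩ := hw.isSlitPentagon hE hR ha
    exact ⟨f, hf, hfe.2⟩
  · obtain ⟨p, h, E, hEq, hR, w₁, w₂, hw, hwf⟩ := hf.exists_equation hκ hx hq0 hq1 hqx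
    have hiff := hw.isApparentAt_iff hwf
    have hEx : E.x = x := by rw [hEq]
    have hEq' : E.q = q := by rw [hEq]
    have ha : E.IsApparentAt (q : OnePoint ℝ) := by
      rw [hiff, hEx, hEq']
      exact hf.slit
    refine ⟨p, h, E, hEq, hR, ha, ?_, w₁, w₂, hw, hwf.2⟩
    rw [FuchsEquation.ConditionB, hEq', and_iff_right ha]
    simp only [hiff, hEx, hEq']
  · have hE : E.Admissible := by subst hEq; exact ⟨hκ, hx, hq0, hq1, hqx⟩
    subst hEq
    exact hw.monodromy hE ha ⟨hf.developing.continuousOn, hfw⟩ hx₀
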